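/- **Setting.** Let $(Z,w)$ be a Poisson manifold, $w^\sharp:T^*Z\to TZ$, $\{f,g\}=df(w^\sharp dg)$, $X_f=w^\sharp df$. Let $S\subset Z$ be an embedded symplectic leaf with symplectic form $\omega$, whose flat map $\omega^\flat:TS\to T^*S$ is the inverse of the map induced by $w^\sharp$; let $Q\subset Z$ be an embedded coisotropic submanifold containing $S$, and let $X\subset S$ be an embedded Lagrangian submanifold of $S$ (inclusions $i_X,i_S,i_Q$). A *metric* means a smooth field of nondegenerate symmetric bilinear forms, of any signature. Let $\tilde H\in C^\infty(Q)$ with $d\tilde H|_X=0$. Put $\tilde E_X=(TX)^0\subset T^*Q|_X$, $\tilde L_X=(TS)^0\subset T^*Q|_X$, so that $\tilde E_X^*=TQ|_X/TX$. The anchor $\tilde E_X\to TX$, with kernel $\tilde L_X$, is induced by $-w^\sharp$ on lifts to $T^*Z|_X$; an *$\tilde E_X$-connection form* is a smooth bundle map $\alpha:TX\to\tilde E_X$ that splits the anchor. The second derivative of $\tilde H$ along $X$ is a bundle map $j^V\tilde H^\sharp:\tilde E_X^*\to\tilde E_X$. For a morphism $J:\tilde E_X^*\to\tilde E_X$ let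 $J_0:TS|_X/TX\to (TX)^0\subset T^*S|_X$ be its restriction, that is, the composition with the inclusion $TS/TX\to TQ/TX$ and the restriction of covectors to $TS$. *The diagram.* For $J$ and fields $(\gamma,\alpha,\chi)$ on $X$, of the types of a metric on $X$, an $\tilde E_X$-connection form and a bundle metric on $\tilde L_X$, the diagram says that $$\alpha=J\circ Ti_S\circ J_0^{-1}\circ(-\omega^\flat|_{TX}),\qquad \gamma^\flat=(-\omega^\flat|_{TX})^*\circ J_0^{-1}\circ(-\omega^\flat|_{TX}),$$ and that $\chi^\flat$ is the composition $\tilde L_X\hookrightarrow\tilde E_X\xrightarrow{J^{-1}}\tilde E_X^*\to\tilde L_X^*$. A triple $(\gamma,\alpha,\chi)$ *corresponds* to a bundle metric $\tilde\eta$ on $\tilde E_X$ if the diagram holds with $J=(\tilde\eta^\flat)^{-1}$. *Reduced algebras.* $\tilde{\mathfrak P}=i_Q^*\mathfrak N\subset C^\infty(Q)$, where $\mathfrak N\subset C^\infty(Z)$ is the idealizer of the functions vanishing on $Q$; $\tilde H$ is *admissible* if $\tilde H\in\tilde{\mathfrak P}$. On $Z'=E_X^*=TZ|_X/TX$ the linear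 Poisson bracket $\{\cdot,\cdot\}'$ is the one of the Lie algebroid $E_X=(TX)^0\subset T^*Z|_X$ with bracket $[df|_X,dg|_X]=d\{f,g\}|_X$ ($f=g=0$ on $X$) and anchor $-w^\sharp$; $\tilde{\mathfrak P}'$ is the reduced Poisson algebra obtained in the same way from $Q'=\tilde E_X^*\subset Z'$. Sections $s$ of $\tilde E_X$ define fibrewise linear functions $\bar s$ on $Q'$. *Frames.* Let $\mathfrak g$ be a finite-dimensional real Lie algebra, $c\subset\mathfrak g$ a subalgebra, $N=N_{\mathrm{Aut}(\mathfrak g)}(c)$, and $C$ the connected group with Lie algebra $c$, acting on $\mathfrak g$ through the group generated by $e^{\mathrm{ad}\,\zeta}$, $\zeta\in c$. The constraint Lie frame bundle $R_X^c$ consists of the Lie algebra isomorphisms $p:\mathfrak g\to L_x=(T_xS)^0\subset T_x^*Z$, $x\in X$ (with bracket $[df,dg]=d\{f,g\}$ on $L_x$), such that $p(c)=(T_xQ)^0$. We say that $R_X$ *reduces to* $N$ if $R_X^c$ has smooth local sections near every point of $X$. Then $K_1\subset N$ is the kernel of the action on $(\mathfrak g/c)^C=N_{\mathfrak g}(c)/c$,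 $\tilde R_X=R_X^c/K_1$ is a principal bundle with group $N/K_1$, $\tilde L_1=R_X^c\times_N(\mathfrak g/c)^C\subset\tilde L_X$, and $\tilde L_2^*=R_X^c\times_N S^2(c^0)^C$ is the bundle of $C$-invariant symmetric bilinear forms on $\tilde L_X=L_X/(TQ)^0$. **Theorem.** Assume that $j^V\tilde H^\sharp$ is invertible. (a) There is exactly one bundle metric $\tilde\eta$ on $\tilde E_X$ with $\tilde\eta^\flat=(j^V\tilde H^\sharp)^{-1}$. At each $x\in X$, $\tilde\eta|_{\tilde L_X}$ is nondegenerate if and only if the restriction $j_0^\sharp=(j^V\tilde H^\sharp)_0$ is invertible. If $j_0^\sharp$ is invertible at every point, then the diagram with $J=j^V\tilde H^\sharp$ determines exactly one triple $(\gamma_{\tilde H},\alpha_{\tilde H},\chi_{\tilde H})$; $\gamma_{\tilde H}$ is a metric on $X$, $\alpha_{\tilde H}$ an $\tilde E_X$-connection form, $\chi_{\tilde H}$ a bundle metric on $\tilde L_X$, and the triple corresponds to $\tilde\eta$. If $K\in C^\infty(Z)$ satisfies $i_Q^*K=\tilde H$ and $dK|_X=0$, then $j^V\tilde H^\sharp$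 is the restriction to $TQ$ of the second derivative $D^2K$ of $K$ along $X$, and $\alpha_{\tilde H}(V)=D^2K(u,\cdot)|_{TQ}$, where $u\in TS|_X$ satisfies $D^2K(u,\cdot)|_{TS}=-\omega^\flat V$. (b) Bundle metrics on $\tilde E_X$ and triples determine each other: to every bundle metric on $\tilde E_X$ whose restriction to $\tilde L_X$ is nondegenerate there corresponds exactly one triple (a metric on $X$, an $\tilde E_X$-connection form, a bundle metric on $\tilde L_X$), and every such triple corresponds to exactly one bundle metric on $\tilde E_X$. (c) In (a), suppose that $j_0^\sharp$ is invertible at every point and that $\tilde H$ is admissible. Then $\overline{\alpha_{\tilde H}(V)}\in\tilde{\mathfrak P}'$ for every vector field $V$ on $X$. If moreover $R_X$ reduces to $N$, then: - there is exactly one principal connection $A$ on $\tilde R_X$ whose associated covariant derivative on $\tilde L_1$ satisfies $\overline{\nabla_Vs}=\{\overline{\alpha_{\tilde H}(V)},\bar s\}'$ (reduced bracket of $\tilde{\mathfrak P}'$) for all $V$ and all $s\in\Gamma(\tilde L_1)$, where $\bar s\in\tilde{\mathfrak P}'$ and $\nabla_Vs\in\Gamma(\tilde L_1)$; - $A$ takes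 values in $\mathrm{ad}(N_{\mathfrak g}(c)/c)$ in the following sense: through every point of $R_X^c$ there is a smooth local section $\sigma$ such that the local connection form $\sigma^*A$ takes values in the inner derivations of $N_{\mathfrak g}(c)/c$; - $\chi_{\tilde H}$ is a section of $\tilde L_2^*$. -/

import Mathlib

open scoped Manifold ContDiff Bundle
open Bundle

namespace PoissonReduction

noncomputable section

/-! ### Manifolds, covectors, second derivatives -/

section Manifold

variable (E : Type*) {M : Type*} [NormedAddCommGroup E] [NormedSpace ℝ E]
  [TopologicalSpace M] [ChartedSpace E M]

/-- The tangent space of a manifold `M` modelled on `E`. -/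
abbrev Tan (p : M) := TangentSpace 𝓘(ℝ, E) p

/-- The cotangent space. -/
abbrev Cot (p : M) := Tan E p →L[ℝ] ℝ

variable (M) in
/-- The algebra of smooth real functions. -/
abbrev Fn := C^∞⟮𝓘(ℝ, E), M; ℝ⟯

/-- The differential `df` at `p`, a covector. -/
def diff (f : M → ℝ) (p : M) : Cot E p := mfderiv 𝓘(ℝ, E) 𝓘(ℝ, ℝ) f p

/-- The vertical part of the tangent map of the section `df` of `T*M` at `p`, written in the
preferred chart at `p` (the chart in which tangent vectors at `p` are expressed). It is
intrinsic at points where `df` vanishes, and it is only used there. -/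
def hess (f : M → ℝ) (p : M) : Tan E p →L[ℝ] Cot E p :=
  fderiv ℝ (fderiv ℝ (f ∘ (extChartAt 𝓘(ℝ, E) p).symm)) (extChartAt 𝓘(ℝ, E) p p)

theorem contDiffAt_chart (f : Fn E M) (p : M) :
    ContDiffAt ℝ ∞ (f ∘ (extChartAt 𝓘(ℝ, E) p).symm) (extChartAt 𝓘(ℝ, E) p p) := by
  have h := ((contMDiffAt_iff (I := 𝓘(ℝ, E)) (I' := 𝓘(ℝ, ℝ))).1 (f.contMDiff p)).2
  simp only [modelWithCornersSelf_coe, Set.range_id, contDiffWithinAt_univ] at h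
  exact h

theorem hess_symm (f : Fn E M) (p : M) (u v : Tan E p) : hess E f p u v = hess E f p v u :=
  ((contDiffAt_chart E f p).isSymmSndFDerivAt (by simpa using ENat.LEInfty.out)) u v

theorem hess_critical {EX X : Type*} [NormedAddCommGroup EX] [NormedSpace ℝ EX]
    [TopologicalSpace X] [ChartedSpace EX X] [IsManifold 𝓘(ℝ, E) ∞ M] [IsManifold 𝓘(ℝ, EX) ∞ X]
    (f : Fn E M) (j : C^∞⟮𝓘(ℝ, EX), X; 𝓘(ℝ, E), M⟯)
    (hj : ∀ x, diff E f (j x) = 0) (x : X) (w : Tan EX x) :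
    hess E f (j x) (mfderiv 𝓘(ℝ, EX) 𝓘(ℝ, E) j x w) = 0 := by
  set φ := extChartAt 𝓘(ℝ, E) (j x) with hφ
  set ψ := extChartAt 𝓘(ℝ, EX) x with hψ
  set γ : EX → E := φ ∘ j ∘ ψ.symm with hγ
  set G := fderiv ℝ (f ∘ φ.symm) with hG
  have hx : ψ.symm (ψ x) = x := ψ.left_inv (mem_extChartAt_source x)
  have hjd : MDifferentiableAt 𝓘(ℝ, EX) 𝓘(ℝ, E) j x :=
    (j.contMDiff x).mdifferentiableAt (by simp)
  have hmf : mfderiv 𝓘(ℝ, EX) 𝓘(ℝ, E) j x = fderiv ℝ γ (ψ x) := by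
    rw [hjd.mfderiv]
    simp only [modelWithCornersSelf_coe, Set.range_id, fderivWithin_univ]
    rfl
  have hγd : DifferentiableAt ℝ γ (ψ x) := by
    have := hjd.differentiableWithinAt_writtenInExtChartAt
    simp only [modelWithCornersSelf_coe, Set.range_id, differentiableWithinAt_univ] at this
    exact this
  have hγx : γ (ψ x) = φ (j x) := by simp only [hγ, Function.comp_apply, hx]
  have hGd : DifferentiableAt ℝ G (γ (ψ x)) := by
    rw [hγx]
    exact ((contDiffAt_chart E f (j x)).fderiv_right (m := 1)
      (by norm_num; exact ENat.LEInfty.out)).differentiableAt (by norm_num)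
  have hzero : G ∘ γ =ᶠ[nhds (ψ x)] fun _ => 0 := by
    have h1 : ContinuousAt (j ∘ ψ.symm) (ψ x) := by
      refine ContinuousAt.comp ?_ (continuousAt_extChartAt_symm x)
      exact j.contMDiff.continuous.continuousAt
    have h2 : φ.source ∈ nhds ((j ∘ ψ.symm) (ψ x)) := by
      rw [Function.comp_apply, hx]; exact extChartAt_source_mem_nhds (j x)
    filter_upwards [h1 h2] with e he
    have he' : j (ψ.symm e) ∈ φ.source := he
    have hsym : MDifferentiableAt 𝓘(ℝ, E) 𝓘(ℝ, E) φ.symm (φ (j (ψ.symm e))) := by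
      have := (contMDiffOn_extChartAt_symm (I := 𝓘(ℝ, E)) (n := ∞) (j x)).contMDiffAt
        ((isOpen_extChartAt_target (I := 𝓘(ℝ, E)) (j x)).mem_nhds (φ.map_source he'))
      exact this.mdifferentiableAt (by simp)
    have hf : MDifferentiableAt 𝓘(ℝ, E) 𝓘(ℝ, ℝ) f (φ.symm (φ (j (ψ.symm e)))) :=
      (f.contMDiff _).mdifferentiableAt (by simp)
    have hc := mfderiv_comp (φ (j (ψ.symm e))) hf hsym
    have h0 : mfderiv 𝓘(ℝ, E) 𝓘(ℝ, ℝ) f (φ.symm (φ (j (ψ.symm e)))) = 0 := by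
      rw [φ.left_inv he']; exact hj _
    rw [h0] at hc
    change fderiv ℝ (f ∘ φ.symm) (φ (j (ψ.symm e))) = 0
    rw [← mfderiv_eq_fderiv, hc]
    exact ContinuousLinearMap.zero_comp _
  have hchain : fderiv ℝ (G ∘ γ) (ψ x) = (fderiv ℝ G (γ (ψ x))).comp (fderiv ℝ γ (ψ x)) :=
    fderiv_comp _ hGd hγd
  rw [hzero.fderiv_eq, hγx] at hchain
  have := congrArg (fun L => L w) hchain
  rw [hmf]
  have h0 : fderiv ℝ (fun _ : EX => (0 : E →L[ℝ] ℝ)) (ψ x) = 0 := by simp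
  rw [h0] at this
  exact this.symm

/-- A Poisson structure on `M`, given by its bivector field `w` through the bundle map
`sharp = w^♯ : T*M → TM`, so that `w (a, b) = a (sharp b)` and `{f, g} = df (sharp dg)`. -/
structure PoissonStructure (E M : Type*) [NormedAddCommGroup E] [NormedSpace ℝ E]
    [TopologicalSpace M] [ChartedSpace E M] where
  sharp : ∀ p : M, Cot E p →ₗ[ℝ] Tan E p
  skew : ∀ (p : M) (a b : Cot E p), a (sharp p b) = -b (sharp p a)
  smooth : ∀ f g : Fn E M,
    ContMDiff 𝓘(ℝ, E) 𝓘(ℝ, ℝ) ∞ (fun p => diff E f p (sharp p (diff E g p)))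
  jacobi : ∀ f g h : Fn E M,
    let br : (M → ℝ) → (M → ℝ) → (M → ℝ) := fun u v p => diff E u p (sharp p (diff E v p))
    ∀ p, br f (br g h) p + br g (br h f) p + br h (br f g) p = 0

namespace PoissonStructure

variable {E}
variable (P : PoissonStructure E M)

/-- The Poisson bracket on smooth functions. -/
def bracket (f g : Fn E M) : Fn E M := ⟨_, P.smooth f g⟩

/-- The Hamiltonian vector field `X_f = w^♯ (df)`. -/
def ham (f : Fn E M) (p : M) : Tan E p := P.sharp p (diff E f p)

/-- `z'` is reached from `z` along an integral curve of a Hamiltonian vector field. -/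
def HamStep (z z' : M) : Prop :=
  ∃ (f : Fn E M) (c : ℝ → M) (t : ℝ), c 0 = z ∧ c t = z' ∧
    IsMIntegralCurveOn c (P.ham f) (Set.uIcc 0 t)

/-- The symplectic leaf through `z`: all points that can be joined to `z` by a finite chain of
pieces of integral curves of Hamiltonian vector fields. -/
def symplecticLeaf (z : M) : Set M := {z' | Relation.EqvGen P.HamStep z z'}

end PoissonStructure

/-- Smooth vector fields. -/
def SmoothField [IsManifold 𝓘(ℝ, E) ∞ M] (V : ∀ p : M, Tan E p) : Prop :=
  ContMDiff 𝓘(ℝ, E) 𝓘(ℝ, E).tangent ∞ (fun p => (⟨p, V p⟩ : TangentBundle 𝓘(ℝ, E) M))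

/-- Sections over the open set `U ⊆ X` of the restriction `T*M|_X` along `j : X → M`, smooth. -/
def SmoothCovOn [IsManifold 𝓘(ℝ, E) ∞ M] {EX X : Type*} [NormedAddCommGroup EX]
    [NormedSpace ℝ EX] [TopologicalSpace X] [ChartedSpace EX X] (j : X → M)
    (a : ∀ x, Cot E (j x)) (U : Set X) : Prop :=
  ContMDiffOn 𝓘(ℝ, EX) (𝓘(ℝ, E).prod 𝓘(ℝ, E →L[ℝ] ℝ)) ∞
    (fun x => TotalSpace.mk' (E →L[ℝ] ℝ) (E := fun p : M => Cot E p) (j x) (a x)) U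

end Manifold

/-! ### Lie algebra data -/

section LieData

variable {𝔤 : Type*} [LieRing 𝔤] [LieAlgebra ℝ 𝔤] (c : LieSubalgebra ℝ 𝔤)

/-- The group `Ad(C)` of automorphisms of `𝔤` for the analytic subgroup `C` with Lie algebra
`c` of a Lie group with (finite-dimensional) Lie algebra `𝔤`: it is generated by the
exponentials `exp (ad ζ)`, `ζ ∈ c`. The exponential series is written componentwise. -/
def adGroup : Submonoid (Module.End ℝ 𝔤) :=
  Submonoid.closure {T | ∃ ζ ∈ c, ∀ (ξ : 𝔤) (l : Module.Dual ℝ 𝔤),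
    HasSum (fun k : ℕ => ((k.factorial : ℝ))⁻¹ * l (((LieAlgebra.ad ℝ 𝔤 ζ) ^ k) ξ)) (l (T ξ))}

/-- The elements `ξ ∈ 𝔤` whose class in `𝔤/c` is invariant under `Ad_*(C)`. -/
def invLift : Submodule ℝ 𝔤 where
  carrier := {ξ | ∀ T ∈ adGroup c, T ξ - ξ ∈ c}
  zero_mem' := by intro T _; simp
  add_mem' := by
    intro a b ha hb T hT
    have h := c.add_mem (ha T hT) (hb T hT)
    have e : T (a + b) - (a + b) = (T a - a) + (T b - b) := by rw [map_add]; abel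
    rw [e]; exact h
  smul_mem' := by
    intro r a ha T hT
    have e : T (r • a) - r • a = r • (T a - a) := by rw [map_smul, smul_sub]
    rw [e]; exact c.smul_mem r (ha T hT)

/-- The fibre `(𝔤/c)^C` of the reduced Lie algebra bundle, as a subspace of `𝔤/c`. -/
def invQuot : Submodule ℝ (𝔤 ⧸ c.toSubmodule) := (invLift c).map c.toSubmodule.mkQ

/-- The class in `(𝔤/c)^C` of an element of `invLift c`. -/
def invClass (ξ : invLift c) : invQuot c :=
  ⟨c.toSubmodule.mkQ ξ, Submodule.mem_map_of_mem ξ.2⟩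

/-- The space `S²(c⁰)^C`: symmetric bilinear forms on `𝔤` that vanish on `c` (equivalently, on
`𝔤/c`) and are invariant under `C`. -/
def IsInvForm (B : LinearMap.BilinForm ℝ 𝔤) : Prop :=
  (∀ ξ η, B ξ η = B η ξ) ∧ (∀ ξ ∈ c, ∀ η, B ξ η = 0) ∧
    ∀ T ∈ adGroup c, ∀ ξ η, B (T ξ) (T η) = B ξ η

/-- The stabilizer group `N = N_{Aut(𝔤)}(c)`. -/
def IsStab (n : 𝔤 ≃ₗ⁅ℝ⁆ 𝔤) : Prop := ∀ ξ, n ξ ∈ c ↔ ξ ∈ c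

/-- The image in `End((𝔤/c)^C)` of the Lie algebra of `N`, that is, of the derivations of `𝔤`
that preserve `c`. As `K₁` is the kernel of the action of `N` on `(𝔤/c)^C`, this is the Lie
algebra of `Ñ = N/K₁`. -/
def InLieStab (T : invQuot c →ₗ[ℝ] invQuot c) : Prop :=
  ∃ d : LieDerivation ℝ 𝔤 𝔤, (∀ ξ ∈ c, d ξ ∈ c) ∧
    ∀ ξ : invLift c, (T (invClass c ξ) : 𝔤 ⧸ c.toSubmodule) = c.toSubmodule.mkQ (d ξ)

/-- The endomorphism `T` of `(𝔤/c)^C = N_𝔤(c)/c` is an inner derivation of the Lie algebra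
`N_𝔤(c)/c`. -/
def InAd (T : invQuot c →ₗ[ℝ] invQuot c) : Prop :=
  ∃ ζ ∈ c.normalizer, ∀ ξ : invLift c,
    (T (invClass c ξ) : 𝔤 ⧸ c.toSubmodule) = c.toSubmodule.mkQ ⁅ζ, (ξ : 𝔤)⁆

end LieData

/-! ### Lagrangian submanifold, symplectic leaf and coisotropic constraint -/

/-- Maps `X → S → Q → Z` into a Poisson manifold `Z`. -/
structure ConstraintData (EX X ES S EQ Q EZ Z : Type*)
    [NormedAddCommGroup EX] [NormedSpace ℝ EX] [TopologicalSpace X] [ChartedSpace EX X]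
    [NormedAddCommGroup ES] [NormedSpace ℝ ES] [TopologicalSpace S] [ChartedSpace ES S]
    [NormedAddCommGroup EQ] [NormedSpace ℝ EQ] [TopologicalSpace Q] [ChartedSpace EQ Q]
    [NormedAddCommGroup EZ] [NormedSpace ℝ EZ] [TopologicalSpace Z] [ChartedSpace EZ Z] where
  poisson : PoissonStructure EZ Z
  iX : C^∞⟮𝓘(ℝ, EX), X; 𝓘(ℝ, ES), S⟯
  iS : C^∞⟮𝓘(ℝ, ES), S; 𝓘(ℝ, EQ), Q⟯
  iQ : C^∞⟮𝓘(ℝ, EQ), Q; 𝓘(ℝ, EZ), Z⟯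

namespace ConstraintData

variable {EX X ES S EQ Q EZ Z : Type*}
  [NormedAddCommGroup EX] [NormedSpace ℝ EX] [TopologicalSpace X] [ChartedSpace EX X]
  [NormedAddCommGroup ES] [NormedSpace ℝ ES] [TopologicalSpace S] [ChartedSpace ES S]
  [NormedAddCommGroup EQ] [NormedSpace ℝ EQ] [TopologicalSpace Q] [ChartedSpace EQ Q]
  [NormedAddCommGroup EZ] [NormedSpace ℝ EZ] [TopologicalSpace Z] [ChartedSpace EZ Z]
  (D : ConstraintData EX X ES S EQ Q EZ Z)

/-- The point `x ∈ X` in `S`. -/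
def ptS (x : X) : S := D.iX x
/-- The point `x ∈ X` in `Q`. -/
def ptQ (x : X) : Q := D.iS (D.ptS x)
/-- The point `x ∈ X` in `Z`. -/
def ptZ (x : X) : Z := D.iQ (D.ptQ x)

/-- The tangent map of `X → S`. -/
def tX (x : X) : Tan EX x →L[ℝ] Tan ES (D.ptS x) := mfderiv 𝓘(ℝ, EX) 𝓘(ℝ, ES) D.iX x
/-- The tangent map of `S → Q`. -/
def tS (s : S) : Tan ES s →L[ℝ] Tan EQ (D.iS s) :=
  mfderiv 𝓘(ℝ, ES) 𝓘(ℝ, EQ) D.iS s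
/-- The tangent map of `Q → Z`. -/
def tQ (q : Q) : Tan EQ q →L[ℝ] Tan EZ (D.iQ q) :=
  mfderiv 𝓘(ℝ, EQ) 𝓘(ℝ, EZ) D.iQ q
/-- The tangent map of `S → Z`. -/
def tSZ (s : S) : Tan ES s →L[ℝ] Tan EZ (D.iQ (D.iS s)) :=
  (D.tQ (D.iS s)).comp (D.tS s)
/-- The tangent map of `X → Q`. -/
def tXQ (x : X) : Tan EX x →L[ℝ] Tan EQ (D.ptQ x) :=
  (D.tS (D.ptS x)).comp (D.tX x)
/-- The tangent map of `X → Z`. -/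
def tXZ (x : X) : Tan EX x →L[ℝ] Tan EZ (D.ptZ x) :=
  (D.tQ (D.ptQ x)).comp (D.tXQ x)

open Classical in
/-- The flat map `ω_S^♭ : TS → T*S` of the symplectic form of the leaf, the inverse of `w^♯`:
if `w^♯ a = u`, then `ω_S^♭ u` is the restriction of `a` to `TS`. -/
def omegaFlat (s : S) (u : Tan ES s) : Cot ES s :=
  if h : ∃ a : Cot EZ (D.iQ (D.iS s)), D.poisson.sharp _ a = D.tSZ s u
  then h.choose.comp (D.tSZ s) else 0

/-- `X` is an embedded Lagrangian submanifold of the symplectic leaf `S`, which is an embedded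
submanifold of `Z` and lies in the embedded (equivalently, locally closed) coisotropic
submanifold `Q` of `Z`. -/
structure IsConstraint : Prop where
  embX : Manifold.IsSmoothEmbedding 𝓘(ℝ, EX) 𝓘(ℝ, ES) ∞ D.iX
  embS : Manifold.IsSmoothEmbedding 𝓘(ℝ, ES) 𝓘(ℝ, EQ) ∞ D.iS
  embQ : Manifold.IsSmoothEmbedding 𝓘(ℝ, EQ) 𝓘(ℝ, EZ) ∞ D.iQ
  leaf : ∃ z, Set.range (fun s => D.iQ (D.iS s)) = D.poisson.symplecticLeaf z
  leaf_tangent : ∀ (s : S) (v : Tan EZ (D.iQ (D.iS s))),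
    (∃ u, D.tSZ s u = v) ↔ ∃ a, D.poisson.sharp _ a = v
  lagrangian : ∀ (x : X) (u : Tan ES (D.ptS x)),
    (∃ w, D.tX x w = u) ↔ ∀ w, D.omegaFlat _ (D.tX x w) u = 0
  coisotropic : ∀ (q : Q) (a : Cot EZ (D.iQ q)), (∀ u, a (D.tQ q u) = 0) →
    ∃ u, D.tQ q u = D.poisson.sharp _ a

/-! ### The bundles at `X` -/

/-- `Ẽ_X = (TX)⁰ ⊆ T*Q|_X`. -/
def Etil (x : X) : Submodule ℝ (Cot EQ (D.ptQ x)) where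
  carrier := {a | ∀ w, a (D.tXQ x w) = 0}
  zero_mem' := fun _ => rfl
  add_mem' := fun ha hb w =>
    (congrArg₂ (· + ·) (ha w) (hb w)).trans (add_zero (0 : ℝ))
  smul_mem' := fun r _ ha w => (congrArg (r * ·) (ha w)).trans (mul_zero r)

/-- `L̃_X = (TS)⁰ ⊆ T*Q|_X`. -/
def Ltil (x : X) : Submodule ℝ (Cot EQ (D.ptQ x)) where
  carrier := {a | ∀ u, a (D.tS (D.ptS x) u) = 0}
  zero_mem' := fun _ => rfl
  add_mem' := fun ha hb w =>
    (congrArg₂ (· + ·) (ha w) (hb w)).trans (add_zero (0 : ℝ))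
  smul_mem' := fun r _ ha w => (congrArg (r * ·) (ha w)).trans (mul_zero r)

/-- The annihilator of `TX` in `T*S|_X`. -/
def annS (x : X) : Submodule ℝ (Cot ES (D.ptS x)) where
  carrier := {a | ∀ w, a (D.tX x w) = 0}
  zero_mem' := fun _ => rfl
  add_mem' := fun ha hb w =>
    (congrArg₂ (· + ·) (ha w) (hb w)).trans (add_zero (0 : ℝ))
  smul_mem' := fun r _ ha w => (congrArg (r * ·) (ha w)).trans (mul_zero r)

theorem Ltil_le (x : X) : D.Ltil x ≤ D.Etil x := fun _ ha _ => ha _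

/-- The inclusion `L̃_X → Ẽ_X`. -/
def incl (x : X) : D.Ltil x →ₗ[ℝ] D.Etil x := Submodule.inclusion (D.Ltil_le x)

/-- `Ẽ_X^* = TQ|_X / TX`. -/
abbrev EtilDual (x : X) := Tan EQ (D.ptQ x) ⧸ LinearMap.range (D.tXQ x).toLinearMap

/-- `E_X^* = TZ|_X / TX`. -/
abbrev EDual (x : X) := Tan EZ (D.ptZ x) ⧸ LinearMap.range (D.tXZ x).toLinearMap

/-- `TS|_X / TX`. -/
abbrev NS (x : X) := Tan ES (D.ptS x) ⧸ LinearMap.range (D.tX x).toLinearMap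

/-- The duality pairing of `Ẽ_X` and `Ẽ_X^*`. -/
def pair (x : X) (a : D.Etil x) : D.EtilDual x →ₗ[ℝ] ℝ :=
  Submodule.liftQ _ (a : Cot EQ (D.ptQ x)).toLinearMap (by
    rintro _ ⟨w, rfl⟩
    exact a.2 w)

/-- The inclusion `TS|_X / TX → TQ|_X / TX = Ẽ_X^*` induced by the tangent map. -/
def nsIncl (x : X) : D.NS x →ₗ[ℝ] D.EtilDual x :=
  Submodule.mapQ _ _ (D.tS (D.ptS x)).toLinearMap (by
    rintro _ ⟨w, rfl⟩
    exact ⟨w, rfl⟩)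

/-- The restriction `Ẽ_X → (TX)⁰ ⊆ T*S|_X` of covectors to `TS`. -/
def nsRes (x : X) : D.Etil x →ₗ[ℝ] D.annS x where
  toFun a := ⟨(a : Cot EQ (D.ptQ x)).comp (D.tS (D.ptS x)), fun w => a.2 w⟩
  map_add' _ _ := rfl
  map_smul' _ _ := rfl

theorem tXQ_eq (x : X) :
    D.tXQ x = mfderiv 𝓘(ℝ, EX) 𝓘(ℝ, EQ) (D.iS.comp D.iX) x :=
  (mfderiv_comp x ((D.iS.contMDiff _).mdifferentiableAt (by simp))
    ((D.iX.contMDiff x).mdifferentiableAt (by simp))).symm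

section Smooth

variable [IsManifold 𝓘(ℝ, EX) ∞ X] [IsManifold 𝓘(ℝ, EQ) ∞ Q] [IsManifold 𝓘(ℝ, EZ) ∞ Z]

/-- Smooth sections of `T*Q|_X`; applied to sections of subbundles such as `Ẽ_X`. -/
def SmoothSec (a : ∀ x, Cot EQ (D.ptQ x)) : Prop :=
  SmoothCovOn (EX := EX) EQ D.ptQ a Set.univ

/-- A bundle metric on a subbundle `W` of `T*Q|_X`: a smooth field of nondegenerate symmetric
bilinear forms on the fibres (of arbitrary signature). -/
def IsBundleMetric (W : ∀ x, Submodule ℝ (Cot EQ (D.ptQ x)))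
    (h : ∀ x, LinearMap.BilinForm ℝ (W x)) : Prop :=
  (∀ x a b, h x a b = h x b a) ∧ (∀ x a, (∀ b, h x a b = 0) → a = 0) ∧
    ∀ a b : ∀ x, W x, D.SmoothSec (fun x => a x) → D.SmoothSec (fun x => b x) →
      ContMDiff 𝓘(ℝ, EX) 𝓘(ℝ, ℝ) ∞ (fun x => h x (a x) (b x))

/-- A metric on `X` (of arbitrary signature). -/
def IsMetric (h : ∀ x : X, LinearMap.BilinForm ℝ (Tan EX x)) : Prop :=
  (∀ x a b, h x a b = h x b a) ∧ (∀ x a, (∀ b, h x a b = 0) → a = 0) ∧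
    ∀ V W : ∀ x : X, Tan EX x, SmoothField EX V → SmoothField EX W →
      ContMDiff 𝓘(ℝ, EX) 𝓘(ℝ, ℝ) ∞ (fun x => h x (V x) (W x))

/-- An `Ẽ_X`-connection form: a smooth bundle map `α : TX → Ẽ_X` that splits the anchor
`Ẽ_X → TX`, which is induced by `-w^♯` on lifts to `T*Z|_X`. -/
def IsConnForm (α : ∀ x, Tan EX x →ₗ[ℝ] D.Etil x) : Prop :=
  (∀ V, SmoothField EX V → D.SmoothSec (fun x => α x (V x))) ∧
    ∀ x V (a : Cot EZ (D.ptZ x)), a.comp (D.tQ (D.ptQ x)) = α x V →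
      -D.poisson.sharp _ a = D.tXZ x V

/-- Triples `(γ, α, χ)` of fields on `X` of the types of a metric on `X`, an `Ẽ_X`-connection
form, and a bundle metric on `L̃_X`. -/
@[ext]
structure Fields where
  γ : ∀ x : X, LinearMap.BilinForm ℝ (Tan EX x)
  α : ∀ x : X, Tan EX x →ₗ[ℝ] D.Etil x
  χ : ∀ x : X, LinearMap.BilinForm ℝ (D.Ltil x)

/-- `(γ, α, χ)` consists of a metric on `X`, an `Ẽ_X`-connection form and a bundle metric on
`L̃_X`. -/
def IsTriple (τ : D.Fields) : Prop :=
  IsMetric τ.γ ∧ D.IsConnForm τ.α ∧ D.IsBundleMetric D.Ltil τ.χ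

/-- For a morphism `J : Ẽ_X^* → Ẽ_X`, the morphism `J₀ : TS/TX → (TX)⁰ ⊆ T*S` obtained by
composing with the inclusion of `TS` and the restriction to `TS`. -/
def zeroPart {x : X} (J : D.EtilDual x →ₗ[ℝ] D.Etil x) : D.NS x →ₗ[ℝ] D.annS x :=
  D.nsRes x ∘ₗ J ∘ₗ D.nsIncl x

/-- The commutative diagram that expresses `(γ, α, χ)` through `J : Ẽ_X^* → Ẽ_X` at `x`. With
`u = J₀⁻¹ (-ω_X^♭ V)` it says `α V = J (Ti_S u)` and `γ^♭ V = (-ω_X^♭)^* u`, and `χ^♭` is the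
composition of the inclusion `L̃_X → Ẽ_X`, the inverse of `J`, and the projection to `L̃_X^*`. -/
def Diagram (x : X) (J : D.EtilDual x →ₗ[ℝ] D.Etil x) (τ : D.Fields) : Prop :=
  (∀ V : Tan EX x, ∃ u : Tan ES (D.ptS x),
    (D.zeroPart J (Submodule.Quotient.mk u) : Cot ES (D.ptS x)) = -D.omegaFlat _ (D.tX x V) ∧
    τ.α x V = J (D.nsIncl x (Submodule.Quotient.mk u)) ∧
    ∀ W, τ.γ x V W = (-D.omegaFlat _ (D.tX x W)) u) ∧
  ∀ (a b : D.Ltil x) (m : D.EtilDual x), J m = D.incl x a → τ.χ x a b = D.pair x (D.incl x b) m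

/-- `η^♭ : Ẽ_X → Ẽ_X^*` is the inverse of `J` at `x`. -/
def IsInverse (x : X) (J : D.EtilDual x →ₗ[ℝ] D.Etil x) (η : LinearMap.BilinForm ℝ (D.Etil x)) :
    Prop :=
  Function.Bijective J ∧ ∀ m b, η (J m) b = D.pair x b m

/-- The triple `(γ, α, χ)` is obtained from the bundle metric `η` on `Ẽ_X` by the diagram. -/
def Corresponds (η : ∀ x, LinearMap.BilinForm ℝ (D.Etil x)) (τ : D.Fields) : Prop :=
  ∀ x, ∃ J, D.IsInverse x J (η x) ∧ D.Diagram x J τ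

/-- The restriction of a field of bilinear forms on `Ẽ_X` to `L̃_X` is nondegenerate at `x`. -/
def NondegOnL (η : ∀ x, LinearMap.BilinForm ℝ (D.Etil x)) (x : X) : Prop :=
  ∀ a : D.Ltil x, (∀ b : D.Ltil x, η x (D.incl x a) (D.incl x b) = 0) → a = 0

/-! ### The morphism `j^V H̃^♯` -/

/-- `dH̃` vanishes along `X`. -/
def Critical (H : Fn EQ Q) : Prop := ∀ x, diff EQ H (D.ptQ x) = 0

/-- The morphism `j^V H̃^♯ : Ẽ_X^* → Ẽ_X` of the second derivative of `H̃` along `X`. -/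
def jV (H : Fn EQ Q) (hH : D.Critical H) (x : X) : D.EtilDual x →ₗ[ℝ] D.Etil x :=
  have key : ∀ w, hess EQ H (D.ptQ x) (D.tXQ x w) = 0 := fun w => by
    rw [D.tXQ_eq]; exact hess_critical EQ H (D.iS.comp D.iX) hH x w
  Submodule.liftQ _
    { toFun := fun u => (⟨hess EQ H (D.ptQ x) u, fun w => by
        rw [hess_symm, key w]; rfl⟩ : D.Etil x)
      map_add' := fun u v => by ext1; exact map_add _ u v
      map_smul' := fun r u => by ext1; exact map_smul _ r u }
    (by
      rintro _ ⟨w, rfl⟩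
      exact Subtype.ext (key w))

/-! ### The Sternberg–Weinstein approximation and its reduction -/

/-- The points of the Sternberg–Weinstein approximation `Z' = E_X^*`. -/
def ZPrime := Σ x : X, D.EDual x

/-- The points of `Q' = Ẽ_X^*`. -/
def QPrime := Σ x : X, D.EtilDual x

/-- The inclusion `i_{Q'} : Q' → Z'`. -/
def iQPrime (m : D.QPrime) : D.ZPrime :=
  ⟨m.1, Submodule.mapQ _ _ (D.tQ (D.ptQ m.1)).toLinearMap (by
    rintro _ ⟨w, rfl⟩
    exact ⟨w, rfl⟩) m.2⟩

/-- The inclusion `X → Z` as a smooth map. -/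
def zmap : C^∞⟮𝓘(ℝ, EX), X; 𝓘(ℝ, EZ), Z⟯ := D.iQ.comp (D.iS.comp D.iX)

/-- The total space of `TZ|_X`, the pullback of the tangent bundle of `Z` to `X`. -/
abbrev TZX := TotalSpace EZ (D.zmap *ᵖ (fun z : Z => Tan EZ z))

/-- The quotient map `TZ|_X → TZ|_X / TX = Z'`. -/
def proj (p : D.TZX) : D.ZPrime :=
  ⟨p.1, Submodule.Quotient.mk (show Tan EZ (D.ptZ p.1) from p.2)⟩

/-- `C^∞(Z')`: as `TZ|_X → Z'` is a surjective submersion, a function on `Z'` is smooth when its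
pullback to `TZ|_X` is. -/
def SmoothZ (F : D.ZPrime → ℝ) : Prop :=
  ContMDiff (𝓘(ℝ, EX).prod 𝓘(ℝ, EZ)) 𝓘(ℝ, ℝ) ∞ (fun p : D.TZX => F (D.proj p))

/-- The pullback to `TZ|_X` of the function `lin (df|_X) + τ^* φ` on `Z'`, the sum of the
fibrewise linear function given by `df` along `X` and of a function on the base. -/
def affineFn (f : Fn EZ Z) (φ : Fn EX X) (p : D.TZX) : ℝ :=
  diff EZ f (D.ptZ p.1) p.2 + φ p.1

/-- `f` vanishes on `X`, and at the point `p` of `TZ|_X` the functions `F` and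
`lin (df|_X) + τ^* φ` have the same differential. -/
def Represents (F : D.ZPrime → ℝ) (p : D.TZX) (f : Fn EZ Z) (φ : Fn EX X) : Prop :=
  (∀ x, f (D.ptZ x) = 0) ∧
    mfderiv (𝓘(ℝ, EX).prod 𝓘(ℝ, EZ)) 𝓘(ℝ, ℝ) (fun p : D.TZX => F (D.proj p)) p =
      mfderiv (𝓘(ℝ, EX).prod 𝓘(ℝ, EZ)) 𝓘(ℝ, ℝ) (D.affineFn f φ) p

/-- Data to compute the bracket of `F` and `G` at the point `m` of `Z'`: a vector `p` above `m`,
functions of the form `lin (df|_X) + τ^* φ` with the differentials of `F` and `G` at `m`, and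
the values `a`, `b` in `TX` of the Hamiltonian vector fields `X_f`, `X_g`. -/
structure BracketData (F G : D.ZPrime → ℝ) (m : D.ZPrime) where
  p : D.TZX
  f : Fn EZ Z
  g : Fn EZ Z
  φ : Fn EX X
  ψ : Fn EX X
  a : Tan EX p.1
  b : Tan EX p.1
  proj_p : D.proj p = m
  repF : D.Represents F p f φ
  repG : D.Represents G p g ψ
  ham_a : D.tXZ p.1 a = D.poisson.ham f (D.ptZ p.1)
  ham_b : D.tXZ p.1 b = D.poisson.ham g (D.ptZ p.1)

/-- The value at `m` of `{lin (df) + τ^*φ, lin (dg) + τ^*ψ}'`, with (`lin (a)` denoting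
the fibrewise linear function of the section `a`) `{lin (df), lin (dg)}' = lin (d{f,g})`, `{lin (df), τ^*ψ}' = τ^*(-X_f·ψ)`,
`{τ^*φ, lin (dg)}' = τ^*(X_g·φ)` and `{τ^*φ, τ^*ψ}' = 0`. -/
def BracketData.value {F G : D.ZPrime → ℝ} {m : D.ZPrime} (B : D.BracketData F G m) : ℝ :=
  diff EZ (D.poisson.bracket B.f B.g) (D.ptZ B.p.1) B.p.2
    - diff EX B.ψ B.p.1 B.a + diff EX B.φ B.p.1 B.b

open Classical in
/-- The Poisson bracket `{F, G}'` of the Sternberg–Weinstein approximation `Z' = E_X^*`: the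
extension, as a biderivation, of the Lie algebroid bracket `{df|_X, dg|_X} = d{f,g}|_X` on the
sections of `E_X` (fibrewise linear functions) and of the action of the anchor `-w^♯` on the
functions on `X`. As `{F, G}'(m)` depends on the differentials of `F` and `G` at `m` only, it is
computed with functions `lin (df|_X) + τ^*φ`, whose differentials span. -/
def swBracket (F G : D.ZPrime → ℝ) (m : D.ZPrime) : ℝ :=
  if h : Nonempty (D.BracketData F G m) then h.some.value else 0

/-- The constraint algebra `ℭ' = {F ∈ C^∞(Z') | F = 0 on Q'}`. -/
def CPrime (F : D.ZPrime → ℝ) : Prop := D.SmoothZ F ∧ ∀ m, F (D.iQPrime m) = 0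

/-- The idealizer `𝔑'` of `ℭ'` in `C^∞(Z')`, the admissible functions. -/
def NPrime (F : D.ZPrime → ℝ) : Prop :=
  D.SmoothZ F ∧ ∀ G, D.CPrime G → ∀ m, D.swBracket F G (D.iQPrime m) = 0

/-- The reduced Poisson algebra `𝔓̃' = i_{Q'}^* 𝔑'`, functions on `Q'`. -/
def PtilPrime (ψ : D.QPrime → ℝ) : Prop :=
  ∃ F, D.NPrime F ∧ ∀ m, F (D.iQPrime m) = ψ m

open Classical in
/-- The bracket of `𝔓̃'`, induced by `{·,·}'` on admissible extensions. -/
def redBracket (ψ₁ ψ₂ : D.QPrime → ℝ) (m : D.QPrime) : ℝ :=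
  if h : D.PtilPrime ψ₁ ∧ D.PtilPrime ψ₂
  then D.swBracket h.1.choose h.2.choose (D.iQPrime m) else 0

/-- The fibrewise linear function on `Q' = Ẽ_X^*` defined by a section of `Ẽ_X`. -/
def bar (a : ∀ x, D.Etil x) (m : D.QPrime) : ℝ := D.pair m.1 (a m.1) m.2

/-- The reduced Poisson algebra `𝔓̃ = i_Q^* 𝔑` of `C^∞(Z)`, where `𝔑` is the idealizer of the
algebra of functions that vanish on `Q`. -/
def Ptil (H : Fn EQ Q) : Prop :=
  ∃ K : Fn EZ Z, (∀ f : Fn EZ Z, (∀ q, f (D.iQ q) = 0) →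
      ∀ q, D.poisson.bracket K f (D.iQ q) = 0) ∧ ∀ q, K (D.iQ q) = H q

/-! ### Constraint Lie frames and the reduced Lie frame bundle -/

section Frames

variable {𝔤 : Type*} [LieRing 𝔤] [LieAlgebra ℝ 𝔤] (c : LieSubalgebra ℝ 𝔤)

/-- `p` is a Lie frame at `x`, that is, an isomorphism of `𝔤` onto the transverse Lie algebra
`L_x = (T_xS)⁰ ⊆ T*_xZ`, whose bracket is `[df, dg] = d{f, g}`. -/
def IsLieFrame (x : X) (p : 𝔤 →ₗ[ℝ] Cot EZ (D.ptZ x)) : Prop :=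
  Function.Injective p ∧
  (∀ a : Cot EZ (D.ptZ x), (∃ ξ, p ξ = a) ↔ ∀ u, a (D.tSZ (D.ptS x) u) = 0) ∧
  ∀ (ξ η : 𝔤) (f g : Fn EZ Z), diff EZ f (D.ptZ x) = p ξ → diff EZ g (D.ptZ x) = p η →
    diff EZ (D.poisson.bracket f g) (D.ptZ x) = p ⁅ξ, η⁆

/-- The fibre at `x` of the constraint Lie frame bundle `R_X^c`: the Lie frames that map `c` onto
the annihilator `A_x = (T_xQ)⁰`. -/
def IsConstraintFrame (x : X) (p : 𝔤 →ₗ[ℝ] Cot EZ (D.ptZ x)) : Prop :=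
  D.IsLieFrame x p ∧
    ∀ a : Cot EZ (D.ptZ x), (∃ ξ ∈ c, p ξ = a) ↔ ∀ u, a (D.tQ (D.ptQ x) u) = 0

/-- Smooth local sections of `R_X^c`, over an open set `U ⊆ X` (junk outside `U`). -/
structure LocalFrame where
  U : Set X
  isOpen : IsOpen U
  frame : ∀ x, 𝔤 →ₗ[ℝ] Cot EZ (D.ptZ x)
  smooth : ∀ ξ, SmoothCovOn (EX := EX) EZ D.ptZ (fun x => frame x ξ) U
  mem : ∀ x ∈ U, D.IsConstraintFrame c x (frame x)

/-- The Lie frame bundle `R_X` can be reduced to `N = N_{Aut(𝔤)}(c)`, the reduced bundle being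
`R_X^c`: it has smooth local sections near every point of `X`. -/
def Reducible : Prop := ∀ x, ∃ σ : D.LocalFrame c, x ∈ σ.U

/-- The restriction to `TQ` of the covector `p ξ`. -/
def resQ {x : X} (p : 𝔤 →ₗ[ℝ] Cot EZ (D.ptZ x)) (ξ : 𝔤) : Cot EQ (D.ptQ x) :=
  (p ξ).comp (D.tQ (D.ptQ x))

/-- The fibre at `x` of `L̃_1 = R_X^c ×_N (𝔤/c)^C`, as a subset of `L̃_X = L_X/A_X ⊆ T*Q|_X`. -/
def L1 (x : X) : Set (Cot EQ (D.ptQ x)) :=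
  {a | ∃ p, D.IsConstraintFrame c x p ∧ ∃ ξ ∈ invLift c, a = D.resQ p ξ}

/-- Smooth sections of `L̃_1`. -/
def IsSecL1 (s : ∀ x, D.Etil x) : Prop :=
  D.SmoothSec (fun x => s x) ∧ ∀ x, (s x : Cot EQ (D.ptQ x)) ∈ D.L1 c x

/-- The fibre at `x` of `L̃_2^* = R_X^c ×_N S²(c⁰)^C`, in the bilinear forms on `L̃_X`. -/
def L2Dual (x : X) : Set (LinearMap.BilinForm ℝ (D.Ltil x)) :=
  {h | ∃ p, D.IsConstraintFrame c x p ∧ ∃ B, IsInvForm c B ∧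
    ∀ (ξ η : 𝔤) (a b : D.Ltil x), (a : Cot EQ (D.ptQ x)) = D.resQ p ξ →
      (b : Cot EQ (D.ptQ x)) = D.resQ p η → h a b = B ξ η}

/-- A principal connection form `A` on the reduced Lie frame bundle `R̃_X = R_X^c/K₁`, with
structure group `Ñ = N/K₁ ⊆ GL((𝔤/c)^C)`, given by its pullbacks `σ^*A` along the local sections
of `R̃_X` that are represented by smooth local sections `σ` of `R_X^c`. The forms `σ^*A` take
values in the Lie algebra of `Ñ`, and `(σn)^*A = Ad(n⁻¹) σ^*A + n⁻¹ dn` for smooth `N`-valued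
functions `n`. (For `n` with values in `K₁` this says that `σ^*A` depends only on the section of
`R̃_X` represented by `σ`.) Smoothness and derivatives are taken componentwise. -/
structure PrincipalConnection where
  pot : ∀ (_ : D.LocalFrame c) (x : X), Tan EX x →ₗ[ℝ] invQuot c →ₗ[ℝ] invQuot c
  smooth : ∀ (σ : D.LocalFrame c) (V : ∀ x : X, Tan EX x), SmoothField EX V →
    ∀ (ξ : invQuot c) (l : Module.Dual ℝ (𝔤 ⧸ c.toSubmodule)),
      ContMDiffOn 𝓘(ℝ, EX) 𝓘(ℝ, ℝ) ∞ (fun x => l (pot σ x (V x) ξ)) σ.U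
  mem_lie : ∀ (σ : D.LocalFrame c), ∀ x ∈ σ.U, ∀ v, InLieStab c (pot σ x v)
  equivariant : ∀ (σ σ' : D.LocalFrame c) (W : Set X) (n : X → 𝔤 ≃ₗ⁅ℝ⁆ 𝔤),
    IsOpen W → W ⊆ σ.U → W ⊆ σ'.U → (∀ x ∈ W, IsStab c (n x)) →
    (∀ (ξ : 𝔤) (l : Module.Dual ℝ 𝔤),
      ContMDiffOn 𝓘(ℝ, EX) 𝓘(ℝ, ℝ) ∞ (fun x => l (n x ξ)) W) →
    (∀ x ∈ W, ∀ ξ, σ'.frame x ξ = σ.frame x (n x ξ)) →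
    ∀ x ∈ W, ∀ (v : Tan EX x) (ξ η δ : 𝔤) (hξ : ξ ∈ invLift c) (hn : n x ξ ∈ invLift c),
      c.toSubmodule.mkQ η = pot σ' x v (invClass c ⟨ξ, hξ⟩) →
      (∀ l : Module.Dual ℝ 𝔤, diff EX (fun y => l (n y ξ)) x v = l δ) →
      c.toSubmodule.mkQ (n x η) =
        pot σ x v (invClass c ⟨n x ξ, hn⟩) + c.toSubmodule.mkQ δ

/-- `t = ∇_V s` for the covariant derivative `∇` on `L̃_1` associated with the principal
connection `A`: if `s = σ ξ` for a local section `σ` and a smooth `ξ`, then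
`∇_V s = σ (dξ(V) + (σ^*A)(V) ξ)`. -/
def IsCovDeriv (A : D.PrincipalConnection c) (V : ∀ x : X, Tan EX x) (s t : ∀ x, D.Etil x) :
    Prop :=
  ∀ (σ : D.LocalFrame c) (ξ : X → 𝔤),
    (∀ l : Module.Dual ℝ 𝔤, ContMDiffOn 𝓘(ℝ, EX) 𝓘(ℝ, ℝ) ∞ (fun x => l (ξ x)) σ.U) →
    (∀ x ∈ σ.U, ξ x ∈ invLift c) →
    (∀ x ∈ σ.U, (s x : Cot EQ (D.ptQ x)) = D.resQ (σ.frame x) (ξ x)) →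
    ∀ x ∈ σ.U, ∀ (hξ : ξ x ∈ invLift c) (η δ : 𝔤),
      c.toSubmodule.mkQ η = A.pot σ x (V x) (invClass c ⟨ξ x, hξ⟩) →
      (∀ l : Module.Dual ℝ 𝔤, diff EX (fun y => l (ξ y)) x (V x) = l δ) →
      (t x : Cot EQ (D.ptQ x)) = D.resQ (σ.frame x) (δ + η)

/-- The principal connection `A` on `R̃_X` is the one defined by `α`: the associated covariant
derivative `∇_V` on `Γ(L̃_1)` is the adjoint action of the function defined by `α(V)`, by the
reduced bracket of `𝔓̃'`. -/
def IsInducedBy (A : D.PrincipalConnection c) (α : ∀ x, Tan EX x →ₗ[ℝ] D.Etil x) : Prop :=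
  ∀ (V : ∀ x : X, Tan EX x) (s : ∀ x, D.Etil x), SmoothField EX V → D.IsSecL1 c s →
    D.PtilPrime (D.bar (fun x => α x (V x))) ∧ D.PtilPrime (D.bar s) ∧
    ∃ t, D.IsSecL1 c t ∧ D.IsCovDeriv c A V s t ∧
      ∀ m, D.redBracket (D.bar (fun x => α x (V x))) (D.bar s) m = D.bar t m

/-- The principal connection `A` takes values in `ad(𝔤̃)`, `𝔤̃ = N_𝔤(c)/c`: through every point
`p` of the bundle of frames there is a smooth local section `σ` for which `σ^*A` is `ad(𝔤̃)`-valued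
(so that these sections trivialize the bundle, with `ad(𝔤̃)`-valued `n⁻¹dn` for the transition
functions `n`). -/
def IsAdValued (A : D.PrincipalConnection c) : Prop :=
  ∀ (x : X) (p : 𝔤 →ₗ[ℝ] Cot EZ (D.ptZ x)), D.IsConstraintFrame c x p →
    ∃ σ : D.LocalFrame c, x ∈ σ.U ∧ σ.frame x = p ∧
      ∀ y ∈ σ.U, ∀ v, InAd c (A.pot σ y v)

end Frames

end Smooth

end ConstraintData

end

end PoissonReduction

open scoped Manifold ContDiff Bundle
open Bundle

open scoped Topology
open Filter
set_option linter.unusedSectionVars false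

namespace PoissonReduction

/-! ### Germs of smooth maps, differentials of functions and coordinates of tangent vectors. -/

noncomputable section

section ManifoldTools

variable {E : Type*} {M : Type*} [NormedAddCommGroup E] [NormedSpace ℝ E]
  [TopologicalSpace M] [ChartedSpace E M]

/-! Parts (a) and (b) are linear algebra in the fibres. If `η♭ = J⁻¹`, then `η (J m) b = ⟨b, m⟩`,
and `TS/TX` is the annihilator of `L̃` in `Ẽ*`. So `J` maps `TS/TX` onto the `η`-orthogonal
complement of `L̃`, the kernel of `J₀` corresponds to `L̃ ∩ L̃^⊥` (`nondeg_iff`), and the diagram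
says that `α V` is the lift of `V` under the anchor that is orthogonal to `L̃`, that `γ` is the
pull-back of `η` by `α`, and that `χ` is the restriction of `η` (`diagram_iff`). Thus `Ẽ = α(TX) ⊕
L̃` is an orthogonal splitting with blocks `γ` and `χ`, and the splitting and the blocks give back
the metric (`exists_triple`, `exists_metric`). Objects are chosen point by point; they are smooth
because they solve smooth linear systems that are injective at the point (`VecNear.of_system`,
`CovNear.of_system`).

The bridge to (c) is `Adm`: a covector `a` on `TQ` is admissible if, for `df|TQ = a` and every `g`
vanishing on `Q`, the differential of `{f, g}` vanishes on `TQ`. Coisotropy makes this independent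
of `f`. Let `K` be an admissible extension of `H̃`, corrected so that `dK = 0` at the point. Then `α
V = D²K(u, ·)` with `u` tangent to `S`, and `u = Σ kᵢ X_{hᵢ}`, so `f = Σ kᵢ {K, hᵢ}` has
differential `α V` on `TQ`. By the Jacobi identity the differential of `{f, g}` is the second
derivative of `{K, g}` in a direction tangent to `Q`, and `{K, g}` vanishes on `Q` (`adm_alpha`).
For sections with admissible values, the bracket on `Z'` restricted to `Q'` is `d{f, g}` for any
functions on `Z` whose differentials restrict to the two sections (`swBracket_eq`); membership in
the reduced algebra follows (`ptilPrime_bar`).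

The connection: fix a local frame `σ` and `f` with `df|TQ = α V`. The map `ξ ↦ σ⁻¹ d{f, g}` with `dg
= σ ξ` along `X` is a derivation of `𝔤` by the Jacobi identity, and it preserves `c` by
admissibility (`exists_theta`, `theta_mem`). Its action on `N_𝔤(c)/c` does not depend on `f` and is
the local connection form. Since `X_f = -V` on `X`, the Leibniz rule gives both the formula for the
covariant derivative and the equivariance (`diff_bracket_frame`). Uniqueness follows by testing with
cut-off sections (`conn_unique`).

The values in inner derivations come from curvature. For coordinate vector fields the differential
of `{f, f'}` is isotropic, hence equals `σ ζ`, and the Jacobi identity identifies the curvature of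
the family of derivations with `ad ζ`, where `ζ` normalizes `c` (`exists_curvature`). Parallel
transport along rays in a chart consists of automorphisms preserving `c`, and in the radial gauge
the connection form is an integral of transported curvature. It therefore stays in the inner
derivations by the normalizer (`exists_gauge`, `isAdValued_conn`).

Finally, let `g` vanish on `Q` with `dg = σ ζ`, `ζ ∈ c`. The linearization of `X_g` preserves `TQ`
and is skew for the second derivative of `H̃`, because `{K, g}` vanishes on `Q`. Dually, `ad ζ` is
skew for `χ` (`chi_mem_L2Dual`). -/

instance [FiniteDimensional ℝ E] (p : M) : FiniteDimensional ℝ (Tan E p) :=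
  inferInstanceAs (FiniteDimensional ℝ E)

/-- Smoothness of a map into a normed space on a neighbourhood of a point. -/
def SmoothNear {F : Type*} [NormedAddCommGroup F] [NormedSpace ℝ F] (f : M → F) (x : M) : Prop :=
  ∀ᶠ y in 𝓝 x, ContMDiffAt 𝓘(ℝ, E) 𝓘(ℝ, F) ∞ f y

section SmoothNear

variable {F G : Type*} [NormedAddCommGroup F] [NormedSpace ℝ F] [NormedAddCommGroup G]
  [NormedSpace ℝ G] {x : M}

theorem SmoothNear.congr {f g : M → F} (hf : SmoothNear (E := E) f x) (h : g =ᶠ[𝓝 x] f) :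
    SmoothNear (E := E) g x := by
  filter_upwards [hf, h.eventually_nhds] with y h1 h2 using h1.congr_of_eventuallyEq h2

theorem SmoothNear.at {f : M → F} (hf : SmoothNear (E := E) f x) :
    ContMDiffAt 𝓘(ℝ, E) 𝓘(ℝ, F) ∞ f x := hf.self_of_nhds

theorem SmoothNear.mdiff {f : M → F} (hf : SmoothNear (E := E) f x) :
    MDifferentiableAt 𝓘(ℝ, E) 𝓘(ℝ, F) f x := hf.at.mdifferentiableAt (by simp)

/-- This is why a whole neighbourhood is required: smoothness of order `∞` at a single point only
provides, for each finite order, a neighbourhood that may shrink with the order. -/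
theorem SmoothNear.near {f : M → F} (hf : SmoothNear (E := E) f x) :
    ∀ᶠ y in 𝓝 x, SmoothNear (E := E) f y := eventually_eventually_nhds.2 hf

theorem _root_.ContMDiff.smoothNear {f : M → F} (hf : ContMDiff 𝓘(ℝ, E) 𝓘(ℝ, F) ∞ f) :
    SmoothNear (E := E) f x := Eventually.of_forall fun y => hf y

theorem SmoothNear.const (a : F) : SmoothNear (E := E) (fun _ : M => a) x :=
  Eventually.of_forall fun _ => contMDiffAt_const

theorem SmoothNear.add {f g : M → F} (hf : SmoothNear (E := E) f x)
    (hg : SmoothNear (E := E) g x) : SmoothNear (E := E) (fun y => f y + g y) x := by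
  filter_upwards [hf, hg] with y h1 h2 using h1.add h2

theorem SmoothNear.sub {f g : M → F} (hf : SmoothNear (E := E) f x)
    (hg : SmoothNear (E := E) g x) : SmoothNear (E := E) (fun y => f y - g y) x := by
  filter_upwards [hf, hg] with y h1 h2 using h1.sub h2

theorem SmoothNear.neg {f : M → F} (hf : SmoothNear (E := E) f x) :
    SmoothNear (E := E) (fun y => - f y) x := by
  filter_upwards [hf] with y h1 using h1.neg

theorem SmoothNear.sum {ι : Type*} {s : Finset ι} {f : ι → M → F}
    (hf : ∀ i, SmoothNear (E := E) (f i) x) :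
    SmoothNear (E := E) (fun y => ∑ i ∈ s, f i y) x := by
  classical
  induction s using Finset.induction_on with
  | empty => simpa using SmoothNear.const (0 : F)
  | insert i s hi ih =>
    simp only [Finset.sum_insert hi]
    exact (hf i).add ih

theorem SmoothNear.smul {c : M → ℝ} {f : M → F} (hc : SmoothNear (E := E) c x)
    (hf : SmoothNear (E := E) f x) : SmoothNear (E := E) (fun y => c y • f y) x := by
  filter_upwards [hc, hf] with y h1 h2 using h1.smul h2

theorem SmoothNear.clm (L : F →L[ℝ] G) {f : M → F} (hf : SmoothNear (E := E) f x) :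
    SmoothNear (E := E) (fun y => L (f y)) x := by
  filter_upwards [hf] with y h1
  exact L.contDiff.contDiffAt.comp_contMDiffAt h1

theorem SmoothNear.clm_apply {L : M → F →L[ℝ] G} {f : M → F} (hL : SmoothNear (E := E) L x)
    (hf : SmoothNear (E := E) f x) : SmoothNear (E := E) (fun y => L y (f y)) x := by
  filter_upwards [hL, hf] with y h1 h2 using h1.clm_apply h2

theorem SmoothNear.clm_comp {H : Type*} [NormedAddCommGroup H] [NormedSpace ℝ H]
    {L : M → G →L[ℝ] H} {f : M → F →L[ℝ] G} (hL : SmoothNear (E := E) L x)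
    (hf : SmoothNear (E := E) f x) : SmoothNear (E := E) (fun y => (L y).comp (f y)) x := by
  filter_upwards [hL, hf] with y h1 h2 using h1.clm_comp h2

theorem SmoothNear.of_apply [FiniteDimensional ℝ F] {L : M → F →L[ℝ] G}
    (h : ∀ v, SmoothNear (E := E) (fun y => L y v) x) : SmoothNear (E := E) L x := by
  set b := Module.finBasis ℝ F
  have e : L = fun y => ∑ i, ContinuousLinearMap.smulRightL ℝ F G
      (LinearMap.toContinuousLinearMap (b.coord i)) (L y (b i)) := by
    funext y
    ext v
    conv_lhs => rw [← b.sum_repr v]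
    rw [map_sum]
    simp
  rw [e]
  exact SmoothNear.sum fun i => (h (b i)).clm _

theorem SmoothNear.of_dual [FiniteDimensional ℝ F] {f : M → F}
    (h : ∀ l : F →L[ℝ] ℝ, SmoothNear (E := E) (fun y => l (f y)) x) : SmoothNear (E := E) f x := by
  set b := Module.finBasis ℝ F
  have e : f = fun y => ∑ i, (LinearMap.toContinuousLinearMap (b.coord i)) (f y) • b i := by
    funext y
    conv_lhs => rw [← b.sum_repr (f y)]
    simp
  rw [e]
  exact SmoothNear.sum fun i => (h _).smul (SmoothNear.const _)

theorem SmoothNear.prodMk {f : M → F} {g : M → G} (hf : SmoothNear (E := E) f x)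
    (hg : SmoothNear (E := E) g x) : SmoothNear (E := E) (fun y => (f y, g y)) x := by
  filter_upwards [hf, hg] with y h1 h2
  exact h1.prodMk_space h2

theorem SmoothNear.comp_map {EX X : Type*} [NormedAddCommGroup EX] [NormedSpace ℝ EX]
    [TopologicalSpace X] [ChartedSpace EX X] {f : M → F} {j : X → M} {x : X}
    (hf : SmoothNear (E := E) f (j x)) (hj : ContMDiff 𝓘(ℝ, EX) 𝓘(ℝ, E) ∞ j) :
    SmoothNear (E := EX) (fun y => f (j y)) x := by
  filter_upwards [hj.continuous.continuousAt.eventually hf] with y h1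
  exact h1.comp y (hj y)

variable [FiniteDimensional ℝ F] [FiniteDimensional ℝ G]

/-- A smooth family of linear maps which is injective at a point has smooth left inverses. -/
theorem exists_smooth_leftInverse {L : M → F →L[ℝ] G} (hL : SmoothNear (E := E) L x)
    (hi : Function.Injective (L x)) :
    ∃ R : M → G →L[ℝ] F, SmoothNear (E := E) R x ∧ ∀ᶠ y in 𝓝 x, ∀ v, R y (L y v) = v := by
  have := FiniteDimensional.complete ℝ F
  obtain ⟨r, hr⟩ := (L x).toLinearMap.exists_leftInverse_of_injective
    (LinearMap.ker_eq_bot.2 hi)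
  set R0 : G →L[ℝ] F := LinearMap.toContinuousLinearMap r with hR0
  have h1 : SmoothNear (E := E) (fun y => R0.comp (L y)) x := (SmoothNear.const R0).clm_comp hL
  have hx : R0.comp (L x) = 1 := by
    ext v
    exact LinearMap.congr_fun hr v
  have hu : ∀ᶠ y in 𝓝 x, IsUnit (R0.comp (L y)) := by
    have := (Units.isOpen (R := F →L[ℝ] F)).mem_nhds (show R0.comp (L x) ∈ _ by
      rw [hx]; exact isUnit_one)
    exact h1.at.continuousAt.eventually this
  -- A fixed left inverse of `L x` is corrected by the inverse of `R0 ∘ L y`, which exists near `x`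
  -- because units are open, and depends smoothly on `y` because inversion is smooth.
  refine ⟨fun y => (Ring.inverse (R0.comp (L y))).comp R0, ?_, ?_⟩
  · refine SmoothNear.clm_comp ?_ (SmoothNear.const R0)
    filter_upwards [h1, hu] with y h2 ⟨u, h3⟩
    have := contDiffAt_ringInverse ℝ (n := ∞) u
    rw [h3] at this
    exact ContDiffAt.comp_contMDiffAt (f := fun y => R0.comp (L y)) this h2
  · filter_upwards [hu] with y hy v
    exact DFunLike.congr_fun (Ring.inverse_mul_cancel _ hy) v

/-- The main source of smoothness below: a solution chosen point by point is recovered from the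
smooth right-hand side by a smooth left inverse of the coefficients. -/
theorem SmoothNear.of_injective {L : M → F →L[ℝ] G} {u : M → F} (hL : SmoothNear (E := E) L x)
    (hi : Function.Injective (L x)) (hu : SmoothNear (E := E) (fun y => L y (u y)) x) :
    SmoothNear (E := E) u x := by
  obtain ⟨R, h1, hR⟩ := exists_smooth_leftInverse hL hi
  refine (h1.clm_apply hu).congr ?_
  filter_upwards [hR] with y hy using (hy _).symm

end SmoothNear

/-! ### Differentials of functions -/

theorem fn_mdiff (f : Fn E M) (z : M) : MDifferentiableAt 𝓘(ℝ, E) 𝓘(ℝ, ℝ) f z :=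
  (f.contMDiff z).mdifferentiableAt (by simp)

theorem fn_smoothNear (f : Fn E M) (z : M) : SmoothNear (E := E) (F := ℝ) f z :=
  f.contMDiff.smoothNear

theorem diff_congr {f g : M → ℝ} {z : M} (h : f =ᶠ[𝓝 z] g) : diff E f z = diff E g z :=
  h.mfderiv_eq

theorem diff_const (r : ℝ) (z : M) : diff E (fun _ => r) z = 0 := mfderiv_const

theorem diff_add' {f g : M → ℝ} {z : M} (hf : MDifferentiableAt 𝓘(ℝ, E) 𝓘(ℝ, ℝ) f z)
    (hg : MDifferentiableAt 𝓘(ℝ, E) 𝓘(ℝ, ℝ) g z) :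
    diff E (fun y => f y + g y) z = diff E f z + diff E g z :=
  mfderiv_add hf hg

theorem diff_mul' {f g : M → ℝ} {z : M} (hf : MDifferentiableAt 𝓘(ℝ, E) 𝓘(ℝ, ℝ) f z)
    (hg : MDifferentiableAt 𝓘(ℝ, E) 𝓘(ℝ, ℝ) g z) :
    diff E (fun y => f y * g y) z = f z • diff E g z + g z • diff E f z :=
  (hf.hasMFDerivAt.mul hg.hasMFDerivAt).mfderiv

theorem diff_smul' {f : M → ℝ} {z : M} (r : ℝ) (hf : MDifferentiableAt 𝓘(ℝ, E) 𝓘(ℝ, ℝ) f z) :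
    diff E (fun y => r * f y) z = r • diff E f z :=
  const_smul_mfderiv hf r

theorem diff_neg' {f : M → ℝ} {z : M} (hf : MDifferentiableAt 𝓘(ℝ, E) 𝓘(ℝ, ℝ) f z) :
    diff E (fun y => - f y) z = - diff E f z := by
  have := diff_smul' (-1) hf
  simp only [neg_mul, one_mul] at this
  exact this.trans (neg_one_smul ℝ (diff E f z))

theorem diff_add (f g : Fn E M) (z : M) : diff E (f + g : Fn E M) z = diff E f z + diff E g z :=
  diff_add' (fn_mdiff f z) (fn_mdiff g z)

theorem diff_mul (f g : Fn E M) (z : M) :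
    diff E (f * g : Fn E M) z = f z • diff E g z + g z • diff E f z :=
  diff_mul' (fn_mdiff f z) (fn_mdiff g z)

theorem diff_smul (r : ℝ) (f : Fn E M) (z : M) : diff E (r • f : Fn E M) z = r • diff E f z :=
  const_smul_mfderiv (fn_mdiff f z) r

theorem diff_zero (z : M) : diff E (0 : Fn E M) z = 0 := diff_const 0 z

theorem diff_sub (f g : Fn E M) (z : M) : diff E (f - g : Fn E M) z = diff E f z - diff E g z := by
  have h := diff_add (f - g) g z
  rw [sub_add_cancel] at h
  rw [h, add_sub_cancel_right]

theorem diff_sum {ι : Type*} (s : Finset ι) (f : ι → Fn E M) (z : M) :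
    diff E (∑ i ∈ s, f i : Fn E M) z = ∑ i ∈ s, diff E (f i) z := by
  classical
  induction s using Finset.induction_on with
  | empty => simpa using diff_zero z
  | insert i s hi ih => rw [Finset.sum_insert hi, Finset.sum_insert hi, diff_add, ih]

theorem fn_sum_apply {ι : Type*} (s : Finset ι) (f : ι → Fn E M) (z : M) :
    (∑ i ∈ s, f i : Fn E M) z = ∑ i ∈ s, f i z := by
  classical
  induction s using Finset.induction_on with
  | empty => rfl
  | insert i s hi ih =>
    rw [Finset.sum_insert hi, Finset.sum_insert hi, ← ih]; rfl

theorem diff_comp {EX X : Type*} [NormedAddCommGroup EX] [NormedSpace ℝ EX]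
    [TopologicalSpace X] [ChartedSpace EX X] {f : M → ℝ} {j : X → M} {x : X}
    (hf : MDifferentiableAt 𝓘(ℝ, E) 𝓘(ℝ, ℝ) f (j x))
    (hj : MDifferentiableAt 𝓘(ℝ, EX) 𝓘(ℝ, E) j x) :
    diff EX (fun y => f (j y)) x = (diff E f (j x)).comp (mfderiv 𝓘(ℝ, EX) 𝓘(ℝ, E) j x) :=
  mfderiv_comp x hf hj

/-! ### Coordinates of tangent vectors -/

variable [IsManifold 𝓘(ℝ, E) ∞ M]

/-- The coordinates of tangent vectors at `z` in the preferred chart at `z₀`. -/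
def Tc (z₀ z : M) : Tan E z →L[ℝ] E :=
  (trivializationAt E (TangentSpace 𝓘(ℝ, E)) z₀).continuousLinearMapAt ℝ z

/-- The tangent vector at `z` with given coordinates in the preferred chart at `z₀`. -/
def Ti (z₀ z : M) : E →L[ℝ] Tan E z :=
  (trivializationAt E (TangentSpace 𝓘(ℝ, E)) z₀).symmL ℝ z

theorem Tc_Ti {z₀ z : M} (h : z ∈ (chartAt E z₀).source) (e : E) : Tc z₀ z (Ti z₀ z e) = e :=
  (trivializationAt E (TangentSpace 𝓘(ℝ, E)) z₀).continuousLinearMapAt_symmL h e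

theorem Ti_Tc {z₀ z : M} (h : z ∈ (chartAt E z₀).source) (v : Tan E z) : Ti z₀ z (Tc z₀ z v) = v :=
  (trivializationAt E (TangentSpace 𝓘(ℝ, E)) z₀).symmL_continuousLinearMapAt h v

theorem Tc_eq {z₀ z : M} (h : z ∈ (chartAt E z₀).source) :
    Tc z₀ z = mfderiv 𝓘(ℝ, E) 𝓘(ℝ, E) (extChartAt 𝓘(ℝ, E) z₀) z :=
  TangentBundle.continuousLinearMapAt_trivializationAt h

theorem Ti_eq {z₀ z : M} (h : z ∈ (chartAt E z₀).source) (e : E) :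
    Ti z₀ z e = (mfderiv 𝓘(ℝ, E) 𝓘(ℝ, E) (extChartAt 𝓘(ℝ, E) z₀).symm
      (extChartAt 𝓘(ℝ, E) z₀ z) : E →L[ℝ] E) e := by
  have := TangentBundle.symmL_trivializationAt (I := 𝓘(ℝ, E)) h
  simp only [modelWithCornersSelf_coe, Set.range_id, mfderivWithin_univ] at this
  rw [Ti, this]
  rfl

omit [NormedSpace ℝ E] [IsManifold 𝓘(ℝ, E) ∞ M] in
theorem chart_near (z : M) : ∀ᶠ y in 𝓝 z, y ∈ (chartAt E z).source :=
  chart_source_mem_nhds E z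

/-- Tangent vectors at `z` are already expressed in the preferred chart at `z`, so the transition
map is the identity. -/
theorem Tc_self (z : M) (v : Tan E z) : Tc z z v = v := by
  have h := mem_chart_source E z
  have := TangentBundle.continuousLinearMapAt_trivializationAt_eq_core (I := 𝓘(ℝ, E)) h
  rw [Tc, this]
  exact (tangentBundleCore 𝓘(ℝ, E) M).coordChange_self _ _ h _

theorem Ti_self (z : M) (v : E) : Ti z z v = (v : E) := by
  have h := Tc_self z (Ti z z v)
  rw [Tc_Ti (mem_chart_source E z)] at h
  exact h.symm

/-- The change of coordinates of tangent vectors is smooth. -/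
theorem smoothNear_Tc_Ti {z₀ z₁ z : M} (h₀ : z ∈ (chartAt E z₀).source)
    (h₁ : z ∈ (chartAt E z₁).source) :
    SmoothNear (E := E) (fun y => (Tc (E := E) z₁ y).comp (Ti (E := E) z₀ y)) z := by
  have n0 := (chartAt E z₀).open_source.mem_nhds h₀
  have n1 := (chartAt E z₁).open_source.mem_nhds h₁
  filter_upwards [n0, n1] with y h0 h1
  have := contMDiffAt_coordChangeL (n := ∞) (IB := 𝓘(ℝ, E)) (𝕜 := ℝ) (F := E)
    (E := (TangentSpace 𝓘(ℝ, E) : M → Type _))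
    (e := trivializationAt E (TangentSpace 𝓘(ℝ, E)) z₀)
    (e' := trivializationAt E (TangentSpace 𝓘(ℝ, E)) z₁) (x := y) h0 h1
  refine this.congr_of_eventuallyEq ?_
  filter_upwards [(chartAt E z₀).open_source.mem_nhds h0,
    (chartAt E z₁).open_source.mem_nhds h1] with w g0 g1
  ext v
  have hw : w ∈ (trivializationAt E (TangentSpace 𝓘(ℝ, E)) z₀).baseSet ∩
    (trivializationAt E (TangentSpace 𝓘(ℝ, E)) z₁).baseSet := ⟨g0, g1⟩
  have := Trivialization.coordChangeL_apply (R := ℝ)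
    (trivializationAt E (TangentSpace 𝓘(ℝ, E)) z₀)
    (trivializationAt E (TangentSpace 𝓘(ℝ, E)) z₁) hw v
  refine Eq.trans ?_ this.symm
  simp only [Tc, Ti, ContinuousLinearMap.comp_apply]
  rw [Trivialization.continuousLinearMapAt_apply, Trivialization.linearMapAt_apply, if_pos hw.2,
    Trivialization.symmL_apply _ hw.1]

theorem diff_apply_chart {f : M → ℝ} {z₀ z : M} (h : z ∈ (chartAt E z₀).source)
    (hf : MDifferentiableAt 𝓘(ℝ, E) 𝓘(ℝ, ℝ) f z) (e : E) :
    diff E f z (Ti z₀ z e) =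
      fderiv ℝ (f ∘ (extChartAt 𝓘(ℝ, E) z₀).symm) (extChartAt 𝓘(ℝ, E) z₀ z) e := by
  set φ := extChartAt 𝓘(ℝ, E) z₀
  have hz : z ∈ φ.source := by rw [extChartAt_source]; exact h
  have hsym : MDifferentiableAt 𝓘(ℝ, E) 𝓘(ℝ, E) φ.symm (φ z) := by
    have := (contMDiffOn_extChartAt_symm (I := 𝓘(ℝ, E)) (n := ∞) z₀).contMDiffAt
      ((isOpen_extChartAt_target (I := 𝓘(ℝ, E)) z₀).mem_nhds (φ.map_source hz))
    exact this.mdifferentiableAt (by simp)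
  have hf' : MDifferentiableAt 𝓘(ℝ, E) 𝓘(ℝ, ℝ) f (φ.symm (φ z)) := by
    rw [φ.left_inv hz]; exact hf
  have hc := mfderiv_comp (φ z) hf' hsym
  rw [← mfderiv_eq_fderiv, hc, Ti_eq h, diff]
  have h1 : (mfderiv 𝓘(ℝ, E) 𝓘(ℝ, ℝ) f (φ.symm (φ z)) : E →L[ℝ] ℝ) =
      mfderiv 𝓘(ℝ, E) 𝓘(ℝ, ℝ) f z := by rw [φ.left_inv hz]
  exact (DFunLike.congr_fun h1 _).symm

theorem contDiffAt_chart' (f : Fn E M) {z₀ z : M} (h : z ∈ (chartAt E z₀).source) :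
    ContDiffAt ℝ ∞ (f ∘ (extChartAt 𝓘(ℝ, E) z₀).symm) (extChartAt 𝓘(ℝ, E) z₀ z) := by
  set φ := extChartAt 𝓘(ℝ, E) z₀
  have hz : z ∈ φ.source := by rw [extChartAt_source]; exact h
  have hsym := (contMDiffOn_extChartAt_symm (I := 𝓘(ℝ, E)) (n := ∞) z₀).contMDiffAt
      ((isOpen_extChartAt_target (I := 𝓘(ℝ, E)) z₀).mem_nhds (φ.map_source hz))
  exact ((f.contMDiff _).comp _ hsym).contDiffAt

theorem smoothNear_extChart {z₀ z : M} (h : z ∈ (chartAt E z₀).source) :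
    SmoothNear (E := E) (extChartAt 𝓘(ℝ, E) z₀) z := by
  filter_upwards [(chartAt E z₀).open_source.mem_nhds h] with y hy
  exact contMDiffAt_extChartAt' hy

end ManifoldTools

end

/-! ### Cut-offs, second derivatives at critical points, and sections along maps. -/

noncomputable section

section LocalTools

variable {E : Type*} {M : Type*} [NormedAddCommGroup E] [NormedSpace ℝ E]
  [TopologicalSpace M] [ChartedSpace E M] [IsManifold 𝓘(ℝ, E) ∞ M]

theorem exists_bump [FiniteDimensional ℝ E] [T2Space M] (z₀ : M) {O : Set M} (hO : O ∈ 𝓝 z₀) :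
    ∃ χ : Fn E M, (∀ᶠ z in 𝓝 z₀, χ z = 1) ∧ tsupport χ ⊆ O := by
  obtain ⟨f, -, hf⟩ := (SmoothBumpFunction.nhds_basis_tsupport (I := 𝓘(ℝ, E)) z₀).mem_iff.1 hO
  exact ⟨⟨f, f.contMDiff⟩, f.eventuallyEq_one, hf⟩

/-- A germ of a smooth function extends to a global one supported in a given neighbourhood. -/
theorem exists_fn_of_germ [FiniteDimensional ℝ E] [T2Space M] {z₀ : M} {f : M → ℝ}
    (hf : SmoothNear (E := E) f z₀) {O : Set M} (hO : O ∈ 𝓝 z₀) :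
    ∃ χ g : Fn E M, (∀ᶠ z in 𝓝 z₀, χ z = 1) ∧ tsupport χ ⊆ O ∧ ∀ z, g z = χ z * f z := by
  obtain ⟨χ, h1, h2⟩ := exists_bump (E := E) z₀ (inter_mem hO hf)
  refine ⟨χ, ⟨fun z => χ z * f z, ?_⟩, h1, h2.trans Set.inter_subset_left, fun z => rfl⟩
  intro z
  by_cases hz : z ∈ tsupport χ
  · exact (χ.contMDiff z).mul (h2 hz).2
  · have : (fun z => χ z * f z) =ᶠ[𝓝 z] fun _ => 0 := by
      filter_upwards [(isClosed_tsupport χ).isOpen_compl.mem_nhds hz] with y hy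
      rw [image_eq_zero_of_notMem_tsupport hy, zero_mul]
    exact contMDiffAt_const.congr_of_eventuallyEq this

theorem exists_fn_eventuallyEq [FiniteDimensional ℝ E] [T2Space M] {z₀ : M} {f : M → ℝ}
    (hf : SmoothNear (E := E) f z₀) : ∃ g : Fn E M, g =ᶠ[𝓝 z₀] f := by
  obtain ⟨χ, g, h1, -, h2⟩ := exists_fn_of_germ hf univ_mem
  exact ⟨g, by filter_upwards [h1] with z hz; rw [h2, hz, one_mul]⟩

/-- Global functions that are linear coordinate functions near a given point. -/
theorem exists_coordFn [FiniteDimensional ℝ E] [T2Space M] (z₀ : M) {O : Set M} (hO : O ∈ 𝓝 z₀) :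
    ∃ q : (E →L[ℝ] ℝ) → Fn E M, (∀ l z, z ∉ O → q l =ᶠ[𝓝 z] 0) ∧
      ∀ᶠ z in 𝓝 z₀, z ∈ (chartAt E z₀).source ∧
        ∀ l (v : Tan E z), diff E (q l) z v = l (Tc z₀ z v) := by
  obtain ⟨χ, h1, h2⟩ := exists_bump (E := E) z₀ (inter_mem hO (chart_source_mem_nhds E z₀))
  have hs : ∀ l : E →L[ℝ] ℝ, ContMDiff 𝓘(ℝ, E) 𝓘(ℝ, ℝ) ∞
      (fun z => χ z * l (extChartAt 𝓘(ℝ, E) z₀ z)) := by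
    intro l z
    by_cases hz : z ∈ tsupport χ
    · exact (χ.contMDiff z).mul (l.contDiff.contDiffAt.comp_contMDiffAt
        (contMDiffAt_extChartAt' (h2 hz).2))
    · have : (fun z => χ z * l (extChartAt 𝓘(ℝ, E) z₀ z)) =ᶠ[𝓝 z] fun _ => 0 := by
        filter_upwards [(isClosed_tsupport χ).isOpen_compl.mem_nhds hz] with y hy
        rw [image_eq_zero_of_notMem_tsupport hy, zero_mul]
      exact contMDiffAt_const.congr_of_eventuallyEq this
  refine ⟨fun l => ⟨_, hs l⟩, ?_, ?_⟩
  · intro l z hz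
    have hz : z ∉ tsupport χ := fun h => hz (h2 h).1
    filter_upwards [(isClosed_tsupport χ).isOpen_compl.mem_nhds hz] with y hy
    change χ y * _ = 0
    rw [image_eq_zero_of_notMem_tsupport hy, zero_mul]
  · filter_upwards [eventually_eventually_nhds.2 h1, chart_near (E := E) z₀] with z hz hc
    refine ⟨hc, fun l v => ?_⟩
    have e : (fun z => χ z * l (extChartAt 𝓘(ℝ, E) z₀ z)) =ᶠ[𝓝 z]
        fun z => l (extChartAt 𝓘(ℝ, E) z₀ z) := by
      filter_upwards [hz] with y hy
      rw [hy, one_mul]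
    have e1 : diff E (fun z => χ z * l (extChartAt 𝓘(ℝ, E) z₀ z)) z =
        diff E (fun z => l (extChartAt 𝓘(ℝ, E) z₀ z)) z := diff_congr e
    have e2 : diff E (fun z => l (extChartAt 𝓘(ℝ, E) z₀ z)) z = _ :=
      diff_comp (f := l) (l.contDiff (n := 1).contMDiff.mdifferentiable (by simp) _)
        (mdifferentiableAt_extChartAt hc)
    change diff E (fun z => χ z * l (extChartAt 𝓘(ℝ, E) z₀ z)) z v = _
    rw [e1, e2, Tc_eq hc]
    have : diff E l (extChartAt 𝓘(ℝ, E) z₀ z) = l := by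
      rw [diff, mfderiv_eq_fderiv]; exact l.fderiv
    rw [this]
    rfl

theorem exists_fn_diff [FiniteDimensional ℝ E] [T2Space M] (z₀ : M) (a : Cot E z₀) :
    ∃ f : Fn E M, diff E f z₀ = a := by
  obtain ⟨q, -, hq⟩ := exists_coordFn (E := E) z₀ univ_mem
  refine ⟨q a, ?_⟩
  ext v
  exact (hq.self_of_nhds.2 a v).trans (congrArg a (Tc_self z₀ v))

omit [IsManifold 𝓘(ℝ, E) ∞ M] in
/-- Linear functionals on tangent spaces are covectors. -/
theorem exists_cot [FiniteDimensional ℝ E] (p : M) (φ : Tan E p →ₗ[ℝ] ℝ) :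
    ∃ a : Cot E p, ∀ v, a v = φ v :=
  ⟨(LinearMap.toContinuousLinearMap (show E →ₗ[ℝ] ℝ from φ) : E →L[ℝ] ℝ), fun _ => rfl⟩

omit [IsManifold 𝓘(ℝ, E) ∞ M] in
theorem tan_eq_zero [FiniteDimensional ℝ E] {p : M} {v : Tan E p} (h : ∀ a : Cot E p, a v = 0) :
    v = 0 := by
  rw [← Module.forall_dual_apply_eq_zero_iff ℝ]
  intro φ
  obtain ⟨a, ha⟩ := exists_cot p φ
  rw [← ha, h]

omit [IsManifold 𝓘(ℝ, E) ∞ M] in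
/-- A vector annihilated by all covectors that vanish on a subspace lies in the subspace. -/
theorem mem_of_annihilator [FiniteDimensional ℝ E] {p : M} {W : Submodule ℝ (Tan E p)}
    {v : Tan E p} (h : ∀ a : Cot E p, (∀ w ∈ W, a w = 0) → a v = 0) : v ∈ W := by
  by_contra hv
  obtain ⟨φ, h1, h2⟩ := Submodule.exists_le_ker_of_notMem hv
  obtain ⟨a, ha⟩ := exists_cot p φ
  exact h1 (by rw [← ha]; exact h a fun w hw => by rw [ha]; exact h2 hw)

/-! ### Second derivatives at critical points -/

theorem fderiv_chart_self {f : M → ℝ} {z : M} (hf : MDifferentiableAt 𝓘(ℝ, E) 𝓘(ℝ, ℝ) f z) :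
    fderiv ℝ (f ∘ (extChartAt 𝓘(ℝ, E) z).symm) (extChartAt 𝓘(ℝ, E) z z) =
      (diff E f z : E →L[ℝ] ℝ) := by
  ext e
  rw [← diff_apply_chart (mem_chart_source E z) hf, Ti_self]
  rfl

/-- Along sections of the tangent bundle, the derivative of the pairing with `df` at a critical
point is given by the second derivative. -/
theorem hess_deriv (f : Fn E M) {EN N : Type*} [NormedAddCommGroup EN] [NormedSpace ℝ EN]
    [TopologicalSpace N] [ChartedSpace EN N] {c : N → M} {y : N}
    (hc : MDifferentiableAt 𝓘(ℝ, EN) 𝓘(ℝ, E) c y) {v : ∀ y', Tan E (c y')}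
    (hv : MDifferentiableAt 𝓘(ℝ, EN) 𝓘(ℝ, E) (fun y' => Tc (c y) (c y') (v y')) y)
    (h0 : diff E f (c y) = 0) (w : Tan EN y) :
    diff EN (fun y' => diff E f (c y') (v y')) y w =
      hess E f (c y) (mfderiv 𝓘(ℝ, EN) 𝓘(ℝ, E) c y w) (v y) := by
  set φ := extChartAt 𝓘(ℝ, E) (c y) with hφ
  set G : E → E →L[ℝ] ℝ := fderiv ℝ (f ∘ φ.symm) with hG
  have hφc : MDifferentiableAt 𝓘(ℝ, EN) 𝓘(ℝ, E) (fun y' => φ (c y')) y :=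
    MDifferentiableAt.comp y (mdifferentiableAt_extChartAt (mem_chart_source E (c y))) hc
  have hGd : DifferentiableAt ℝ G (φ (c y)) :=
    ((contDiffAt_chart E f (c y)).fderiv_right (m := 1)
      (by norm_num; exact ENat.LEInfty.out)).differentiableAt (by norm_num)
  have hloc : (fun y' => diff E f (c y') (v y')) =ᶠ[𝓝 y]
      fun y' => G (φ (c y')) (Tc (c y) (c y') (v y')) := by
    filter_upwards [hc.continuousAt.eventually (chart_near (E := E) (c y))] with y' hy'
    rw [hG, ← diff_apply_chart hy' (fn_mdiff f _), Ti_Tc hy']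
  have hGm : HasMFDerivAt 𝓘(ℝ, EN) 𝓘(ℝ, E →L[ℝ] ℝ) (fun y' => G (φ (c y'))) y
      ((fderiv ℝ G (φ (c y))).comp (mfderiv 𝓘(ℝ, EN) 𝓘(ℝ, E) (fun y' => φ (c y')) y)) :=
    HasMFDerivAt.comp y hGd.hasFDerivAt.hasMFDerivAt hφc.hasMFDerivAt
  have hpair : HasMFDerivAt 𝓘(ℝ, EN) 𝓘(ℝ, (E →L[ℝ] ℝ) × E)
      (fun y' => (G (φ (c y')), Tc (c y) (c y') (v y'))) y
      (ContinuousLinearMap.prod (M₂ := E →L[ℝ] ℝ) (M₃ := E) ((fderiv ℝ G (φ (c y))).comp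
        (mfderiv 𝓘(ℝ, EN) 𝓘(ℝ, E) (fun y' => φ (c y')) y : EN →L[ℝ] E))
        (mfderiv 𝓘(ℝ, EN) 𝓘(ℝ, E) (fun y' => Tc (c y) (c y') (v y')) y : EN →L[ℝ] E)) :=
    ⟨hGm.1.prodMk hv.hasMFDerivAt.1, hGm.2.prodMk hv.hasMFDerivAt.2⟩
  have hb := (isBoundedBilinearMap_apply (𝕜 := ℝ) (E := E) (F := ℝ)).hasFDerivAt
    (G (φ (c y)), Tc (c y) (c y) (v y))
  have hcomp := HasMFDerivAt.comp y hb.hasMFDerivAt hpair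
  -- The product rule also produces `df` applied to the derivative of `v`. This term vanishes at a
  -- critical point, which is why only the value of `v` at `y` matters.
  have hG0 : G (φ (c y)) = 0 := by
    rw [hG, fderiv_chart_self (fn_mdiff f _), h0]; rfl
  rw [diff_congr hloc]
  have e1 : diff EN (fun y' => G (φ (c y')) (Tc (c y) (c y') (v y'))) y = _ := hcomp.mfderiv
  have e2 : mfderiv 𝓘(ℝ, EN) 𝓘(ℝ, E) (fun y' => φ (c y')) y w =
      mfderiv 𝓘(ℝ, EN) 𝓘(ℝ, E) c y w := by
    have := mfderiv_comp y (mdifferentiableAt_extChartAt (I := 𝓘(ℝ, E))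
      (mem_chart_source E (c y))) hc
    refine (DFunLike.congr_fun this w).trans ?_
    have h3 := Tc_self (c y) (mfderiv 𝓘(ℝ, EN) 𝓘(ℝ, E) c y w)
    rw [Tc_eq (mem_chart_source E (c y))] at h3
    exact h3
  rw [e1]
  refine Eq.trans (b := G (φ (c y)) (mfderiv 𝓘(ℝ, EN) 𝓘(ℝ, E)
    (fun y' => Tc (c y) (c y') (v y')) y w) + fderiv ℝ G (φ (c y))
      (mfderiv 𝓘(ℝ, EN) 𝓘(ℝ, E) (fun y' => φ (c y')) y w) (Tc (c y) (c y) (v y))) rfl ?_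
  rw [hG0, e2, Tc_self]
  exact zero_add _

/-! ### Sections along maps -/

section Along

variable {EX X : Type*} [NormedAddCommGroup EX] [NormedSpace ℝ EX] [TopologicalSpace X]
  [ChartedSpace EX X]

/-- A section of the tangent bundle along `j` is smooth near `x₀`. -/
def VecNear (j : X → M) (V : ∀ x, Tan E (j x)) (x₀ : X) : Prop :=
  SmoothNear (E := EX) (F := E) (fun x => Tc (j x₀) (j x) (V x)) x₀

/-- A section of the cotangent bundle along `j` is smooth near `x₀`. -/
def CovNear (j : X → M) (a : ∀ x, Cot E (j x)) (x₀ : X) : Prop :=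
  SmoothNear (E := EX) (F := E →L[ℝ] ℝ) (fun x => (a x).comp (Ti (j x₀) (j x))) x₀

theorem VecNear.congr {j : X → M} {V W : ∀ x, Tan E (j x)} {x₀ : X}
    (hV : VecNear (EX := EX) j V x₀) (h : ∀ᶠ x in 𝓝 x₀, W x = V x) :
    VecNear (EX := EX) j W x₀ :=
  SmoothNear.congr hV (by filter_upwards [h] with x hx; rw [hx])

theorem CovNear.congr {j : X → M} {a b : ∀ x, Cot E (j x)} {x₀ : X}
    (ha : CovNear (EX := EX) j a x₀) (h : ∀ᶠ x in 𝓝 x₀, b x = a x) :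
    CovNear (EX := EX) j b x₀ :=
  SmoothNear.congr ha (by filter_upwards [h] with x hx; rw [hx])

theorem cov_trivialization {z₀ z : M} (a : Cot E z) :
    (trivializationAt (E →L[ℝ] ℝ) (fun p : M => Cot E p) z₀
      (TotalSpace.mk' (E →L[ℝ] ℝ) (E := fun p : M => Cot E p) z a)).2 = a.comp (Ti z₀ z) := by
  ext v
  change (ContinuousLinearMap.inCoordinates E (TangentSpace 𝓘(ℝ, E)) ℝ (fun _ : M => ℝ)
    z₀ z z₀ z a) v = _
  rw [ContinuousLinearMap.inCoordinates]
  simp only [ContinuousLinearMap.comp_apply]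
  exact DFunLike.congr_fun (Bundle.Trivial.continuousLinearMapAt_trivialization ℝ M ℝ z)
    (a (Ti z₀ z v))

theorem contMDiffAt_cov_iff {j : X → M} (hj : ContMDiff 𝓘(ℝ, EX) 𝓘(ℝ, E) ∞ j)
    (a : ∀ x, Cot E (j x)) {z₀ : M} {x : X} (h : j x ∈ (chartAt E z₀).source) :
    ContMDiffAt 𝓘(ℝ, EX) (𝓘(ℝ, E).prod 𝓘(ℝ, E →L[ℝ] ℝ)) ∞
      (fun x => TotalSpace.mk' (E →L[ℝ] ℝ) (E := fun p : M => Cot E p) (j x) (a x)) x ↔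
    ContMDiffAt 𝓘(ℝ, EX) 𝓘(ℝ, E →L[ℝ] ℝ) ∞ (fun x => (a x).comp (Ti z₀ (j x))) x := by
  have he : TotalSpace.mk' (E →L[ℝ] ℝ) (E := fun p : M => Cot E p) (j x) (a x) ∈
      (trivializationAt (E →L[ℝ] ℝ) (fun p : M => Cot E p) z₀).source := by
    rw [Trivialization.mem_source]
    exact ⟨h, Set.mem_univ _⟩
  have := (trivializationAt (E →L[ℝ] ℝ) (fun p : M => Cot E p) z₀).contMDiffAt_iff
    (IM := 𝓘(ℝ, EX)) (IB := 𝓘(ℝ, E)) (n := ∞) (x₀ := x)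
    (f := fun x => TotalSpace.mk' (E →L[ℝ] ℝ) (E := fun p : M => Cot E p) (j x) (a x)) he
  rw [this]
  constructor
  · rintro ⟨-, h2⟩
    refine h2.congr_of_eventuallyEq ?_
    filter_upwards [hj.continuous.continuousAt.eventually
      ((chartAt E z₀).open_source.mem_nhds h)] with y hy
    exact (cov_trivialization (a y)).symm
  · intro h2
    refine ⟨hj x, h2.congr_of_eventuallyEq ?_⟩
    filter_upwards [hj.continuous.continuousAt.eventually
      ((chartAt E z₀).open_source.mem_nhds h)] with y hy
    exact (cov_trivialization (a y))

theorem SmoothCovOn.covNear {j : X → M} (hj : ContMDiff 𝓘(ℝ, EX) 𝓘(ℝ, E) ∞ j)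
    {a : ∀ x, Cot E (j x)} {U : Set X} (ha : SmoothCovOn (EX := EX) E j a U) {x₀ : X}
    (hU : U ∈ 𝓝 x₀) : CovNear (EX := EX) j a x₀ := by
  filter_upwards [eventually_mem_nhds_iff.2 hU,
    hj.continuous.continuousAt.eventually (chart_near (E := E) (j x₀))] with x hx hc
  exact (contMDiffAt_cov_iff hj a hc).1 ((ha x (mem_of_mem_nhds hx)).contMDiffAt hx)

theorem CovNear.smoothCovOn {j : X → M} (hj : ContMDiff 𝓘(ℝ, EX) 𝓘(ℝ, E) ∞ j)
    {a : ∀ x, Cot E (j x)} {U : Set X} (ha : ∀ x ∈ U, CovNear (EX := EX) j a x) :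
    SmoothCovOn (EX := EX) E j a U := fun x hx =>
  ((contMDiffAt_cov_iff hj a (mem_chart_source E (j x))).2
    (SmoothNear.at (ha x hx))).contMDiffWithinAt

theorem contMDiffAt_field_iff {V : ∀ z : M, Tan E z} {z₀ z : M}
    (h : z ∈ (chartAt E z₀).source) :
    ContMDiffAt 𝓘(ℝ, E) 𝓘(ℝ, E).tangent ∞ (fun p => (⟨p, V p⟩ : TangentBundle 𝓘(ℝ, E) M)) z ↔
      ContMDiffAt 𝓘(ℝ, E) 𝓘(ℝ, E) ∞ (fun y => Tc z₀ y (V y)) z := by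
  have := (trivializationAt E (TangentSpace 𝓘(ℝ, E)) z₀).contMDiffAt_section_iff
    (IB := 𝓘(ℝ, E)) (n := ∞) (s := V) (x₀ := z) h
  refine this.trans ?_
  have e : (fun y => (trivializationAt E (TangentSpace 𝓘(ℝ, E)) z₀ ⟨y, V y⟩).2) =ᶠ[𝓝 z]
      fun y => Tc z₀ y (V y) := by
    filter_upwards [(chartAt E z₀).open_source.mem_nhds h] with y hy
    have hy' : y ∈ (trivializationAt E (TangentSpace 𝓘(ℝ, E)) z₀).baseSet := hy
    rw [Tc, Trivialization.continuousLinearMapAt_apply, Trivialization.linearMapAt_apply,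
      if_pos hy']
  exact ⟨fun h => h.congr_of_eventuallyEq e.symm, fun h => h.congr_of_eventuallyEq e⟩

theorem SmoothField.vecNear {V : ∀ z : M, Tan E z} (hV : SmoothField E V) (z₀ : M) :
    VecNear (EX := E) (fun z : M => z) V z₀ := by
  filter_upwards [chart_near (E := E) z₀] with z hz
  exact (contMDiffAt_field_iff hz).1 (hV z)

theorem VecNear.smoothField {V : ∀ z : M, Tan E z}
    (hV : ∀ z, VecNear (EX := E) (fun z : M => z) V z) : SmoothField E V := fun z =>
  (contMDiffAt_field_iff (mem_chart_source E z)).2 (hV z).at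

theorem CovNear.apply {j : X → M} (hj : Continuous j) {a : ∀ x, Cot E (j x)}
    {V : ∀ x, Tan E (j x)} {x₀ : X} (ha : CovNear (EX := EX) j a x₀)
    (hV : VecNear (EX := EX) j V x₀) : SmoothNear (E := EX) (F := ℝ) (fun x => a x (V x)) x₀ := by
  refine (SmoothNear.clm_apply ha hV).congr ?_
  filter_upwards [hj.continuousAt.eventually (chart_near (E := E) (j x₀))] with x hx
  rw [ContinuousLinearMap.comp_apply, Ti_Tc hx]

/-- The coordinates of a tangent vector are its pairings with differentials of global functions that
are linear coordinates near the point. -/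
theorem VecNear.of_fn [FiniteDimensional ℝ E] [T2Space M] {j : X → M} (hj : Continuous j)
    {V : ∀ x, Tan E (j x)} {x₀ : X}
    (h : ∀ f : Fn E M, SmoothNear (E := EX) (F := ℝ) (fun x => diff E f (j x) (V x)) x₀) :
    VecNear (EX := EX) j V x₀ := by
  obtain ⟨q, -, hq⟩ := exists_coordFn (E := E) (j x₀) univ_mem
  refine SmoothNear.of_dual fun l => (h (q l)).congr ?_
  filter_upwards [hj.continuousAt.eventually hq] with x hx
  exact (hx.2 l _).symm

theorem VecNear.const {j : X → M} (hj : Continuous j) (e : E) (x₀ : X) :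
    VecNear (EX := EX) j (fun x => Ti (j x₀) (j x) e) x₀ := by
  refine (SmoothNear.const e).congr ?_
  filter_upwards [hj.continuousAt.eventually (chart_near (E := E) (j x₀))] with x hx
  rw [Tc_Ti hx]

theorem CovNear.of_vec [FiniteDimensional ℝ E] {j : X → M} {a : ∀ x, Cot E (j x)} {x₀ : X}
    (h : ∀ e, SmoothNear (E := EX) (F := ℝ) (fun x => a x (Ti (j x₀) (j x) e)) x₀) :
    CovNear (EX := EX) j a x₀ := SmoothNear.of_apply h

theorem VecNear.smul {j : X → M} {c : X → ℝ} {V : ∀ x, Tan E (j x)} {x₀ : X}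
    (hc : SmoothNear (E := EX) c x₀) (hV : VecNear (EX := EX) j V x₀) :
    VecNear (EX := EX) j (fun x => c x • V x) x₀ := by
  refine (SmoothNear.smul hc hV).congr (Eventually.of_forall fun x => map_smul _ _ _)

theorem CovNear.sub {j : X → M} {V W : ∀ x, Cot E (j x)} {x₀ : X}
    (hV : CovNear (EX := EX) j V x₀) (hW : CovNear (EX := EX) j W x₀) :
    CovNear (EX := EX) j (fun x => V x - W x) x₀ :=
  (SmoothNear.sub hV hW).congr (Eventually.of_forall fun _ => rfl)

theorem CovNear.smul {j : X → M} {c : X → ℝ} {V : ∀ x, Cot E (j x)} {x₀ : X}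
    (hc : SmoothNear (E := EX) c x₀) (hV : CovNear (EX := EX) j V x₀) :
    CovNear (EX := EX) j (fun x => c x • V x) x₀ :=
  (SmoothNear.smul hc hV).congr (Eventually.of_forall fun _ => rfl)

theorem CovNear.sum {j : X → M} {ι : Type*} {s : Finset ι} {V : ι → ∀ x, Cot E (j x)} {x₀ : X}
    (hV : ∀ i, CovNear (EX := EX) j (V i) x₀) :
    CovNear (EX := EX) j (fun x => ∑ i ∈ s, V i x) x₀ := by
  refine (SmoothNear.sum (s := s) hV).congr (Eventually.of_forall fun x => ?_)
  ext v
  simp only [ContinuousLinearMap.comp_apply]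
  rw [sum_apply, sum_apply]
  rfl

theorem covNear_diff [FiniteDimensional ℝ E] {j : X → M} (hj : ContMDiff 𝓘(ℝ, EX) 𝓘(ℝ, E) ∞ j)
    (f : Fn E M) (x₀ : X) : CovNear (EX := EX) j (fun x => diff E f (j x)) x₀ := by
  have h : SmoothNear (E := E) (fun z => (diff E f z).comp (Ti (j x₀) z) : M → E →L[ℝ] ℝ)
      (j x₀) := by
    filter_upwards [chart_near (E := E) (j x₀)] with z hz
    have h1 := (contDiffAt_chart' f hz).fderiv_right (m := ∞) (by simp)
    have h2 := h1.comp_contMDiffAt (contMDiffAt_extChartAt' (I := 𝓘(ℝ, E)) (n := ∞) hz)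
    refine h2.congr_of_eventuallyEq ?_
    filter_upwards [(chartAt E (j x₀)).open_source.mem_nhds hz] with y hy
    ext e
    exact diff_apply_chart hy (fn_mdiff f y) e
  exact h.comp_map hj

end Along

end LocalTools

end

/-! ### Push-forward and pull-back, calculus of second derivatives, embeddings. -/

noncomputable section

section PushPull

variable {EX X EM M EN N : Type*} [NormedAddCommGroup EX] [NormedSpace ℝ EX] [TopologicalSpace X]
  [ChartedSpace EX X]
  [NormedAddCommGroup EM] [NormedSpace ℝ EM] [FiniteDimensional ℝ EM] [TopologicalSpace M]
  [ChartedSpace EM M] [IsManifold 𝓘(ℝ, EM) ∞ M]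
  [NormedAddCommGroup EN] [NormedSpace ℝ EN] [FiniteDimensional ℝ EN] [TopologicalSpace N]
  [ChartedSpace EN N] [IsManifold 𝓘(ℝ, EN) ∞ N] [T2Space N]

omit [FiniteDimensional ℝ EM] [FiniteDimensional ℝ EN] [IsManifold 𝓘(ℝ, EN) ∞ N]
  [IsManifold 𝓘(ℝ, EM) ∞ M] [T2Space N] in
theorem smooth_mdiff (i : C^∞⟮𝓘(ℝ, EM), M; 𝓘(ℝ, EN), N⟯) (m : M) :
    MDifferentiableAt 𝓘(ℝ, EM) 𝓘(ℝ, EN) i m :=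
  (i.contMDiff m).mdifferentiableAt (by simp)

omit [FiniteDimensional ℝ EM] [FiniteDimensional ℝ EN] [IsManifold 𝓘(ℝ, EN) ∞ N]
  [IsManifold 𝓘(ℝ, EM) ∞ M] [T2Space N] in
theorem diff_comp_fn (f : Fn EN N) (i : C^∞⟮𝓘(ℝ, EM), M; 𝓘(ℝ, EN), N⟯) (m : M) :
    diff EM (f.comp i : Fn EM M) m = (diff EN f (i m)).comp (mfderiv 𝓘(ℝ, EM) 𝓘(ℝ, EN) i m) :=
  diff_comp (fn_mdiff f _) (smooth_mdiff i m)

/-- Tested on functions: `df` on the pushed vector is `d(f ∘ i)` on the original one. -/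
theorem VecNear.push (i : C^∞⟮𝓘(ℝ, EM), M; 𝓘(ℝ, EN), N⟯) {j : X → M}
    (hj : ContMDiff 𝓘(ℝ, EX) 𝓘(ℝ, EM) ∞ j) {V : ∀ x, Tan EM (j x)} {x₀ : X}
    (hV : VecNear (EX := EX) j V x₀) :
    VecNear (EX := EX) (fun x => i (j x)) (fun x => mfderiv 𝓘(ℝ, EM) 𝓘(ℝ, EN) i (j x) (V x)) x₀ := by
  refine VecNear.of_fn (i.contMDiff.continuous.comp hj.continuous) fun f => ?_
  refine (CovNear.apply hj.continuous (covNear_diff hj (f.comp i) x₀) hV).congr ?_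
  refine Eventually.of_forall fun x => ?_
  exact (DFunLike.congr_fun (diff_comp_fn f i (j x)) (V x)).symm

theorem CovNear.pull (i : C^∞⟮𝓘(ℝ, EM), M; 𝓘(ℝ, EN), N⟯) {j : X → M}
    (hj : ContMDiff 𝓘(ℝ, EX) 𝓘(ℝ, EM) ∞ j) {a : ∀ x, Cot EN (i (j x))} {x₀ : X}
    (ha : CovNear (EX := EX) (fun x => i (j x)) a x₀) :
    CovNear (EX := EX) j (fun x => (a x).comp (mfderiv 𝓘(ℝ, EM) 𝓘(ℝ, EN) i (j x))) x₀ :=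
  CovNear.of_vec fun e => CovNear.apply (j := fun x => i (j x)) (a := a)
    (i.contMDiff.continuous.comp hj.continuous) ha
    (VecNear.push i hj (VecNear.const hj.continuous e x₀))

end PushPull

section Hess

variable {E M : Type*} [NormedAddCommGroup E] [NormedSpace ℝ E] [FiniteDimensional ℝ E]
  [TopologicalSpace M] [ChartedSpace E M] [IsManifold 𝓘(ℝ, E) ∞ M] [T2Space M]

omit [FiniteDimensional ℝ E] [T2Space M] in
/-- The second derivative at a critical point through a vector field. -/
theorem hess_field (f : Fn E M) {z : M} (h0 : diff E f z = 0) {W : ∀ y : M, Tan E y}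
    (hW : VecNear (EX := E) (fun y : M => y) W z) (u : Tan E z) :
    hess E f z u (W z) = diff E (fun y => diff E f y (W y)) z u := by
  have h := hess_deriv f (c := fun y : M => y) (y := z) (v := W) mdifferentiableAt_id hW.mdiff h0 u
  have h2 : mfderiv 𝓘(ℝ, E) 𝓘(ℝ, E) (fun y : M => y) z u = u := by
    rw [show (fun y : M => y) = id from rfl, mfderiv_id]; rfl
  rw [h2] at h
  exact h.symm

/-- Near a point, the second derivative at critical points is given by the differentials of
fixed smooth functions. -/
theorem exists_hess_fn (f : Fn E M) (z₀ : M) : ∃ G : E → Fn E M, ∀ e, ∀ᶠ z in 𝓝 z₀,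
    G e z = diff E f z (Ti z₀ z e) ∧
      (diff E f z = 0 → ∀ u, hess E f z u (Ti z₀ z e) = diff E (G e) z u) := by
  have hG : ∀ e : E, ∃ g : Fn E M, g =ᶠ[𝓝 z₀] fun z => diff E f z (Ti z₀ z e) := fun e =>
    exists_fn_eventuallyEq (CovNear.apply (EX := E) (j := fun z : M => z) continuous_id
      (covNear_diff contMDiff_id f z₀) (VecNear.const continuous_id e z₀))
  choose G hG using hG
  refine ⟨G, fun e => ?_⟩
  filter_upwards [(hG e).eventually_nhds, hG e, chart_near (E := E) z₀] with z h1 h2 h3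
  refine ⟨h2, fun h0 u => ?_⟩
  rw [diff_congr h1]
  refine hess_field f h0 (W := fun y => Ti z₀ y e) ?_ u
  exact (((smoothNear_Tc_Ti h3 (mem_chart_source E z)).clm_apply (SmoothNear.const e)).congr
    (Eventually.of_forall fun _ => rfl) :)

/-- `hess` is written in the preferred chart of each point, and this chart may jump from point to
point. Near `x₀`, `exists_hess_fn` replaces the components of `hess` by differentials of fixed
functions, which vary smoothly. -/
theorem CovNear.hess {EX X : Type*} [NormedAddCommGroup EX] [NormedSpace ℝ EX]
    [TopologicalSpace X] [ChartedSpace EX X] (f : Fn E M) {j : X → M}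
    (hj : ContMDiff 𝓘(ℝ, EX) 𝓘(ℝ, E) ∞ j) {x₀ : X} (h0 : ∀ᶠ x in 𝓝 x₀, diff E f (j x) = 0)
    {u : ∀ x, Tan E (j x)} (hu : VecNear (EX := EX) j u x₀) :
    CovNear (EX := EX) j (fun x => hess E f (j x) (u x)) x₀ := by
  obtain ⟨G, hG⟩ := exists_hess_fn f (j x₀)
  refine CovNear.of_vec fun e => ?_
  refine (CovNear.apply hj.continuous (covNear_diff hj (G e) x₀) hu).congr ?_
  filter_upwards [hj.continuous.continuousAt.eventually (hG e), h0] with x h1 h2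
  exact h1.2 h2 (u x)

omit [FiniteDimensional ℝ E] [T2Space M] in
theorem vecNear_const_id (z : M) (e : E) :
    VecNear (EX := E) (fun y : M => y) (fun y => Ti z y e) z :=
  VecNear.const continuous_id e z

omit [FiniteDimensional ℝ E] [T2Space M] in
theorem hess_const (f : Fn E M) {z : M} (h0 : diff E f z = 0) (u v : Tan E z) :
    hess E f z u v = diff E (fun y => diff E f y (Ti z y (Tc z z v))) z u := by
  have h := hess_field f h0 (vecNear_const_id z (Tc z z v)) u
  rw [Ti_Tc (mem_chart_source _ _)] at h
  exact h

/-- The second derivative of a pull-back at a critical point. -/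
theorem hess_comp {EX X : Type*} [NormedAddCommGroup EX] [NormedSpace ℝ EX]
    [FiniteDimensional ℝ EX] [TopologicalSpace X] [ChartedSpace EX X] [IsManifold 𝓘(ℝ, EX) ∞ X]
    (f : Fn E M) (i : C^∞⟮𝓘(ℝ, EX), X; 𝓘(ℝ, E), M⟯) {x : X} (h0 : diff E f (i x) = 0)
    (u v : Tan EX x) :
    hess EX (f.comp i : Fn EX X) x u v =
      hess E f (i x) (mfderiv 𝓘(ℝ, EX) 𝓘(ℝ, E) i x u) (mfderiv 𝓘(ℝ, EX) 𝓘(ℝ, E) i x v) := by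
  have hc : diff EX (f.comp i : Fn EX X) x = 0 := by
    rw [diff_comp_fn, h0]; exact ContinuousLinearMap.zero_comp _
  rw [hess_const _ hc]
  have hp := VecNear.push i (j := fun y : X => y) contMDiff_id (vecNear_const_id x (Tc x x v))
  have h := hess_deriv f (smooth_mdiff i x) hp.mdiff h0 u
  rw [Ti_Tc (mem_chart_source _ _)] at h
  refine Eq.trans ?_ h
  congr 2
  funext y
  exact DFunLike.congr_fun (diff_comp_fn f i y) _

omit [FiniteDimensional ℝ E] [T2Space M] in
theorem hess_of_diff_near {f g : Fn E M} {z : M} (hf : diff E f z = 0)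
    (h : ∀ᶠ y in 𝓝 z, f y = g y) (u v : Tan E z) : hess E f z u v = hess E g z u v := by
  have e : ∀ᶠ y in 𝓝 z, diff E f y = diff E g y := by
    filter_upwards [h.eventually_nhds] with y hy using diff_congr hy
  have hg : diff E g z = 0 := by rw [← e.self_of_nhds, hf]
  rw [hess_const f hf, hess_const g hg]
  congr 1
  exact diff_congr (by filter_upwards [e] with y hy; rw [hy])

omit [FiniteDimensional ℝ E] [T2Space M] in
theorem diff_section_mdiff (f : Fn E M) (z : M) (e : E) [FiniteDimensional ℝ E] :
    MDifferentiableAt 𝓘(ℝ, E) 𝓘(ℝ, ℝ) (fun y => diff E f y (Ti z y e)) z :=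
  (CovNear.apply (EX := E) (j := fun z : M => z) continuous_id
      (covNear_diff contMDiff_id f z) (vecNear_const_id z e)).mdiff

omit [T2Space M] in
theorem hess_sub (f g : Fn E M) {z : M} (hf : diff E f z = 0) (hg : diff E g z = 0)
    (u v : Tan E z) : hess E (f - g : Fn E M) z u v = hess E f z u v - hess E g z u v := by
  have hfg : diff E (f - g : Fn E M) z = 0 := by rw [diff_sub, hf, hg, sub_zero]
  rw [hess_const _ hf, hess_const _ hg, hess_const _ hfg]
  have e : (fun y => diff E (f - g : Fn E M) y (Ti z y (Tc z z v))) =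
      fun y => diff E f y (Ti z y (Tc z z v)) + -diff E g y (Ti z y (Tc z z v)) := by
    funext y
    rw [diff_sub]
    exact sub_eq_add_neg _ _
  have m1 := diff_section_mdiff f z (Tc z z v)
  have m2 := diff_section_mdiff g z (Tc z z v)
  rw [e, diff_add' (g := fun y => -diff E g y (Ti z y (Tc z z v))) m1 m2.neg, diff_neg' m2]
  exact (sub_eq_add_neg _ _).symm

omit [T2Space M] in
/-- The second derivative of a product of two functions that vanish at the point. -/
theorem hess_mul (f g : Fn E M) {z : M} (hf : f z = 0) (hg : g z = 0) (u v : Tan E z) :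
    hess E (f * g : Fn E M) z u v =
      diff E f z u * diff E g z v + diff E g z u * diff E f z v := by
  have h0 : diff E (f * g : Fn E M) z = 0 := by
    rw [diff_mul, hf, hg, zero_smul, zero_smul, zero_add]
  rw [hess_const _ h0]
  have e : (fun y => diff E (f * g : Fn E M) y (Ti z y (Tc z z v))) =
      fun y => f y * diff E g y (Ti z y (Tc z z v)) + g y * diff E f y (Ti z y (Tc z z v)) := by
    funext y
    rw [diff_mul]
    rfl
  have m1 := diff_section_mdiff f z (Tc z z v)
  have m2 := diff_section_mdiff g z (Tc z z v)
  rw [e, diff_add' (f := fun y => f y * diff E g y (Ti z y (Tc z z v)))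
    (g := fun y => g y * diff E f y (Ti z y (Tc z z v))) ((fn_mdiff f z).mul m2)
    ((fn_mdiff g z).mul m1), diff_mul' (fn_mdiff f z) m2,
    diff_mul' (fn_mdiff g z) m1, hf, hg, Ti_Tc (mem_chart_source _ _)]
  change (0 * _ + diff E g z v * diff E f z u) + (0 * _ + diff E f z v * diff E g z u) = _
  ring

end Hess

/-! ### Embeddings -/

section Embedding

variable {EM M EN N : Type*}
  [NormedAddCommGroup EM] [NormedSpace ℝ EM] [FiniteDimensional ℝ EM] [TopologicalSpace M]
  [ChartedSpace EM M] [IsManifold 𝓘(ℝ, EM) ∞ M] [T2Space M]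
  [NormedAddCommGroup EN] [NormedSpace ℝ EN] [FiniteDimensional ℝ EN] [TopologicalSpace N]
  [ChartedSpace EN N] [IsManifold 𝓘(ℝ, EN) ∞ N] [T2Space N]

/-- Topological embeddings along which functions extend locally. -/
def Extends (i : C^∞⟮𝓘(ℝ, EM), M; 𝓘(ℝ, EN), N⟯) : Prop :=
  Topology.IsInducing i ∧ ∀ (m : M) (f : Fn EM M), ∃ g : Fn EN N, ∀ᶠ y in 𝓝 m, g (i y) = f y

omit [FiniteDimensional ℝ EM] [IsManifold 𝓘(ℝ, EM) ∞ M] [T2Space M] in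
-- In the charts of the immersion the map is a linear inclusion. Composing with the linear
-- projection extends the function to a neighbourhood, and a cut-off makes the extension global.
theorem extends_of_embedding {i : C^∞⟮𝓘(ℝ, EM), M; 𝓘(ℝ, EN), N⟯}
    (hi : Manifold.IsSmoothEmbedding 𝓘(ℝ, EM) 𝓘(ℝ, EN) ∞ i) : Extends i := by
  refine ⟨hi.isEmbedding.isInducing, fun m f => ?_⟩
  have h := hi.isImmersion.isImmersionAt m
  set φ := h.domChart with hφ
  set ψ := h.codChart with hψ
  set pr : EN →L[ℝ] EM := (ContinuousLinearMap.fst ℝ EM h.complement).comp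
    (h.equiv.symm : EN →L[ℝ] EM × h.complement) with hpr
  have key : ∀ y ∈ φ.source, pr (ψ (i y)) = φ y := by
    intro y hy
    have hy' : φ y ∈ (φ.extend 𝓘(ℝ, EM)).target := by
      rw [OpenPartialHomeomorph.extend_target]
      simpa using φ.map_source hy
    have := h.writtenInCharts hy'
    simp only [Function.comp_apply, OpenPartialHomeomorph.extend_coe,
      OpenPartialHomeomorph.extend_coe_symm, modelWithCornersSelf_coe,
      modelWithCornersSelf_coe_symm, id] at this
    rw [← hφ, ← hψ, φ.left_inv hy] at this
    rw [this]
    simp [hpr]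
  have hm : m ∈ φ.source := h.mem_domChart_source
  have hn : i m ∈ ψ.source := h.mem_codChart_source
  have hs : SmoothNear (E := EN) (F := ℝ) (fun z => f (φ.symm (pr (ψ z)))) (i m) := by
    have hO : {z | z ∈ ψ.source ∧ pr (ψ z) ∈ φ.target} ∈ 𝓝 (i m) := by
      refine inter_mem (ψ.open_source.mem_nhds hn) ?_
      have hc : ContinuousAt (fun z => pr (ψ z)) (i m) :=
        pr.continuous.continuousAt.comp (ψ.continuousAt hn)
      refine hc.preimage_mem_nhds (φ.open_target.mem_nhds ?_)
      rw [key m hm]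
      exact φ.map_source hm
    filter_upwards [hO] with z hz
    have h1 : ContMDiffAt 𝓘(ℝ, EN) 𝓘(ℝ, EN) ∞ ψ z :=
      contMDiffAt_of_mem_maximalAtlas h.codChart_mem_maximalAtlas hz.1
    have h2 : ContMDiffAt 𝓘(ℝ, EN) 𝓘(ℝ, EM) ∞ (fun z => pr (ψ z)) z :=
      pr.contDiff.contDiffAt.comp_contMDiffAt h1
    have h3 : ContMDiffAt 𝓘(ℝ, EM) 𝓘(ℝ, EM) ∞ φ.symm (pr (ψ z)) :=
      contMDiffAt_symm_of_mem_maximalAtlas h.domChart_mem_maximalAtlas hz.2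
    exact (f.contMDiff _).comp z (h3.comp z h2)
  obtain ⟨g, hg⟩ := exists_fn_eventuallyEq hs
  refine ⟨g, ?_⟩
  filter_upwards [i.contMDiff.continuous.continuousAt.eventually hg,
    φ.open_source.mem_nhds hm] with y h1 h2
  rw [h1, key y h2, φ.left_inv h2]

omit [FiniteDimensional ℝ EM] [IsManifold 𝓘(ℝ, EM) ∞ M] [T2Space M] 
 [FiniteDimensional ℝ EN] [IsManifold 𝓘(ℝ, EN) ∞ N] [T2Space N] in
theorem Extends.comp {EP P : Type*} [NormedAddCommGroup EP] [NormedSpace ℝ EP]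
    [TopologicalSpace P] [ChartedSpace EP P] {i : C^∞⟮𝓘(ℝ, EM), M; 𝓘(ℝ, EN), N⟯}
    {k : C^∞⟮𝓘(ℝ, EN), N; 𝓘(ℝ, EP), P⟯} (hk : Extends k) (hi : Extends i) :
    Extends (k.comp i) := by
  refine ⟨hk.1.comp hi.1, fun m f => ?_⟩
  obtain ⟨g, hg⟩ := hi.2 m f
  obtain ⟨g', hg'⟩ := hk.2 (i m) g
  refine ⟨g', ?_⟩
  filter_upwards [hg, i.contMDiff.continuous.continuousAt.eventually hg'] with y h1 h2
  exact h2.trans h1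

variable {i : C^∞⟮𝓘(ℝ, EM), M; 𝓘(ℝ, EN), N⟯}

omit [FiniteDimensional ℝ EN] [IsManifold 𝓘(ℝ, EN) ∞ N] [T2Space N] in
-- A tangent vector killed by the tangent map of `i` annihilates all functions that extend to the
-- ambient manifold. Near the point these are all functions.
theorem Extends.mfderiv_injective (hi : Extends i) (m : M) :
    Function.Injective (mfderiv 𝓘(ℝ, EM) 𝓘(ℝ, EN) i m) := by
  rw [injective_iff_map_eq_zero]
  intro v hv
  refine tan_eq_zero fun a => ?_
  obtain ⟨f, rfl⟩ := exists_fn_diff m a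
  obtain ⟨g, hg⟩ := hi.2 m f
  have : diff EM f m = diff EM (g.comp i : Fn EM M) m :=
    diff_congr (by filter_upwards [hg] with y hy using hy.symm)
  rw [this, diff_comp_fn, ContinuousLinearMap.comp_apply, hv, map_zero]

omit [FiniteDimensional ℝ EN] [IsManifold 𝓘(ℝ, EN) ∞ N] [T2Space N] in
/-- A germ of a function on the submanifold extends to the ambient manifold. -/
theorem Extends.exists_ext (hi : Extends i) {m : M} {f : M → ℝ} (hf : SmoothNear (E := EM) f m) :
    ∃ g : Fn EN N, ∀ᶠ y in 𝓝 m, g (i y) = f y := by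
  obtain ⟨f', h'⟩ := exists_fn_eventuallyEq hf
  obtain ⟨g, hg⟩ := hi.2 m f'
  exact ⟨g, by filter_upwards [h', hg] with y h1 h2; rw [h2, h1]⟩

/-- A family of functions vanishing on the submanifold whose differentials span its conormal
space near a point. -/
theorem Extends.exists_conormal (hi : Extends i) (m : M) :
    ∃ n : Fin (Module.finrank ℝ EN) → Fn EN N, (∀ k y, n k (i y) = 0) ∧
      ∀ᶠ y in 𝓝 m, ∀ a : Cot EN (i y),
        (∀ w, a (mfderiv 𝓘(ℝ, EM) 𝓘(ℝ, EN) i y w) = 0) →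
        a = ∑ k, a (Ti (i m) (i y) (Module.finBasis ℝ EN k)) • diff EN (n k) (i y) := by
  set b := Module.finBasis ℝ EN
  set φ := chartAt EM m
  -- coordinates of the submanifold, extended
  have hx : ∀ l : EM →L[ℝ] ℝ, ∃ g : Fn EN N, ∀ᶠ y in 𝓝 m, g (i y) = l (φ y) := fun l =>
    hi.exists_ext ((smoothNear_extChart (mem_chart_source EM m)).clm l)
  choose X hX using hx
  set bM := Module.finBasis ℝ EM
  -- `ρ` extends the chart of the submanifold, so `i ∘ φ⁻¹ ∘ ρ` is a local retraction `r` onto it.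
  -- The functions `n k` below are the coordinates of `z` minus those of `r z`, cut off.
  set ρ : N → EM := fun z => ∑ k, X (LinearMap.toContinuousLinearMap (bM.coord k)) z • bM k
  have hρs : ContMDiff 𝓘(ℝ, EN) 𝓘(ℝ, EM) ∞ ρ := by
    intro z
    have : SmoothNear (E := EN) (F := EM) ρ z :=
      SmoothNear.sum fun k => (fn_smoothNear _ z).smul (SmoothNear.const _)
    exact this.at
  have hρ : ∀ᶠ y in 𝓝 m, ρ (i y) = φ y := by
    have : ∀ᶠ y in 𝓝 m, ∀ k, X (LinearMap.toContinuousLinearMap (bM.coord k)) (i y) =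
      LinearMap.toContinuousLinearMap (bM.coord k) (φ y) := eventually_all.2 fun k => hX _
    filter_upwards [this] with y hy
    simp only [ρ, hy]
    exact bM.sum_repr (φ y)
  set r : N → N := fun z => i (φ.symm (ρ z)) with hr
  have hρm := hρ.self_of_nhds
  have hφm : φ m ∈ φ.target := φ.map_source (mem_chart_source EM m)
  have hO : {z | ρ z ∈ φ.target} ∈ 𝓝 (i m) := by
    refine hρs.continuous.continuousAt.preimage_mem_nhds (φ.open_target.mem_nhds ?_)
    rw [hρm]; exact hφm
  have hrs : ∀ᶠ z in 𝓝 (i m), ContMDiffAt 𝓘(ℝ, EN) 𝓘(ℝ, EN) ∞ r z := by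
    filter_upwards [hO] with z hz
    have h3 : ContMDiffAt 𝓘(ℝ, EM) 𝓘(ℝ, EM) ∞ φ.symm (ρ z) :=
      contMDiffAt_symm_of_mem_maximalAtlas (IsManifold.chart_mem_maximalAtlas m) hz
    exact (i.contMDiff _).comp z (h3.comp z (hρs z))
  have hri : ∀ᶠ y in 𝓝 m, r (i y) = i y := by
    filter_upwards [hρ, chart_near (E := EM) m] with y h1 h2
    simp only [hr, h1]
    rw [φ.left_inv h2]
  -- the neighbourhood in the ambient manifold
  obtain ⟨O₁, hO₁, hO₁m⟩ : ∃ O₁ ∈ 𝓝 (i m), i ⁻¹' O₁ ⊆ {y | r (i y) = i y} := by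
    have := hi.1.nhds_eq_comap m
    rw [eventually_iff, this, mem_comap] at hri
    exact hri
  obtain ⟨q, -, hq⟩ := exists_coordFn (E := EN) (i m) univ_mem
  set l : Fin (Module.finrank ℝ EN) → EN →L[ℝ] ℝ := fun k =>
    LinearMap.toContinuousLinearMap (b.coord k)
  have hf : ∀ k, SmoothNear (E := EN) (F := ℝ) (fun z => q (l k) z - q (l k) (r z)) (i m) := by
    intro k
    refine (fn_smoothNear (q (l k)) _).sub ?_
    filter_upwards [hrs] with z hz using ((q (l k)).contMDiff _).comp z hz
  have hn : ∀ k, ∃ χ g : Fn EN N, (∀ᶠ z in 𝓝 (i m), χ z = 1) ∧ tsupport χ ⊆ O₁ ∧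
      ∀ z, g z = χ z * (q (l k) z - q (l k) (r z)) := fun k => exists_fn_of_germ (hf k) hO₁
  choose χ n hχ hχO hn using hn
  refine ⟨n, ?_, ?_⟩
  · intro k y
    rw [hn]
    by_cases hy : i y ∈ tsupport (χ k)
    · have : r (i y) = i y := hO₁m (hχO k hy)
      rw [this, sub_self, mul_zero]
    · rw [image_eq_zero_of_notMem_tsupport hy, zero_mul]
  · have ci := i.contMDiff.continuous.continuousAt (x := m)
    filter_upwards [ci.eventually hq, ci.eventually (eventually_eventually_nhds.2
      (eventually_all.2 hχ)), ci.eventually hrs, hri, ci.eventually hO,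
      hρ, chart_near (E := EM) m] with y hq hχ hrs hri hO hρy hym a ha
    have e : φ.symm (ρ (i y)) = y := by rw [hρy, φ.left_inv hym]
    -- The differential of `r` takes tangent values. So a conormal covector `a` satisfies `a v = a
    -- (v - dr v)`, and the coordinates of `v - dr v` are the numbers `d(n k) v`.
    have hdr : ∀ v, ∃ w : Tan EM y, (mfderiv 𝓘(ℝ, EN) 𝓘(ℝ, EN) r (i y) v : EN) =
        mfderiv 𝓘(ℝ, EM) 𝓘(ℝ, EN) i y w := by
      intro v
      have h3 : ContMDiffAt 𝓘(ℝ, EM) 𝓘(ℝ, EM) ∞ φ.symm (ρ (i y)) :=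
        contMDiffAt_symm_of_mem_maximalAtlas (IsManifold.chart_mem_maximalAtlas m) hO
      have h4 : MDifferentiableAt 𝓘(ℝ, EN) 𝓘(ℝ, EM) (fun z => φ.symm (ρ z)) (i y) :=
        (h3.comp (i y) (hρs _)).mdifferentiableAt (by simp)
      have h5 := mfderiv_comp (i y) (smooth_mdiff i _) h4
      have h6 : ∀ p : M, p = y → ∀ w : EM, ∃ w' : Tan EM y,
          ((mfderiv 𝓘(ℝ, EM) 𝓘(ℝ, EN) i p : EM →L[ℝ] EN) w : EN) =
            mfderiv 𝓘(ℝ, EM) 𝓘(ℝ, EN) i y w' := by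
        rintro _ rfl w
        exact ⟨w, rfl⟩
      obtain ⟨w', hw'⟩ := h6 _ e (mfderiv 𝓘(ℝ, EN) 𝓘(ℝ, EM) (fun z => φ.symm (ρ z)) (i y) v)
      exact ⟨w', (DFunLike.congr_fun h5 v).trans hw'⟩
    have hqz : ∀ k, ∀ z : N, z = i y → ∀ u : EN, (diff EN (q (l k)) z : EN →L[ℝ] ℝ) u =
        l k ((Tc (i m) (i y) : EN →L[ℝ] EN) u) := by
      rintro k _ rfl u
      exact hq.2 _ _
    ext v
    obtain ⟨w, hw⟩ := hdr v
    have hdk : ∀ k, diff EN (n k) (i y) v = l k (Tc (i m) (i y) v) -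
        l k (Tc (i m) (i y) (mfderiv 𝓘(ℝ, EM) 𝓘(ℝ, EN) i y w)) := by
      intro k
      have h1 : n k =ᶠ[𝓝 (i y)] fun z => q (l k) z + -q (l k) (r z) := by
        filter_upwards [hχ] with z hz
        rw [hn, hz k, one_mul, sub_eq_add_neg]
      have h2 : MDifferentiableAt 𝓘(ℝ, EN) 𝓘(ℝ, ℝ) (fun z => q (l k) (r z)) (i y) :=
        (fn_mdiff (q (l k)) _).comp (i y) (hrs.mdifferentiableAt (by simp))
      rw [diff_congr h1, diff_add' (g := fun z => -q (l k) (r z)) (fn_mdiff _ _) h2.neg,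
        diff_neg' h2, diff_comp (fn_mdiff _ _) (hrs.mdifferentiableAt (by simp)), sub_eq_add_neg]
      refine congrArg₂ (· + ·) (hq.2 _ _) (congrArg Neg.neg ?_)
      exact (hqz k _ hri _).trans (congrArg (fun u => l k ((Tc (i m) (i y) : EN →L[ℝ] EN) u)) hw)
    have hexp : ∀ u : Tan EN (i y), a u =
        ∑ k, a (Ti (i m) (i y) (b k)) * l k (Tc (i m) (i y) u) := by
      intro u
      conv_lhs => rw [← Ti_Tc hq.1 u, ← b.sum_repr (Tc (i m) (i y) u), map_sum, map_sum]
      refine Finset.sum_congr rfl fun k _ => ?_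
      rw [map_smul, map_smul, smul_eq_mul, mul_comm]
      rfl
    have h0 := ha w
    rw [hexp] at h0
    rw [sum_apply]
    refine (hexp v).trans ?_
    rw [← sub_zero (∑ k, _), ← h0, ← Finset.sum_sub_distrib]
    refine Finset.sum_congr rfl fun k _ => ?_
    rw [← mul_sub, ← hdk]
    rfl

end Embedding

end

/-! ### Poisson calculus, the geometry of the leaf, and extension of data from `X` to `Z`. -/

noncomputable section

namespace PoissonStructure

variable {E M : Type*} [NormedAddCommGroup E] [NormedSpace ℝ E]
  [TopologicalSpace M] [ChartedSpace E M] (P : PoissonStructure E M)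

theorem bracket_apply (f g : Fn E M) (z : M) : P.bracket f g z = diff E f z (P.ham g z) := rfl

theorem bracket_skew (f g : Fn E M) : P.bracket f g = - P.bracket g f := by
  ext z
  exact P.skew z _ _

theorem bracket_add_left (f g h : Fn E M) :
    P.bracket (f + g) h = P.bracket f h + P.bracket g h := by
  ext z
  change diff E (f + g : Fn E M) z _ = _
  rw [diff_add]; rfl

theorem bracket_sub_left (f g h : Fn E M) :
    P.bracket (f - g) h = P.bracket f h - P.bracket g h := by
  ext z
  change diff E (f - g : Fn E M) z _ = _
  rw [diff_sub]; rfl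

theorem bracket_mul_left (f g h : Fn E M) :
    P.bracket (f * g) h = f * P.bracket g h + g * P.bracket f h := by
  ext z
  change diff E (f * g : Fn E M) z _ = _
  rw [diff_mul]; rfl

theorem bracket_sum_left {ι : Type*} (s : Finset ι) (f : ι → Fn E M) (h : Fn E M) :
    P.bracket (∑ i ∈ s, f i) h = ∑ i ∈ s, P.bracket (f i) h := by
  ext z
  change diff E (∑ i ∈ s, f i : Fn E M) z _ = _
  rw [diff_sum, fn_sum_apply, sum_apply]; rfl

theorem bracket_add_right (f g h : Fn E M) :
    P.bracket f (g + h) = P.bracket f g + P.bracket f h := by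
  rw [bracket_skew, bracket_add_left, P.bracket_skew f g, P.bracket_skew f h, neg_add]

theorem bracket_sub_right (f g h : Fn E M) :
    P.bracket f (g - h) = P.bracket f g - P.bracket f h := by
  rw [bracket_skew, bracket_sub_left, P.bracket_skew f g, P.bracket_skew f h]
  abel

theorem bracket_mul_right (f g h : Fn E M) :
    P.bracket f (g * h) = g * P.bracket f h + h * P.bracket f g := by
  rw [bracket_skew, bracket_mul_left, P.bracket_skew f g, P.bracket_skew f h]
  ring

theorem bracket_sum_right {ι : Type*} (s : Finset ι) (f : ι → Fn E M) (h : Fn E M) :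
    P.bracket h (∑ i ∈ s, f i) = ∑ i ∈ s, P.bracket h (f i) := by
  rw [bracket_skew, bracket_sum_left, ← Finset.sum_neg_distrib]
  exact Finset.sum_congr rfl fun i _ => (P.bracket_skew _ _).symm

/-- The Jacobi identity, as a derivation rule. -/
theorem bracket_leibniz (f g h : Fn E M) :
    P.bracket f (P.bracket g h) = P.bracket (P.bracket f g) h + P.bracket g (P.bracket f h) := by
  have hj : P.bracket f (P.bracket g h) + P.bracket g (P.bracket h f) +
      P.bracket h (P.bracket f g) = 0 := by
    ext z
    exact P.jacobi f g h z
  have neg_right : ∀ a b : Fn E M, P.bracket a (-b) = -P.bracket a b := by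
    intro a b
    have := P.bracket_sub_right a 0 b
    have h0 := P.bracket_sub_right a 0 0
    rw [sub_zero, sub_self] at h0
    rwa [zero_sub, h0, zero_sub] at this
  rw [P.bracket_skew h f, neg_right, P.bracket_skew h] at hj
  have := sub_eq_zero.1 (hj ▸ (by abel) : P.bracket f (P.bracket g h) -
    (P.bracket (P.bracket f g) h + P.bracket g (P.bracket f h)) = 0)
  exact this

theorem ham_eq (f : Fn E M) (z : M) : P.ham f z = P.sharp z (diff E f z) := rfl

variable [FiniteDimensional ℝ E] [IsManifold 𝓘(ℝ, E) ∞ M] [T2Space M]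

theorem vecNear_ham {EX X : Type*} [NormedAddCommGroup EX] [NormedSpace ℝ EX] [TopologicalSpace X]
    [ChartedSpace EX X] {j : X → M} (hj : ContMDiff 𝓘(ℝ, EX) 𝓘(ℝ, E) ∞ j) (f : Fn E M) (x₀ : X) :
    VecNear (EX := EX) j (fun x => P.ham f (j x)) x₀ :=
  VecNear.of_fn hj.continuous fun g => (fn_smoothNear (P.bracket g f) (j x₀)).comp_map hj

/-- By skew-symmetry `dg (w♯ a) = -a (X_g)`, which reduces arbitrary covector fields to Hamiltonian
vector fields. -/
theorem vecNear_sharp {EX X : Type*} [NormedAddCommGroup EX] [NormedSpace ℝ EX]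
    [TopologicalSpace X] [ChartedSpace EX X] {j : X → M} (hj : ContMDiff 𝓘(ℝ, EX) 𝓘(ℝ, E) ∞ j)
    {a : ∀ x, Cot E (j x)} {x₀ : X} (ha : CovNear (EX := EX) j a x₀) :
    VecNear (EX := EX) j (fun x => P.sharp (j x) (a x)) x₀ := by
  refine VecNear.of_fn hj.continuous fun g => ?_
  refine (CovNear.apply hj.continuous ha (P.vecNear_ham hj g x₀)).neg.congr ?_
  exact Eventually.of_forall fun x => P.skew _ _ _

/-- `{f, g}` is the pairing of `df` with the vector field `X_g`, and at a critical point of `f` the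
derivative of such a pairing is the second derivative. -/
theorem diff_bracket_left {f : Fn E M} {z : M} (hf : diff E f z = 0) (g : Fn E M) (v : Tan E z) :
    diff E (P.bracket f g) z v = hess E f z v (P.ham g z) :=
  (hess_field f hf (P.vecNear_ham (j := fun y : M => y) contMDiff_id g z) v).symm

theorem diff_bracket_right {g : Fn E M} {z : M} (hg : diff E g z = 0) (f : Fn E M) (v : Tan E z) :
    diff E (P.bracket f g) z v = -hess E g z v (P.ham f z) := by
  have h : diff E (P.bracket f g) z = -diff E (P.bracket g f) z := by
    rw [P.bracket_skew f g]
    exact diff_neg' (fn_mdiff (P.bracket g f) z)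
  rw [h, ← P.diff_bracket_left hg f]
  rfl

theorem bracket_eq_neg_sharp (f g : Fn E M) (z : M) :
    P.bracket f g z = - diff E g z (P.ham f z) := P.skew _ _ _

end PoissonStructure

/-- Covectors extend along injective linear maps. -/
theorem exists_cot_extend {E M E' M' : Type*} [NormedAddCommGroup E] [NormedSpace ℝ E]
    [FiniteDimensional ℝ E] [NormedAddCommGroup E'] [NormedSpace ℝ E'] [FiniteDimensional ℝ E']
    [TopologicalSpace M] [ChartedSpace E M] [TopologicalSpace M'] [ChartedSpace E' M'] {p : M}
    {q : M'} {T : Tan E p →L[ℝ] Tan E' q} (hT : Function.Injective T) (a : Cot E p) :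
    ∃ b : Cot E' q, b.comp T = a := by
  obtain ⟨r, hr⟩ := T.toLinearMap.exists_leftInverse_of_injective (LinearMap.ker_eq_bot.2 hT)
  obtain ⟨b, hb⟩ := exists_cot q (a.toLinearMap ∘ₗ r)
  refine ⟨b, ?_⟩
  ext v
  rw [ContinuousLinearMap.comp_apply, hb]
  exact congrArg a (LinearMap.congr_fun hr v)

namespace ConstraintData

variable {EX X ES S EQ Q EZ Z : Type*}
    [NormedAddCommGroup EX] [NormedSpace ℝ EX] [FiniteDimensional ℝ EX]
    [TopologicalSpace X] [ChartedSpace EX X] [IsManifold 𝓘(ℝ, EX) ∞ X]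
    [T2Space X] [SecondCountableTopology X]
    [NormedAddCommGroup ES] [NormedSpace ℝ ES] [FiniteDimensional ℝ ES]
    [TopologicalSpace S] [ChartedSpace ES S] [IsManifold 𝓘(ℝ, ES) ∞ S]
    [T2Space S] [SecondCountableTopology S]
    [NormedAddCommGroup EQ] [NormedSpace ℝ EQ] [FiniteDimensional ℝ EQ]
    [TopologicalSpace Q] [ChartedSpace EQ Q] [IsManifold 𝓘(ℝ, EQ) ∞ Q]
    [T2Space Q] [SecondCountableTopology Q]
    [NormedAddCommGroup EZ] [NormedSpace ℝ EZ] [FiniteDimensional ℝ EZ]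
    [TopologicalSpace Z] [ChartedSpace EZ Z] [IsManifold 𝓘(ℝ, EZ) ∞ Z]
    [T2Space Z] [SecondCountableTopology Z]
    {D : ConstraintData EX X ES S EQ Q EZ Z}

theorem tQ_eq (q : Q) : D.tQ q = mfderiv 𝓘(ℝ, EQ) 𝓘(ℝ, EZ) D.iQ q := rfl

theorem tXZ_eq (x : X) : D.tXZ x = mfderiv 𝓘(ℝ, EX) 𝓘(ℝ, EZ) D.zmap x := by
  rw [tXZ, tXQ_eq]
  exact (mfderiv_comp x (smooth_mdiff D.iQ _) (smooth_mdiff (D.iS.comp D.iX) x)).symm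

theorem tSZ_eq (s : S) : D.tSZ s = mfderiv 𝓘(ℝ, ES) 𝓘(ℝ, EZ) (D.iQ.comp D.iS) s :=
  (mfderiv_comp s (smooth_mdiff D.iQ _) (smooth_mdiff D.iS s)).symm

theorem contMDiff_ptS : ContMDiff 𝓘(ℝ, EX) 𝓘(ℝ, ES) ∞ D.ptS := D.iX.contMDiff
theorem contMDiff_ptQ : ContMDiff 𝓘(ℝ, EX) 𝓘(ℝ, EQ) ∞ D.ptQ := (D.iS.comp D.iX).contMDiff
theorem contMDiff_ptZ : ContMDiff 𝓘(ℝ, EX) 𝓘(ℝ, EZ) ∞ D.ptZ := D.zmap.contMDiff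

variable (hD : D.IsConstraint)
include hD

theorem IsConstraint.extendsQ : Extends D.iQ := extends_of_embedding hD.embQ

theorem IsConstraint.extendsZ : Extends D.zmap :=
  hD.extendsQ.comp ((extends_of_embedding hD.embS).comp (extends_of_embedding hD.embX))

theorem IsConstraint.tX_injective (x : X) : Function.Injective (D.tX x) :=
  (extends_of_embedding hD.embX).mfderiv_injective x

theorem IsConstraint.tS_injective (s : S) : Function.Injective (D.tS s) :=
  (extends_of_embedding hD.embS).mfderiv_injective s

theorem IsConstraint.tQ_injective (q : Q) : Function.Injective (D.tQ q) :=
  hD.extendsQ.mfderiv_injective q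

theorem IsConstraint.tSZ_injective (s : S) : Function.Injective (D.tSZ s) :=
  (hD.tQ_injective _).comp (hD.tS_injective s)

theorem IsConstraint.tXQ_injective (x : X) : Function.Injective (D.tXQ x) :=
  (hD.tS_injective _).comp (hD.tX_injective x)

theorem IsConstraint.tXZ_injective (x : X) : Function.Injective (D.tXZ x) :=
  (hD.tQ_injective _).comp (hD.tXQ_injective x)

/-! ### The symplectic form of the leaf -/

/-- The kernel of a skew map is the annihilator of its image, and the image of `w♯` at a point of
the leaf is `TS`. -/
theorem IsConstraint.sharp_eq_zero_iff {s : S} (a : Cot EZ (D.iQ (D.iS s))) :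
    D.poisson.sharp _ a = 0 ↔ ∀ u, a (D.tSZ s u) = 0 := by
  constructor
  · intro h u
    obtain ⟨b, hb⟩ := (hD.leaf_tangent s _).1 ⟨u, rfl⟩
    rw [← hb, D.poisson.skew, h, map_zero, neg_zero]
  · intro h
    refine tan_eq_zero fun b => ?_
    obtain ⟨u, hu⟩ := (hD.leaf_tangent s _).2 ⟨b, rfl⟩
    rw [D.poisson.skew, ← hu, h, neg_zero]

/-- The choice in `omegaFlat` is immaterial: two lifts of `u` differ by an element of the kernel of
`w♯`, which vanishes on `TS`. -/
theorem IsConstraint.omegaFlat_eq {s : S} {a : Cot EZ (D.iQ (D.iS s))} {u : Tan ES s}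
    (h : D.poisson.sharp _ a = D.tSZ s u) : D.omegaFlat s u = a.comp (D.tSZ s) := by
  have hex : ∃ a : Cot EZ (D.iQ (D.iS s)), D.poisson.sharp _ a = D.tSZ s u := ⟨a, h⟩
  rw [omegaFlat, dif_pos hex]
  have h1 := hex.choose_spec
  ext v
  have h2 := (hD.sharp_eq_zero_iff (hex.choose - a)).1 (by rw [map_sub, h1, h, sub_self]) v
  exact sub_eq_zero.1 h2

theorem IsConstraint.exists_lift (s : S) (u : Tan ES s) :
    ∃ a : Cot EZ (D.iQ (D.iS s)), D.poisson.sharp _ a = D.tSZ s u ∧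
      D.omegaFlat s u = a.comp (D.tSZ s) := by
  obtain ⟨a, ha⟩ := (hD.leaf_tangent s _).1 ⟨u, rfl⟩
  exact ⟨a, ha, hD.omegaFlat_eq ha⟩

theorem IsConstraint.omegaFlat_add (s : S) (u v : Tan ES s) :
    D.omegaFlat s (u + v) = D.omegaFlat s u + D.omegaFlat s v := by
  obtain ⟨a, ha, ha'⟩ := hD.exists_lift s u
  obtain ⟨b, hb, hb'⟩ := hD.exists_lift s v
  rw [ha', hb', hD.omegaFlat_eq (a := a + b) (by rw [map_add, ha, hb, map_add])]
  rfl

theorem IsConstraint.omegaFlat_smul (s : S) (r : ℝ) (u : Tan ES s) :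
    D.omegaFlat s (r • u) = r • D.omegaFlat s u := by
  obtain ⟨a, ha, ha'⟩ := hD.exists_lift s u
  rw [ha', hD.omegaFlat_eq (a := r • a) (by rw [map_smul, ha, map_smul])]
  rfl

theorem IsConstraint.omegaFlat_neg (s : S) (u : Tan ES s) :
    D.omegaFlat s (-u) = - D.omegaFlat s u := by
  obtain ⟨a, ha, ha'⟩ := hD.exists_lift s u
  rw [ha', hD.omegaFlat_eq (a := -a) (by rw [map_neg, ha, map_neg])]
  rfl

theorem IsConstraint.omegaFlat_skew (s : S) (u v : Tan ES s) :
    D.omegaFlat s u v = - D.omegaFlat s v u := by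
  obtain ⟨a, ha, ha'⟩ := hD.exists_lift s u
  obtain ⟨b, hb, hb'⟩ := hD.exists_lift s v
  rw [ha', hb', ContinuousLinearMap.comp_apply, ContinuousLinearMap.comp_apply, ← ha, ← hb,
    D.poisson.skew]

theorem IsConstraint.omegaFlat_injective (s : S) {u : Tan ES s} (h : D.omegaFlat s u = 0) :
    u = 0 := by
  obtain ⟨a, ha, ha'⟩ := hD.exists_lift s u
  apply hD.tSZ_injective s
  rw [← ha, map_zero, hD.sharp_eq_zero_iff]
  intro v
  have := DFunLike.congr_fun (ha'.symm.trans h) v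
  exact this

theorem IsConstraint.omegaFlat_surjective (s : S) (b : Cot ES s) :
    ∃ u, D.omegaFlat s u = b := by
  obtain ⟨a, ha⟩ := exists_cot_extend (hD.tSZ_injective s) b
  obtain ⟨u, hu⟩ := (hD.leaf_tangent s _).2 ⟨a, rfl⟩
  exact ⟨u, by rw [hD.omegaFlat_eq hu.symm, ha]⟩

theorem IsConstraint.omegaFlat_tX (x : X) (v w : Tan EX x) :
    D.omegaFlat _ (D.tX x v) (D.tX x w) = 0 :=
  (hD.lagrangian x _).1 ⟨w, rfl⟩ v

/-- Covectors on the leaf that annihilate `TX` come from `TX` through the symplectic form. -/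
theorem IsConstraint.exists_omegaFlat_tX {x : X} {b : Cot ES (D.ptS x)}
    (hb : ∀ w, b (D.tX x w) = 0) : ∃ V, b = - D.omegaFlat _ (D.tX x V) := by
  obtain ⟨u, hu⟩ := hD.omegaFlat_surjective _ b
  obtain ⟨w, hw⟩ := (hD.lagrangian x u).2 fun w => by
    rw [hD.omegaFlat_skew, hu, hb, neg_zero]
  refine ⟨-w, ?_⟩
  rw [map_neg, hD.omegaFlat_neg, neg_neg, hw, hu]

theorem IsConstraint.neg_sharp_iff {s : S} (a : Cot EZ (D.iQ (D.iS s))) (v : Tan ES s) :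
    -D.poisson.sharp _ a = D.tSZ s v ↔ a.comp (D.tSZ s) = - D.omegaFlat _ v := by
  constructor
  · intro h
    rw [← hD.omegaFlat_neg]
    refine (hD.omegaFlat_eq ?_).symm
    rw [map_neg, ← h, neg_neg]
  · intro h
    obtain ⟨b, hb, hb'⟩ := hD.exists_lift s (-v)
    rw [← hD.omegaFlat_neg, hb'] at h
    have h2 := (hD.sharp_eq_zero_iff (a - b)).2 fun u =>
      sub_eq_zero.2 (DFunLike.congr_fun h u)
    rw [map_sub, hb, map_neg, sub_eq_zero] at h2
    rw [h2, neg_neg]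

/-- The anchor in terms of the symplectic form. -/
theorem IsConstraint.anchor_iff {x : X} (a : Cot EZ (D.ptZ x)) (V : Tan EX x) :
    -D.poisson.sharp _ a = D.tXZ x V ↔
      a.comp (D.tSZ (D.ptS x)) = - D.omegaFlat _ (D.tX x V) := by
  exact hD.neg_sharp_iff a (D.tX x V)

theorem IsConstraint.anchor_mem {x : X} {a : Cot EZ (D.ptZ x)} (ha : ∀ w, a (D.tXZ x w) = 0) :
    ∃ V, -D.poisson.sharp _ a = D.tXZ x V := by
  obtain ⟨V, hV⟩ := hD.exists_omegaFlat_tX (x := x) (b := a.comp (D.tSZ (D.ptS x))) ha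
  exact ⟨V, (hD.anchor_iff a V).2 hV⟩

/-! ### Functions vanishing on the constraint submanifold -/

theorem IsConstraint.diff_tQ {f : Fn EZ Z} (hf : ∀ q, f (D.iQ q) = 0) (q : Q) (u : Tan EQ q) :
    diff EZ f (D.iQ q) (D.tQ q u) = 0 := by
  have h := DFunLike.congr_fun (diff_comp_fn f D.iQ q) u
  have h2 : (f.comp D.iQ : Fn EQ Q) = 0 := by ext q; exact hf q
  rw [h2, diff_zero] at h
  exact h.symm

/-- Coisotropy makes `X_g` tangent to `Q`, where `f` is constant. -/
theorem IsConstraint.bracket_van {f g : Fn EZ Z} (hf : ∀ q, f (D.iQ q) = 0)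
    (hg : ∀ q, g (D.iQ q) = 0) (q : Q) : D.poisson.bracket f g (D.iQ q) = 0 := by
  obtain ⟨u, hu⟩ := hD.coisotropic q (diff EZ g (D.iQ q)) (hD.diff_tQ hg q)
  rw [PoissonStructure.bracket_apply, PoissonStructure.ham_eq, ← hu]
  exact hD.diff_tQ hf q u

theorem IsConstraint.ham_zero {g : Fn EZ Z} {s : S}
    (hg : ∀ u, diff EZ g (D.iQ (D.iS s)) (D.tSZ s u) = 0) : D.poisson.ham g (D.iQ (D.iS s)) = 0 :=
  (hD.sharp_eq_zero_iff _).2 hg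

/-- The differential of `g` vanishes on `TQ`, hence on `TS`. This is what makes linearizations along
the leaf meaningful. -/
theorem IsConstraint.ham_van {g : Fn EZ Z} (hg : ∀ q, g (D.iQ q) = 0) (s : S) :
    D.poisson.ham g (D.iQ (D.iS s)) = 0 :=
  hD.ham_zero fun u => hD.diff_tQ hg _ (D.tS s u)

/-! ### Local extensions of data on `X` -/

theorem IsConstraint.exists_ext {x₀ : X} {f : X → ℝ} (hf : SmoothNear (E := EX) f x₀) :
    ∃ g : Fn EZ Z, ∀ᶠ x in 𝓝 x₀, g (D.ptZ x) = f x :=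
  hD.extendsZ.exists_ext hf

/-- The coefficients of `a` in the conormal family are functions on `X`; they are extended to `Z`.
Since the `n k` vanish on `X`, the product rule leaves only `c k • d(n k)`. -/
theorem exists_conormal_aux {x₀ : X} {a : ∀ x, Cot EZ (D.ptZ x)}
    (ha : CovNear (EX := EX) D.ptZ a x₀) {n : Fin (Module.finrank ℝ EZ) → Fn EZ Z}
    (hn : ∀ k x, n k (D.ptZ x) = 0) (h : ∀ᶠ x in 𝓝 x₀,
      a x = ∑ k, a x (Ti (D.ptZ x₀) (D.ptZ x) (Module.finBasis ℝ EZ k)) • diff EZ (n k) (D.ptZ x)) :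
    ∃ c : Fin (Module.finrank ℝ EZ) → Fn EZ Z,
      ∀ᶠ x in 𝓝 x₀, diff EZ (∑ k, c k * n k : Fn EZ Z) (D.ptZ x) = a x := by
  have hc : ∀ k, ∃ c : Fn EZ Z, ∀ᶠ x in 𝓝 x₀, c (D.ptZ x) =
      a x (Ti (D.ptZ x₀) (D.ptZ x) (Module.finBasis ℝ EZ k)) := fun k =>
    hD.exists_ext (CovNear.apply contMDiff_ptZ.continuous ha
      (VecNear.const contMDiff_ptZ.continuous _ x₀))
  choose c hc using hc
  refine ⟨c, ?_⟩
  filter_upwards [h, eventually_all.2 hc] with x h1 h2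
  rw [h1, diff_sum]
  refine Finset.sum_congr rfl fun k _ => ?_
  rw [diff_mul, hn, zero_smul, add_zero, h2]

/-- Sections of `E_X` are locally differentials of functions that vanish on `X`. -/
theorem IsConstraint.exists_fn_cov {x₀ : X} {a : ∀ x, Cot EZ (D.ptZ x)}
    (ha : CovNear (EX := EX) D.ptZ a x₀) (h : ∀ᶠ x in 𝓝 x₀, ∀ w, a x (D.tXZ x w) = 0) :
    ∃ g : Fn EZ Z, (∀ x, g (D.ptZ x) = 0) ∧ ∀ᶠ x in 𝓝 x₀, diff EZ g (D.ptZ x) = a x := by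
  obtain ⟨n, hn, hs⟩ := hD.extendsZ.exists_conormal x₀
  obtain ⟨c, hc⟩ := exists_conormal_aux hD ha hn (by
    filter_upwards [hs, h] with x h1 h2
    exact h1 (a x) fun w => by
      have := h2 w
      rw [tXZ_eq] at this
      exact this)
  refine ⟨_, fun x => ?_, hc⟩
  rw [fn_sum_apply]
  exact Finset.sum_eq_zero fun k _ => mul_eq_zero_of_right _ (hn k x)

/-- Sections of `(TQ)⁰|_X` are locally differentials of functions that vanish on `Q`. -/
theorem IsConstraint.exists_fn_cov_van {x₀ : X} {a : ∀ x, Cot EZ (D.ptZ x)}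
    (ha : CovNear (EX := EX) D.ptZ a x₀) (h : ∀ᶠ x in 𝓝 x₀, ∀ u, a x (D.tQ (D.ptQ x) u) = 0) :
    ∃ g : Fn EZ Z, (∀ q, g (D.iQ q) = 0) ∧ ∀ᶠ x in 𝓝 x₀, diff EZ g (D.ptZ x) = a x := by
  obtain ⟨n, hn, hs⟩ := hD.extendsQ.exists_conormal (D.ptQ x₀)
  obtain ⟨c, hc⟩ := exists_conormal_aux hD ha (fun k x => hn k (D.ptQ x)) (by
    filter_upwards [contMDiff_ptQ.continuous.continuousAt.eventually hs, h] with x h1 h2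
    exact h1 (a x) h2)
  refine ⟨_, fun x => ?_, hc⟩
  rw [fn_sum_apply]
  exact Finset.sum_eq_zero fun k _ => mul_eq_zero_of_right _ (hn k x)

end ConstraintData

end

/-! ### Smooth linear systems, the duality of `Ẽ` and `Ẽ*`, and the diagram in terms of the metric.
-/

noncomputable section

section Systems

instance {E M : Type*} [NormedAddCommGroup E] [NormedSpace ℝ E] [FiniteDimensional ℝ E]
    [TopologicalSpace M] [ChartedSpace E M] (p : M) : FiniteDimensional ℝ (Cot E p) :=
  inferInstanceAs (FiniteDimensional ℝ (E →L[ℝ] ℝ))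

variable {EX X E M G : Type*} [NormedAddCommGroup EX] [NormedSpace ℝ EX] [TopologicalSpace X]
  [ChartedSpace EX X]
  [NormedAddCommGroup E] [NormedSpace ℝ E] [FiniteDimensional ℝ E] [TopologicalSpace M]
  [ChartedSpace E M] [IsManifold 𝓘(ℝ, E) ∞ M]
  [NormedAddCommGroup G] [NormedSpace ℝ G] [FiniteDimensional ℝ G]

/-- Solutions of smooth injective linear systems for vectors are smooth. -/
theorem VecNear.of_system {j : X → M} (hj : Continuous j) {x₀ : X} (Λ : ∀ x, Tan E (j x) →ₗ[ℝ] G)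
    (hi : Function.Injective (Λ x₀))
    (hs : ∀ e : E, SmoothNear (E := EX) (F := G) (fun x => Λ x (Ti (j x₀) (j x) e)) x₀)
    {V : ∀ x, Tan E (j x)} (hV : SmoothNear (E := EX) (F := G) (fun x => Λ x (V x)) x₀) :
    VecNear (EX := EX) j V x₀ := by
  set L : X → E →L[ℝ] G := fun x =>
    LinearMap.toContinuousLinearMap ((Λ x) ∘ₗ (Ti (j x₀) (j x)).toLinearMap)
  have hL : SmoothNear (E := EX) L x₀ := SmoothNear.of_apply hs
  have hinj : Function.Injective (L x₀) := by
    refine hi.comp (Function.LeftInverse.injective (g := Tc (j x₀) (j x₀)) fun e => ?_)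
    exact Tc_Ti (mem_chart_source E (j x₀)) e
  refine SmoothNear.of_injective hL hinj (hV.congr ?_)
  filter_upwards [hj.continuousAt.eventually (chart_near (E := E) (j x₀))] with x hx
  change Λ x (Ti _ _ (Tc _ _ (V x))) = _
  rw [Ti_Tc hx]

/-- Solutions of smooth injective linear systems for covectors are smooth. -/
theorem CovNear.of_system {j : X → M} (hj : Continuous j) {x₀ : X} (Λ : ∀ x, Cot E (j x) →ₗ[ℝ] G)
    (hi : Function.Injective (Λ x₀))
    (hs : ∀ e : E →L[ℝ] ℝ, SmoothNear (E := EX) (F := G)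
      (fun x => Λ x (e.comp (Tc (j x₀) (j x)))) x₀)
    {a : ∀ x, Cot E (j x)} (ha : SmoothNear (E := EX) (F := G) (fun x => Λ x (a x)) x₀) :
    CovNear (EX := EX) j a x₀ := by
  set L : X → (E →L[ℝ] ℝ) →L[ℝ] G := fun x =>
    LinearMap.toContinuousLinearMap
      { toFun := fun e => Λ x (e.comp (Tc (j x₀) (j x)))
        map_add' := fun e e' => (Λ x).map_add (e.comp (Tc (j x₀) (j x))) (e'.comp _)
        map_smul' := fun r e => (Λ x).map_smul r (e.comp (Tc (j x₀) (j x))) }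
  have hL : SmoothNear (E := EX) L x₀ := SmoothNear.of_apply hs
  have hinj : Function.Injective (L x₀) := by
    intro e e' h
    have h1 : e.comp (Tc (j x₀) (j x₀)) = e'.comp (Tc (j x₀) (j x₀)) := hi h
    ext v
    have h2 := DFunLike.congr_fun h1 (Ti (j x₀) (j x₀) v)
    rw [ContinuousLinearMap.comp_apply, ContinuousLinearMap.comp_apply,
      Tc_Ti (mem_chart_source E (j x₀))] at h2
    exact h2
  refine SmoothNear.of_injective hL hinj (ha.congr ?_)
  filter_upwards [hj.continuousAt.eventually (chart_near (E := E) (j x₀))] with x hx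
  change Λ x (((a x).comp (Ti _ _)).comp (Tc _ _)) = _
  congr 1
  ext v
  exact congrArg (a x) (Ti_Tc hx v)

theorem CovNear.constCoord {j : X → M} (hj : Continuous j) (e : E →L[ℝ] ℝ) (x₀ : X) :
    CovNear (EX := EX) j (fun x => e.comp (Tc (j x₀) (j x))) x₀ := by
  refine (SmoothNear.const e).congr ?_
  filter_upwards [hj.continuousAt.eventually (chart_near (E := E) (j x₀))] with x hx
  ext v
  exact congrArg e (Tc_Ti hx v)

/-- Smooth left inverses of injective tangent maps. -/
theorem exists_leftInv {EN N : Type*} [NormedAddCommGroup EN] [NormedSpace ℝ EN]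
    [FiniteDimensional ℝ EN] [TopologicalSpace N] [ChartedSpace EN N] [IsManifold 𝓘(ℝ, EN) ∞ N]
    [T2Space N] (i : C^∞⟮𝓘(ℝ, E), M; 𝓘(ℝ, EN), N⟯) {j : X → M}
    (hj : ContMDiff 𝓘(ℝ, EX) 𝓘(ℝ, E) ∞ j)
    (hi : ∀ m, Function.Injective (mfderiv 𝓘(ℝ, E) 𝓘(ℝ, EN) i m)) (x₀ : X) :
    ∃ ρ : ∀ x, Tan EN (i (j x)) →L[ℝ] Tan E (j x),
      (∀ x v, ρ x (mfderiv 𝓘(ℝ, E) 𝓘(ℝ, EN) i (j x) v) = v) ∧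
      (∀ V : ∀ x, Tan EN (i (j x)), VecNear (EX := EX) (fun x => i (j x)) V x₀ →
        VecNear (EX := EX) j (fun x => ρ x (V x)) x₀) ∧
      ∀ a : ∀ x, Cot E (j x), CovNear (EX := EX) j a x₀ →
        CovNear (EX := EX) (fun x => i (j x)) (fun x => (a x).comp (ρ x)) x₀ := by
  have hij := i.contMDiff.continuous.comp hj.continuous
  set B : X → E →L[ℝ] EN := fun x => (Tc (i (j x₀)) (i (j x))).comp
    ((mfderiv 𝓘(ℝ, E) 𝓘(ℝ, EN) i (j x)).comp (Ti (j x₀) (j x)))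
  have hB : SmoothNear (E := EX) B x₀ := SmoothNear.of_apply fun e =>
    VecNear.push i hj (VecNear.const hj.continuous e x₀)
  have ns := hj.continuous.continuousAt.eventually (chart_near (E := E) (j x₀))
  have nt := hij.continuousAt.eventually (chart_near (E := EN) (i (j x₀)))
  have hBi : Function.Injective (B x₀) := by
    refine (Function.LeftInverse.injective (f := Tc (i (j x₀)) (i (j x₀)))
      (g := Ti (i (j x₀)) (i (j x₀))) fun e => ?_).comp ((hi _).comp
      (Function.LeftInverse.injective (g := Tc (j x₀) (j x₀)) fun e => ?_))
    · exact Ti_Tc (mem_chart_source _ _) e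
    · exact Tc_Ti (mem_chart_source _ _) e
  obtain ⟨R, hR, hRB⟩ := exists_smooth_leftInverse hB hBi
  have hex : ∀ x, ∃ ρ : Tan EN (i (j x)) →L[ℝ] Tan E (j x),
      ∀ v, ρ (mfderiv 𝓘(ℝ, E) 𝓘(ℝ, EN) i (j x) v) = v := by
    intro x
    obtain ⟨r, hr⟩ := (mfderiv 𝓘(ℝ, E) 𝓘(ℝ, EN) i (j x)).toLinearMap.exists_leftInverse_of_injective
      (LinearMap.ker_eq_bot.2 (hi _))
    exact ⟨(LinearMap.toContinuousLinearMap (show EN →ₗ[ℝ] E from r) : EN →L[ℝ] E),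
      fun v => LinearMap.congr_fun hr v⟩
  choose ρ' hρ' using hex
  set ρ₀ : ∀ x, Tan EN (i (j x)) →L[ℝ] Tan E (j x) := fun x =>
    (Ti (j x₀) (j x)).comp ((R x).comp (Tc (i (j x₀)) (i (j x))))
  have hρ₀ : ∀ᶠ x in 𝓝 x₀, ∀ v, ρ₀ x (mfderiv 𝓘(ℝ, E) 𝓘(ℝ, EN) i (j x) v) = v := by
    filter_upwards [hRB, ns] with x h1 h2 v
    have := h1 (Tc (j x₀) (j x) v)
    simp only [B, ContinuousLinearMap.comp_apply] at this
    rw [Ti_Tc h2] at this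
    simp only [ρ₀, ContinuousLinearMap.comp_apply]
    rw [this, Ti_Tc h2]
  -- The smooth left inverse `ρ₀` is one only near `x₀`. Elsewhere an arbitrary left inverse `ρ'`
  -- takes its place, so that the algebraic identity holds at every point and smoothness near `x₀`
  -- is kept.
  classical
  have heq : ∀ᶠ x in 𝓝 x₀, (if ∀ v, ρ₀ x (mfderiv 𝓘(ℝ, E) 𝓘(ℝ, EN) i (j x) v) = v then ρ₀ x
      else ρ' x) = ρ₀ x := by
    filter_upwards [hρ₀] with x hx
    rw [if_pos hx]
  refine ⟨fun x => if ∀ v, ρ₀ x (mfderiv 𝓘(ℝ, E) 𝓘(ℝ, EN) i (j x) v) = v then ρ₀ x else ρ' x,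
    fun x v => ?_, fun V hV => ?_, fun a ha => ?_⟩
  · dsimp only
    split_ifs with h
    · exact h v
    · exact hρ' x v
  · refine VecNear.congr (V := fun x => ρ₀ x (V x)) ?_ (by filter_upwards [heq] with x hx; rw [hx])
    refine (SmoothNear.clm_apply hR hV).congr ?_
    filter_upwards [ns] with x h2
    exact Tc_Ti h2 _
  · refine CovNear.congr (a := fun x => (a x).comp (ρ₀ x)) ?_
      (by filter_upwards [heq] with x hx; rw [hx])
    refine (SmoothNear.clm_comp ha hR).congr ?_
    filter_upwards [nt] with x h2
    ext e
    exact congrArg (fun e => a x (Ti (j x₀) (j x) (R x e))) (Tc_Ti h2 e)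

end Systems

section Pairing

variable {V W : Type*} [AddCommGroup V] [Module ℝ V] [FiniteDimensional ℝ V] [AddCommGroup W]
  [Module ℝ W] [FiniteDimensional ℝ W]

theorem finrank_eq_of_pairing (B : V →ₗ[ℝ] W →ₗ[ℝ] ℝ) (h : ∀ v, (∀ w, B v w = 0) → v = 0)
    (h' : ∀ w, (∀ v, B v w = 0) → w = 0) : Module.finrank ℝ V = Module.finrank ℝ W := by
  apply le_antisymm
  · have : Function.Injective (show V →ₗ[ℝ] Module.Dual ℝ W from B) :=
      (injective_iff_map_eq_zero _).2 fun v hv => h v fun w => LinearMap.congr_fun hv w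
    have := LinearMap.finrank_le_finrank_of_injective this
    rwa [Subspace.dual_finrank_eq] at this
  · have : Function.Injective (show W →ₗ[ℝ] Module.Dual ℝ V from B.flip) :=
      (injective_iff_map_eq_zero _).2 fun v hv => h' v fun w => LinearMap.congr_fun hv w
    have := LinearMap.finrank_le_finrank_of_injective this
    rwa [Subspace.dual_finrank_eq] at this

theorem bijective_of_pairing (B : V →ₗ[ℝ] W →ₗ[ℝ] ℝ) (h : ∀ v, (∀ w, B v w = 0) → v = 0)
    (h' : ∀ w, (∀ v, B v w = 0) → w = 0) :
    Function.Bijective (show V →ₗ[ℝ] Module.Dual ℝ W from B) := by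
  have hi : Function.Injective (show V →ₗ[ℝ] Module.Dual ℝ W from B) :=
      (injective_iff_map_eq_zero _).2 fun v hv => h v fun w => LinearMap.congr_fun hv w
  refine ⟨hi, (LinearMap.injective_iff_surjective_of_finrank_eq_finrank ?_).1 hi⟩
  rw [Subspace.dual_finrank_eq, finrank_eq_of_pairing B h h']

end Pairing

namespace ConstraintData

variable {EX X ES S EQ Q EZ Z : Type*}
    [NormedAddCommGroup EX] [NormedSpace ℝ EX] [FiniteDimensional ℝ EX]
    [TopologicalSpace X] [ChartedSpace EX X] [IsManifold 𝓘(ℝ, EX) ∞ X]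
    [T2Space X] [SecondCountableTopology X]
    [NormedAddCommGroup ES] [NormedSpace ℝ ES] [FiniteDimensional ℝ ES]
    [TopologicalSpace S] [ChartedSpace ES S] [IsManifold 𝓘(ℝ, ES) ∞ S]
    [T2Space S] [SecondCountableTopology S]
    [NormedAddCommGroup EQ] [NormedSpace ℝ EQ] [FiniteDimensional ℝ EQ]
    [TopologicalSpace Q] [ChartedSpace EQ Q] [IsManifold 𝓘(ℝ, EQ) ∞ Q]
    [T2Space Q] [SecondCountableTopology Q]
    [NormedAddCommGroup EZ] [NormedSpace ℝ EZ] [FiniteDimensional ℝ EZ]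
    [TopologicalSpace Z] [ChartedSpace EZ Z] [IsManifold 𝓘(ℝ, EZ) ∞ Z]
    [T2Space Z] [SecondCountableTopology Z]
    {D : ConstraintData EX X ES S EQ Q EZ Z}

section Linear

theorem pair_nsIncl (x : X) (a : D.Etil x) (u : Tan ES (D.ptS x)) :
    D.pair x a (D.nsIncl x (Submodule.Quotient.mk u)) =
      (a : Cot EQ (D.ptQ x)) (D.tS (D.ptS x) u) := rfl

/-- The duality pairing as a bilinear map. -/
def pairing (x : X) : D.EtilDual x →ₗ[ℝ] Module.Dual ℝ (D.Etil x) :=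
  LinearMap.mk₂ ℝ (fun m a => D.pair x a m) (fun m m' a => map_add _ m m')
    (fun r m a => map_smul _ r m)
    (fun m a a' => by
      induction m using Submodule.Quotient.induction_on with | H u => rfl)
    (fun r m a => by
      induction m using Submodule.Quotient.induction_on with | H u => rfl)

theorem pair_separates (x : X) {m : D.EtilDual x} (h : ∀ a, D.pair x a m = 0) : m = 0 := by
  induction m using Submodule.Quotient.induction_on with
  | H u =>
    rw [Submodule.Quotient.mk_eq_zero]
    refine mem_of_annihilator fun a ha => ?_
    exact h ⟨a, fun w => ha _ ⟨w, rfl⟩⟩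

theorem pairing_zero_right (x : X) {a : D.Etil x} (h : ∀ m, D.pairing x m a = 0) : a = 0 := by
  ext u
  exact h (Submodule.Quotient.mk u)

theorem finrank_Etil (x : X) :
    Module.finrank ℝ (D.EtilDual x) = Module.finrank ℝ (D.Etil x) :=
  finrank_eq_of_pairing (V := D.EtilDual x) (W := D.Etil x) (D.pairing x) (fun _ h => pair_separates x h)
    fun _ h => pairing_zero_right (D := D) x h

theorem pairing_bijective (x : X) : Function.Bijective (D.pairing x) :=
  bijective_of_pairing (V := D.EtilDual x) (W := D.Etil x) (D.pairing x) (fun _ h => pair_separates x h)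
    fun _ h => pairing_zero_right (D := D) x h

/-- A class annihilated by `L̃` comes from `TS`. -/
theorem exists_nsIncl (x : X) {m : D.EtilDual x} (h : ∀ b, D.pair x (D.incl x b) m = 0) :
    ∃ u, m = D.nsIncl x (Submodule.Quotient.mk u) := by
  induction m using Submodule.Quotient.induction_on with
  | H v =>
    have : v ∈ LinearMap.range (D.tS (D.ptS x)).toLinearMap := by
      refine mem_of_annihilator fun a ha => ?_
      exact h ⟨a, fun u => ha _ ⟨u, rfl⟩⟩
    obtain ⟨u, rfl⟩ := this
    exact ⟨u, rfl⟩

theorem mem_Ltil_of_nsRes (x : X) {a : D.Etil x} (h : D.nsRes x a = 0) :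
    ∃ b, D.incl x b = a :=
  ⟨⟨a, fun u => DFunLike.congr_fun (congrArg Subtype.val h) u⟩, rfl⟩

theorem nsRes_incl (x : X) (b : D.Ltil x) : D.nsRes x (D.incl x b) = 0 := by
  ext u
  exact b.2 u

theorem incl_injective (x : X) : Function.Injective (D.incl x) :=
  Submodule.inclusion_injective _

/-- `annS` is the dual of `TS/TX`. The equality of dimensions lets injectivity of `J₀` stand for
bijectivity. -/
theorem finrank_NS (x : X) : Module.finrank ℝ (D.NS x) = Module.finrank ℝ (D.annS x) := by
  set P : D.annS x →ₗ[ℝ] Module.Dual ℝ (D.NS x) :=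
    { toFun := fun a => Submodule.liftQ _ (a : Cot ES (D.ptS x)).toLinearMap (by
        rintro _ ⟨w, rfl⟩
        exact a.2 w)
      map_add' := fun a b => by
        refine Submodule.linearMap_qext _ ?_
        rfl
      map_smul' := fun r a => by
        refine Submodule.linearMap_qext _ ?_
        rfl } with hP
  refine (finrank_eq_of_pairing (V := D.annS x) (W := D.NS x) P ?_ ?_).symm
  · intro a ha
    ext u
    exact ha (Submodule.Quotient.mk u)
  · intro m hm
    induction m using Submodule.Quotient.induction_on with
    | H u =>
      rw [Submodule.Quotient.mk_eq_zero]
      refine mem_of_annihilator fun a ha => ?_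
      exact hm ⟨a, fun w => ha _ ⟨w, rfl⟩⟩

/-- Nondegenerate forms on `Ẽ` are inverse to isomorphisms `Ẽ^* → Ẽ`. -/
theorem exists_isInverse (x : X) (η : LinearMap.BilinForm ℝ (D.Etil x))
    (hη : ∀ a, (∀ b, η a b = 0) → a = 0) : ∃ J, D.IsInverse x J η := by
  set e := LinearEquiv.ofBijective (D.pairing x) (pairing_bijective x)
  set K : D.Etil x →ₗ[ℝ] D.EtilDual x := e.symm.toLinearMap ∘ₗ η
  have hK : Function.Injective K := by
    rw [injective_iff_map_eq_zero]
    intro a ha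
    refine hη a fun b => ?_
    have : e.symm (η a) = 0 := ha
    rw [LinearEquiv.map_eq_zero_iff] at this
    rw [this]; rfl
  have hK' := (LinearMap.injective_iff_surjective_of_finrank_eq_finrank
    (V := D.Etil x) (V₂ := D.EtilDual x) (finrank_Etil (D := D) x).symm).1 hK
  set k := LinearEquiv.ofBijective K ⟨hK, hK'⟩
  refine ⟨k.symm.toLinearMap, k.symm.bijective, fun m b => ?_⟩
  have h1 : e.symm (η (k.symm m)) = m := k.apply_symm_apply m
  have h2 : η (k.symm m) = e m := by rw [← h1, LinearEquiv.apply_symm_apply, h1]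
  exact LinearMap.congr_fun h2 b

/-- The conditions on a triple expressed through the metric on `Ẽ`. -/
def MetricTriple (x : X) (η : LinearMap.BilinForm ℝ (D.Etil x)) (τ : D.Fields) : Prop :=
  (∀ V u, (τ.α x V : Cot EQ (D.ptQ x)) (D.tS (D.ptS x) u) = - D.omegaFlat _ (D.tX x V) u) ∧
  (∀ V b, η (τ.α x V) (D.incl x b) = 0) ∧
  (∀ V W, τ.γ x V W = η (τ.α x V) (τ.α x W)) ∧
  ∀ a b, τ.χ x a b = η (D.incl x a) (D.incl x b)

/-- Because `η (J m) b = ⟨b, m⟩`, a covector `J m` is orthogonal to `L̃` exactly when `m`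
annihilates `L̃`, that is, when `m` comes from `TS`. So the vector `u` in the diagram exists if and
only if `α V` is orthogonal to `L̃`. The other entries then translate directly. -/
theorem diagram_iff {x : X} {J : D.EtilDual x →ₗ[ℝ] D.Etil x}
    {η : LinearMap.BilinForm ℝ (D.Etil x)} (hJ : D.IsInverse x J η) (τ : D.Fields) :
    D.Diagram x J τ ↔ D.MetricTriple x η τ := by
  constructor
  · rintro ⟨h1, h2⟩
    choose u hu hα hγ using h1
    have h3 : ∀ V v, (τ.α x V : Cot EQ (D.ptQ x)) (D.tS (D.ptS x) v) =
        - D.omegaFlat _ (D.tX x V) v := fun V v => by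
      rw [hα]
      exact DFunLike.congr_fun (hu V) v
    refine ⟨h3, fun V b => ?_, fun V W => ?_, fun a b => ?_⟩
    · rw [hα, hJ.2, pair_nsIncl]
      exact b.2 (u V)
    · rw [hγ, hα V, hJ.2, pair_nsIncl, h3 W]
      rfl
    · obtain ⟨m, hm⟩ := hJ.1.2 (D.incl x a)
      rw [h2 a b m hm, ← hm, hJ.2]
  · rintro ⟨h1, h2, h3, h4⟩
    refine ⟨fun V => ?_, fun a b m hm => ?_⟩
    · obtain ⟨m, hm⟩ := hJ.1.2 (τ.α x V)
      obtain ⟨u, rfl⟩ := exists_nsIncl x (m := m) fun b => by rw [← hJ.2, hm, h2]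
      refine ⟨u, ?_, hm.symm, fun W => ?_⟩
      · ext v
        change (J (D.nsIncl x (Submodule.Quotient.mk u)) : Cot EQ (D.ptQ x)) _ = _
        exact (congrArg (fun a : D.Etil x => (a : Cot EQ (D.ptQ x)) (D.tS (D.ptS x) v)) hm).trans
          (h1 V v)
      · rw [h3, ← hm, hJ.2, pair_nsIncl, h1]
        rfl
    · rw [h4, ← hm, hJ.2]

theorem corresponds_iff {η : ∀ x, LinearMap.BilinForm ℝ (D.Etil x)}
    (hη : ∀ x a, (∀ b, η x a b = 0) → a = 0) (τ : D.Fields) :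
    D.Corresponds η τ ↔ ∀ x, D.MetricTriple x (η x) τ := by
  constructor
  · intro h x
    obtain ⟨J, h1, h2⟩ := h x
    exact (diagram_iff h1 τ).1 h2
  · intro h x
    obtain ⟨J, hJ⟩ := exists_isInverse x (η x) (hη x)
    exact ⟨J, hJ, (diagram_iff hJ τ).2 (h x)⟩

variable (hD : D.IsConstraint)
include hD

theorem IsConstraint.nsIncl_injective (x : X) : Function.Injective (D.nsIncl x) := by
  rw [injective_iff_map_eq_zero]
  intro m hm
  induction m using Submodule.Quotient.induction_on with
  | H u =>
    have h : D.tS (D.ptS x) u ∈ LinearMap.range (D.tXQ x).toLinearMap :=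
      (Submodule.Quotient.mk_eq_zero _).1 hm
    rw [Submodule.Quotient.mk_eq_zero]
    obtain ⟨w, hw⟩ := h
    exact ⟨w, hD.tS_injective _ hw⟩

/-- `J` carries `TS/TX` onto the orthogonal complement of `L̃`, and restriction of covectors to `TS`
has kernel `L̃`. So the kernel of `J₀` is the radical `L̃ ∩ L̃^⊥` of the restricted form. -/
theorem IsConstraint.nondeg_iff {η : ∀ x, LinearMap.BilinForm ℝ (D.Etil x)} {x : X}
    {J : D.EtilDual x →ₗ[ℝ] D.Etil x} (hJ : D.IsInverse x J (η x)) :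
    D.NondegOnL η x ↔ Function.Bijective (D.zeroPart J) := by
  have hb : Function.Bijective (D.zeroPart J) ↔ Function.Injective (D.zeroPart J) :=
    ⟨fun h => h.1, fun h =>
      ⟨h, (LinearMap.injective_iff_surjective_of_finrank_eq_finrank
        (V := D.NS x) (V₂ := D.annS x) (finrank_NS (D := D) x)).1 h⟩⟩
  rw [hb, injective_iff_map_eq_zero]
  constructor
  · intro h n hn
    induction n using Submodule.Quotient.induction_on with
    | H u =>
      obtain ⟨a, ha⟩ := mem_Ltil_of_nsRes x (a := J (D.nsIncl x (Submodule.Quotient.mk u))) hn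
      have h0 : a = 0 := h a fun b => by
        rw [ha, hJ.2, pair_nsIncl]
        exact b.2 u
      rw [h0, map_zero] at ha
      apply hD.nsIncl_injective x
      apply hJ.1.1
      rw [← ha, map_zero, map_zero]
  · intro h a ha
    obtain ⟨m, hm⟩ := hJ.1.2 (D.incl x a)
    obtain ⟨u, rfl⟩ := exists_nsIncl x (m := m) fun b => by rw [← hJ.2, hm, ha]
    have h0 := h (Submodule.Quotient.mk u) (by
      change D.nsRes x (J _) = 0
      rw [hm, nsRes_incl])
    rw [h0, map_zero, map_zero] at hm
    exact incl_injective x (by rw [← hm, map_zero])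

/-- The anchor `Ẽ_X → TX`. -/
theorem IsConstraint.exists_anchor (x : X) : ∃ r : D.Etil x →ₗ[ℝ] Tan EX x,
    ∀ (a : D.Etil x) u, (a : Cot EQ (D.ptQ x)) (D.tS (D.ptS x) u) =
      - D.omegaFlat _ (D.tX x (r a)) u := by
  have h : ∀ a : D.Etil x, ∃ V, ∀ u, (a : Cot EQ (D.ptQ x)) (D.tS (D.ptS x) u) =
      - D.omegaFlat _ (D.tX x V) u := fun a => by
    obtain ⟨V, hV⟩ := hD.exists_omegaFlat_tX (x := x)
      (b := (a : Cot EQ (D.ptQ x)).comp (D.tS (D.ptS x))) a.2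
    exact ⟨V, fun u => DFunLike.congr_fun hV u⟩
  choose r hr using h
  have uniq : ∀ V W, (∀ u, D.omegaFlat _ (D.tX x V) u = D.omegaFlat _ (D.tX x W) u) → V = W := by
    intro V W h
    apply hD.tX_injective
    rw [← sub_eq_zero]
    apply hD.omegaFlat_injective
    rw [sub_eq_add_neg, hD.omegaFlat_add, hD.omegaFlat_neg]
    ext u
    exact (sub_eq_add_neg _ _).symm.trans (sub_eq_zero.2 (h u))
  refine ⟨{ toFun := r, map_add' := fun a b => uniq _ _ fun u => ?_,
            map_smul' := fun c a => uniq _ _ fun u => ?_ }, hr⟩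
  · rw [map_add, hD.omegaFlat_add]
    have h1 := hr (a + b) u
    have h2 := hr a u
    have h3 := hr b u
    have h4 : ((a + b : D.Etil x) : Cot EQ (D.ptQ x)) (D.tS (D.ptS x) u) =
      (a : Cot EQ (D.ptQ x)) (D.tS (D.ptS x) u) + (b : Cot EQ (D.ptQ x)) (D.tS (D.ptS x) u) := rfl
    rw [h1, h2, h3] at h4
    change _ = D.omegaFlat _ (D.tX x (r a)) u + D.omegaFlat _ (D.tX x (r b)) u
    linarith
  · rw [RingHom.id_apply, map_smul, hD.omegaFlat_smul]
    have h1 := hr (c • a) u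
    have h2 := hr a u
    have h4 : ((c • a : D.Etil x) : Cot EQ (D.ptQ x)) (D.tS (D.ptS x) u) =
      c * (a : Cot EQ (D.ptQ x)) (D.tS (D.ptS x) u) := rfl
    rw [h1, h2] at h4
    change _ = c * D.omegaFlat _ (D.tX x (r a)) u
    linarith

theorem IsConstraint.omegaFlat_tX_injective (x : X) {V W : Tan EX x}
    (h : ∀ u, D.omegaFlat _ (D.tX x V) u = D.omegaFlat _ (D.tX x W) u) : V = W := by
  apply hD.tX_injective
  rw [← sub_eq_zero]
  apply hD.omegaFlat_injective
  rw [sub_eq_add_neg, hD.omegaFlat_add, hD.omegaFlat_neg]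
  ext u
  exact (sub_eq_add_neg _ _).symm.trans (sub_eq_zero.2 (h u))

end Linear

end ConstraintData

end

/-! ### Cut-offs of sections; smoothness of the symplectic form, of the anchor and of the metric of
`H̃`. -/

noncomputable section

section Cutoff

variable {EX X E M : Type*} [NormedAddCommGroup EX] [NormedSpace ℝ EX] [TopologicalSpace X]
  [ChartedSpace EX X]
  [NormedAddCommGroup E] [NormedSpace ℝ E] [FiniteDimensional ℝ E] [TopologicalSpace M]
  [ChartedSpace E M] [IsManifold 𝓘(ℝ, E) ∞ M]

theorem CovNear.near {j : X → M} (hj : ContMDiff 𝓘(ℝ, EX) 𝓘(ℝ, E) ∞ j) {a : ∀ x, Cot E (j x)}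
    {x₀ : X} (ha : CovNear (EX := EX) j a x₀) : ∀ᶠ x in 𝓝 x₀, CovNear (EX := EX) j a x := by
  have h : ∀ᶠ x in 𝓝 x₀, ContMDiffAt 𝓘(ℝ, EX) (𝓘(ℝ, E).prod 𝓘(ℝ, E →L[ℝ] ℝ)) ∞
      (fun x => TotalSpace.mk' (E →L[ℝ] ℝ) (E := fun p : M => Cot E p) (j x) (a x)) x := by
    filter_upwards [ha, hj.continuous.continuousAt.eventually (chart_near (E := E) (j x₀))]
      with x h1 h2 using (contMDiffAt_cov_iff hj a h2).2 h1
  filter_upwards [h.eventually_nhds] with x hx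
  change ∀ᶠ y in 𝓝 x, _
  filter_upwards [hx, hj.continuous.continuousAt.eventually (chart_near (E := E) (j x))]
    with y h1 h2 using (contMDiffAt_cov_iff hj a h2).1 h1

theorem VecNear.near {V : ∀ z : M, Tan E z} {z₀ : M}
    (hV : VecNear (EX := E) (fun z : M => z) V z₀) :
    ∀ᶠ z in 𝓝 z₀, VecNear (EX := E) (fun z : M => z) V z := by
  have h : ∀ᶠ z in 𝓝 z₀, ContMDiffAt 𝓘(ℝ, E) 𝓘(ℝ, E).tangent ∞
      (fun p => (⟨p, V p⟩ : TangentBundle 𝓘(ℝ, E) M)) z := by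
    filter_upwards [hV, chart_near (E := E) z₀] with z h1 h2 using (contMDiffAt_field_iff h2).2 h1
  filter_upwards [h.eventually_nhds] with z hz
  change ∀ᶠ y in 𝓝 z, _
  filter_upwards [hz, chart_near (E := E) z] with y h1 h2 using (contMDiffAt_field_iff h2).1 h1

/-- `IsMetric`, `IsBundleMetric` and `IsConnForm` express smoothness through global sections.
Cut-offs turn local sections into global ones without changing the germ. -/
theorem VecNear.cutoff [T2Space M] {V : ∀ z : M, Tan E z} {z₀ : M}
    (hV : VecNear (EX := E) (fun z : M => z) V z₀) :
    ∃ χ : Fn E M, (∀ᶠ z in 𝓝 z₀, χ z = 1) ∧ SmoothField E (fun z => χ z • V z) := by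
  obtain ⟨χ, h1, h2⟩ := exists_bump (E := E) z₀ hV.near
  refine ⟨χ, h1, VecNear.smoothField fun z => ?_⟩
  by_cases hz : z ∈ tsupport χ
  · exact VecNear.smul (fn_smoothNear χ z) (h2 hz)
  · refine VecNear.congr (V := fun z => (0 : ℝ) • Ti z z (0 : E))
      ((SmoothNear.const (0 : E)).congr (Eventually.of_forall fun y => ?_)) ?_
    · dsimp only
      rw [zero_smul, map_zero]
    · filter_upwards [(isClosed_tsupport χ).isOpen_compl.mem_nhds hz] with y hy
      rw [image_eq_zero_of_notMem_tsupport hy, zero_smul, zero_smul]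

theorem CovNear.cutoff [FiniteDimensional ℝ EX] [IsManifold 𝓘(ℝ, EX) ∞ X] [T2Space X] {j : X → M}
    (hj : ContMDiff 𝓘(ℝ, EX) 𝓘(ℝ, E) ∞ j) {a : ∀ x, Cot E (j x)}
    {x₀ : X} (ha : CovNear (EX := EX) j a x₀) {O : Set X} (hO : O ∈ 𝓝 x₀) :
    ∃ χ : Fn EX X, (∀ᶠ z in 𝓝 x₀, χ z = 1) ∧ tsupport χ ⊆ O ∧
      SmoothCovOn (EX := EX) E j (fun x => χ x • a x) Set.univ := by
  obtain ⟨χ, h1, h2⟩ := exists_bump (E := EX) x₀ (inter_mem hO (ha.near hj))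
  refine ⟨χ, h1, h2.trans Set.inter_subset_left, CovNear.smoothCovOn hj fun z _ => ?_⟩
  by_cases hz : z ∈ tsupport χ
  · exact CovNear.smul (fn_smoothNear χ z) (h2 hz).2
  · refine CovNear.congr (a := fun z => (0 : Cot E (j z)))
      ((SmoothNear.const (0 : E →L[ℝ] ℝ)).congr (Eventually.of_forall fun y => ?_)) ?_
    · exact ContinuousLinearMap.zero_comp _
    · filter_upwards [(isClosed_tsupport χ).isOpen_compl.mem_nhds hz] with y hy
      rw [image_eq_zero_of_notMem_tsupport hy, zero_smul]

end Cutoff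

namespace ConstraintData

variable {EX X ES S EQ Q EZ Z : Type*}
    [NormedAddCommGroup EX] [NormedSpace ℝ EX] [FiniteDimensional ℝ EX]
    [TopologicalSpace X] [ChartedSpace EX X] [IsManifold 𝓘(ℝ, EX) ∞ X]
    [T2Space X] [SecondCountableTopology X]
    [NormedAddCommGroup ES] [NormedSpace ℝ ES] [FiniteDimensional ℝ ES]
    [TopologicalSpace S] [ChartedSpace ES S] [IsManifold 𝓘(ℝ, ES) ∞ S]
    [T2Space S] [SecondCountableTopology S]
    [NormedAddCommGroup EQ] [NormedSpace ℝ EQ] [FiniteDimensional ℝ EQ]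
    [TopologicalSpace Q] [ChartedSpace EQ Q] [IsManifold 𝓘(ℝ, EQ) ∞ Q]
    [T2Space Q] [SecondCountableTopology Q]
    [NormedAddCommGroup EZ] [NormedSpace ℝ EZ] [FiniteDimensional ℝ EZ]
    [TopologicalSpace Z] [ChartedSpace EZ Z] [IsManifold 𝓘(ℝ, EZ) ∞ Z]
    [T2Space Z] [SecondCountableTopology Z]
    {D : ConstraintData EX X ES S EQ Q EZ Z}

theorem SmoothSec.covNear {a : ∀ x, Cot EQ (D.ptQ x)} (ha : D.SmoothSec a) (x₀ : X) :
    CovNear (EX := EX) D.ptQ a x₀ := SmoothCovOn.covNear contMDiff_ptQ ha univ_mem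

theorem smoothSec_of_covNear {a : ∀ x, Cot EQ (D.ptQ x)}
    (ha : ∀ x, CovNear (EX := EX) D.ptQ a x) : D.SmoothSec a :=
  CovNear.smoothCovOn contMDiff_ptQ fun x _ => ha x

theorem IsBundleMetric.near {W : ∀ x, Submodule ℝ (Cot EQ (D.ptQ x))}
    {h : ∀ x, LinearMap.BilinForm ℝ (W x)} (hh : D.IsBundleMetric W h) {a b : ∀ x, W x} {x₀ : X}
    (ha : CovNear (EX := EX) D.ptQ (fun x => (a x : Cot EQ (D.ptQ x))) x₀)
    (hb : CovNear (EX := EX) D.ptQ (fun x => (b x : Cot EQ (D.ptQ x))) x₀) :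
    SmoothNear (E := EX) (F := ℝ) (fun x => h x (a x) (b x)) x₀ := by
  obtain ⟨χ, h1, -, h2⟩ := ha.cutoff contMDiff_ptQ univ_mem
  obtain ⟨χ', h1', -, h2'⟩ := hb.cutoff contMDiff_ptQ univ_mem
  have := (hh.2.2 (fun x => χ x • a x) (fun x => χ' x • b x) h2 h2').smoothNear (x := x₀)
  refine this.congr ?_
  filter_upwards [h1, h1'] with x e1 e2
  rw [e1, e2, one_smul, one_smul]

theorem IsConnForm.near {α : ∀ x, Tan EX x →ₗ[ℝ] D.Etil x}
    (hα : D.IsConnForm α) {V : ∀ x, Tan EX x} {x₀ : X}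
    (hV : VecNear (EX := EX) (fun x : X => x) V x₀) :
    CovNear (EX := EX) D.ptQ (fun x => (α x (V x) : Cot EQ (D.ptQ x))) x₀ := by
  obtain ⟨χ, h1, h2⟩ := hV.cutoff
  refine CovNear.congr ((hα.1 _ h2).covNear x₀) ?_
  filter_upwards [h1] with x e1
  rw [e1, one_smul]

theorem tSS_eq (s : S) : D.tS s = mfderiv 𝓘(ℝ, ES) 𝓘(ℝ, EQ) D.iS s := rfl

variable (hD : D.IsConstraint)
include hD

theorem IsConstraint.exists_leftInv_tSZ (x₀ : X) :
    ∃ ρ : ∀ x, Tan EZ (D.ptZ x) →L[ℝ] Tan ES (D.ptS x),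
      (∀ x v, ρ x (D.tSZ (D.ptS x) v) = v) ∧
      (∀ V : ∀ x, Tan EZ (D.ptZ x), VecNear (EX := EX) D.ptZ V x₀ →
        VecNear (EX := EX) D.ptS (fun x => ρ x (V x)) x₀) ∧
      ∀ a : ∀ x, Cot ES (D.ptS x), CovNear (EX := EX) D.ptS a x₀ →
        CovNear (EX := EX) D.ptZ (fun x => (a x).comp (ρ x)) x₀ := by
  obtain ⟨ρ, h1, h2, h3⟩ := exists_leftInv (D.iQ.comp D.iS) (j := D.ptS) contMDiff_ptS
    (fun s => by rw [← tSZ_eq]; exact hD.tSZ_injective s) x₀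
  exact ⟨ρ, fun x v => by rw [tSZ_eq]; exact h1 x v, h2, h3⟩

theorem IsConstraint.exists_leftInv_tXQ (x₀ : X) :
    ∃ ρ : ∀ x, Tan EQ (D.ptQ x) →L[ℝ] Tan EX x,
      (∀ x v, ρ x (D.tXQ x v) = v) ∧
      (∀ V : ∀ x, Tan EQ (D.ptQ x), VecNear (EX := EX) D.ptQ V x₀ →
        VecNear (EX := EX) (fun x : X => x) (fun x => ρ x (V x)) x₀) ∧
      ∀ a : ∀ x, Cot EX x, CovNear (EX := EX) (fun x : X => x) a x₀ →
        CovNear (EX := EX) D.ptQ (fun x => (a x).comp (ρ x)) x₀ := by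
  obtain ⟨ρ, h1, h2, h3⟩ := exists_leftInv (D.iS.comp D.iX) (j := (fun x : X => x)) contMDiff_id
    (fun s => by rw [← tXQ_eq]; exact hD.tXQ_injective s) x₀
  exact ⟨ρ, fun x v => by rw [tXQ_eq]; exact h1 x v, h2, h3⟩

theorem IsConstraint.exists_leftInv_tS (x₀ : X) :
    ∃ ρ : ∀ x, Tan EQ (D.ptQ x) →L[ℝ] Tan ES (D.ptS x),
      (∀ x v, ρ x (D.tS (D.ptS x) v) = v) ∧
      (∀ V : ∀ x, Tan EQ (D.ptQ x), VecNear (EX := EX) D.ptQ V x₀ →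
        VecNear (EX := EX) D.ptS (fun x => ρ x (V x)) x₀) ∧
      ∀ a : ∀ x, Cot ES (D.ptS x), CovNear (EX := EX) D.ptS a x₀ →
        CovNear (EX := EX) D.ptQ (fun x => (a x).comp (ρ x)) x₀ := by
  obtain ⟨ρ, h1, h2, h3⟩ := exists_leftInv D.iS (j := D.ptS) contMDiff_ptS
    (fun s => by rw [← tSS_eq]; exact hD.tS_injective s) x₀
  exact ⟨ρ, fun x v => by rw [tSS_eq]; exact h1 x v, h2, h3⟩

theorem IsConstraint.exists_leftInv_tQ (x₀ : X) :
    ∃ ρ : ∀ x, Tan EZ (D.ptZ x) →L[ℝ] Tan EQ (D.ptQ x),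
      (∀ x v, ρ x (D.tQ (D.ptQ x) v) = v) ∧
      (∀ V : ∀ x, Tan EZ (D.ptZ x), VecNear (EX := EX) D.ptZ V x₀ →
        VecNear (EX := EX) D.ptQ (fun x => ρ x (V x)) x₀) ∧
      ∀ a : ∀ x, Cot EQ (D.ptQ x), CovNear (EX := EX) D.ptQ a x₀ →
        CovNear (EX := EX) D.ptZ (fun x => (a x).comp (ρ x)) x₀ := by
  obtain ⟨ρ, h1, h2, h3⟩ := exists_leftInv D.iQ (j := D.ptQ) contMDiff_ptQ
    (fun s => by rw [← tQ_eq]; exact hD.tQ_injective s) x₀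
  exact ⟨ρ, fun x v => by rw [tQ_eq]; exact h1 x v, h2, h3⟩

theorem IsConstraint.sharp_ptZ_eq_zero_iff {x : X} (a : Cot EZ (D.ptZ x)) :
    D.poisson.sharp (D.ptZ x) a = 0 ↔ ∀ u, a (D.tSZ (D.ptS x) u) = 0 :=
  hD.sharp_eq_zero_iff a

theorem IsConstraint.exists_lift_ptZ (x : X) (u : Tan ES (D.ptS x)) :
    ∃ a : Cot EZ (D.ptZ x), D.poisson.sharp (D.ptZ x) a = D.tSZ (D.ptS x) u ∧
      D.omegaFlat (D.ptS x) u = a.comp (D.tSZ (D.ptS x)) := hD.exists_lift _ u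

/-- `omegaFlat` is built from unrelated choices at the points. With a smooth left inverse `ρ` of `TS
→ TZ` it is the inverse of the smooth map `c ↦ ρ (w♯ (c ∘ ρ))`, hence the solution of a smooth
injective system. -/
theorem IsConstraint.covNear_omegaFlat {V : ∀ x, Tan ES (D.ptS x)} {x₀ : X}
    (hV : VecNear (EX := EX) D.ptS V x₀) :
    CovNear (EX := EX) D.ptS (fun x => D.omegaFlat _ (V x)) x₀ := by
  obtain ⟨ρ, h1, h2, h3⟩ := hD.exists_leftInv_tSZ x₀
  -- The covectors `ω♭ v ∘ ρ` and a lift `a` of `v` agree on `TS`, so their images under `w♯`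
  -- coincide.
  have sharp_ρ : ∀ x (v : Tan ES (D.ptS x)),
      ρ x (D.poisson.sharp (D.ptZ x) ((D.omegaFlat _ v).comp (ρ x))) = v := by
    intro x v
    obtain ⟨a, ha, ha'⟩ := hD.exists_lift_ptZ x v
    have : D.poisson.sharp (D.ptZ x) ((D.omegaFlat _ v).comp (ρ x) - a) = 0 := by
      rw [hD.sharp_ptZ_eq_zero_iff]
      intro u
      refine sub_eq_zero.2 ?_
      rw [ha']
      exact congrArg (fun z => a (D.tSZ (D.ptS x) z)) (h1 x u)
    rw [map_sub, sub_eq_zero, ha] at this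
    exact (congrArg (ρ x) this).trans (h1 x v)
  refine CovNear.of_system contMDiff_ptS.continuous
    (fun x => { toFun := fun c => Tc (D.ptS x₀) (D.ptS x)
                  (ρ x (D.poisson.sharp (D.ptZ x) (c.comp (ρ x))))
                map_add' := fun c c' => by
                  rw [ContinuousLinearMap.add_comp, map_add, map_add, map_add]
                map_smul' := fun r c => by
                  rw [ContinuousLinearMap.smul_comp, map_smul, map_smul, map_smul]; rfl }) ?_ ?_ ?_
  · rw [injective_iff_map_eq_zero]
    intro c hc
    obtain ⟨v, rfl⟩ := hD.omegaFlat_surjective _ c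
    have h := congrArg (Ti (D.ptS x₀) (D.ptS x₀)) hc
    have h' := (Ti_Tc (mem_chart_source ES (D.ptS x₀)) _).symm.trans h
    rw [sharp_ρ, map_zero] at h'
    rw [h', ← zero_smul ℝ (0 : Tan ES (D.ptS x₀)), hD.omegaFlat_smul, zero_smul]
  · intro e
    exact h2 _ (D.poisson.vecNear_sharp contMDiff_ptZ
      (h3 _ (CovNear.constCoord contMDiff_ptS.continuous e x₀)))
  · refine SmoothNear.congr hV (Eventually.of_forall fun x => ?_)
    exact congrArg (Tc (D.ptS x₀) (D.ptS x)) (sharp_ρ x (V x))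

/-- The value `r a` is the solution of the system `-ω♭ V = a|TS`, which is injective in `V`. -/
theorem IsConstraint.vecNear_anchor {r : ∀ x, D.Etil x →ₗ[ℝ] Tan EX x}
    (hr : ∀ x (a : D.Etil x) u, (a : Cot EQ (D.ptQ x)) (D.tS (D.ptS x) u) =
      - D.omegaFlat _ (D.tX x (r x a)) u) {a : ∀ x, D.Etil x} {x₀ : X}
    (ha : CovNear (EX := EX) D.ptQ (fun x => (a x : Cot EQ (D.ptQ x))) x₀) :
    VecNear (EX := EX) (fun x : X => x) (fun x => r x (a x)) x₀ := by
  refine VecNear.of_system continuous_id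
    (fun x => { toFun := fun V => (D.omegaFlat _ (D.tX x V)).comp (Ti (D.ptS x₀) (D.ptS x))
                map_add' := fun V W => by
                  rw [map_add, hD.omegaFlat_add, ContinuousLinearMap.add_comp]
                map_smul' := fun c V => by
                  rw [map_smul, hD.omegaFlat_smul, ContinuousLinearMap.smul_comp]; rfl }) ?_ ?_ ?_
  · intro V W h
    refine hD.omegaFlat_tX_injective x₀ fun u => ?_
    have := DFunLike.congr_fun h (Tc (D.ptS x₀) (D.ptS x₀) u)
    change D.omegaFlat _ _ (Ti _ _ (Tc _ _ u)) = D.omegaFlat _ _ (Ti _ _ (Tc _ _ u)) at this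
    rwa [Ti_Tc (mem_chart_source ES (D.ptS x₀))] at this
  · intro e
    exact hD.covNear_omegaFlat (VecNear.push D.iX (j := fun x : X => x) contMDiff_id
      (VecNear.const continuous_id e x₀))
  · have h := CovNear.pull D.iS contMDiff_ptS ha
    refine (SmoothNear.neg h).congr (Eventually.of_forall fun x => ?_)
    ext e
    have := hr x (a x) (Ti (D.ptS x₀) (D.ptS x) e)
    change D.omegaFlat _ _ (Ti (D.ptS x₀) (D.ptS x) e) =
      -((a x : Cot EQ (D.ptQ x)) (D.tS (D.ptS x) (Ti (D.ptS x₀) (D.ptS x) e)))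
    rw [this, neg_neg]

/-- The metric defined by the second derivative is smooth. -/
theorem IsConstraint.isBundleMetric_of_isInverse {H : Fn EQ Q} {hH : D.Critical H}
    {η : ∀ x, LinearMap.BilinForm ℝ (D.Etil x)} (hη : ∀ x, D.IsInverse x (D.jV H hH x) (η x)) :
    D.IsBundleMetric D.Etil η := by
  refine ⟨fun x a b => ?_, fun x a h => ?_, fun a b ha hb => ?_⟩
  · obtain ⟨m, rfl⟩ := (hη x).1.2 a
    obtain ⟨n, rfl⟩ := (hη x).1.2 b
    rw [(hη x).2, (hη x).2]
    induction m using Submodule.Quotient.induction_on with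
    | H u =>
      induction n using Submodule.Quotient.induction_on with
      | H v => exact hess_symm EQ H (D.ptQ x) v u
  · obtain ⟨m, rfl⟩ := (hη x).1.2 a
    rw [pair_separates x (m := m) fun b => by rw [← (hη x).2, h], map_zero]
  · obtain ⟨u, hu⟩ : ∃ u : ∀ x, Tan EQ (D.ptQ x), ∀ x,
        D.jV H hH x (Submodule.Quotient.mk (u x)) = a x := by
      have : ∀ x, ∃ u : Tan EQ (D.ptQ x), D.jV H hH x (Submodule.Quotient.mk u) = a x := fun x => by
        obtain ⟨m, hm⟩ := (hη x).1.2 (a x)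
        induction m using Submodule.Quotient.induction_on with
        | H u => exact ⟨u, hm⟩
      choose u hu using this
      exact ⟨u, hu⟩
    intro x₀
    obtain ⟨ρ, h1, h2, h3⟩ := hD.exists_leftInv_tXQ x₀
    -- the solution in a smooth complement
    set w : ∀ x, Tan EQ (D.ptQ x) := fun x => u x - D.tXQ x (ρ x (u x)) with hw
    have hwu : ∀ x, (Submodule.Quotient.mk (w x) : D.EtilDual x) = Submodule.Quotient.mk (u x) := by
      intro x
      rw [Submodule.Quotient.eq]
      refine ⟨-ρ x (u x), ?_⟩
      change D.tXQ x (-ρ x (u x)) = u x - D.tXQ x (ρ x (u x)) - u x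
      rw [map_neg]; abel
    have hρw : ∀ x, ρ x (w x) = 0 := fun x => by
      rw [hw]
      change ρ x (u x - D.tXQ x (ρ x (u x))) = 0
      rw [map_sub, h1, sub_self]
    -- The second derivative determines `u` only modulo `TX`. The additional equation `ρ u = 0`
    -- selects a complement of `TX` and makes the system injective.
    have hws : VecNear (EX := EX) D.ptQ w x₀ := by
      refine VecNear.of_system (G := (EQ →L[ℝ] ℝ) × EX) contMDiff_ptQ.continuous
        (fun x => { toFun := fun u => ((hess EQ H (D.ptQ x) u).comp (Ti (D.ptQ x₀) (D.ptQ x)),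
                      Tc x₀ x (ρ x u))
                    map_add' := fun u v => by
                      rw [map_add, map_add, map_add, ContinuousLinearMap.add_comp]; rfl
                    map_smul' := fun c v => by
                      rw [map_smul, map_smul, map_smul, ContinuousLinearMap.smul_comp]
                      rfl }) ?_ ?_ ?_
      · rw [injective_iff_map_eq_zero]
        intro v hv
        have e1 := congrArg Prod.fst hv
        have e2 := congrArg Prod.snd hv
        have e3 : ρ x₀ v = 0 := by
          have := congrArg (Ti x₀ x₀) e2
          exact (Ti_Tc (mem_chart_source EX x₀) _).symm.trans (this.trans (map_zero _))
        have e4 : D.jV H hH x₀ (Submodule.Quotient.mk v) = 0 := by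
          ext z
          have := DFunLike.congr_fun e1 (Tc (D.ptQ x₀) (D.ptQ x₀) z)
          change hess EQ H (D.ptQ x₀) v (Ti _ _ (Tc _ _ z)) = 0 at this
          rwa [Ti_Tc (mem_chart_source EQ (D.ptQ x₀))] at this
        rw [← map_zero (D.jV H hH x₀)] at e4
        obtain ⟨y, hy⟩ := (Submodule.Quotient.mk_eq_zero _).1 ((hη x₀).1.1 e4)
        have hy' : D.tXQ x₀ y = v := hy
        rw [← hy', h1] at e3
        rw [← hy', e3, map_zero]
      · intro e
        have hv := VecNear.const (EX := EX) (contMDiff_ptQ (D := D)).continuous e x₀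
        exact SmoothNear.prodMk (CovNear.hess H contMDiff_ptQ (Eventually.of_forall hH) hv)
          (h2 _ hv)
      · refine SmoothNear.prodMk ((ha.covNear x₀).congr ?_) ((SmoothNear.const (0 : EX)).congr ?_)
        · refine Eventually.of_forall fun x => ?_
          have : hess EQ H (D.ptQ x) (w x) = (a x : Cot EQ (D.ptQ x)) := by
            have := hu x
            rw [← hwu] at this
            exact congrArg Subtype.val this
          exact this
        · exact Eventually.of_forall fun x =>
            (congrArg (Tc x₀ x) (hρw x)).trans (map_zero _)
    have := CovNear.apply contMDiff_ptQ.continuous (hb.covNear x₀) hws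
    refine (this.congr (Eventually.of_forall fun x => ?_)).at
    dsimp only
    rw [← hu, (hη x).2, ← hwu]
    rfl

end ConstraintData

end

/-! ### The correspondence between metrics on `Ẽ_X` and triples. -/

noncomputable section

theorem SmoothNear.pi {E M F ι : Type*} [NormedAddCommGroup E] [NormedSpace ℝ E]
    [TopologicalSpace M] [ChartedSpace E M] [NormedAddCommGroup F] [NormedSpace ℝ F] [Fintype ι]
    {f : M → ι → F} {x : M} (h : ∀ i, SmoothNear (E := E) (fun y => f y i) x) :
    SmoothNear (E := E) f x := by
  filter_upwards [eventually_all.2 h] with y hy using contMDiffAt_pi_space.2 hy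

namespace ConstraintData

variable {EX X ES S EQ Q EZ Z : Type*}
    [NormedAddCommGroup EX] [NormedSpace ℝ EX] [FiniteDimensional ℝ EX]
    [TopologicalSpace X] [ChartedSpace EX X] [IsManifold 𝓘(ℝ, EX) ∞ X]
    [T2Space X] [SecondCountableTopology X]
    [NormedAddCommGroup ES] [NormedSpace ℝ ES] [FiniteDimensional ℝ ES]
    [TopologicalSpace S] [ChartedSpace ES S] [IsManifold 𝓘(ℝ, ES) ∞ S]
    [T2Space S] [SecondCountableTopology S]
    [NormedAddCommGroup EQ] [NormedSpace ℝ EQ] [FiniteDimensional ℝ EQ]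
    [TopologicalSpace Q] [ChartedSpace EQ Q] [IsManifold 𝓘(ℝ, EQ) ∞ Q]
    [T2Space Q] [SecondCountableTopology Q]
    [NormedAddCommGroup EZ] [NormedSpace ℝ EZ] [FiniteDimensional ℝ EZ]
    [TopologicalSpace Z] [ChartedSpace EZ Z] [IsManifold 𝓘(ℝ, EZ) ∞ Z]
    [T2Space Z] [SecondCountableTopology Z]
    {D : ConstraintData EX X ES S EQ Q EZ Z}

variable (hD : D.IsConstraint)

instance (x : X) : AddCommGroup (D.Etil x) := Submodule.addCommGroup (D.Etil x)

instance (x : X) : AddCommGroup (D.Ltil x) := Submodule.addCommGroup (D.Ltil x)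

instance (x : X) : Sub (D.Etil x) := SubNegMonoid.toSub

theorem Etil_tXQ {x : X} (a : D.Etil x) (w : Tan EX x) :
    (a : Cot EQ (D.ptQ x)) (D.tXQ x w) = 0 := a.2 w

theorem Ltil_tS {x : X} (a : D.Ltil x) (w : Tan ES (D.ptS x)) :
    (a : Cot EQ (D.ptQ x)) (D.tS (D.ptS x) w) = 0 := a.2 w

/-- Projection of covectors onto `Ẽ`. -/
def projE (x : X) (ρ : Tan EQ (D.ptQ x) →L[ℝ] Tan EX x) (hρ : ∀ v, ρ (D.tXQ x v) = v) :
    Cot EQ (D.ptQ x) →ₗ[ℝ] D.Etil x where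
  toFun a := ⟨a - (a.comp (D.tXQ x)).comp ρ, fun w => by
    change a (D.tXQ x w) - a (D.tXQ x (ρ (D.tXQ x w))) = 0
    rw [hρ, sub_self]⟩
  map_add' a b := by
    ext v
    change a v + b v - (a _ + b _) = (a v - a _) + (b v - b _)
    ring
  map_smul' r a := by
    ext v
    change r * a v - r * a _ = r * (a v - a _)
    ring

/-- Projection of covectors onto `L̃`. -/
def projL (x : X) (ρ : Tan EQ (D.ptQ x) →L[ℝ] Tan ES (D.ptS x))
    (hρ : ∀ v, ρ (D.tS (D.ptS x) v) = v) :
    Cot EQ (D.ptQ x) →ₗ[ℝ] D.Ltil x where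
  toFun a := ⟨a - (a.comp (D.tS (D.ptS x))).comp ρ, fun w => by
    change a (D.tS (D.ptS x) w) - a (D.tS (D.ptS x) (ρ (D.tS (D.ptS x) w))) = 0
    rw [hρ, sub_self]⟩
  map_add' a b := by
    ext v
    change a v + b v - (a _ + b _) = (a v - a _) + (b v - b _)
    ring
  map_smul' r a := by
    ext v
    change r * a v - r * a _ = r * (a v - a _)
    ring

theorem projE_coe (x : X) (ρ : Tan EQ (D.ptQ x) →L[ℝ] Tan EX x) (hρ : ∀ v, ρ (D.tXQ x v) = v)
    (a : D.Etil x) : D.projE x ρ hρ a = a := by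
  ext v
  change (a : Cot EQ (D.ptQ x)) v - (a : Cot EQ (D.ptQ x)) (D.tXQ x (ρ v)) = _
  rw [Etil_tXQ, sub_zero]

theorem projL_coe (x : X) (ρ : Tan EQ (D.ptQ x) →L[ℝ] Tan ES (D.ptS x))
    (hρ : ∀ v, ρ (D.tS (D.ptS x) v) = v) (a : D.Ltil x) : D.projL x ρ hρ a = a := by
  ext v
  change (a : Cot EQ (D.ptQ x)) v - (a : Cot EQ (D.ptQ x)) (D.tS (D.ptS x) (ρ v)) = _
  rw [Ltil_tS, sub_zero]

theorem covNear_comp_tXQ {a : ∀ x, Cot EQ (D.ptQ x)} {x₀ : X}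
    (ha : CovNear (EX := EX) D.ptQ a x₀) :
    CovNear (EX := EX) (fun x : X => x) (fun x => (a x).comp (D.tXQ x)) x₀ := by
  refine CovNear.congr (CovNear.pull (D.iS.comp D.iX) (j := fun x : X => x) contMDiff_id ha)
    (Eventually.of_forall fun x => ?_)
  rw [tXQ_eq]
  rfl

/-- Elements of `Ẽ` with equal restrictions to `TS` differ by an element of `L̃`. If they also have
equal products with `L̃`, this difference lies in the radical of `η|L̃`. Linearity and uniqueness of
`α` rest on this. -/
theorem MetricTriple.ext_aux {x : X} {η : LinearMap.BilinForm ℝ (D.Etil x)}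
    (hn : ∀ a : D.Ltil x, (∀ b : D.Ltil x, η (D.incl x a) (D.incl x b) = 0) → a = 0)
    {a a' : D.Etil x}
    (h : ∀ u, (a : Cot EQ (D.ptQ x)) (D.tS (D.ptS x) u) =
      (a' : Cot EQ (D.ptQ x)) (D.tS (D.ptS x) u))
    (h' : ∀ b, η a (D.incl x b) = η a' (D.incl x b)) : a = a' := by
  obtain ⟨l, hl⟩ := mem_Ltil_of_nsRes x (a := a - a') (by
    ext u
    exact sub_eq_zero.2 (h u))
  have : l = 0 := hn l fun b => by
    rw [hl, map_sub, LinearMap.sub_apply, h', sub_self]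
  rw [this, map_zero] at hl
  exact (sub_eq_zero.1 hl.symm)

include hD

/-- Any extension of `-ω♭ V` from `TS` to `TQ` lies in `Ẽ`, since `X` is isotropic in `S`.
Subtracting its `η`-orthogonal projection to `L̃` gives the value of `α`. -/
theorem IsConstraint.exists_alpha (x : X) {η : LinearMap.BilinForm ℝ (D.Etil x)}
    (hs : ∀ a b, η a b = η b a)
    (hn : ∀ a : D.Ltil x, (∀ b : D.Ltil x, η (D.incl x a) (D.incl x b) = 0) → a = 0) :
    ∃ α : Tan EX x →ₗ[ℝ] D.Etil x,
      (∀ V u, (α V : Cot EQ (D.ptQ x)) (D.tS (D.ptS x) u) = - D.omegaFlat _ (D.tX x V) u) ∧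
      ∀ V b, η (α V) (D.incl x b) = 0 := by
  have h : ∀ V, ∃ a : D.Etil x,
      (∀ u, (a : Cot EQ (D.ptQ x)) (D.tS (D.ptS x) u) = - D.omegaFlat _ (D.tX x V) u) ∧
      ∀ b, η a (D.incl x b) = 0 := by
    intro V
    obtain ⟨a₀, ha₀⟩ := exists_cot_extend (hD.tS_injective (D.ptS x)) (-D.omegaFlat _ (D.tX x V))
    have ha₀' : ∀ u, a₀ (D.tS (D.ptS x) u) = - D.omegaFlat _ (D.tX x V) u := fun u =>
      DFunLike.congr_fun ha₀ u
    set a₁ : D.Etil x := ⟨a₀, fun w => by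
      refine (ha₀' (D.tX x w)).trans ?_
      rw [hD.omegaFlat_tX, neg_zero]⟩
    set B : D.Ltil x →ₗ[ℝ] D.Ltil x →ₗ[ℝ] ℝ := η.compl₁₂ (D.incl x) (D.incl x)
    have hB := bijective_of_pairing (V := D.Ltil x) (W := D.Ltil x) B hn fun w hw => hn w fun v => by
      rw [hs]; exact hw v
    obtain ⟨l, hl⟩ := hB.2 (η a₁ ∘ₗ D.incl x)
    refine ⟨a₁ - D.incl x l, fun u => ?_, fun b => ?_⟩
    · change a₀ (D.tS (D.ptS x) u) - (l : Cot EQ (D.ptQ x)) (D.tS (D.ptS x) u) = _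
      rw [Ltil_tS, sub_zero, ha₀']
    · rw [map_sub, LinearMap.sub_apply, sub_eq_zero]
      exact (LinearMap.congr_fun hl b).symm
  choose α h1 h2 using h
  refine ⟨{ toFun := α, map_add' := fun V W => ?_, map_smul' := fun r V => ?_ }, h1, h2⟩
  · refine MetricTriple.ext_aux hn (fun u => ?_) fun b => ?_
    · refine (h1 _ u).trans ?_
      change _ = (α V : Cot EQ (D.ptQ x)) (D.tS (D.ptS x) u) +
        (α W : Cot EQ (D.ptQ x)) (D.tS (D.ptS x) u)
      rw [h1, h1, map_add, hD.omegaFlat_add]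
      exact neg_add _ _
    · rw [map_add, LinearMap.add_apply, h2, h2, h2, add_zero]
  · refine MetricTriple.ext_aux hn (fun u => ?_) fun b => ?_
    · refine (h1 _ u).trans ?_
      change _ = r * (α V : Cot EQ (D.ptQ x)) (D.tS (D.ptS x) u)
      rw [h1, map_smul, hD.omegaFlat_smul]
      exact (mul_neg _ _).symm
    · rw [RingHom.id_apply, map_smul, LinearMap.smul_apply, h2, h2, smul_zero]

/-- Covectors in `Ẽ` are sums of values of `α` and elements of `L̃`. -/
theorem IsConstraint.exists_decomp {x : X} {α : Tan EX x →ₗ[ℝ] D.Etil x}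
    (hα : ∀ V u, (α V : Cot EQ (D.ptQ x)) (D.tS (D.ptS x) u) = - D.omegaFlat _ (D.tX x V) u)
    (a : D.Etil x) : ∃ V l, a = α V + D.incl x l := by
  obtain ⟨V, hV⟩ := hD.exists_omegaFlat_tX (x := x)
      (b := (a : Cot EQ (D.ptQ x)).comp (D.tS (D.ptS x))) a.2
  obtain ⟨l, hl⟩ := mem_Ltil_of_nsRes x (a := a - α V) (by
    ext u
    refine sub_eq_zero.2 ?_
    exact (DFunLike.congr_fun hV u).trans (hα V u).symm)
  exact ⟨V, l, by rw [hl]; abel⟩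

set_option maxHeartbeats 1000000 in
-- The value `α V` solves the linear system `a|TS = -ω♭ V`, `η a (ε i) = 0`. Outside `Ẽ` the form
-- `η` is not defined, so it is evaluated after projecting `a` to `Ẽ`; this leaves the solution
-- unchanged.
theorem IsConstraint.alpha_smooth {η : ∀ x, LinearMap.BilinForm ℝ (D.Etil x)}
    (hη : D.IsBundleMetric D.Etil η) (hn : ∀ x, D.NondegOnL η x)
    {α : ∀ x, Tan EX x →ₗ[ℝ] D.Etil x}
    (h1 : ∀ x V u, (α x V : Cot EQ (D.ptQ x)) (D.tS (D.ptS x) u) = - D.omegaFlat _ (D.tX x V) u)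
    (h2 : ∀ x V b, η x (α x V) (D.incl x b) = 0) {V : ∀ x, Tan EX x} {x₀ : X}
    (hV : VecNear (EX := EX) (fun x : X => x) V x₀) :
    CovNear (EX := EX) D.ptQ (fun x => (α x (V x) : Cot EQ (D.ptQ x))) x₀ := by
  obtain ⟨ρ, hρ, -, hρc⟩ := hD.exists_leftInv_tXQ x₀
  obtain ⟨σ, hσ, -, hσc⟩ := hD.exists_leftInv_tS x₀
  set bas := Module.finBasis ℝ (EQ →L[ℝ] ℝ)
  have pE : ∀ a : ∀ x, Cot EQ (D.ptQ x), CovNear (EX := EX) D.ptQ a x₀ →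
      CovNear (EX := EX) D.ptQ (fun x => (D.projE x (ρ x) (hρ x) (a x) : Cot EQ (D.ptQ x))) x₀ :=
    fun a ha => CovNear.sub ha (hρc _ (covNear_comp_tXQ ha))
  have pL : ∀ a : ∀ x, Cot EQ (D.ptQ x), CovNear (EX := EX) D.ptQ a x₀ →
      CovNear (EX := EX) D.ptQ
        (fun x => (D.incl x (D.projL x (σ x) (hσ x) (a x)) : Cot EQ (D.ptQ x))) x₀ :=
    fun a ha => CovNear.sub ha (hσc _ (CovNear.pull D.iS contMDiff_ptS ha))
  have hc : ∀ e : EQ →L[ℝ] ℝ, CovNear (EX := EX) D.ptQ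
      (fun x => e.comp (Tc (D.ptQ x₀) (D.ptQ x))) x₀ :=
    fun e => CovNear.constCoord contMDiff_ptQ.continuous e x₀
  -- Projections to `L̃` of a coordinate coframe. They span `L̃` and are in general linearly
  -- dependent, which suffices to test orthogonality.
  set ε : Fin (Module.finrank ℝ (EQ →L[ℝ] ℝ)) → ∀ x, D.Ltil x := fun i x =>
    D.projL x (σ x) (hσ x) ((bas i).comp (Tc (D.ptQ x₀) (D.ptQ x)))
  refine CovNear.of_system (G := (ES →L[ℝ] ℝ) × (Fin (Module.finrank ℝ (EQ →L[ℝ] ℝ)) → ℝ))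
    contMDiff_ptQ.continuous
    (fun x => { toFun := fun a => ((a.comp (D.tS (D.ptS x))).comp (Ti (D.ptS x₀) (D.ptS x)),
                  fun i => η x (D.projE x (ρ x) (hρ x) a) (D.incl x (ε i x)))
                map_add' := fun a b => by
                  refine Prod.ext rfl (funext fun i => ?_)
                  rw [map_add, map_add]; rfl
                map_smul' := fun r a => by
                  refine Prod.ext rfl (funext fun i => ?_)
                  rw [map_smul, map_smul]; rfl }) ?_ ?_ ?_
  · rw [injective_iff_map_eq_zero]
    intro a ha
    have e1 := congrArg Prod.fst ha
    have e2 := congrArg Prod.snd ha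
    have haL : ∀ u, a (D.tS (D.ptS x₀) u) = 0 := fun u => by
      have := DFunLike.congr_fun e1 (Tc (D.ptS x₀) (D.ptS x₀) u)
      change a (D.tS (D.ptS x₀) (Ti _ _ (Tc _ _ u))) = 0 at this
      rwa [Ti_Tc (mem_chart_source ES (D.ptS x₀))] at this
    set l : D.Ltil x₀ := ⟨a, haL⟩
    have hl : D.projE x₀ (ρ x₀) (hρ x₀) a = D.incl x₀ l :=
      projE_coe x₀ (ρ x₀) (hρ x₀) (D.incl x₀ l)
    have e3 : ∀ i, η x₀ (D.incl x₀ l) (D.incl x₀ (ε i x₀)) = 0 := fun i => by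
      rw [← hl]; exact congrFun e2 i
    have hl0 : l = 0 := by
      refine hn x₀ l fun b => ?_
      set φ : (EQ →L[ℝ] ℝ) →ₗ[ℝ] ℝ := (η x₀ (D.incl x₀ l)) ∘ₗ (D.incl x₀) ∘ₗ
        (D.projL x₀ (σ x₀) (hσ x₀)) ∘ₗ
        { toFun := fun e => (e.comp (Tc (D.ptQ x₀) (D.ptQ x₀)) : Cot EQ (D.ptQ x₀))
          map_add' := fun _ _ => rfl
          map_smul' := fun _ _ => rfl }
      have hφ : φ = 0 := bas.ext fun i => e3 i
      have hb := LinearMap.congr_fun hφ ((b : Cot EQ (D.ptQ x₀)).comp (Ti (D.ptQ x₀) (D.ptQ x₀)))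
      have hb2 : (((b : Cot EQ (D.ptQ x₀)).comp (Ti (D.ptQ x₀) (D.ptQ x₀))).comp
          (Tc (D.ptQ x₀) (D.ptQ x₀)) : Cot EQ (D.ptQ x₀)) = b := by
        ext v
        exact congrArg (b : Cot EQ (D.ptQ x₀)) (Ti_Tc (mem_chart_source EQ (D.ptQ x₀)) v)
      have hb3 : η x₀ (D.incl x₀ l) (D.incl x₀ (D.projL x₀ (σ x₀) (hσ x₀)
        (((b : Cot EQ (D.ptQ x₀)).comp (Ti (D.ptQ x₀) (D.ptQ x₀))).comp
          (Tc (D.ptQ x₀) (D.ptQ x₀))))) = 0 := hb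
      rwa [hb2, projL_coe] at hb3
    exact congrArg Subtype.val hl0
  · intro e
    refine SmoothNear.prodMk (CovNear.pull D.iS contMDiff_ptS (hc e)) (SmoothNear.pi fun i => ?_)
    exact hη.near (pE _ (hc e)) (pL _ (hc (bas i)))
  · refine SmoothNear.prodMk ?_ ?_
    · refine (SmoothNear.neg (hD.covNear_omegaFlat (VecNear.push D.iX (j := fun x : X => x)
        contMDiff_id hV))).congr (Eventually.of_forall fun x => ?_)
      ext e
      exact h1 x (V x) _
    · refine (SmoothNear.const 0).congr (Eventually.of_forall fun x => ?_)
      funext i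
      change η x (D.projE x (ρ x) (hρ x) (α x (V x))) _ = 0
      rw [projE_coe, h2]

/-- The triple of a metric on `Ẽ`. -/
theorem IsConstraint.exists_triple {η : ∀ x, LinearMap.BilinForm ℝ (D.Etil x)}
    (hη : D.IsBundleMetric D.Etil η) (hn : ∀ x, D.NondegOnL η x) :
    ∃ τ : D.Fields, D.IsTriple τ ∧ (∀ x, D.MetricTriple x (η x) τ) ∧
      ∀ τ' : D.Fields, (∀ x, D.MetricTriple x (η x) τ') → τ' = τ := by
  choose α h1 h2 using fun x => hD.exists_alpha x (hη.1 x) (hn x)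
  have hα : ∀ V, SmoothField EX V → D.SmoothSec (fun x => α x (V x)) := fun V hV =>
    smoothSec_of_covNear fun x => hD.alpha_smooth hη hn h1 h2 (hV.vecNear x)
  refine ⟨⟨fun x => (η x).compl₁₂ (α x) (α x), α, fun x => (η x).compl₁₂ (D.incl x) (D.incl x)⟩,
    ⟨⟨fun x V W => hη.1 x _ _, fun x V h => ?_, fun V W hV hW => hη.2.2 _ _ (hα V hV) (hα W hW)⟩,
      ⟨hα, fun x V a ha => ?_⟩,
      ⟨fun x a b => hη.1 x _ _, fun x a h => hn x a h,
        fun a b ha hb => hη.2.2 (fun x => D.incl x (a x)) (fun x => D.incl x (b x)) ha hb⟩⟩,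
    fun x => ⟨h1 x, h2 x, fun V W => rfl, fun a b => rfl⟩, fun τ' hτ' => ?_⟩
  -- If `γ V` is zero, then `α V` is orthogonal to `α(TX)`. It is always orthogonal to `L̃`, and
  -- together these spaces span `Ẽ`.
  · have h0 : α x V = 0 := hη.2.1 x _ fun b => by
      obtain ⟨W, l, rfl⟩ := hD.exists_decomp (h1 x) b
      rw [map_add, h2, add_zero]
      exact h W
    refine hD.omegaFlat_tX_injective x fun u => ?_
    have h3 := h1 x V u
    rw [h0] at h3
    have h4 : D.omegaFlat _ (D.tX x V) u = 0 := neg_eq_zero.1 h3.symm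
    have h5 := h1 x 0 u
    rw [map_zero] at h5
    rw [h4]
    exact (neg_eq_zero.1 h5.symm).symm
  · refine (hD.anchor_iff a V).2 ?_
    ext u
    refine Eq.trans ?_ (h1 x V u)
    exact DFunLike.congr_fun ha (D.tS (D.ptS x) u)
  · have e : τ'.α = α := by
      funext x
      ext1 V
      refine MetricTriple.ext_aux (hn x) (fun u => ?_) fun b => ?_
      · rw [(hτ' x).1, h1]
      · rw [(hτ' x).2.1, h2]
    ext x V W
    · rw [(hτ' x).2.2.1, e]; rfl
    · rw [e]
    · rw [(hτ' x).2.2.2]; rfl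

theorem IsConstraint.isConnForm_apply {α : ∀ x, Tan EX x →ₗ[ℝ] D.Etil x} (hα : D.IsConnForm α)
    (x : X) (V : Tan EX x) (u : Tan ES (D.ptS x)) :
    (α x V : Cot EQ (D.ptQ x)) (D.tS (D.ptS x) u) = - D.omegaFlat _ (D.tX x V) u := by
  obtain ⟨a, ha⟩ := exists_cot_extend (hD.tQ_injective (D.ptQ x)) (α x V : Cot EQ (D.ptQ x))
  have h := DFunLike.congr_fun ((hD.anchor_iff a V).1 (hα.2 x V a ha)) u
  rw [← ha]
  exact h

/-- The metric on `Ẽ` of a triple. -/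
theorem IsConstraint.exists_metric {τ : D.Fields} (hτ : D.IsTriple τ) :
    ∃ η, D.IsBundleMetric D.Etil η ∧ (∀ x, D.MetricTriple x (η x) τ) ∧
      ∀ η', D.IsBundleMetric D.Etil η' → (∀ x, D.MetricTriple x (η' x) τ) → η' = η := by
  obtain ⟨hγ, hα, hχ⟩ := hτ
  have h1 := hD.isConnForm_apply hα
  choose r hr using fun x => hD.exists_anchor x
  have hrα : ∀ x V, r x (τ.α x V) = V := fun x V => hD.omegaFlat_tX_injective x fun u => by
    have := hr x (τ.α x V) u
    rw [h1] at this
    exact (neg_injective this).symm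
  have hrl : ∀ x l, r x (D.incl x l) = 0 := fun x l => hD.omegaFlat_tX_injective x fun u => by
    have h3 := hr x (D.incl x l) u
    have h4 : (D.incl x l : Cot EQ (D.ptQ x)) (D.tS (D.ptS x) u) = 0 := Ltil_tS l u
    rw [h4] at h3
    have h5 := h1 x 0 u
    rw [map_zero] at h5
    rw [neg_eq_zero.1 h3.symm]
    exact (neg_eq_zero.1 h5.symm).symm
  have hp : ∀ x (a : D.Etil x), ∀ u,
      ((a - τ.α x (r x a) : D.Etil x) : Cot EQ (D.ptQ x)) (D.tS (D.ptS x) u) = 0 := by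
    intro x a u
    exact sub_eq_zero.2 ((hr x a u).trans (h1 x _ u).symm)
  -- The connection form splits the anchor `r`, so `a = α (r a) + p a` with `p` the projection onto
  -- `L̃` along `α(TX)`.
  set p : ∀ x, D.Etil x →ₗ[ℝ] D.Ltil x := fun x =>
    { toFun := fun a => ⟨(a - τ.α x (r x a) : D.Etil x), hp x a⟩
      map_add' := fun a b => by
        apply incl_injective x
        change a + b - τ.α x (r x (a + b)) = (a - τ.α x (r x a)) + (b - τ.α x (r x b))
        rw [map_add, map_add]; abel
      map_smul' := fun c a => by
        apply incl_injective x
        change c • a - τ.α x (r x (c • a)) = c • (a - τ.α x (r x a))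
        rw [map_smul, map_smul, smul_sub] } with hpdef
  have hpi : ∀ x a, D.incl x (p x a) = a - τ.α x (r x a) := fun x a => rfl
  have hpα : ∀ x V, p x (τ.α x V) = 0 := fun x V => by
    apply incl_injective x
    rw [hpi, hrα, sub_self, map_zero]
  have hpl : ∀ x l, p x (D.incl x l) = l := fun x l => by
    apply incl_injective x
    rw [hpi, hrl, map_zero, sub_zero]
  -- The orthogonal sum of `χ` on `L̃` and of `γ` transported to `α(TX)`. The conditions on a triple
  -- force these blocks and the vanishing of the mixed one, whence uniqueness.
  refine ⟨fun x => (τ.χ x).compl₁₂ (p x) (p x) + (τ.γ x).compl₁₂ (r x) (r x),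
    ⟨fun x a b => ?_, fun x a h => ?_, fun a b ha hb => ?_⟩,
    fun x => ⟨h1 x, fun V b => ?_, fun V W => ?_, fun a b => ?_⟩, fun η' hη' hm => ?_⟩
  · exact congrArg₂ (· + ·) (hχ.1 x _ _) (hγ.1 x _ _)
  · have e1 : p x a = 0 := hχ.2.1 x _ fun b => by
      have := h (D.incl x b)
      change τ.χ x (p x a) (p x (D.incl x b)) + τ.γ x (r x a) (r x (D.incl x b)) = 0 at this
      rwa [hpl, hrl, map_zero, add_zero] at this
    have e2 : r x a = 0 := hγ.2.1 x _ fun V => by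
      have := h (τ.α x V)
      change τ.χ x (p x a) (p x (τ.α x V)) + τ.γ x (r x a) (r x (τ.α x V)) = 0 at this
      rwa [hpα, hrα, map_zero, zero_add] at this
    have e3 := hpi x a
    rw [e1, e2, map_zero, map_zero, sub_zero] at e3
    exact e3.symm
  · have hr' : ∀ a : ∀ x, D.Etil x, D.SmoothSec (fun x => a x) →
        SmoothField EX (fun x => r x (a x)) := fun a ha =>
      VecNear.smoothField fun x => hD.vecNear_anchor hr (ha.covNear x)
    have hp' : ∀ a : ∀ x, D.Etil x, D.SmoothSec (fun x => a x) →
        D.SmoothSec (fun x => p x (a x)) := fun a ha =>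
      smoothSec_of_covNear fun x =>
        CovNear.sub (ha.covNear x) ((hα.1 _ (hr' a ha)).covNear x)
    exact (hχ.2.2 _ _ (hp' a ha) (hp' b hb)).add (hγ.2.2 _ _ (hr' a ha) (hr' b hb))
  · change τ.χ x (p x (τ.α x V)) _ + τ.γ x _ (r x (D.incl x b)) = 0
    rw [hpα, hrl, map_zero, map_zero, LinearMap.zero_apply, add_zero]
  · change _ = τ.χ x (p x (τ.α x V)) _ + τ.γ x (r x (τ.α x V)) (r x (τ.α x W))
    rw [hpα, hrα, hrα, map_zero, LinearMap.zero_apply, zero_add]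
  · change _ = τ.χ x (p x (D.incl x a)) (p x (D.incl x b)) + τ.γ x (r x (D.incl x a)) _
    rw [hpl, hpl, hrl, map_zero, LinearMap.zero_apply, add_zero]
  · funext x
    refine LinearMap.ext₂ fun a b => ?_
    have ea : a = τ.α x (r x a) + D.incl x (p x a) := by rw [hpi]; abel
    have eb : b = τ.α x (r x b) + D.incl x (p x b) := by rw [hpi]; abel
    change η' x a b = τ.χ x (p x a) (p x b) + τ.γ x (r x a) (r x b)
    rw [(hm x).2.2.1, (hm x).2.2.2]
    conv_lhs => rw [ea, eb]
    simp only [map_add, LinearMap.add_apply]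
    rw [(hm x).2.1, hη'.1 x (D.incl x (p x a)) (τ.α x (r x b)), (hm x).2.1]
    ring

end ConstraintData

end

/-! ### Admissible covectors and the vectors `u` of the diagram. -/

noncomputable section

namespace ConstraintData

variable {EX X ES S EQ Q EZ Z : Type*}
    [NormedAddCommGroup EX] [NormedSpace ℝ EX] [FiniteDimensional ℝ EX]
    [TopologicalSpace X] [ChartedSpace EX X] [IsManifold 𝓘(ℝ, EX) ∞ X]
    [T2Space X] [SecondCountableTopology X]
    [NormedAddCommGroup ES] [NormedSpace ℝ ES] [FiniteDimensional ℝ ES]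
    [TopologicalSpace S] [ChartedSpace ES S] [IsManifold 𝓘(ℝ, ES) ∞ S]
    [T2Space S] [SecondCountableTopology S]
    [NormedAddCommGroup EQ] [NormedSpace ℝ EQ] [FiniteDimensional ℝ EQ]
    [TopologicalSpace Q] [ChartedSpace EQ Q] [IsManifold 𝓘(ℝ, EQ) ∞ Q]
    [T2Space Q] [SecondCountableTopology Q]
    [NormedAddCommGroup EZ] [NormedSpace ℝ EZ] [FiniteDimensional ℝ EZ]
    [TopologicalSpace Z] [ChartedSpace EZ Z] [IsManifold 𝓘(ℝ, EZ) ∞ Z]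
    [T2Space Z] [SecondCountableTopology Z]
    {D : ConstraintData EX X ES S EQ Q EZ Z}

/-- The tangent map of `S → Q` at `x`. -/
def sQ (D : ConstraintData EX X ES S EQ Q EZ Z) (x : X) :
    Tan ES (D.ptS x) →L[ℝ] Tan EQ (D.ptQ x) := D.tS (D.ptS x)

/-- The tangent map of `Q → Z` at `x`. -/
def qZ (D : ConstraintData EX X ES S EQ Q EZ Z) (x : X) :
    Tan EQ (D.ptQ x) →L[ℝ] Tan EZ (D.ptZ x) := D.tQ (D.ptQ x)

/-- The tangent map of `S → Z` at `x`. -/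
def sZ (D : ConstraintData EX X ES S EQ Q EZ Z) (x : X) :
    Tan ES (D.ptS x) →L[ℝ] Tan EZ (D.ptZ x) := (D.qZ x).comp (D.sQ x)

theorem tXQ_sQ (x : X) (w : Tan EX x) : D.tXQ x w = D.sQ x (D.tX x w) := rfl

theorem tXZ_qZ (x : X) (w : Tan EX x) : D.tXZ x w = D.qZ x (D.tXQ x w) := rfl

theorem sZ_apply (x : X) (u : Tan ES (D.ptS x)) : D.sZ x u = D.qZ x (D.sQ x u) := rfl

theorem jV_mk {H : Fn EQ Q} (hH : D.Critical H) (x : X) (u : Tan EQ (D.ptQ x)) :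
    (D.jV H hH x (Submodule.Quotient.mk u) : Cot EQ (D.ptQ x)) = hess EQ H (D.ptQ x) u := rfl

theorem exists_form_of_bijective {x : X} {J : D.EtilDual x →ₗ[ℝ] D.Etil x}
    (hJ : Function.Bijective J) : ∃ η, D.IsInverse x J η := by
  set e := LinearEquiv.ofBijective J hJ
  refine ⟨(D.pairing x) ∘ₗ e.symm.toLinearMap, hJ, fun m b => ?_⟩
  have h : e.symm (J m) = m := e.symm_apply_apply m
  change D.pairing x (e.symm (J m)) b = _
  rw [h]
  rfl

theorem IsInverse.unique {x : X} {J : D.EtilDual x →ₗ[ℝ] D.Etil x}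
    {η η' : LinearMap.BilinForm ℝ (D.Etil x)} (h : D.IsInverse x J η) (h' : D.IsInverse x J η') :
    η = η' := by
  refine LinearMap.ext₂ fun a b => ?_
  obtain ⟨m, rfl⟩ := h.1.2 a
  rw [h.2, h'.2]

theorem hess_restrict {K : Fn EZ Z} {H : Fn EQ Q} (hK : ∀ q, K (D.iQ q) = H q) {x : X}
    (h0 : diff EZ K (D.ptZ x) = 0) (u v : Tan EQ (D.ptQ x)) :
    hess EQ H (D.ptQ x) u v = hess EZ K (D.ptZ x) (D.qZ x u) (D.qZ x v) := by
  have h : H = K.comp D.iQ := by ext q; exact (hK q).symm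
  rw [h]
  exact hess_comp K D.iQ h0 u v

/-- The second derivative lives on `TQ/TX`, so the vectors `u` below may be changed by elements of
`TX`. -/
theorem hess_tXQ {H : Fn EQ Q} (hH : D.Critical H) (x : X) (w : Tan EX x) :
    hess EQ H (D.ptQ x) (D.tXQ x w) = 0 := by
  rw [← jV_mk hH, show (Submodule.Quotient.mk (D.tXQ x w) : D.EtilDual x) = 0 from
    (Submodule.Quotient.mk_eq_zero _).2 ⟨w, rfl⟩, map_zero]
  rfl

theorem Diagram.exists_vec {H : Fn EQ Q} {hH : D.Critical H} {x : X} {τ : D.Fields}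
    (h : D.Diagram x (D.jV H hH x) τ) (V : Tan EX x) : ∃ u : Tan ES (D.ptS x),
      (∀ v, hess EQ H (D.ptQ x) (D.sQ x u) (D.sQ x v) =
        - D.omegaFlat _ (D.tX x V) v) ∧
      (τ.α x V : Cot EQ (D.ptQ x)) = hess EQ H (D.ptQ x) (D.sQ x u) := by
  obtain ⟨u, h1, h2, -⟩ := h.1 V
  exact ⟨u, fun v => DFunLike.congr_fun h1 v, by rw [h2]; rfl⟩

/-- Admissible covectors: the brackets of functions with these differentials and of functions
vanishing on `Q` have differentials that vanish on `TQ`. -/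
def Adm (D : ConstraintData EX X ES S EQ Q EZ Z) (x : X) (a : Cot EQ (D.ptQ x)) : Prop :=
  ∀ f : Fn EZ Z, (∀ u, diff EZ f (D.ptZ x) (D.qZ x u) = a u) →
    ∀ g : Fn EZ Z, (∀ q, g (D.iQ q) = 0) →
      ∀ u, diff EZ (D.poisson.bracket f g) (D.ptZ x) (D.qZ x u) = 0

variable (hD : D.IsConstraint)
include hD

theorem IsConstraint.exists_fn_van {x : X} {a : Cot EZ (D.ptZ x)}
    (ha : ∀ u, a (D.qZ x u) = 0) :
    ∃ g : Fn EZ Z, (∀ q, g (D.iQ q) = 0) ∧ diff EZ g (D.ptZ x) = a := by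
  obtain ⟨n, hn, hs⟩ := hD.extendsQ.exists_conormal (D.ptQ x)
  have h := hs.self_of_nhds a ha
  refine ⟨∑ k, a (Ti (D.ptZ x) (D.ptZ x) (Module.finBasis ℝ EZ k)) • n k, fun q => ?_, ?_⟩
  · rw [fn_sum_apply]
    exact Finset.sum_eq_zero fun k _ => mul_eq_zero_of_right _ (hn k q)
  · rw [diff_sum]
    refine Eq.trans ?_ h.symm
    exact Finset.sum_congr rfl fun k _ => diff_smul _ _ _

/-- Write `f` as a function vanishing on `Q` plus a function critical at `x`. The first part has a
bracket vanishing on `Q` by coisotropy; the second contributes a second derivative paired with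
`X_g`, which is zero on the leaf. -/
theorem IsConstraint.diff_bracket_van {x : X} {f g : Fn EZ Z}
    (hf : ∀ u, diff EZ f (D.ptZ x) (D.qZ x u) = 0) (hg : ∀ q, g (D.iQ q) = 0)
    (u : Tan EQ (D.ptQ x)) :
    diff EZ (D.poisson.bracket f g) (D.ptZ x) (D.qZ x u) = 0 := by
  obtain ⟨f', hf', he⟩ := hD.exists_fn_van hf
  have h0 : diff EZ (f - f' : Fn EZ Z) (D.ptZ x) = 0 := by rw [diff_sub, he, sub_self]
  have h1 : D.poisson.bracket f g = D.poisson.bracket (f - f') g + D.poisson.bracket f' g := by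
    rw [← D.poisson.bracket_add_left, sub_add_cancel]
  rw [h1, diff_add]
  change diff EZ (D.poisson.bracket (f - f') g) (D.ptZ x) _ +
    diff EZ (D.poisson.bracket f' g) (D.ptZ x) _ = 0
  rw [D.poisson.diff_bracket_left h0]
  have h2 : D.poisson.ham g (D.ptZ x) = 0 := hD.ham_van hg (D.ptS x)
  rw [h2, map_zero, zero_add]
  exact hD.diff_tQ (fun q => hD.bracket_van hf' hg q) (D.ptQ x) u

/-- Two choices of `f` differ by a function whose differential vanishes on `TQ`, and such functions
contribute nothing by `diff_bracket_van`. So one `f` decides admissibility. -/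
theorem IsConstraint.adm_of_exists {x : X} {a : Cot EQ (D.ptQ x)} {f : Fn EZ Z}
    (hf : ∀ u, diff EZ f (D.ptZ x) (D.qZ x u) = a u)
    (h : ∀ g : Fn EZ Z, (∀ q, g (D.iQ q) = 0) →
      ∀ u, diff EZ (D.poisson.bracket f g) (D.ptZ x) (D.qZ x u) = 0) : D.Adm x a := by
  intro f' hf' g hg u
  have h1 : D.poisson.bracket f' g = D.poisson.bracket (f' - f) g + D.poisson.bracket f g := by
    rw [← D.poisson.bracket_add_left, sub_add_cancel]
  rw [h1, diff_add]
  refine (congrArg₂ (· + ·) (hD.diff_bracket_van (f := f' - f) (fun v => ?_) hg u)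
    (h g hg u)).trans (add_zero _)
  rw [diff_sub]
  exact sub_eq_zero.2 ((hf' v).trans (hf v).symm)

/-- The diagram fixes `u` only modulo `TX`. Normalized by `ρ u = 0` it becomes the unique solution
of a smooth system, injective because `J₀` is. Smoothness lets `exists_ham_comb` write `u` through
Hamiltonian vector fields. -/
theorem IsConstraint.exists_smooth_vec {H : Fn EQ Q} {hH : D.Critical H}
    (hJ : ∀ x, Function.Bijective (D.zeroPart (D.jV H hH x))) {τ : D.Fields}
    (hτ : ∀ x, D.Diagram x (D.jV H hH x) τ) {V : ∀ x, Tan EX x} {x₀ : X}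
    (hV : VecNear (EX := EX) (fun x : X => x) V x₀) :
    ∃ u : ∀ x, Tan ES (D.ptS x), VecNear (EX := EX) D.ptS u x₀ ∧ ∀ x,
      (∀ v, hess EQ H (D.ptQ x) (D.sQ x (u x)) (D.sQ x v) =
        - D.omegaFlat _ (D.tX x (V x)) v) ∧
      (τ.α x (V x) : Cot EQ (D.ptQ x)) = hess EQ H (D.ptQ x) (D.sQ x (u x)) := by
  obtain ⟨ρ, hρ, hρV, -⟩ := hD.exists_leftInv_tXQ x₀
  choose u₀ h1 h2 using fun x => (hτ x).exists_vec (V x)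
  set u : ∀ x, Tan ES (D.ptS x) := fun x => u₀ x - D.tX x (ρ x (D.sQ x (u₀ x)))
  have hu : ∀ x, hess EQ H (D.ptQ x) (D.sQ x (u x)) =
      hess EQ H (D.ptQ x) (D.sQ x (u₀ x)) := fun x => by
    have h := hess_tXQ hH x (ρ x (D.sQ x (u₀ x)))
    have h' : D.sQ x (u x) = D.sQ x (u₀ x) -
      D.tXQ x (ρ x (D.sQ x (u₀ x))) := map_sub _ _ _
    rw [h']
    exact (map_sub _ _ _).trans ((congrArg _ h).trans (sub_zero _))
  have hρu : ∀ x, ρ x (D.sQ x (u x)) = 0 := fun x => by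
    have h' : D.sQ x (u x) = D.sQ x (u₀ x) -
      D.tXQ x (ρ x (D.sQ x (u₀ x))) := map_sub _ _ _
    exact (congrArg (ρ x) h').trans ((map_sub _ _ _).trans (sub_eq_zero.2 (hρ x _).symm))
  refine ⟨u, ?_, fun x => ⟨fun v => ?_, ?_⟩⟩
  · have hsys : ∀ w : ∀ x, Tan ES (D.ptS x), VecNear (EX := EX) D.ptS w x₀ →
        SmoothNear (E := EX) (F := (ES →L[ℝ] ℝ) × EX) (fun x =>
          (((hess EQ H (D.ptQ x) (D.sQ x (w x))).comp (D.sQ x)).comp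
            (Ti (D.ptS x₀) (D.ptS x)), Tc x₀ x (ρ x (D.sQ x (w x))))) x₀ := by
      intro w hw
      have hw' := VecNear.push D.iS contMDiff_ptS hw
      exact SmoothNear.prodMk (CovNear.pull D.iS contMDiff_ptS
        (CovNear.hess H contMDiff_ptQ (Eventually.of_forall hH) hw')) (hρV _ hw')
    refine VecNear.of_system (G := (ES →L[ℝ] ℝ) × EX) contMDiff_ptS.continuous
      (fun x => LinearMap.prod
        { toFun := fun w => ((hess EQ H (D.ptQ x) (D.sQ x w)).comp (D.sQ x)).comp
            (Ti (D.ptS x₀) (D.ptS x))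
          map_add' := fun v w => by rw [map_add, map_add]; rfl
          map_smul' := fun r w => by rw [map_smul, map_smul]; rfl }
        ((Tc (E := EX) x₀ x).comp ((ρ x).comp (D.sQ x))).toLinearMap) ?_
      (fun e => hsys _ (VecNear.const contMDiff_ptS.continuous e x₀)) ?_
    · rw [injective_iff_map_eq_zero]
      intro w hw
      have e1 := congrArg Prod.fst hw
      have e2 : Tc x₀ x₀ (ρ x₀ (D.sQ x₀ w)) = 0 := congrArg Prod.snd hw
      have h3 : D.zeroPart (D.jV H hH x₀) (Submodule.Quotient.mk w) = 0 := by
        ext v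
        have := DFunLike.congr_fun e1 (Tc (D.ptS x₀) (D.ptS x₀) v)
        change hess EQ H (D.ptQ x₀) (D.sQ x₀ w)
          (D.sQ x₀ (Ti _ _ (Tc _ _ v))) = 0 at this
        rwa [Ti_Tc (mem_chart_source ES (D.ptS x₀))] at this
      rw [← map_zero (D.zeroPart (D.jV H hH x₀))] at h3
      obtain ⟨y, hy⟩ := (Submodule.Quotient.mk_eq_zero _).1 ((hJ x₀).1 h3)
      have e3 : ρ x₀ (D.sQ x₀ w) = y := by
        rw [← hy]; exact hρ x₀ y
      rw [e3] at e2
      have e4 := congrArg (Ti x₀ x₀) e2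
      rw [Ti_Tc (mem_chart_source EX x₀), map_zero] at e4
      rw [← hy, e4]
      exact map_zero _
    · have hω := SmoothNear.neg (hD.covNear_omegaFlat (VecNear.push D.iX (j := fun x : X => x)
        contMDiff_id hV))
      refine (SmoothNear.prodMk hω (SmoothNear.const (0 : EX))).congr
        (Eventually.of_forall fun x => ?_)
      refine Prod.ext ?_ ?_
      · ext e
        change hess EQ H (D.ptQ x) (D.sQ x (u x)) _ = _
        rw [hu]
        exact h1 x _
      · change Tc x₀ x (ρ x (D.sQ x (u x))) = 0
        rw [hρu, map_zero]
  · rw [hu]; exact h1 x v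
  · rw [hu]; exact h2 x

end ConstraintData

end

/-! ### Admissibility of the values of `α`. -/

noncomputable section

namespace ConstraintData

variable {EX X ES S EQ Q EZ Z : Type*}
    [NormedAddCommGroup EX] [NormedSpace ℝ EX] [FiniteDimensional ℝ EX]
    [TopologicalSpace X] [ChartedSpace EX X] [IsManifold 𝓘(ℝ, EX) ∞ X]
    [T2Space X] [SecondCountableTopology X]
    [NormedAddCommGroup ES] [NormedSpace ℝ ES] [FiniteDimensional ℝ ES]
    [TopologicalSpace S] [ChartedSpace ES S] [IsManifold 𝓘(ℝ, ES) ∞ S]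
    [T2Space S] [SecondCountableTopology S]
    [NormedAddCommGroup EQ] [NormedSpace ℝ EQ] [FiniteDimensional ℝ EQ]
    [TopologicalSpace Q] [ChartedSpace EQ Q] [IsManifold 𝓘(ℝ, EQ) ∞ Q]
    [T2Space Q] [SecondCountableTopology Q]
    [NormedAddCommGroup EZ] [NormedSpace ℝ EZ] [FiniteDimensional ℝ EZ]
    [TopologicalSpace Z] [ChartedSpace EZ Z] [IsManifold 𝓘(ℝ, EZ) ∞ Z]
    [T2Space Z] [SecondCountableTopology Z]
    {D : ConstraintData EX X ES S EQ Q EZ Z}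
variable (hD : D.IsConstraint)
include hD

theorem IsConstraint.ham_zero_ptZ {g : Fn EZ Z} {x : X}
    (hg : ∀ u, diff EZ g (D.ptZ x) (D.sZ x u) = 0) : D.poisson.ham g (D.ptZ x) = 0 :=
  hD.ham_zero (s := D.ptS x) hg

theorem IsConstraint.ham_van_ptZ {g : Fn EZ Z} (hg : ∀ q, g (D.iQ q) = 0) (x : X) :
    D.poisson.ham g (D.ptZ x) = 0 := hD.ham_van hg (D.ptS x)

/-- Tangent vectors of the leaf are smooth combinations of Hamiltonian vector fields. -/
theorem IsConstraint.exists_ham_comb {u : ∀ x, Tan ES (D.ptS x)} {x₀ : X}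
    (hu : VecNear (EX := EX) D.ptS u x₀) :
    ∃ (k h : Fin (Module.finrank ℝ EZ) → Fn EZ Z), ∀ᶠ x in 𝓝 x₀,
      D.sZ x (u x) = ∑ i, k i (D.ptZ x) • D.poisson.ham (h i) (D.ptZ x) := by
  obtain ⟨ρ, hρ, -, hρc⟩ := hD.exists_leftInv_tSZ x₀
  have ha := hρc _ (hD.covNear_omegaFlat hu)
  -- A smooth lift of `u` under `w♯`. Expanding it in differentials of coordinate functions and
  -- applying `w♯` gives the combination.
  set a : ∀ x, Cot EZ (D.ptZ x) := fun x => (D.omegaFlat (D.ptS x) (u x)).comp (ρ x) with hadef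
  have hsharp : ∀ x, D.poisson.sharp (D.ptZ x) (a x) = D.sZ x (u x) := by
    intro x
    obtain ⟨b, hb, hb'⟩ := hD.exists_lift_ptZ x (u x)
    have h0 := (hD.sharp_ptZ_eq_zero_iff (a x - b)).2 fun v => by
      have e1 : a x (D.tSZ (D.ptS x) v) = D.omegaFlat (D.ptS x) (u x) v :=
        congrArg (D.omegaFlat (D.ptS x) (u x)) (hρ x v)
      have e2 := DFunLike.congr_fun hb' v
      exact sub_eq_zero.2 (e1.trans e2)
    rw [map_sub, sub_eq_zero] at h0
    exact h0.trans hb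
  obtain ⟨q, -, hq⟩ := exists_coordFn (E := EZ) (D.ptZ x₀) (O := Set.univ) Filter.univ_mem
  set bas := Module.finBasis ℝ EZ
  have hk : ∀ i, ∃ k : Fn EZ Z, ∀ᶠ x in 𝓝 x₀, k (D.ptZ x) =
      a x (Ti (D.ptZ x₀) (D.ptZ x) (bas i)) := fun i =>
    hD.exists_ext (CovNear.apply contMDiff_ptZ.continuous ha
      (VecNear.const contMDiff_ptZ.continuous _ x₀))
  choose k hk using hk
  refine ⟨k, fun i => q (LinearMap.toContinuousLinearMap (bas.coord i)), ?_⟩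
  filter_upwards [eventually_all.2 hk,
    contMDiff_ptZ.continuous.continuousAt.eventually hq] with x h1 h2
  have h3 : a x = ∑ i, k i (D.ptZ x) •
      diff EZ (q (LinearMap.toContinuousLinearMap (bas.coord i))) (D.ptZ x) := by
    ext v
    rw [sum_apply]
    have hv : v = ∑ i, bas.coord i (Tc (D.ptZ x₀) (D.ptZ x) v) •
        Ti (D.ptZ x₀) (D.ptZ x) (bas i) := by
      rw [← Ti_Tc h2.1 v]
      conv_lhs => rw [← bas.sum_repr (Tc (D.ptZ x₀) (D.ptZ x) v)]
      rw [map_sum]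
      refine Finset.sum_congr rfl fun i _ => ?_
      rw [map_smul, Ti_Tc h2.1]
      rfl
    conv_lhs => rw [hv]
    rw [map_sum]
    refine Finset.sum_congr rfl fun i _ => ?_
    rw [map_smul, ← h1]
    refine (mul_comm _ _).trans ?_
    exact congrArg (k i (D.ptZ x) * ·)
      (h2.2 (LinearMap.toContinuousLinearMap (bas.coord i)) v).symm
  rw [← hsharp, h3, map_sum]
  exact Finset.sum_congr rfl fun i _ => map_smul _ _ _

/-- The covectors `α V` are admissible when the Hamiltonian is. -/
theorem IsConstraint.adm_alpha {H : Fn EQ Q} {hH : D.Critical H} (hP : D.Ptil H)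
    (hJ : ∀ x, Function.Bijective (D.zeroPart (D.jV H hH x))) {τ : D.Fields}
    (hτ : ∀ x, D.Diagram x (D.jV H hH x) τ) (x₀ : X) (v : Tan EX x₀) :
    D.Adm x₀ (τ.α x₀ v : Cot EQ (D.ptQ x₀)) := by
  obtain ⟨K, hKadm, hK⟩ := hP
  have hdK : ∀ x u, diff EZ K (D.ptZ x) (D.qZ x u) = 0 := fun x u => by
    have h : H = K.comp D.iQ := by ext q; exact (hK q).symm
    have h1 := DFunLike.congr_fun (diff_comp_fn K D.iQ (D.ptQ x)) u
    rw [← h, hH x] at h1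
    exact h1.symm
  obtain ⟨f₁, hf₁, hdf₁⟩ := hD.exists_fn_cov_van (x₀ := x₀) (covNear_diff contMDiff_ptZ K x₀)
    (Eventually.of_forall hdK)
  -- The differential of `K` along `X` vanishes on `TQ`, but perhaps not on `TZ`. Subtracting `f₁`,
  -- which vanishes on `Q`, makes `K'` critical along `X` near `x₀`; it remains an admissible
  -- extension of `H` by coisotropy.
  set K' : Fn EZ Z := K - f₁ with hK'
  have hdK' : ∀ᶠ x in 𝓝 x₀, diff EZ K' (D.ptZ x) = 0 := by
    filter_upwards [hdf₁] with x hx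
    rw [hK', diff_sub, hx, sub_self]
  have hK'H : ∀ q, K' (D.iQ q) = H q := fun q => by
    rw [← hK q]
    change K (D.iQ q) - f₁ (D.iQ q) = _
    rw [hf₁, sub_zero]
  have hK'adm : ∀ g : Fn EZ Z, (∀ q, g (D.iQ q) = 0) →
      ∀ q, D.poisson.bracket K' g (D.iQ q) = 0 := fun g hg q => by
    rw [hK', D.poisson.bracket_sub_left]
    change D.poisson.bracket K g (D.iQ q) - D.poisson.bracket f₁ g (D.iQ q) = 0
    rw [hKadm g hg, hD.bracket_van hf₁ hg, sub_zero]
  obtain ⟨u, hu, hu'⟩ := hD.exists_smooth_vec hJ hτ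
    (V := fun x => Ti x₀ x (Tc x₀ x₀ v)) (x₀ := x₀)
    (VecNear.const (j := fun x : X => x) continuous_id _ x₀)
  obtain ⟨k, h, hkh⟩ := hD.exists_ham_comb hu
  have h0 : diff EZ K' (D.ptZ x₀) = 0 := hdK'.self_of_nhds
  have hc := hkh.self_of_nhds
  have hα : (τ.α x₀ v : Cot EQ (D.ptQ x₀)) = hess EQ H (D.ptQ x₀) (D.sQ x₀ (u x₀)) := by
    have := (hu' x₀).2
    rwa [Ti_Tc (mem_chart_source EX x₀)] at this
  have hbr0 : ∀ i, D.poisson.bracket K' (h i) (D.ptZ x₀) = 0 := fun i => by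
    rw [D.poisson.bracket_apply, h0]; rfl
  set P := D.poisson with hPdef
  -- This is the derivative of `K'` along `Σ kᵢ X_{hᵢ}`. As `K'` is critical at `x₀`, its
  -- differential there is the second derivative in the direction `u`, which restricts to `α v`.
  refine hD.adm_of_exists (f := ∑ i, k i * P.bracket K' (h i)) (fun w => ?_) fun g hg w => ?_
  · rw [diff_sum, sum_apply]
    have e : ∀ i, diff EZ (k i * P.bracket K' (h i) : Fn EZ Z) (D.ptZ x₀) (D.qZ x₀ w) =
        hess EZ K' (D.ptZ x₀) (D.qZ x₀ w) (k i (D.ptZ x₀) • P.ham (h i) (D.ptZ x₀)) := fun i => by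
      rw [diff_mul, hbr0, zero_smul, add_zero, map_smul, ← P.diff_bracket_left h0]
      rfl
    rw [Finset.sum_congr rfl fun i _ => e i, ← map_sum, ← hc, hα,
      hess_restrict hK'H h0]
    exact hess_symm EZ K' _ _ _
  · have hXg : P.ham g (D.ptZ x₀) = 0 := hD.ham_van_ptZ hg x₀
    rw [P.bracket_sum_left, diff_sum, sum_apply]
    set wK : Fn EZ Z := P.bracket K' g with hwK
    have hw0 : ∀ q, wK (D.iQ q) = 0 := hK'adm g hg
    have hdw : diff EZ wK (D.ptZ x₀) = 0 := by
      ext y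
      rw [hwK, P.diff_bracket_left h0, hXg, map_zero]
      rfl
    have e : ∀ i, diff EZ (P.bracket (k i * P.bracket K' (h i)) g) (D.ptZ x₀) (D.qZ x₀ w) =
        hess EZ wK (D.ptZ x₀) (D.qZ x₀ w) (k i (D.ptZ x₀) • P.ham (h i) (D.ptZ x₀)) := by
      intro i
      -- The Jacobi identity moves `g` next to `K'`. The first term involves `wK = {K', g}`, which
      -- vanishes on `Q`; the second turns out to have zero differential.
      have c1 : P.bracket (P.bracket K' (h i)) g =
          P.bracket wK (h i) + P.bracket K' (P.bracket (h i) g) := by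
        rw [P.bracket_skew _ g, P.bracket_leibniz g K' (h i), P.bracket_skew g K', ← hwK,
          P.bracket_skew g (h i)]
        have n1 : P.bracket (-wK) (h i) = - P.bracket wK (h i) := by
          have := P.bracket_sub_left 0 wK (h i)
          have z := P.bracket_sub_left 0 0 (h i)
          rw [sub_self, sub_self] at z
          rwa [z, zero_sub, zero_sub] at this
        have n2 : P.bracket K' (-P.bracket (h i) g) = - P.bracket K' (P.bracket (h i) g) := by
          have := P.bracket_sub_right K' 0 (P.bracket (h i) g)
          have z := P.bracket_sub_right K' 0 0
          rw [sub_self, sub_self] at z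
          rwa [z, zero_sub, zero_sub] at this
        rw [n1, n2]
        abel
      -- The function `{hᵢ, g}` is zero on the leaf because `X_g` is, so its Hamiltonian vector
      -- field is zero there too.
      have c2 : P.ham (P.bracket (h i) g) (D.ptZ x₀) = 0 := by
        refine hD.ham_zero_ptZ fun y => ?_
        have z : ((P.bracket (h i) g).comp (D.iQ.comp D.iS) : Fn ES S) = 0 := by
          ext s
          change P.bracket (h i) g (D.iQ (D.iS s)) = 0
          rw [P.bracket_apply, hD.ham_van hg s, map_zero]
        have z1 := DFunLike.congr_fun
          (diff_comp_fn (P.bracket (h i) g) (D.iQ.comp D.iS) (D.ptS x₀)) y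
        rw [z, diff_zero, ← tSZ_eq] at z1
        exact z1.symm
      have c3 : diff EZ (P.bracket (P.bracket K' (h i)) g) (D.ptZ x₀) (D.qZ x₀ w) =
          hess EZ wK (D.ptZ x₀) (D.qZ x₀ w) (P.ham (h i) (D.ptZ x₀)) := by
        rw [c1, diff_add]
        change diff EZ (P.bracket wK (h i)) (D.ptZ x₀) (D.qZ x₀ w) +
          diff EZ (P.bracket K' (P.bracket (h i) g)) (D.ptZ x₀) (D.qZ x₀ w) = _
        rw [P.diff_bracket_left hdw, P.diff_bracket_left h0, c2, map_zero, add_zero]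
      have c4 : P.bracket (P.bracket K' (h i)) g (D.ptZ x₀) = 0 := by
        rw [P.bracket_apply, hXg, map_zero]
      have c5 : P.bracket (k i) g (D.ptZ x₀) = 0 := by
        rw [P.bracket_apply, hXg, map_zero]
      rw [P.bracket_mul_left, diff_add, diff_mul, diff_mul, hbr0, c4, c5, zero_smul, zero_smul,
        zero_smul, add_zero, add_zero, add_zero, map_smul, ← c3]
      rfl
    rw [Finset.sum_congr rfl fun i _ => e i, ← map_sum, ← hc]
    -- What remains is the second derivative of `wK` on two vectors tangent to `Q`, and `wK`
    -- restricts to zero on `Q`.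
    have c6 := hess_restrict (K := wK) (H := 0) (x := x₀) hw0 hdw w (D.sQ x₀ (u x₀))
    refine Eq.trans c6.symm ?_
    have c7 : diff EQ (0 : Fn EQ Q) (D.ptQ x₀) = 0 := diff_zero _
    have c8 := hess_sub (0 : Fn EQ Q) 0 c7 c7 w (D.sQ x₀ (u x₀))
    rwa [sub_self, sub_self] at c8

end ConstraintData

end

/-! ### Differential calculus on the total space of `TZ|_X`. -/

noncomputable section

namespace ConstraintData

variable {EX X ES S EQ Q EZ Z : Type*}
    [NormedAddCommGroup EX] [NormedSpace ℝ EX] [FiniteDimensional ℝ EX]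
    [TopologicalSpace X] [ChartedSpace EX X] [IsManifold 𝓘(ℝ, EX) ∞ X]
    [T2Space X] [SecondCountableTopology X]
    [NormedAddCommGroup ES] [NormedSpace ℝ ES] [FiniteDimensional ℝ ES]
    [TopologicalSpace S] [ChartedSpace ES S] [IsManifold 𝓘(ℝ, ES) ∞ S]
    [T2Space S] [SecondCountableTopology S]
    [NormedAddCommGroup EQ] [NormedSpace ℝ EQ] [FiniteDimensional ℝ EQ]
    [TopologicalSpace Q] [ChartedSpace EQ Q] [IsManifold 𝓘(ℝ, EQ) ∞ Q]
    [T2Space Q] [SecondCountableTopology Q]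
    [NormedAddCommGroup EZ] [NormedSpace ℝ EZ] [FiniteDimensional ℝ EZ]
    [TopologicalSpace Z] [ChartedSpace EZ Z] [IsManifold 𝓘(ℝ, EZ) ∞ Z]
    [T2Space Z] [SecondCountableTopology Z]
    {D : ConstraintData EX X ES S EQ Q EZ Z}

section TZX

/-- The vector of a point of `TZ|_X`. -/
def vec (D : ConstraintData EX X ES S EQ Q EZ Z) (q : D.TZX) : Tan EZ (D.ptZ q.1) := q.2

theorem tzx_snd {x₀ : X} {q : D.TZX} (hq : D.ptZ q.1 ∈ (chartAt EZ (D.ptZ x₀)).source) :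
    (trivializationAt EZ (D.zmap *ᵖ (fun z : Z => Tan EZ z)) x₀ q).2 =
      Tc (D.ptZ x₀) (D.ptZ q.1) (D.vec q) := by
  have hy' : D.ptZ q.1 ∈ (trivializationAt EZ (TangentSpace 𝓘(ℝ, EZ)) (D.ptZ x₀)).baseSet := hq
  rw [Tc, Trivialization.continuousLinearMapAt_apply, Trivialization.linearMapAt_apply,
    if_pos hy']
  rfl

theorem tzx_contMDiffAt_fst (p : D.TZX) :
    ContMDiffAt (𝓘(ℝ, EX).prod 𝓘(ℝ, EZ)) 𝓘(ℝ, EX) ∞ (fun q : D.TZX => q.1) p :=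
  Bundle.contMDiffAt_proj (D.zmap *ᵖ (fun z : Z => Tan EZ z))

theorem tzx_continuous_fst : Continuous (fun q : D.TZX => q.1) :=
  continuous_iff_continuousAt.2 fun p => (tzx_contMDiffAt_fst p).continuousAt

theorem tzx_contMDiffAt_snd (p : D.TZX) :
    ContMDiffAt (𝓘(ℝ, EX).prod 𝓘(ℝ, EZ)) 𝓘(ℝ, EZ) ∞
      (fun q : D.TZX => Tc (D.ptZ p.1) (D.ptZ q.1) (D.vec q)) p := by
  have h : ContMDiffAt (𝓘(ℝ, EX).prod 𝓘(ℝ, EZ)) (𝓘(ℝ, EX).prod 𝓘(ℝ, EZ)) ∞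
    (fun q : D.TZX => q) p := contMDiffAt_id
  refine (contMDiffAt_totalSpace.1 h).2.congr_of_eventuallyEq ?_
  have := (contMDiff_ptZ (D := D)).continuous.comp (tzx_continuous_fst (D := D))
  filter_upwards [this.continuousAt.eventually (chart_near (E := EZ) (D.ptZ p.1))] with q hq
  exact (tzx_snd hq).symm

theorem contMDiffAt_tzx {EN N : Type*} [NormedAddCommGroup EN] [NormedSpace ℝ EN]
    [TopologicalSpace N] [ChartedSpace EN N] {b : N → X} {w : ∀ n, Tan EZ (D.ptZ (b n))} {n₀ : N}
    (hb : ContMDiffAt 𝓘(ℝ, EN) 𝓘(ℝ, EX) ∞ b n₀)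
    (hw : ContMDiffAt 𝓘(ℝ, EN) 𝓘(ℝ, EZ) ∞
      (fun n => Tc (D.ptZ (b n₀)) (D.ptZ (b n)) (w n)) n₀) :
    ContMDiffAt 𝓘(ℝ, EN) (𝓘(ℝ, EX).prod 𝓘(ℝ, EZ)) ∞ (fun n => (⟨b n, w n⟩ : D.TZX)) n₀ := by
  refine contMDiffAt_totalSpace.2 ⟨hb, hw.congr_of_eventuallyEq ?_⟩
  have h1 := (contMDiff_ptZ (D := D)).continuous.continuousAt.comp hb.continuousAt
  filter_upwards [h1.eventually (chart_near (E := EZ) (D.ptZ (b n₀)))] with n hn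
  exact tzx_snd (q := ⟨b n, w n⟩) hn

/-- Fibrewise linear functions of smooth sections are smooth. -/
theorem contMDiffAt_tzx_cov {a : ∀ x, Cot EZ (D.ptZ x)} {p : D.TZX}
    (ha : CovNear (EX := EX) D.ptZ a p.1) :
    ContMDiffAt (𝓘(ℝ, EX).prod 𝓘(ℝ, EZ)) 𝓘(ℝ, ℝ) ∞ (fun q : D.TZX => a q.1 (D.vec q)) p := by
  have h1 := ContMDiffAt.comp p (SmoothNear.at ha) (tzx_contMDiffAt_fst p)
  have h2 := ContMDiffAt.clm_apply h1 (tzx_contMDiffAt_snd p)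
  refine h2.congr_of_eventuallyEq ?_
  have := (contMDiff_ptZ (D := D)).continuous.comp (tzx_continuous_fst (D := D))
  filter_upwards [this.continuousAt.eventually (chart_near (E := EZ) (D.ptZ p.1))] with q hq
  exact (congrArg (a q.1) (Ti_Tc hq _)).symm

theorem affineFn_contMDiffAt (f : Fn EZ Z) (φ : Fn EX X) (p : D.TZX) :
    ContMDiffAt (𝓘(ℝ, EX).prod 𝓘(ℝ, EZ)) 𝓘(ℝ, ℝ) ∞ (D.affineFn f φ) p :=
  (contMDiffAt_tzx_cov (covNear_diff contMDiff_ptZ f p.1)).add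
    (ContMDiffAt.comp p (φ.contMDiff p.1) (tzx_contMDiffAt_fst p))

/-- The section of `TQ|_X` through `v` that is constant in a chart. -/
def vsec (D : ConstraintData EX X ES S EQ Q EZ Z) (x : X) (v : Tan EQ (D.ptQ x)) (y : X) :
    Tan EQ (D.ptQ y) := Ti (D.ptQ x) (D.ptQ y) (Tc (D.ptQ x) (D.ptQ x) v)

theorem vsec_self (x : X) (v : Tan EQ (D.ptQ x)) : D.vsec x v x = v :=
  Ti_Tc (mem_chart_source EQ (D.ptQ x)) v

theorem vecNear_vsec (x : X) (v : Tan EQ (D.ptQ x)) :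
    VecNear (EX := EX) D.ptZ (fun y => D.qZ y (D.vsec x v y)) x :=
  VecNear.push D.iQ contMDiff_ptQ (VecNear.const contMDiff_ptQ.continuous _ x)

/-- The section `vsec` as a map into `TZ|_X`. -/
def horiz (D : ConstraintData EX X ES S EQ Q EZ Z) (x : X) (v : Tan EQ (D.ptQ x)) (y : X) :
    D.TZX := ⟨y, D.qZ y (D.vsec x v y)⟩

theorem horiz_self (x : X) (v : Tan EQ (D.ptQ x)) : D.horiz x v x = ⟨x, D.qZ x v⟩ := by
  rw [horiz, vsec_self]

theorem contMDiffAt_horiz (x : X) (v : Tan EQ (D.ptQ x)) :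
    ContMDiffAt 𝓘(ℝ, EX) (𝓘(ℝ, EX).prod 𝓘(ℝ, EZ)) ∞ (D.horiz x v) x :=
  contMDiffAt_tzx (b := fun y => y) contMDiffAt_id (SmoothNear.at (vecNear_vsec x v))

/-- The fibre of `TZ|_X` at `x`, in coordinates. -/
def fib (D : ConstraintData EX X ES S EQ Q EZ Z) (x : X) (e : EZ) : D.TZX :=
  ⟨x, (Ti (E := EZ) (D.ptZ x) (D.ptZ x) e : Tan EZ (D.ptZ x))⟩

theorem contMDiffAt_fib (x : X) (e : EZ) :
    ContMDiffAt 𝓘(ℝ, EZ) (𝓘(ℝ, EX).prod 𝓘(ℝ, EZ)) ∞ (D.fib x) e := by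
  refine contMDiffAt_tzx (b := fun _ : EZ => x) contMDiffAt_const ?_
  refine contMDiffAt_id.congr_of_eventuallyEq (Eventually.of_forall fun n => ?_)
  exact Tc_Ti (mem_chart_source EZ (D.ptZ x)) n

theorem fib_eq (p : D.TZX) : D.fib p.1 (Tc (D.ptZ p.1) (D.ptZ p.1) (D.vec p)) = p := by
  obtain ⟨x, v⟩ := p
  exact congrArg (fun w => (⟨x, w⟩ : D.TZX)) (Ti_Tc (mem_chart_source EZ (D.ptZ x)) v)

/-- The tangent map of `horiz`. -/
def dHoriz (D : ConstraintData EX X ES S EQ Q EZ Z) (x : X) (v : Tan EQ (D.ptQ x)) :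
    EX →L[ℝ] EX × EZ := mfderiv 𝓘(ℝ, EX) (𝓘(ℝ, EX).prod 𝓘(ℝ, EZ)) (D.horiz x v) x

/-- The tangent map of `fib`. -/
def dFib (D : ConstraintData EX X ES S EQ Q EZ Z) (x : X) (e : EZ) : EZ →L[ℝ] EX × EZ :=
  mfderiv 𝓘(ℝ, EZ) (𝓘(ℝ, EX).prod 𝓘(ℝ, EZ)) (D.fib x) e

/-- The tangent map of a vector valued map on `TZ|_X`. -/
def dTot (D : ConstraintData EX X ES S EQ Q EZ Z) {F : Type*} [NormedAddCommGroup F]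
    [NormedSpace ℝ F] (G : D.TZX → F) (p : D.TZX) : EX × EZ →L[ℝ] F :=
  mfderiv (𝓘(ℝ, EX).prod 𝓘(ℝ, EZ)) 𝓘(ℝ, F) G p

theorem mfderiv_horiz {F N : Type*} [NormedAddCommGroup F] [NormedSpace ℝ F] [TopologicalSpace N]
    [ChartedSpace F N] {x : X} {v : Tan EQ (D.ptQ x)} {G : D.TZX → N}
    (hG : MDifferentiableAt (𝓘(ℝ, EX).prod 𝓘(ℝ, EZ)) 𝓘(ℝ, F) G ⟨x, D.qZ x v⟩) (w : EX) :
    (mfderiv 𝓘(ℝ, EX) 𝓘(ℝ, F) (fun y => G (D.horiz x v y)) x w : F) =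
      (mfderiv (𝓘(ℝ, EX).prod 𝓘(ℝ, EZ)) 𝓘(ℝ, F) G ⟨x, D.qZ x v⟩ : EX × EZ →L[ℝ] F)
        (D.dHoriz x v w) := by
  have hs : MDifferentiableAt 𝓘(ℝ, EX) (𝓘(ℝ, EX).prod 𝓘(ℝ, EZ)) (D.horiz x v) x :=
    (contMDiffAt_horiz x v).mdifferentiableAt (by simp)
  rw [dHoriz]
  rw [← horiz_self] at hG ⊢
  exact DFunLike.congr_fun (mfderiv_comp x hG hs) w

theorem mfderiv_fib {F N : Type*} [NormedAddCommGroup F] [NormedSpace ℝ F] [TopologicalSpace N]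
    [ChartedSpace F N] {x : X} {e : EZ} {G : D.TZX → N}
    (hG : MDifferentiableAt (𝓘(ℝ, EX).prod 𝓘(ℝ, EZ)) 𝓘(ℝ, F) G (D.fib x e)) (w : EZ) :
    (mfderiv 𝓘(ℝ, EZ) 𝓘(ℝ, F) (fun y => G (D.fib x y)) e w : F) =
      (mfderiv (𝓘(ℝ, EX).prod 𝓘(ℝ, EZ)) 𝓘(ℝ, F) G (D.fib x e) : EX × EZ →L[ℝ] F)
        (D.dFib x e w) := by
  have hs : MDifferentiableAt 𝓘(ℝ, EZ) (𝓘(ℝ, EX).prod 𝓘(ℝ, EZ)) (D.fib x) e :=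
    (contMDiffAt_fib x e).mdifferentiableAt (by simp)
  exact DFunLike.congr_fun (mfderiv_comp e hG hs) w

theorem fib_Tc (x : X) (v : Tan EZ (D.ptZ x)) :
    D.fib x (Tc (D.ptZ x) (D.ptZ x) v) = ⟨x, v⟩ := fib_eq (⟨x, v⟩ : D.TZX)

/-- The tangent space of `TZ|_X` is spanned by the tangent spaces of a section and of a fibre. -/
theorem exists_horiz_fib (x : X) (v : Tan EQ (D.ptQ x)) (y : EX × EZ) : ∃ w e,
    y = D.dHoriz x v w + D.dFib x (Tc (D.ptZ x) (D.ptZ x) (D.qZ x v)) e := by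
  set p : D.TZX := ⟨x, D.qZ x v⟩ with hp
  set e₀ : EZ := Tc (D.ptZ x) (D.ptZ x) (D.qZ x v) with he₀
  have hp2 : D.fib x e₀ = p := fib_Tc x _
  have hπ : MDifferentiableAt (𝓘(ℝ, EX).prod 𝓘(ℝ, EZ)) 𝓘(ℝ, EX) (fun q : D.TZX => q.1) p :=
    (tzx_contMDiffAt_fst p).mdifferentiableAt (by simp)
  have hσ : MDifferentiableAt (𝓘(ℝ, EX).prod 𝓘(ℝ, EZ)) 𝓘(ℝ, EZ)
      (fun q : D.TZX => Tc (D.ptZ x) (D.ptZ q.1) (D.vec q)) p :=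
    (tzx_contMDiffAt_snd p).mdifferentiableAt (by simp)
  have k1 : ∀ w, (mfderiv (𝓘(ℝ, EX).prod 𝓘(ℝ, EZ)) 𝓘(ℝ, EX) (fun q : D.TZX => q.1) p :
      EX × EZ →L[ℝ] EX) (D.dHoriz x v w) = w := fun w => by
    refine (mfderiv_horiz hπ w).symm.trans ?_
    change mfderiv 𝓘(ℝ, EX) 𝓘(ℝ, EX) (id : X → X) x w = w
    rw [mfderiv_id]
    rfl
  have k2 : ∀ e, (mfderiv (𝓘(ℝ, EX).prod 𝓘(ℝ, EZ)) 𝓘(ℝ, EX) (fun q : D.TZX => q.1) p :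
      EX × EZ →L[ℝ] EX) (D.dFib x e₀ e) = 0 := fun e => by
    rw [← hp2] at hπ ⊢
    refine (mfderiv_fib hπ e).symm.trans ?_
    change mfderiv 𝓘(ℝ, EZ) 𝓘(ℝ, EX) (fun _ : EZ => x) e₀ e = 0
    rw [mfderiv_const]
    rfl
  have k3 : ∀ e, (mfderiv (𝓘(ℝ, EX).prod 𝓘(ℝ, EZ)) 𝓘(ℝ, EZ)
      (fun q : D.TZX => Tc (D.ptZ x) (D.ptZ q.1) (D.vec q)) p :
      EX × EZ →L[ℝ] EZ) (D.dFib x e₀ e) = e := fun e => by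
    rw [← hp2] at hσ ⊢
    refine (mfderiv_fib hσ e).symm.trans ?_
    have he : (fun y => Tc (D.ptZ x) (D.ptZ (D.fib x y).1) (D.vec (D.fib x y))) =
        (id : EZ → EZ) := funext fun y => Tc_Ti (mem_chart_source EZ (D.ptZ x)) y
    rw [he, mfderiv_id]
    rfl
  obtain ⟨dp, hdp, hdp'⟩ : ∃ dp : EX × EZ →L[ℝ] EX, (∀ w, dp (D.dHoriz x v w) = w) ∧
    ∀ e, dp (D.dFib x e₀ e) = 0 := ⟨_, k1, k2⟩
  obtain ⟨dt, hdt⟩ : ∃ dt : EX × EZ →L[ℝ] EZ, ∀ e, dt (D.dFib x e₀ e) = e := ⟨_, k3⟩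
  -- The projection to `X` recovers `w`, and then the fibre coordinate recovers `e`. So `Φ` is
  -- injective, and it is an endomorphism of a finite-dimensional space.
  set Φ : EX × EZ →ₗ[ℝ] EX × EZ :=
    LinearMap.coprod (D.dHoriz x v).toLinearMap (D.dFib x e₀).toLinearMap
  have hΦ : Function.Injective Φ := by
    rw [injective_iff_map_eq_zero]
    rintro ⟨w, e⟩ h
    have h' : D.dHoriz x v w + D.dFib x e₀ e = 0 := h
    have e1 := congrArg dp h'
    rw [map_add, hdp, hdp', add_zero, map_zero] at e1
    have e2 := congrArg dt h'
    rw [e1, map_zero, zero_add, hdt, map_zero] at e2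
    rw [e1, e2]
    rfl
  obtain ⟨⟨w, e⟩, rfl⟩ := LinearMap.injective_iff_surjective.1 hΦ y
  exact ⟨w, e, rfl⟩

/-- Differentials at points of `TZ|_X` are determined by a section and a fibre. -/
theorem tzx_ext (x : X) (v : Tan EQ (D.ptQ x)) {F G : D.TZX → ℝ}
    (hF : MDifferentiableAt (𝓘(ℝ, EX).prod 𝓘(ℝ, EZ)) 𝓘(ℝ, ℝ) F ⟨x, D.qZ x v⟩)
    (hG : MDifferentiableAt (𝓘(ℝ, EX).prod 𝓘(ℝ, EZ)) 𝓘(ℝ, ℝ) G ⟨x, D.qZ x v⟩) :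
    mfderiv (𝓘(ℝ, EX).prod 𝓘(ℝ, EZ)) 𝓘(ℝ, ℝ) F ⟨x, D.qZ x v⟩ =
        mfderiv (𝓘(ℝ, EX).prod 𝓘(ℝ, EZ)) 𝓘(ℝ, ℝ) G ⟨x, D.qZ x v⟩ ↔
      (∀ w : EX, diff EX (fun y => F (D.horiz x v y)) x w =
        diff EX (fun y => G (D.horiz x v y)) x w) ∧
      ∀ w : EZ, diff EZ (fun e => F (D.fib x e)) (Tc (D.ptZ x) (D.ptZ x) (D.qZ x v) : EZ) w =
        diff EZ (fun e => G (D.fib x e)) (Tc (D.ptZ x) (D.ptZ x) (D.qZ x v) : EZ) w := by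
  have c1 : ∀ {F : D.TZX → ℝ},
      MDifferentiableAt (𝓘(ℝ, EX).prod 𝓘(ℝ, EZ)) 𝓘(ℝ, ℝ) F ⟨x, D.qZ x v⟩ → ∀ w : EX,
      diff EX (fun y => F (D.horiz x v y)) x w = D.dTot F ⟨x, D.qZ x v⟩ (D.dHoriz x v w) :=
    fun hF w => mfderiv_horiz hF w
  have c2 : ∀ {F : D.TZX → ℝ},
      MDifferentiableAt (𝓘(ℝ, EX).prod 𝓘(ℝ, EZ)) 𝓘(ℝ, ℝ) F ⟨x, D.qZ x v⟩ → ∀ w : EZ,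
      diff EZ (fun e => F (D.fib x e)) (Tc (D.ptZ x) (D.ptZ x) (D.qZ x v) : EZ) w =
        D.dTot F ⟨x, D.qZ x v⟩ (D.dFib x (Tc (D.ptZ x) (D.ptZ x) (D.qZ x v)) w) := by
    intro F hF w
    rw [← fib_Tc] at hF ⊢
    exact mfderiv_fib hF w
  change D.dTot F ⟨x, D.qZ x v⟩ = D.dTot G ⟨x, D.qZ x v⟩ ↔ _
  constructor
  · intro h
    refine ⟨fun w => ?_, fun w => ?_⟩
    · exact (c1 hF w).trans ((DFunLike.congr_fun h _).trans (c1 hG w).symm)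
    · exact (c2 hF w).trans ((DFunLike.congr_fun h _).trans (c2 hG w).symm)
  · rintro ⟨h1, h2⟩
    refine ContinuousLinearMap.ext fun y => ?_
    obtain ⟨w, e, rfl⟩ := exists_horiz_fib x v y
    rw [map_add, map_add]
    exact congrArg₂ (· + ·) ((c1 hF w).symm.trans ((h1 w).trans (c1 hG w)))
      ((c2 hF e).symm.trans ((h2 e).trans (c2 hG e)))

end TZX

end ConstraintData

end

/-! ### Functions on `Z'` represented by functions on `Z` and on `X`. -/

noncomputable section

namespace ConstraintData

variable {EX X ES S EQ Q EZ Z : Type*}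
    [NormedAddCommGroup EX] [NormedSpace ℝ EX] [FiniteDimensional ℝ EX]
    [TopologicalSpace X] [ChartedSpace EX X] [IsManifold 𝓘(ℝ, EX) ∞ X]
    [T2Space X] [SecondCountableTopology X]
    [NormedAddCommGroup ES] [NormedSpace ℝ ES] [FiniteDimensional ℝ ES]
    [TopologicalSpace S] [ChartedSpace ES S] [IsManifold 𝓘(ℝ, ES) ∞ S]
    [T2Space S] [SecondCountableTopology S]
    [NormedAddCommGroup EQ] [NormedSpace ℝ EQ] [FiniteDimensional ℝ EQ]
    [TopologicalSpace Q] [ChartedSpace EQ Q] [IsManifold 𝓘(ℝ, EQ) ∞ Q]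
    [T2Space Q] [SecondCountableTopology Q]
    [NormedAddCommGroup EZ] [NormedSpace ℝ EZ] [FiniteDimensional ℝ EZ]
    [TopologicalSpace Z] [ChartedSpace EZ Z] [IsManifold 𝓘(ℝ, EZ) ∞ Z]
    [T2Space Z] [SecondCountableTopology Z]
    {D : ConstraintData EX X ES S EQ Q EZ Z}

theorem diff_line {E : Type*} [NormedAddCommGroup E] [NormedSpace ℝ E] {h : E → ℝ} {e₀ : E}
    (hd : MDifferentiableAt 𝓘(ℝ, E) 𝓘(ℝ, ℝ) h e₀) (d : E) {A B : ℝ}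
    (hh : ∀ t : ℝ, h (e₀ + t • d) = A + t * B) : diff E h e₀ d = B := by
  have h1 : diff E h e₀ d = fderiv ℝ h e₀ d := by
    rw [diff, mfderiv_eq_fderiv]
    rfl
  rw [h1, ← (mdifferentiableAt_iff_differentiableAt.1 hd).lineDeriv_eq_fderiv, lineDeriv]
  rw [show (fun t : ℝ => h (e₀ + t • d)) = fun t => A + t * B from funext hh]
  have : HasDerivAt (fun t : ℝ => A + t * B) (1 * B) 0 :=
    ((hasDerivAt_id 0).mul_const B).const_add A
  rw [this.deriv, one_mul]

theorem SmoothZ.mdiff {F : D.ZPrime → ℝ} (hF : D.SmoothZ F) (p : D.TZX) :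
    MDifferentiableAt (𝓘(ℝ, EX).prod 𝓘(ℝ, EZ)) 𝓘(ℝ, ℝ) (fun q : D.TZX => F (D.proj q)) p :=
  (hF p).mdifferentiableAt (by simp)

theorem affineFn_mdiff (f : Fn EZ Z) (φ : Fn EX X) (p : D.TZX) :
    MDifferentiableAt (𝓘(ℝ, EX).prod 𝓘(ℝ, EZ)) 𝓘(ℝ, ℝ) (D.affineFn f φ) p :=
  (affineFn_contMDiffAt f φ p).mdifferentiableAt (by simp)

theorem mdiff_fib {G : D.TZX → ℝ} {x : X} {v : Tan EZ (D.ptZ x)}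
    (hG : MDifferentiableAt (𝓘(ℝ, EX).prod 𝓘(ℝ, EZ)) 𝓘(ℝ, ℝ) G ⟨x, v⟩) :
    MDifferentiableAt 𝓘(ℝ, EZ) 𝓘(ℝ, ℝ) (fun e => G (D.fib x e))
      (Tc (D.ptZ x) (D.ptZ x) v : EZ) := by
  rw [← fib_Tc] at hG
  exact MDifferentiableAt.comp (Tc (D.ptZ x) (D.ptZ x) v : EZ) hG
    ((contMDiffAt_fib x _).mdifferentiableAt (by simp))

theorem fib_add (x : X) (v w : Tan EZ (D.ptZ x)) (t : ℝ) :
    D.fib x (Tc (D.ptZ x) (D.ptZ x) v + t • Tc (D.ptZ x) (D.ptZ x) w) = ⟨x, v + t • w⟩ := by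
  rw [← map_smul, ← map_add]
  exact fib_Tc x _

theorem mdiff_vsec (f : Fn EZ Z) (x : X) (v : Tan EQ (D.ptQ x)) :
    MDifferentiableAt 𝓘(ℝ, EX) 𝓘(ℝ, ℝ)
      (fun y => diff EZ f (D.ptZ y) (D.qZ y (D.vsec x v y))) x :=
  (CovNear.apply contMDiff_ptZ.continuous (covNear_diff contMDiff_ptZ f x)
    (vecNear_vsec x v)).mdiff

/-- The differentials of functions that represent an extension of `bar a`. -/
theorem Represents.diff_eq {F : D.ZPrime → ℝ} (hF : D.SmoothZ F) {a : ∀ x, D.Etil x}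
    (hFa : ∀ m, F (D.iQPrime m) = D.bar a m) {x : X} {v : Tan EQ (D.ptQ x)} {f : Fn EZ Z}
    {φ : Fn EX X} (h : D.Represents F ⟨x, D.qZ x v⟩ f φ) :
    (∀ u, diff EZ f (D.ptZ x) (D.qZ x u) = (a x : Cot EQ (D.ptQ x)) u) ∧
    ∀ w : Tan EX x, diff EX (fun y => diff EZ f (D.ptZ y) (D.qZ y (D.vsec x v y))) x w +
      diff EX φ x w = diff EX (fun y => (a y : Cot EQ (D.ptQ y)) (D.vsec x v y)) x w := by
  have hm := hF.mdiff ⟨x, D.qZ x v⟩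
  have ha := affineFn_mdiff (D := D) f φ ⟨x, D.qZ x v⟩
  obtain ⟨h1, h2⟩ := (tzx_ext x v hm ha).1 h.2
  have hval : ∀ y (u : Tan EQ (D.ptQ y)), F (D.proj ⟨y, D.qZ y u⟩) =
      (a y : Cot EQ (D.ptQ y)) u := fun y u => hFa ⟨y, Submodule.Quotient.mk u⟩
  constructor
  · intro u
    have e1 := diff_line (mdiff_fib hm) (Tc (D.ptZ x) (D.ptZ x) (D.qZ x u))
      (A := (a x : Cot EQ (D.ptQ x)) v) (B := (a x : Cot EQ (D.ptQ x)) u) fun t => by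
        rw [fib_add, ← map_smul, ← map_add, hval, map_add, map_smul]
        rfl
    have e2 := diff_line (mdiff_fib ha) (Tc (D.ptZ x) (D.ptZ x) (D.qZ x u))
      (A := diff EZ f (D.ptZ x) (D.qZ x v) + φ x) (B := diff EZ f (D.ptZ x) (D.qZ x u))
      fun t => by
        rw [fib_add]
        change diff EZ f (D.ptZ x) (D.qZ x v + t • D.qZ x u) + φ x = _
        rw [map_add, map_smul, smul_eq_mul]
        ring
    exact e2.symm.trans ((h2 _).symm.trans e1)
  · intro w
    have e1 := h1 w
    have e2 : (fun y => F (D.proj (D.horiz x v y))) =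
        fun y => (a y : Cot EQ (D.ptQ y)) (D.vsec x v y) := funext fun y => hval y _
    rw [e2] at e1
    rw [e1]
    have e3 := diff_add' (mdiff_vsec f x v) (fn_mdiff φ x)
    exact (DFunLike.congr_fun e3 w).symm

variable (hD : D.IsConstraint)
include hD

theorem IsConstraint.exists_fn_X {x : X} {a : Cot EZ (D.ptZ x)}
    (ha : ∀ w, a (D.tXZ x w) = 0) :
    ∃ g : Fn EZ Z, (∀ y, g (D.ptZ y) = 0) ∧ diff EZ g (D.ptZ x) = a := by
  obtain ⟨n, hn, hs⟩ := hD.extendsZ.exists_conormal x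
  have h := hs.self_of_nhds a (by
    intro w
    have := ha w
    rw [tXZ_eq] at this
    exact this)
  refine ⟨∑ k, a (Ti (D.ptZ x) (D.ptZ x) (Module.finBasis ℝ EZ k)) • n k, fun q => ?_, ?_⟩
  · rw [fn_sum_apply]
    exact Finset.sum_eq_zero fun k _ => mul_eq_zero_of_right _ (hn k q)
  · rw [diff_sum]
    refine Eq.trans ?_ h.symm
    exact Finset.sum_congr rfl fun k _ => diff_smul _ _ _

omit hD in
theorem diff_tXZ {f : Fn EZ Z} {x : X} (hf : ∀ᶠ y in 𝓝 x, f (D.ptZ y) = 0) (w : Tan EX x) :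
    diff EZ f (D.ptZ x) (D.tXZ x w) = 0 := by
  have h := DFunLike.congr_fun (diff_comp_fn f D.zmap x) w
  rw [← tXZ_eq] at h
  refine Eq.trans h.symm ?_
  have e : diff EX (f.comp D.zmap : Fn EX X) x = 0 :=
    (diff_congr (g := fun _ => (0 : ℝ)) hf).trans (diff_const 0 x)
  rw [e]
  rfl

/-- The fibre derivative of `F` kills `TX`, because `F` is a function on the quotient. Hence it is
the differential of some `f` vanishing on `X`, and `φ` accounts for the remaining derivative along
the section through `v`. -/
theorem IsConstraint.exists_represents {F : D.ZPrime → ℝ} (hF : D.SmoothZ F) (x : X)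
    (v : Tan EQ (D.ptQ x)) : ∃ f φ, D.Represents F ⟨x, D.qZ x v⟩ f φ := by
  have hm := hF.mdiff ⟨x, D.qZ x v⟩
  set e₀ : EZ := Tc (D.ptZ x) (D.ptZ x) (D.qZ x v) with he₀
  set ℓ : Cot EZ (D.ptZ x) :=
    (diff EZ (fun e => F (D.proj (D.fib x e))) e₀ : EZ →L[ℝ] ℝ).comp (Tc (D.ptZ x) (D.ptZ x))
  obtain ⟨f, hf, hdf⟩ := hD.exists_fn_X (x := x) (a := ℓ) fun w => by
    refine diff_line (mdiff_fib hm) (Tc (D.ptZ x) (D.ptZ x) (D.tXZ x w))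
      (A := F (D.proj ⟨x, D.qZ x v⟩)) (B := 0) fun t => ?_
    rw [fib_add, mul_zero, add_zero]
    congr 1
    refine congrArg (Sigma.mk x) ?_
    refine (Submodule.Quotient.eq _).2 ?_
    refine ⟨t • w, ?_⟩
    change D.tXZ x (t • w) = D.qZ x v + t • D.tXZ x w - D.qZ x v
    rw [map_smul, add_sub_cancel_left]
  obtain ⟨φ, hφ⟩ := exists_fn_diff x
    (diff EX (fun y => F (D.proj (D.horiz x v y))) x -
      diff EX (fun y => diff EZ f (D.ptZ y) (D.qZ y (D.vsec x v y))) x)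
  have ha := affineFn_mdiff (D := D) f φ ⟨x, D.qZ x v⟩
  refine ⟨f, φ, hf, (tzx_ext x v hm ha).2 ⟨fun w => ?_, fun w => ?_⟩⟩
  · have e3 := diff_add' (mdiff_vsec f x v) (fn_mdiff φ x)
    rw [hφ, add_sub_cancel] at e3
    exact (DFunLike.congr_fun e3 w).symm
  · have e2 := diff_line (mdiff_fib ha) w
      (A := diff EZ f (D.ptZ x) (D.qZ x v) + φ x) (B := ℓ (Ti (D.ptZ x) (D.ptZ x) w))
      fun t => by
        have h1 : w = Tc (D.ptZ x) (D.ptZ x) (Ti (D.ptZ x) (D.ptZ x) w) :=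
          (Tc_Ti (mem_chart_source EZ (D.ptZ x)) w).symm
        conv_lhs => rw [h1]
        rw [fib_add]
        change diff EZ f (D.ptZ x) (D.qZ x v + t • Ti (D.ptZ x) (D.ptZ x) w) + φ x = _
        rw [map_add, map_smul, smul_eq_mul, hdf]
        ring
    refine Eq.trans ?_ e2.symm
    exact (congrArg (diff EZ (fun e => F (D.proj (D.fib x e))) e₀ : EZ →L[ℝ] ℝ)
      (Tc_Ti (mem_chart_source EZ (D.ptZ x)) w)).symm

theorem IsConstraint.ham_mem_tX {f : Fn EZ Z} {x : X}
    (hf : ∀ w, diff EZ f (D.ptZ x) (D.tXZ x w) = 0) :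
    ∃ a, D.tXZ x a = D.poisson.ham f (D.ptZ x) := by
  obtain ⟨V, hV⟩ := hD.anchor_mem hf
  exact ⟨-V, by rw [map_neg, ← hV, neg_neg]; rfl⟩

/-- On `Q'` the default value in the definition of `swBracket` is never used. -/
theorem IsConstraint.nonempty_bracketData {F G : D.ZPrime → ℝ} (hF : D.SmoothZ F)
    (hG : D.SmoothZ G) (m : D.QPrime) : Nonempty (D.BracketData F G (D.iQPrime m)) := by
  obtain ⟨x, m⟩ := m
  induction m using Submodule.Quotient.induction_on with
  | H v =>
    obtain ⟨f, φ, hf⟩ := hD.exists_represents hF x v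
    obtain ⟨g, ψ, hg⟩ := hD.exists_represents hG x v
    obtain ⟨a, ha⟩ := hD.ham_mem_tX (f := f) (x := x)
      (diff_tXZ (Eventually.of_forall fun y => hf.1 y))
    obtain ⟨b, hb⟩ := hD.ham_mem_tX (f := g) (x := x)
      (diff_tXZ (Eventually.of_forall fun y => hg.1 y))
    exact ⟨⟨⟨x, D.qZ x v⟩, f, g, φ, ψ, a, b, rfl, hf, hg, ha, hb⟩⟩

/-- Brackets of functions with admissible differential depend only on the fibrewise linear
function on `Q'` up to a correction by a function on the base. -/
theorem IsConstraint.diff_bracket_rep {x : X} {v : Tan EQ (D.ptQ x)} {f g g₁ : Fn EZ Z}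
    {ψ : Cot EX x} {w : Tan EX x} {a : Cot EQ (D.ptQ x)} (ha : D.Adm x a)
    (hf : ∀ u, diff EZ f (D.ptZ x) (D.qZ x u) = a u)
    (hw : D.tXZ x w = D.poisson.ham f (D.ptZ x))
    (h1 : ∀ u, diff EZ g (D.ptZ x) (D.qZ x u) = diff EZ g₁ (D.ptZ x) (D.qZ x u))
    (h2 : ∀ w : Tan EX x, diff EX (fun y => diff EZ g (D.ptZ y) (D.qZ y (D.vsec x v y))) x w +
      ψ w = diff EX (fun y => diff EZ g₁ (D.ptZ y) (D.qZ y (D.vsec x v y))) x w) :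
    diff EZ (D.poisson.bracket f g) (D.ptZ x) (D.qZ x v) =
      diff EZ (D.poisson.bracket f g₁) (D.ptZ x) (D.qZ x v) + ψ w := by
  set P := D.poisson
  -- Decompose `g = g₁ + g' + g₀` with `g'` vanishing on `Q` and `g₀` critical at `x`. Admissibility
  -- disposes of `g'`, and the correction `ψ w` comes from `g₀`.
  obtain ⟨g', hg', he⟩ := hD.exists_fn_van (x := x) (a := diff EZ (g - g₁ : Fn EZ Z) (D.ptZ x))
    fun u => by
      rw [diff_sub]
      exact sub_eq_zero.2 (h1 u)
  set g₀ : Fn EZ Z := g - g₁ - g' with hg₀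
  have hdg₀ : diff EZ g₀ (D.ptZ x) = 0 := by rw [hg₀, diff_sub, he, sub_self]
  have hsum : g = g₁ + (g' + g₀) := by rw [hg₀]; abel
  have hb : P.bracket f g = P.bracket f g₁ + (P.bracket f g' + P.bracket f g₀) := by
    rw [← P.bracket_add_right, ← P.bracket_add_right, ← hsum]
  have e1 : diff EZ (P.bracket f g') (D.ptZ x) (D.qZ x v) = 0 := ha f hf g' hg' v
  have e2 : diff EZ (P.bracket f g₀) (D.ptZ x) (D.qZ x v) = ψ w := by
    have e3 : ∀ y u, diff EZ g (D.ptZ y) (D.qZ y u) =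
        diff EZ g₁ (D.ptZ y) (D.qZ y u) + diff EZ g₀ (D.ptZ y) (D.qZ y u) := fun y u => by
      have h3 : diff EZ g' (D.ptZ y) (D.qZ y u) = 0 := hD.diff_tQ hg' (D.ptQ y) u
      rw [hg₀, diff_sub, diff_sub]
      change _ = _ + (diff EZ g (D.ptZ y) (D.qZ y u) - diff EZ g₁ (D.ptZ y) (D.qZ y u) -
        diff EZ g' (D.ptZ y) (D.qZ y u))
      rw [h3]
      ring
    have e4 := h2 w
    rw [funext fun y => e3 y (D.vsec x v y), diff_add' (mdiff_vsec g₁ x v)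
      (mdiff_vsec g₀ x v)] at e4
    have e5 : diff EX (fun y => diff EZ g₀ (D.ptZ y) (D.qZ y (D.vsec x v y))) x w = - ψ w := by
      have e4' : diff EX (fun y => diff EZ g₁ (D.ptZ y) (D.qZ y (D.vsec x v y))) x w +
        diff EX (fun y => diff EZ g₀ (D.ptZ y) (D.qZ y (D.vsec x v y))) x w + ψ w =
        diff EX (fun y => diff EZ g₁ (D.ptZ y) (D.qZ y (D.vsec x v y))) x w := e4
      linarith
    -- The differential of `{f, g₀}` is minus the second derivative of `g₀` in the direction `X_f =
    -- w`. As this direction is tangent to `X`, it is a derivative along `X` of `dg₀` on the section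
    -- through `v`.
    have e6 := hess_deriv g₀ (c := D.ptZ) (y := x)
      (contMDiff_ptZ.contMDiffAt.mdifferentiableAt (by simp))
      (v := fun y => D.qZ y (D.vsec x v y)) (SmoothNear.mdiff (vecNear_vsec x v)) hdg₀ w
    rw [P.diff_bracket_right hdg₀, ← hw, hess_symm]
    have e7 : hess EZ g₀ (D.ptZ x) (D.tXZ x w) (D.qZ x v) =
        diff EX (fun y => diff EZ g₀ (D.ptZ y) (D.qZ y (D.vsec x v y))) x w := by
      rw [e6, vsec_self, tXZ_eq]
      rfl
    rw [e7, e5, neg_neg]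
  rw [hb, diff_add, diff_add]
  change _ + (diff EZ (P.bracket f g') (D.ptZ x) (D.qZ x v) +
    diff EZ (P.bracket f g₀) (D.ptZ x) (D.qZ x v)) = _
  rw [e1, e2, zero_add]
  rfl

end ConstraintData

end

/-! ### The bracket of `Z'` on `Q'` and the reduced bracket of fibrewise linear functions. -/

noncomputable section

namespace ConstraintData

variable {EX X ES S EQ Q EZ Z : Type*}
    [NormedAddCommGroup EX] [NormedSpace ℝ EX] [FiniteDimensional ℝ EX]
    [TopologicalSpace X] [ChartedSpace EX X] [IsManifold 𝓘(ℝ, EX) ∞ X]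
    [T2Space X] [SecondCountableTopology X]
    [NormedAddCommGroup ES] [NormedSpace ℝ ES] [FiniteDimensional ℝ ES]
    [TopologicalSpace S] [ChartedSpace ES S] [IsManifold 𝓘(ℝ, ES) ∞ S]
    [T2Space S] [SecondCountableTopology S]
    [NormedAddCommGroup EQ] [NormedSpace ℝ EQ] [FiniteDimensional ℝ EQ]
    [TopologicalSpace Q] [ChartedSpace EQ Q] [IsManifold 𝓘(ℝ, EQ) ∞ Q]
    [T2Space Q] [SecondCountableTopology Q]
    [NormedAddCommGroup EZ] [NormedSpace ℝ EZ] [FiniteDimensional ℝ EZ]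
    [TopologicalSpace Z] [ChartedSpace EZ Z] [IsManifold 𝓘(ℝ, EZ) ∞ Z]
    [T2Space Z] [SecondCountableTopology Z]
    {D : ConstraintData EX X ES S EQ Q EZ Z}

variable (hD : D.IsConstraint)
include hD

theorem IsConstraint.ham_congr {f g : Fn EZ Z} {x : X}
    (h : ∀ u, diff EZ f (D.ptZ x) (D.qZ x u) = diff EZ g (D.ptZ x) (D.qZ x u)) :
    D.poisson.ham f (D.ptZ x) = D.poisson.ham g (D.ptZ x) := by
  have h0 : D.poisson.ham (f - g) (D.ptZ x) = 0 := hD.ham_zero_ptZ fun u => by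
    rw [diff_sub]
    exact sub_eq_zero.2 (h (D.sQ x u))
  rw [PoissonStructure.ham_eq, diff_sub, map_sub] at h0
  exact sub_eq_zero.1 h0

/-- The bracket is evaluated with data chosen arbitrarily, over a vector that need not be the given
one. Modulo `TX` they agree, whence the term `w`. Statements about the bracket must therefore be
proved for all data. -/
theorem IsConstraint.swBracket_spec {F G : D.ZPrime → ℝ} (hF : D.SmoothZ F) (hG : D.SmoothZ G)
    (x : X) (v : Tan EQ (D.ptQ x)) :
    ∃ (w : Tan EX x) (f g : Fn EZ Z) (φ ψ : Fn EX X) (a b : Tan EX x),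
      D.Represents F ⟨x, D.qZ x (v + D.tXQ x w)⟩ f φ ∧
      D.Represents G ⟨x, D.qZ x (v + D.tXQ x w)⟩ g ψ ∧
      D.tXZ x a = D.poisson.ham f (D.ptZ x) ∧ D.tXZ x b = D.poisson.ham g (D.ptZ x) ∧
      D.swBracket F G (D.iQPrime ⟨x, Submodule.Quotient.mk v⟩) =
        diff EZ (D.poisson.bracket f g) (D.ptZ x) (D.qZ x (v + D.tXQ x w)) -
          diff EX ψ x a + diff EX φ x b := by
  have hne := hD.nonempty_bracketData hF hG ⟨x, Submodule.Quotient.mk v⟩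
  rw [swBracket, dif_pos hne]
  generalize hne.some = B
  obtain ⟨⟨x', p⟩, f, g, φ, ψ, a, b, hp, hf, hg, ha, hb⟩ := B
  obtain ⟨h1, h2⟩ := Sigma.mk.inj_iff.1 hp
  dsimp only at h1
  subst h1
  obtain ⟨p', hpp⟩ : ∃ p' : Tan EZ (D.ptZ x'), p' = p := ⟨p, rfl⟩
  subst hpp
  obtain ⟨w, hw⟩ := (Submodule.Quotient.eq _).1 (eq_of_heq h2)
  have hp' : p' = D.qZ x' (v + D.tXQ x' w) := by
    rw [map_add, ← tXZ_qZ]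
    have hw' : D.tXZ x' w = p' - D.qZ x' v := hw
    rw [hw']
    exact (add_sub_cancel (D.qZ x' v) p').symm
  exact ⟨w, f, g, φ, ψ, a, b, by rw [← hp']; exact hf, by rw [← hp']; exact hg, ha, hb, by
    rw [← hp']; rfl⟩

/-- `diff_bracket_rep` with comparison function `0` shows that `d{f, g}` contributes exactly the
derivative of `ψ` along `X_f`, which the second term of the bracket cancels. The third term drops
out since `X_g = 0`. -/
theorem IsConstraint.swBracket_van {F G : D.ZPrime → ℝ} (hF : D.SmoothZ F) (hG : D.SmoothZ G)
    {a : ∀ x, D.Etil x} (hFa : ∀ m, F (D.iQPrime m) = D.bar a m)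
    (ha : ∀ x, D.Adm x (a x : Cot EQ (D.ptQ x))) (hG0 : ∀ m, G (D.iQPrime m) = 0) (m : D.QPrime) :
    D.swBracket F G (D.iQPrime m) = 0 := by
  obtain ⟨x, m⟩ := m
  induction m using Submodule.Quotient.induction_on with
  | H v =>
    obtain ⟨w, f, g, φ, ψ, A, B, hf, hg, hA, hB, e⟩ := hD.swBracket_spec hF hG x v
    obtain ⟨f1, -⟩ := hf.diff_eq hF hFa
    have hz : ∀ m, G (D.iQPrime m) = D.bar (fun y => (0 : D.Etil y)) m := fun m => by
      rw [hG0]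
      obtain ⟨y, m⟩ := m
      induction m using Submodule.Quotient.induction_on with
      | H u => rfl
    obtain ⟨g1, g2⟩ := hg.diff_eq hG hz
    have d0 : ∀ y, diff EZ (0 : Fn EZ Z) (D.ptZ y) = 0 := fun y => diff_zero _
    have e1 := hD.diff_bracket_rep (g₁ := 0) (ψ := diff EX ψ x) (ha x) f1 hA (fun u => by
      rw [g1, d0]; rfl) (fun w => by
      rw [g2]
      congr 2
      funext y
      rw [d0]
      rfl)
    have b0 : D.poisson.bracket f (0 : Fn EZ Z) = 0 := by
      have := D.poisson.bracket_sub_right f 0 0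
      rwa [sub_self, sub_self] at this
    rw [b0, d0] at e1
    have hg0 : D.poisson.ham g (D.ptZ x) = 0 := hD.ham_zero_ptZ fun u => g1 (D.sQ x u)
    have hB0 : B = 0 := hD.tXZ_injective x (by rw [hB, hg0, map_zero])
    rw [e, e1, hB0, map_zero, add_zero]
    change (0 : ℝ) + _ - _ = 0
    ring

/-- The reduced bracket of fibrewise linear functions, in terms of functions on `Z`. -/
theorem IsConstraint.swBracket_eq {F G : D.ZPrime → ℝ} (hF : D.SmoothZ F) (hG : D.SmoothZ G)
    {a b : ∀ x, D.Etil x} (hFa : ∀ m, F (D.iQPrime m) = D.bar a m)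
    (hGb : ∀ m, G (D.iQPrime m) = D.bar b m)
    (ha : ∀ x, D.Adm x (a x : Cot EQ (D.ptQ x))) (hb : ∀ x, D.Adm x (b x : Cot EQ (D.ptQ x)))
    {x : X} {f₁ g₁ : Fn EZ Z}
    (hf₁ : ∀ᶠ y in 𝓝 x, ∀ u, diff EZ f₁ (D.ptZ y) (D.qZ y u) = (a y : Cot EQ (D.ptQ y)) u)
    (hg₁ : ∀ᶠ y in 𝓝 x, ∀ u, diff EZ g₁ (D.ptZ y) (D.qZ y u) = (b y : Cot EQ (D.ptQ y)) u)
    (v : Tan EQ (D.ptQ x)) :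
    D.swBracket F G (D.iQPrime ⟨x, Submodule.Quotient.mk v⟩) =
      diff EZ (D.poisson.bracket f₁ g₁) (D.ptZ x) (D.qZ x v) := by
  obtain ⟨w, f, g, φ, ψ, A, B, hf, hg, hA, hB, e⟩ := hD.swBracket_spec hF hG x v
  obtain ⟨f1, f2⟩ := hf.diff_eq hF hFa
  obtain ⟨g1, g2⟩ := hg.diff_eq hG hGb
  set v' := v + D.tXQ x w with hv'
  have f1x := hf₁.self_of_nhds
  have g1x := hg₁.self_of_nhds
  have cf : diff EX (fun y => (a y : Cot EQ (D.ptQ y)) (D.vsec x v' y)) x =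
      diff EX (fun y => diff EZ f₁ (D.ptZ y) (D.qZ y (D.vsec x v' y))) x :=
    diff_congr (by filter_upwards [hf₁] with y hy using (hy _).symm)
  have cg : diff EX (fun y => (b y : Cot EQ (D.ptQ y)) (D.vsec x v' y)) x =
      diff EX (fun y => diff EZ g₁ (D.ptZ y) (D.qZ y (D.vsec x v' y))) x :=
    diff_congr (by filter_upwards [hg₁] with y hy using (hy _).symm)
  -- First `g` is replaced by `g₁`, then in `e2` `f` by `f₁` with the arguments exchanged. The two
  -- corrections cancel the base terms of the bracket.
  have e1 := hD.diff_bracket_rep (g₁ := g₁) (ψ := diff EX ψ x) (ha x) f1 hA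
    (fun u => (g1 u).trans (g1x u).symm) (fun w => by rw [g2, cg])
  have hB' : D.tXZ x B = D.poisson.ham g₁ (D.ptZ x) :=
    hB.trans (hD.ham_congr fun u => (g1 u).trans (g1x u).symm)
  have e2 := hD.diff_bracket_rep (f := g₁) (g := f) (g₁ := f₁) (ψ := diff EX φ x) (hb x) g1x hB'
    (fun u => (f1 u).trans (f1x u).symm) (fun w => by rw [f2, cf])
  have sk : ∀ h k : Fn EZ Z, diff EZ (D.poisson.bracket h k) (D.ptZ x) (D.qZ x v') =
      - diff EZ (D.poisson.bracket k h) (D.ptZ x) (D.qZ x v') := fun h k => by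
    have : diff EZ (D.poisson.bracket h k) (D.ptZ x) =
        - diff EZ (D.poisson.bracket k h) (D.ptZ x) := by
      rw [D.poisson.bracket_skew h k]
      exact diff_neg' (fn_mdiff _ _)
    rw [this]
    rfl
  -- `X_{g₁}` is tangent to `X` and `df₁` kills `TX`, so `{f₁, g₁}` vanishes along `X` near `x`. The
  -- ambiguity `w` of the chosen vector is harmless.
  have e3 : diff EZ (D.poisson.bracket f₁ g₁) (D.ptZ x) (D.tXZ x w) = 0 := by
    refine diff_tXZ ?_ w
    filter_upwards [hf₁, hg₁] with y hfy hgy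
    obtain ⟨c, hc⟩ := hD.ham_mem_tX (f := g₁) (x := y) fun w => by
      rw [tXZ_qZ, hgy]
      exact Etil_tXQ _ _
    rw [PoissonStructure.bracket_apply, ← hc, tXZ_qZ, hfy]
    exact Etil_tXQ _ _
  have e4 : diff EZ (D.poisson.bracket f₁ g₁) (D.ptZ x) (D.qZ x v') =
      diff EZ (D.poisson.bracket f₁ g₁) (D.ptZ x) (D.qZ x v) := by
    rw [hv', map_add, map_add, ← tXZ_qZ, e3, add_zero]
  rw [e, e1, sk f g₁, e2, sk g₁ f₁, e4]
  ring

/-- Sections of `Ẽ` extend to fibrewise linear functions on `Z'`. -/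
theorem IsConstraint.exists_extension {a : ∀ x, D.Etil x} (ha : D.SmoothSec (fun x => a x)) :
    ∃ F : D.ZPrime → ℝ, D.SmoothZ F ∧ ∀ m, F (D.iQPrime m) = D.bar a m := by
  have : LocallyCompactSpace X := ChartedSpace.locallyCompactSpace EX X
  have : SigmaCompactSpace X := sigmaCompactSpace_of_locallyCompact_secondCountable
  choose ρ hρ hρV hρc using fun x₀ => hD.exists_leftInv_tQ x₀
  have hcov : ∀ i, CovNear (EX := EX) D.ptZ
      (fun x => (a x : Cot EQ (D.ptQ x)).comp (ρ i x)) i := fun i => hρc i _ (ha.covNear i)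
  set U : X → Set X := fun i => interior {y | CovNear (EX := EX) D.ptZ
      (fun x => (a x : Cot EQ (D.ptQ x)).comp (ρ i x)) y}
  obtain ⟨χ, hχ⟩ := SmoothPartitionOfUnity.exists_isSubordinate 𝓘(ℝ, EX) (isClosed_univ (X := X)) U
    (fun i => isOpen_interior) fun i _ => Set.mem_iUnion.2
      ⟨i, mem_interior_iff_mem_nhds.2 (CovNear.near contMDiff_ptZ (hcov i))⟩
  -- Composition with a left inverse of `TQ → TZ` extends the covector to `TZ` without changing it
  -- on `TX`, so it passes to the quotient. The local extensions are averaged by a partition of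
  -- unity.
  set B : ∀ (i x : X), D.EDual x →ₗ[ℝ] ℝ := fun i x =>
    Submodule.liftQ _ ((a x : Cot EQ (D.ptQ x)).comp (ρ i x)).toLinearMap (by
      rintro _ ⟨w, rfl⟩
      change (a x : Cot EQ (D.ptQ x)) (ρ i x (D.qZ x (D.tXQ x w))) = 0
      have h1 : ρ i x (D.qZ x (D.tXQ x w)) = D.tXQ x w := hρ i x _
      rw [h1]
      exact Etil_tXQ _ _)
  refine ⟨fun m => ∑ᶠ i, χ i m.1 * B i m.1 m.2, fun p => ?_, fun m => ?_⟩
  · change ContMDiffAt _ _ _ (fun q : D.TZX => ∑ᶠ i, χ i q.1 *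
      ((a q.1 : Cot EQ (D.ptQ q.1)).comp (ρ i q.1)) (D.vec q)) p
    refine _root_.contMDiffAt_finsum (f := fun i (q : D.TZX) => χ i q.1 *
      ((a q.1 : Cot EQ (D.ptQ q.1)).comp (ρ i q.1)) (D.vec q)) ?_ fun i => ?_
    · refine (χ.locallyFinite.preimage_continuous (tzx_continuous_fst (D := D))).subset
        fun i q hq => ?_
      intro h0
      apply hq
      change χ i q.1 * _ = 0
      rw [h0, zero_mul]
    · by_cases hp : p.1 ∈ tsupport (χ i)
      · have hc : p.1 ∈ {y | CovNear (EX := EX) D.ptZ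
            (fun x => (a x : Cot EQ (D.ptQ x)).comp (ρ i x)) y} := interior_subset (hχ i hp)
        exact (ContMDiffAt.comp p ((χ i).contMDiff p.1) (tzx_contMDiffAt_fst p)).mul
          (contMDiffAt_tzx_cov hc)
      · refine (contMDiffAt_const (c := (0 : ℝ))).congr_of_eventuallyEq ?_
        have h0 := (tzx_continuous_fst (D := D)).continuousAt.eventually
          ((isClosed_tsupport (χ i)).isOpen_compl.mem_nhds hp)
        filter_upwards [h0] with q hq
        rw [image_eq_zero_of_notMem_tsupport hq, zero_mul]
  · obtain ⟨x, m⟩ := m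
    induction m using Submodule.Quotient.induction_on with
    | H v =>
      change ∑ᶠ i, χ i x * (a x : Cot EQ (D.ptQ x)) (ρ i x (D.qZ x v)) =
        (a x : Cot EQ (D.ptQ x)) v
      have h1 : ∀ i, ρ i x (D.qZ x v) = v := fun i => hρ i x v
      simp only [h1]
      rw [← finsum_mul, χ.sum_eq_one (Set.mem_univ x), one_mul]

theorem IsConstraint.ptilPrime_bar {a : ∀ x, D.Etil x} (ha : D.SmoothSec (fun x => a x))
    (ha' : ∀ x, D.Adm x (a x : Cot EQ (D.ptQ x))) : D.PtilPrime (D.bar a) := by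
  obtain ⟨F, hF, hFa⟩ := hD.exists_extension ha
  exact ⟨F, ⟨hF, fun G hG m => hD.swBracket_van hF hG.1 hFa ha' hG.2 m⟩, hFa⟩

/-- `redBracket` selects some admissible extensions; the value is the right one because
`swBracket_eq` holds for all extensions. -/
theorem IsConstraint.redBracket_bar {a b : ∀ x, D.Etil x} (ha : D.SmoothSec (fun x => a x))
    (ha' : ∀ x, D.Adm x (a x : Cot EQ (D.ptQ x))) (hb : D.SmoothSec (fun x => b x))
    (hb' : ∀ x, D.Adm x (b x : Cot EQ (D.ptQ x))) {x : X} {f₁ g₁ : Fn EZ Z}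
    (hf₁ : ∀ᶠ y in 𝓝 x, ∀ u, diff EZ f₁ (D.ptZ y) (D.qZ y u) = (a y : Cot EQ (D.ptQ y)) u)
    (hg₁ : ∀ᶠ y in 𝓝 x, ∀ u, diff EZ g₁ (D.ptZ y) (D.qZ y u) = (b y : Cot EQ (D.ptQ y)) u)
    (v : Tan EQ (D.ptQ x)) :
    D.redBracket (D.bar a) (D.bar b) ⟨x, Submodule.Quotient.mk v⟩ =
      diff EZ (D.poisson.bracket f₁ g₁) (D.ptZ x) (D.qZ x v) := by
  have h : D.PtilPrime (D.bar a) ∧ D.PtilPrime (D.bar b) :=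
    ⟨hD.ptilPrime_bar ha ha', hD.ptilPrime_bar hb hb'⟩
  unfold redBracket
  rw [dif_pos h]
  exact hD.swBracket_eq h.1.choose_spec.1.1 h.2.choose_spec.1.1 h.1.choose_spec.2
    h.2.choose_spec.2 ha' hb' hf₁ hg₁ v

end ConstraintData

end

/-! ### Exponentials of derivations, and invariants of `C` in infinitesimal form. -/

noncomputable section

section LieData

variable {𝔤 : Type*} [LieRing 𝔤] [LieAlgebra ℝ 𝔤] [Module.Finite ℝ 𝔤]

variable (𝔤) in
/-- The coordinate space of a finite-dimensional real Lie algebra. -/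
abbrev Coord := Fin (Module.finrank ℝ 𝔤) → ℝ

variable (𝔤) in
/-- Linear coordinates on a finite-dimensional real Lie algebra. -/
def coord : 𝔤 ≃ₗ[ℝ] Coord 𝔤 := (Module.finBasis ℝ 𝔤).equivFun

variable (𝔤) in
/-- Linear endomorphisms in coordinates, as bounded operators. -/
def opCoord : Module.End ℝ 𝔤 ≃ₐ[ℝ] (Coord 𝔤 →L[ℝ] Coord 𝔤) :=
  (LinearEquiv.conjAlgEquiv ℝ (coord 𝔤)).trans (Module.End.toContinuousLinearMap (Coord 𝔤))

theorem opCoord_apply (A : Module.End ℝ 𝔤) (ξ : 𝔤) : opCoord 𝔤 A (coord 𝔤 ξ) = coord 𝔤 (A ξ) := by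
  change coord 𝔤 (A ((coord 𝔤).symm (coord 𝔤 ξ))) = _
  rw [LinearEquiv.symm_apply_apply]

/-- The exponential of a linear endomorphism. -/
def expEnd (A : Module.End ℝ 𝔤) : Module.End ℝ 𝔤 := (opCoord 𝔤).symm (NormedSpace.exp (opCoord 𝔤 A))

theorem opCoord_expEnd (A : Module.End ℝ 𝔤) :
    opCoord 𝔤 (expEnd A) = NormedSpace.exp (opCoord 𝔤 A) := (opCoord 𝔤).apply_symm_apply _

theorem expEnd_hasSum (A : Module.End ℝ 𝔤) (ξ : 𝔤) (l : Module.Dual ℝ 𝔤) :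
    HasSum (fun k : ℕ => ((k.factorial : ℝ))⁻¹ * l ((A ^ k) ξ)) (l (expEnd A ξ)) := by
  have h := NormedSpace.exp_series_hasSum_exp' (𝕂 := ℝ) (opCoord 𝔤 A)
  let L : (Coord 𝔤 →L[ℝ] Coord 𝔤) →L[ℝ] ℝ :=
    (LinearMap.toContinuousLinearMap (l ∘ₗ (coord 𝔤).symm.toLinearMap)).comp
      (ContinuousLinearMap.apply ℝ (Coord 𝔤) (coord 𝔤 ξ))
  have hL : ∀ T : Module.End ℝ 𝔤, L (opCoord 𝔤 T) = l (T ξ) := fun T => by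
    change l ((coord 𝔤).symm (opCoord 𝔤 T (coord 𝔤 ξ))) = _
    rw [opCoord_apply, LinearEquiv.symm_apply_apply]
  have h' := L.hasSum h
  rw [← opCoord_expEnd, hL] at h'
  convert h' using 2 with k
  rw [map_smul, ← map_pow, hL, smul_eq_mul]

theorem hasDerivAt_expEnd (A : Module.End ℝ 𝔤) (ξ : 𝔤) (l : Module.Dual ℝ 𝔤) :
    HasDerivAt (fun t : ℝ => l (expEnd (t • A) ξ)) (l (A ξ)) 0 := by
  have h := hasDerivAt_exp_smul_const (𝕂 := ℝ) (opCoord 𝔤 A) 0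
  let L : (Coord 𝔤 →L[ℝ] Coord 𝔤) →L[ℝ] ℝ :=
    (LinearMap.toContinuousLinearMap (l ∘ₗ (coord 𝔤).symm.toLinearMap)).comp
      (ContinuousLinearMap.apply ℝ (Coord 𝔤) (coord 𝔤 ξ))
  have hL : ∀ T : Module.End ℝ 𝔤, L (opCoord 𝔤 T) = l (T ξ) := fun T => by
    change l ((coord 𝔤).symm (opCoord 𝔤 T (coord 𝔤 ξ))) = _
    rw [opCoord_apply, LinearEquiv.symm_apply_apply]
  have h' := L.hasFDerivAt.comp_hasDerivAt (0 : ℝ) h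
  rw [zero_smul, NormedSpace.exp_zero, one_mul, hL] at h'
  have e : (fun t : ℝ => l (expEnd (t • A) ξ)) =
      L ∘ fun t : ℝ => NormedSpace.exp (t • opCoord 𝔤 A) := by
    funext t
    rw [Function.comp_apply, ← map_smul, ← opCoord_expEnd, hL]
  rw [e]
  exact h'

/-- Identifies the generators of `adGroup`, which are given only through componentwise convergent
series. -/
theorem eq_expEnd {A T : Module.End ℝ 𝔤} (h : ∀ (ξ : 𝔤) (l : Module.Dual ℝ 𝔤),
    HasSum (fun k : ℕ => ((k.factorial : ℝ))⁻¹ * l ((A ^ k) ξ)) (l (T ξ))) : T = expEnd A := by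
  ext ξ
  rw [← sub_eq_zero, ← Module.forall_dual_apply_eq_zero_iff ℝ]
  intro l
  rw [map_sub, (h ξ l).unique (expEnd_hasSum A ξ l), sub_self]

theorem expEnd_neg_mul (A : Module.End ℝ 𝔤) : expEnd (-A) * expEnd A = 1 := by
  apply (opCoord 𝔤).injective
  let _ : NormedAlgebra ℚ (Coord 𝔤 →L[ℝ] Coord 𝔤) := NormedAlgebra.restrictScalars ℚ ℝ _
  have hc : Commute (opCoord 𝔤 (-A)) (opCoord 𝔤 A) :=
    Commute.map ((Commute.refl A).neg_left) (opCoord 𝔤)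
  rw [map_mul, opCoord_expEnd, opCoord_expEnd, ← NormedSpace.exp_add_of_commute hc, ← map_add,
    neg_add_cancel, map_zero, NormedSpace.exp_zero, map_one]

variable {c : LieSubalgebra ℝ 𝔤}

theorem mem_of_dual {W : Submodule ℝ 𝔤} {ξ : 𝔤}
    (h : ∀ l : Module.Dual ℝ 𝔤, (∀ ζ ∈ W, l ζ = 0) → l ξ = 0) : ξ ∈ W := by
  by_contra hv
  obtain ⟨φ, h1, h2⟩ := Submodule.exists_le_ker_of_notMem hv
  exact h1 (h φ fun w hw => h2 hw)

theorem expEnd_mem_adGroup {ζ : 𝔤} (hζ : ζ ∈ c) : expEnd (LieAlgebra.ad ℝ 𝔤 ζ) ∈ adGroup c :=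
  Submonoid.subset_closure ⟨ζ, hζ, fun ξ l => expEnd_hasSum _ ξ l⟩

theorem adGroup_induction {p : Module.End ℝ 𝔤 → Prop} (h1 : p 1)
    (hm : ∀ S T, p S → p T → p (S * T))
    (he : ∀ ζ ∈ c, p (expEnd (LieAlgebra.ad ℝ 𝔤 ζ))) {T : Module.End ℝ 𝔤} (hT : T ∈ adGroup c) :
    p T := by
  induction hT using Submonoid.closure_induction with
  | mem T h =>
    obtain ⟨ζ, hζ, h⟩ := h
    rw [eq_expEnd h]
    exact he ζ hζ
  | one => exact h1
  | mul S T _ _ hS hT => exact hm S T hS hT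

theorem ad_pow_mem {ζ ξ : 𝔤} (hζ : ζ ∈ c) (hξ : ⁅ζ, ξ⁆ ∈ c) (k : ℕ) :
    ((LieAlgebra.ad ℝ 𝔤 ζ) ^ (k + 1)) ξ ∈ c := by
  induction k with
  | zero => simpa using hξ
  | succ k ih =>
    rw [pow_succ']
    exact c.lie_mem hζ ih

theorem expEnd_sub_mem {ζ ξ : 𝔤} (hζ : ζ ∈ c) (hξ : ⁅ζ, ξ⁆ ∈ c) :
    expEnd (LieAlgebra.ad ℝ 𝔤 ζ) ξ - ξ ∈ c := by
  refine mem_of_dual (W := c.toSubmodule) fun l hl => ?_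
  have h := expEnd_hasSum (LieAlgebra.ad ℝ 𝔤 ζ) ξ l
  have h0 : HasSum (fun k : ℕ => ((k.factorial : ℝ))⁻¹ * l (((LieAlgebra.ad ℝ 𝔤 ζ) ^ k) ξ))
      (((Nat.factorial 0 : ℝ))⁻¹ * l (((LieAlgebra.ad ℝ 𝔤 ζ) ^ 0) ξ)) := by
    refine hasSum_single 0 fun k hk => ?_
    obtain ⟨k, rfl⟩ := Nat.exists_eq_succ_of_ne_zero hk
    rw [hl _ (ad_pow_mem hζ hξ k), mul_zero]
  rw [map_sub, h.unique h0]
  simp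

/-- In one direction, differentiate the condition for `exp (t ad ζ)` at `t = 0`. In the other, all
terms of the exponential series after the first lie in `c`, and the property is inherited by
products. This is the identity `(𝔤/c)^C = N_𝔤(c)/c`. -/
theorem mem_invLift_iff {ξ : 𝔤} : ξ ∈ invLift c ↔ ∀ ζ ∈ c, ⁅ζ, ξ⁆ ∈ c := by
  constructor
  · intro h ζ hζ
    refine mem_of_dual (W := c.toSubmodule) fun l hl => ?_
    have hd := hasDerivAt_expEnd (LieAlgebra.ad ℝ 𝔤 ζ) ξ l
    have hc : (fun t : ℝ => l (expEnd (t • LieAlgebra.ad ℝ 𝔤 ζ) ξ)) = fun _ => l ξ := by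
      funext t
      rw [← map_smul, ← sub_eq_zero, ← map_sub]
      exact hl _ (h _ (expEnd_mem_adGroup (c.smul_mem t hζ)))
    rw [hc] at hd
    exact hd.unique (hasDerivAt_const 0 (l ξ))
  · intro h T hT
    refine adGroup_induction (c := c)
      (p := fun T => ∀ ξ : 𝔤, (∀ ζ ∈ c, ⁅ζ, ξ⁆ ∈ c) → T ξ - ξ ∈ c) (fun ξ _ => by simp)
      (fun S T hS hT ξ hξ => ?_) (fun ζ hζ ξ hξ => expEnd_sub_mem hζ (hξ ζ hζ)) hT ξ h
    have h1 := hT ξ hξ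
    have h2 := hS (T ξ) fun ζ hζ => by
      rw [← sub_add_cancel (T ξ) ξ, lie_add]
      exact c.add_mem (c.lie_mem hζ h1) (hξ ζ hζ)
    have h3 := c.add_mem h2 h1
    rwa [sub_add_sub_cancel] at h3

theorem le_invLift {ξ : 𝔤} (h : ξ ∈ c) : ξ ∈ invLift c :=
  mem_invLift_iff.2 fun _ hζ => c.lie_mem hζ h

/-- If `ad ζ` is skew for `B`, moving `exp (ad ζ)` to the other argument turns it into its inverse.
-/
theorem isInvForm_of_infinitesimal {B : LinearMap.BilinForm ℝ 𝔤} (hs : ∀ ξ η, B ξ η = B η ξ)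
    (h0 : ∀ ξ ∈ c, ∀ η, B ξ η = 0) (hi : ∀ ζ ∈ c, ∀ ξ η, B ⁅ζ, ξ⁆ η + B ξ ⁅ζ, η⁆ = 0) :
    IsInvForm c B := by
  refine ⟨hs, h0, fun T hT => ?_⟩
  refine adGroup_induction (c := c) (p := fun T => ∀ ξ η, B (T ξ) (T η) = B ξ η)
    (fun _ _ => rfl) (fun S T hS hT ξ η => (hS _ _).trans (hT _ _)) (fun ζ hζ => ?_) hT
  set A := LieAlgebra.ad ℝ 𝔤 ζ with hA
  have hpow : ∀ (k : ℕ) ξ η, B ((A ^ k) ξ) η = B ξ (((-A) ^ k) η) := by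
    intro k
    induction k with
    | zero => intro ξ η; rfl
    | succ k ih =>
      intro ξ η
      have e : B (A ((A ^ k) ξ)) η = B ((A ^ k) ξ) (-A η) := by
        rw [map_neg]
        exact eq_neg_of_add_eq_zero_left (hi ζ hζ _ _)
      rw [pow_succ', pow_succ]
      exact e.trans (ih _ _)
  have hB : ∀ ξ η, B (expEnd A ξ) η = B ξ (expEnd (-A) η) := fun ξ η => by
    have h1 := expEnd_hasSum A ξ (B.flip η)
    have h2 := expEnd_hasSum (-A) η (B ξ)
    refine h1.unique ?_
    convert h2 using 3 with k
    exact hpow k ξ η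
  intro ξ η
  rw [hB]
  exact congrArg (fun T : Module.End ℝ 𝔤 => B ξ (T η)) (expEnd_neg_mul A)

end LieData

end

/-! ### The bracket of sections along `X`. -/

noncomputable section

namespace ConstraintData

variable {EX X ES S EQ Q EZ Z : Type*}
    [NormedAddCommGroup EX] [NormedSpace ℝ EX] [FiniteDimensional ℝ EX]
    [TopologicalSpace X] [ChartedSpace EX X] [IsManifold 𝓘(ℝ, EX) ∞ X]
    [T2Space X] [SecondCountableTopology X]
    [NormedAddCommGroup ES] [NormedSpace ℝ ES] [FiniteDimensional ℝ ES]
    [TopologicalSpace S] [ChartedSpace ES S] [IsManifold 𝓘(ℝ, ES) ∞ S]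
    [T2Space S] [SecondCountableTopology S]
    [NormedAddCommGroup EQ] [NormedSpace ℝ EQ] [FiniteDimensional ℝ EQ]
    [TopologicalSpace Q] [ChartedSpace EQ Q] [IsManifold 𝓘(ℝ, EQ) ∞ Q]
    [T2Space Q] [SecondCountableTopology Q]
    [NormedAddCommGroup EZ] [NormedSpace ℝ EZ] [FiniteDimensional ℝ EZ]
    [TopologicalSpace Z] [ChartedSpace EZ Z] [IsManifold 𝓘(ℝ, EZ) ∞ Z]
    [T2Space Z] [SecondCountableTopology Z]
    {D : ConstraintData EX X ES S EQ Q EZ Z}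

/-- Along `X` the pairing of `dh` with any section vanishes identically, hence so does its
derivative along `X`. -/
theorem hess_tXZ_near {h : Fn EZ Z} {x : X} (h0 : ∀ᶠ y in 𝓝 x, diff EZ h (D.ptZ y) = 0)
    (w : Tan EX x) (v : Tan EZ (D.ptZ x)) : hess EZ h (D.ptZ x) (D.tXZ x w) v = 0 := by
  have hc : MDifferentiableAt 𝓘(ℝ, EX) 𝓘(ℝ, EZ) D.ptZ x :=
    (D.contMDiff_ptZ x).mdifferentiableAt (by simp)
  have hv := VecNear.const (EX := EX) D.contMDiff_ptZ.continuous (Tc (E := EZ) (D.ptZ x) (D.ptZ x) v) x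
  have e := hess_deriv (EN := EX) (N := X) h (c := D.ptZ) (y := x) hc
    (v := fun y => Ti (E := EZ) (D.ptZ x) (D.ptZ y) (Tc (D.ptZ x) (D.ptZ x) v))
    (SmoothNear.mdiff hv) h0.self_of_nhds w
  rw [Ti_Tc (mem_chart_source _ _)] at e
  have e0 : diff EX (fun y => diff EZ h (D.ptZ y)
      (Ti (E := EZ) (D.ptZ x) (D.ptZ y) (Tc (D.ptZ x) (D.ptZ x) v))) x = 0 := by
    rw [← diff_const (E := EX) 0 x]
    refine diff_congr ?_
    filter_upwards [h0] with y hy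
    rw [hy]
    rfl
  rw [e0] at e
  rw [tXZ_eq]
  exact e.symm

variable (hD : D.IsConstraint)
include hD

/-- At a critical point of `h` the differential of `{f, h}` is a second derivative of `h` in the
direction `X_f`, and `X_f` is tangent to `X`. Consequently `d{f, g}` at a point of `X` depends on
`g` only through the germ of `dg` along `X`. -/
theorem IsConstraint.diff_bracket_eq_zero {f h : Fn EZ Z} {x : X}
    (hf : ∀ w, diff EZ f (D.ptZ x) (D.tXZ x w) = 0)
    (h0 : ∀ᶠ y in 𝓝 x, diff EZ h (D.ptZ y) = 0) :
    diff EZ (D.poisson.bracket f h) (D.ptZ x) = 0 := by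
  obtain ⟨a, ha⟩ := hD.ham_mem_tX hf
  refine ContinuousLinearMap.ext fun v => ?_
  rw [D.poisson.diff_bracket_right h0.self_of_nhds, ← ha, hess_symm, hess_tXZ_near h0, neg_zero]
  rfl

theorem IsConstraint.diff_bracket_congr {f g g' : Fn EZ Z} {x : X}
    (hf : ∀ w, diff EZ f (D.ptZ x) (D.tXZ x w) = 0)
    (hg : ∀ᶠ y in 𝓝 x, diff EZ g (D.ptZ y) = diff EZ g' (D.ptZ y)) :
    diff EZ (D.poisson.bracket f g) (D.ptZ x) = diff EZ (D.poisson.bracket f g') (D.ptZ x) := by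
  have h := hD.diff_bracket_eq_zero (h := g - g') hf (by
    filter_upwards [hg] with y hy
    rw [diff_sub, hy, sub_self])
  rw [D.poisson.bracket_sub_right, diff_sub] at h
  exact sub_eq_zero.1 h

/-- The bracket with `f` preserves the functions with differentials in the isotropy. -/
theorem IsConstraint.diff_bracket_isotropy {f g : Fn EZ Z} {x : X}
    (hf : ∀ w, diff EZ f (D.ptZ x) (D.tXZ x w) = 0)
    (hg : ∀ᶠ y in 𝓝 x, ∀ u, diff EZ g (D.ptZ y) (D.sZ y u) = 0) (u : Tan ES (D.ptS x)) :
    diff EZ (D.poisson.bracket f g) (D.ptZ x) (D.sZ x u) = 0 := by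
  obtain ⟨a, ha⟩ := hD.ham_mem_tX hf
  have hz : ∀ᶠ y in 𝓝 x, D.poisson.ham g (D.ptZ y) = 0 := by
    filter_upwards [hg] with y hy using hD.ham_zero_ptZ hy
  -- Tested on `h` by the Jacobi identity: `{{h, f}, g}` vanishes since `X_g = 0`, and `{f, {h, g}}`
  -- is a derivative along `X` of a function that is zero there.
  have key : D.poisson.ham (D.poisson.bracket f g) (D.ptZ x) = 0 := by
    refine tan_eq_zero fun b => ?_
    obtain ⟨h, rfl⟩ := exists_fn_diff (D.ptZ x) b
    rw [← D.poisson.bracket_apply, D.poisson.bracket_leibniz]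
    change D.poisson.bracket (D.poisson.bracket h f) g (D.ptZ x) +
      D.poisson.bracket f (D.poisson.bracket h g) (D.ptZ x) = 0
    rw [D.poisson.bracket_apply, hz.self_of_nhds, map_zero, zero_add,
      D.poisson.bracket_eq_neg_sharp, ← ha, diff_tXZ, neg_zero]
    filter_upwards [hz] with y hy
    rw [D.poisson.bracket_apply, hy, map_zero]
  exact (hD.sharp_ptZ_eq_zero_iff _).1 key u

/-- The anchor is `-w♯`; with this sign `{f, ·}` differentiates functions along `+v`. -/
theorem IsConstraint.ham_conn {α : ∀ x, Tan EX x →ₗ[ℝ] D.Etil x} (hα : D.IsConnForm α) {x : X}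
    {v : Tan EX x} {f : Fn EZ Z}
    (hf : ∀ u, diff EZ f (D.ptZ x) (D.qZ x u) = (α x v : Cot EQ (D.ptQ x)) u) :
    D.poisson.ham f (D.ptZ x) = -D.tXZ x v := by
  have h := hα.2 x v (diff EZ f (D.ptZ x)) (ContinuousLinearMap.ext fun u => hf u)
  rw [← h, neg_neg]
  rfl

omit hD in
theorem diff_tXZ_of_Etil {x : X} {a : D.Etil x} {f : Fn EZ Z}
    (hf : ∀ u, diff EZ f (D.ptZ x) (D.qZ x u) = (a : Cot EQ (D.ptQ x)) u) (w : Tan EX x) :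
    diff EZ f (D.ptZ x) (D.tXZ x w) = 0 := by
  rw [tXZ_qZ, hf, Etil_tXQ]

/-- A smooth section of `Ẽ_X` is the restriction of the differential of a function. -/
theorem IsConstraint.exists_fn_Etil {a : ∀ x, D.Etil x} {x₀ : X}
    (ha : CovNear (EX := EX) D.ptQ (fun x => (a x : Cot EQ (D.ptQ x))) x₀) :
    ∃ f : Fn EZ Z, ∀ᶠ y in 𝓝 x₀, ∀ u, diff EZ f (D.ptZ y) (D.qZ y u) =
      (a y : Cot EQ (D.ptQ y)) u := by
  obtain ⟨ρ, h1, -, h2⟩ := hD.exists_leftInv_tQ x₀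
  obtain ⟨f, -, hf⟩ := hD.exists_fn_cov (h2 _ ha) (Eventually.of_forall fun y w => by
    change (a y : Cot EQ (D.ptQ y)) (ρ y (D.tQ (D.ptQ y) (D.tXQ y w))) = 0
    rw [h1, Etil_tXQ])
  refine ⟨f, ?_⟩
  filter_upwards [hf] with y hy u
  rw [hy]
  change (a y : Cot EQ (D.ptQ y)) (ρ y (D.tQ (D.ptQ y) u)) = _
  rw [h1]

theorem IsConstraint.exists_fn_Etil_pt {x : X} (a : D.Etil x) :
    ∃ f : Fn EZ Z, ∀ u, diff EZ f (D.ptZ x) (D.qZ x u) = (a : Cot EQ (D.ptQ x)) u := by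
  obtain ⟨b, hb⟩ := exists_cot_extend (T := D.qZ x) (hD.tQ_injective _) (a : Cot EQ (D.ptQ x))
  obtain ⟨f, hf⟩ := exists_fn_diff (D.ptZ x) b
  exact ⟨f, fun u => by rw [hf, ← hb]; rfl⟩

end ConstraintData

end

/-! ### The derivations of `𝔤` defined by a local frame. -/

noncomputable section

namespace ConstraintData

variable {EX X ES S EQ Q EZ Z : Type*}
    [NormedAddCommGroup EX] [NormedSpace ℝ EX] [FiniteDimensional ℝ EX]
    [TopologicalSpace X] [ChartedSpace EX X] [IsManifold 𝓘(ℝ, EX) ∞ X]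
    [T2Space X] [SecondCountableTopology X]
    [NormedAddCommGroup ES] [NormedSpace ℝ ES] [FiniteDimensional ℝ ES]
    [TopologicalSpace S] [ChartedSpace ES S] [IsManifold 𝓘(ℝ, ES) ∞ S]
    [T2Space S] [SecondCountableTopology S]
    [NormedAddCommGroup EQ] [NormedSpace ℝ EQ] [FiniteDimensional ℝ EQ]
    [TopologicalSpace Q] [ChartedSpace EQ Q] [IsManifold 𝓘(ℝ, EQ) ∞ Q]
    [T2Space Q] [SecondCountableTopology Q]
    [NormedAddCommGroup EZ] [NormedSpace ℝ EZ] [FiniteDimensional ℝ EZ]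
    [TopologicalSpace Z] [ChartedSpace EZ Z] [IsManifold 𝓘(ℝ, EZ) ∞ Z]
    [T2Space Z] [SecondCountableTopology Z]
    {D : ConstraintData EX X ES S EQ Q EZ Z}
    {𝔤 : Type*} [LieRing 𝔤] [LieAlgebra ℝ 𝔤] [Module.Finite ℝ 𝔤] {c : LieSubalgebra ℝ 𝔤}

theorem IsLieFrame.sZ {x : X} {p : 𝔤 →ₗ[ℝ] Cot EZ (D.ptZ x)} (hp : D.IsLieFrame x p) (ξ : 𝔤)
    (u : Tan ES (D.ptS x)) : p ξ (D.sZ x u) = 0 := (hp.2.1 (p ξ)).1 ⟨ξ, rfl⟩ u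

theorem IsLieFrame.exists_eq {x : X} {p : 𝔤 →ₗ[ℝ] Cot EZ (D.ptZ x)} (hp : D.IsLieFrame x p)
    {a : Cot EZ (D.ptZ x)} (ha : ∀ u, a (D.sZ x u) = 0) : ∃ ξ, p ξ = a := (hp.2.1 a).2 ha

theorem IsLieFrame.tXZ {x : X} {p : 𝔤 →ₗ[ℝ] Cot EZ (D.ptZ x)} (hp : D.IsLieFrame x p) (ξ : 𝔤)
    (w : Tan EX x) : p ξ (D.tXZ x w) = 0 := by
  rw [tXZ_qZ, tXQ_sQ, ← sZ_apply]
  exact hp.sZ ξ _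

theorem IsConstraintFrame.mem_iff {x : X} {p : 𝔤 →ₗ[ℝ] Cot EZ (D.ptZ x)}
    (hp : D.IsConstraintFrame c x p) (ξ : 𝔤) : ξ ∈ c ↔ ∀ u, p ξ (D.qZ x u) = 0 := by
  constructor
  · intro h
    exact (hp.2 (p ξ)).1 ⟨ξ, h, rfl⟩
  · intro h
    obtain ⟨η, hη, e⟩ := (hp.2 (p ξ)).2 h
    rwa [← hp.1.1 e]

theorem IsConstraintFrame.exists_mem {x : X} {p : 𝔤 →ₗ[ℝ] Cot EZ (D.ptZ x)}
    (hp : D.IsConstraintFrame c x p) {a : Cot EZ (D.ptZ x)} (ha : ∀ u, a (D.qZ x u) = 0) :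
    ∃ ξ ∈ c, p ξ = a := (hp.2 a).2 ha

theorem resQ_apply {x : X} (p : 𝔤 →ₗ[ℝ] Cot EZ (D.ptZ x)) (ξ : 𝔤) (u : Tan EQ (D.ptQ x)) :
    D.resQ p ξ u = p ξ (D.qZ x u) := rfl

theorem resQ_add {x : X} (p : 𝔤 →ₗ[ℝ] Cot EZ (D.ptZ x)) (ξ η : 𝔤) :
    D.resQ p (ξ + η) = D.resQ p ξ + D.resQ p η := by
  unfold resQ
  rw [map_add]
  rfl

theorem resQ_smul {x : X} (p : 𝔤 →ₗ[ℝ] Cot EZ (D.ptZ x)) (r : ℝ) (ξ : 𝔤) :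
    D.resQ p (r • ξ) = r • D.resQ p ξ := by
  unfold resQ
  rw [map_smul]
  rfl

theorem IsConstraintFrame.resQ_eq_iff {x : X} {p : 𝔤 →ₗ[ℝ] Cot EZ (D.ptZ x)}
    (hp : D.IsConstraintFrame c x p) (ξ η : 𝔤) : D.resQ p ξ = D.resQ p η ↔ ξ - η ∈ c := by
  rw [hp.mem_iff, map_sub]
  constructor
  · intro h u
    exact sub_eq_zero.2 (congrArg (fun L => L u) h)
  · intro h
    exact ContinuousLinearMap.ext fun u => sub_eq_zero.1 (h u)

theorem LocalFrame.covNear (σ : D.LocalFrame c) {x : X} (hx : x ∈ σ.U) {ξ : X → 𝔤}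
    (hξ : SmoothNear (E := EX) (fun y => coord 𝔤 (ξ y)) x) :
    CovNear (EX := EX) D.ptZ (fun y => σ.frame y (ξ y)) x := by
  have h : CovNear (EX := EX) D.ptZ
      (fun y => ∑ i, coord 𝔤 (ξ y) i • σ.frame y (Module.finBasis ℝ 𝔤 i)) x := by
    refine CovNear.sum fun i => CovNear.smul ?_ ?_
    · exact hξ.clm (ContinuousLinearMap.proj (R := ℝ) (φ := fun _ => ℝ) i)
    · exact SmoothCovOn.covNear D.contMDiff_ptZ (σ.smooth _) (σ.isOpen.mem_nhds hx)
  refine h.congr (Eventually.of_forall fun y => ?_)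
  conv_lhs => rw [← (Module.finBasis ℝ 𝔤).sum_repr (ξ y), map_sum]
  exact Finset.sum_congr rfl fun i _ => map_smul _ _ _

theorem LocalFrame.smoothNear (σ : D.LocalFrame c) {x : X} (hx : x ∈ σ.U) {ξ : X → 𝔤}
    (hξ : CovNear (EX := EX) D.ptZ (fun y => σ.frame y (ξ y)) x) :
    SmoothNear (E := EX) (fun y => coord 𝔤 (ξ y)) x := by
  let L : X → Coord 𝔤 →L[ℝ] (EZ →L[ℝ] ℝ) := fun y => LinearMap.toContinuousLinearMap
    { toFun := fun w => (σ.frame y ((coord 𝔤).symm w)).comp (Ti (E := EZ) (D.ptZ x) (D.ptZ y))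
      map_add' := fun w w' => by rw [map_add, map_add]; rfl
      map_smul' := fun r w => by rw [map_smul, map_smul]; rfl }
  have hL : SmoothNear (E := EX) L x := SmoothNear.of_apply fun w =>
    SmoothCovOn.covNear D.contMDiff_ptZ (σ.smooth ((coord 𝔤).symm w)) (σ.isOpen.mem_nhds hx)
  refine SmoothNear.of_injective hL ?_ (hξ.congr ?_)
  · intro w w' h
    apply (coord 𝔤).symm.injective
    apply (σ.mem x hx).1.1
    refine ContinuousLinearMap.ext fun v => ?_
    have := congrArg (fun l : EZ →L[ℝ] ℝ => l (Tc (E := EZ) (D.ptZ x) (D.ptZ x) v)) h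
    change σ.frame x ((coord 𝔤).symm w) (Ti (E := EZ) (D.ptZ x) (D.ptZ x) _) =
      σ.frame x ((coord 𝔤).symm w') (Ti (E := EZ) (D.ptZ x) (D.ptZ x) _) at this
    rwa [Ti_Tc (mem_chart_source _ _)] at this
  · refine Eventually.of_forall fun y => ?_
    rw [LinearEquiv.symm_apply_apply]

/-- The derivation of `𝔤` defined by the bracket with `f` and a frame. -/
def IsTheta (D : ConstraintData EX X ES S EQ Q EZ Z) {c : LieSubalgebra ℝ 𝔤} (σ : D.LocalFrame c)
    (x : X) (f : Fn EZ Z) (d : LieDerivation ℝ 𝔤 𝔤) : Prop :=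
  ∀ (ξ : 𝔤) (g : Fn EZ Z), (∀ᶠ y in 𝓝 x, diff EZ g (D.ptZ y) = σ.frame y ξ) →
    diff EZ (D.poisson.bracket f g) (D.ptZ x) = σ.frame x (d ξ)

theorem LocalFrame.near (σ : D.LocalFrame c) {x : X} (hx : x ∈ σ.U) : ∀ᶠ y in 𝓝 x, y ∈ σ.U :=
  σ.isOpen.mem_nhds hx

variable (hD : D.IsConstraint)
include hD

theorem IsConstraint.exists_frame_fn' (σ : D.LocalFrame c) {x : X} (hx : x ∈ σ.U) {ξ : X → 𝔤}
    (hξ : SmoothNear (E := EX) (fun y => coord 𝔤 (ξ y)) x) :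
    ∃ g : Fn EZ Z, (∀ y, g (D.ptZ y) = 0) ∧
      ∀ᶠ y in 𝓝 x, diff EZ g (D.ptZ y) = σ.frame y (ξ y) :=
  hD.exists_fn_cov (σ.covNear hx hξ) (by
    filter_upwards [σ.near hx] with y hy w using (σ.mem y hy).1.tXZ _ w)

theorem IsConstraint.exists_frame_fn (σ : D.LocalFrame c) {x : X} (hx : x ∈ σ.U) (ξ : 𝔤) :
    ∃ g : Fn EZ Z, (∀ y, g (D.ptZ y) = 0) ∧
      ∀ᶠ y in 𝓝 x, diff EZ g (D.ptZ y) = σ.frame y ξ :=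
  hD.exists_frame_fn' σ hx (SmoothNear.const _)

/-- Bracketing with `f` preserves isotropic differentials (`diff_bracket_isotropy`), so it can be
read off in the frame. The Jacobi identity says that the result is a derivation. -/
theorem IsConstraint.exists_theta (σ : D.LocalFrame c) {x : X} (hx : x ∈ σ.U) {f : Fn EZ Z}
    (hf : ∀ w, diff EZ f (D.ptZ x) (D.tXZ x w) = 0) : ∃ d, D.IsTheta σ x f d := by
  choose g hg0 hg using fun ξ => hD.exists_frame_fn σ hx ξ
  have iso : ∀ ξ, ∃ η, σ.frame x η = diff EZ (D.poisson.bracket f (g ξ)) (D.ptZ x) := fun ξ => by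
    refine (σ.mem x hx).1.exists_eq fun u => hD.diff_bracket_isotropy hf ?_ u
    filter_upwards [hg ξ, σ.near hx] with y hy hU u
    rw [hy]
    exact (σ.mem y hU).1.sZ ξ u
  choose T hT using iso
  have key : ∀ ξ (h : Fn EZ Z), (∀ᶠ y in 𝓝 x, diff EZ h (D.ptZ y) = σ.frame y ξ) →
      diff EZ (D.poisson.bracket f h) (D.ptZ x) = σ.frame x (T ξ) := fun ξ h hh => by
    rw [hT]
    refine hD.diff_bracket_congr hf ?_
    filter_upwards [hg ξ, hh] with y h1 h2
    rw [h1, h2]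
  have inj := (σ.mem x hx).1.1
  let T' : 𝔤 →ₗ[ℝ] 𝔤 :=
    { toFun := T
      map_add' := fun ξ η => inj (by
        rw [← key (ξ + η) (g ξ + g η), map_add, D.poisson.bracket_add_right, diff_add, hT, hT]
        filter_upwards [hg ξ, hg η] with y h1 h2
        rw [diff_add, h1, h2, map_add])
      map_smul' := fun r ξ => inj (by
        have e : r • g ξ = (ContMDiffMap.const r : Fn EZ Z) * g ξ := rfl
        have e2 : D.poisson.bracket f (r • g ξ) = r • D.poisson.bracket f (g ξ) := by
          ext z
          rw [D.poisson.bracket_eq_neg_sharp, diff_smul]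
          change -(r * _) = r * _
          rw [D.poisson.bracket_eq_neg_sharp, mul_neg]
          rfl
        rw [← key (r • ξ) (r • g ξ), RingHom.id_apply, map_smul, e2, diff_smul, hT]
        filter_upwards [hg ξ] with y h1
        rw [diff_smul, h1, map_smul]) }
  refine ⟨⟨T', fun ξ η => inj ?_⟩, key⟩
  change σ.frame x (T ⁅ξ, η⁆) = σ.frame x (⁅ξ, T η⁆ - ⁅η, T ξ⁆)
  -- The function `{g ξ, g η}` has differential `σ ⁅ξ, η⁆` at all nearby points, because `σ`
  -- consists of Lie frames; so it may serve to compute the value at `⁅ξ, η⁆`.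
  rw [← key ⁅ξ, η⁆ (D.poisson.bracket (g ξ) (g η)), D.poisson.bracket_leibniz, diff_add,
    (σ.mem x hx).1.2.2 (T ξ) η _ _ (hT ξ).symm (hg η).self_of_nhds,
    (σ.mem x hx).1.2.2 ξ (T η) _ _ (hg ξ).self_of_nhds (hT η).symm, ← map_add, ← lie_skew η (T ξ)]
  · congr 1
    abel
  · filter_upwards [hg ξ, hg η, σ.near hx] with y h1 h2 hy
    exact (σ.mem y hy).1.2.2 ξ η _ _ h1 h2

/-- For `ξ ∈ c` the covectors `σ ξ` are differentials of a function `g` vanishing on `Q`.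
Admissibility puts `d{f, g}` in `(TQ)⁰`, which is the image of `c`. -/
theorem IsConstraint.theta_mem (σ : D.LocalFrame c) {x : X} (hx : x ∈ σ.U) {f : Fn EZ Z}
    {a : D.Etil x} (hf : ∀ u, diff EZ f (D.ptZ x) (D.qZ x u) = (a : Cot EQ (D.ptQ x)) u)
    (ha : D.Adm x (a : Cot EQ (D.ptQ x))) {d : LieDerivation ℝ 𝔤 𝔤} (hd : D.IsTheta σ x f d) {ξ : 𝔤}
    (hξ : ξ ∈ c) : d ξ ∈ c := by
  obtain ⟨g, hg0, hg⟩ := hD.exists_fn_cov_van (σ.covNear hx (SmoothNear.const (coord 𝔤 ξ)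
    |>.congr (Eventually.of_forall fun _ => rfl))) (by
      filter_upwards [σ.near hx] with y hy
      exact ((σ.mem y hy).mem_iff ξ).1 hξ)
  rw [(σ.mem x hx).mem_iff, ← hd ξ g hg]
  exact ha f hf g hg0

/-- The Leibniz rule in a frame: expand `ξ` in a basis of `𝔤` and extend the coefficients to `Z`.
The bracket of `f` with a coefficient is its derivative along `v`. This is the local formula `d +
A`, and it yields covariant derivative, equivariance and curvature. -/
theorem IsConstraint.diff_bracket_frame (σ : D.LocalFrame c) {x : X} (hx : x ∈ σ.U) {f : Fn EZ Z}
    {v : Tan EX x} (hf : ∀ w, diff EZ f (D.ptZ x) (D.tXZ x w) = 0)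
    (hv : D.poisson.ham f (D.ptZ x) = -D.tXZ x v) {d : LieDerivation ℝ 𝔤 𝔤}
    (hd : D.IsTheta σ x f d) {ξ : X → 𝔤}
    (hξ : SmoothNear (E := EX) (fun y => coord 𝔤 (ξ y)) x) {δ : 𝔤}
    (hδ : ∀ l : Module.Dual ℝ 𝔤, diff EX (fun y => l (ξ y)) x v = l δ) {g : Fn EZ Z}
    (hg : ∀ᶠ y in 𝓝 x, diff EZ g (D.ptZ y) = σ.frame y (ξ y)) :
    diff EZ (D.poisson.bracket f g) (D.ptZ x) = σ.frame x (δ + d (ξ x)) := by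
  set b := Module.finBasis ℝ 𝔤
  choose k hk0 hk using fun i => hD.exists_frame_fn σ hx (b i)
  have hξi : ∀ i, SmoothNear (E := EX) (F := ℝ) (fun y => b.coord i (ξ y)) x := fun i =>
    hξ.clm (ContinuousLinearMap.proj (R := ℝ) (φ := fun _ => ℝ) i)
  choose Ξ hΞ using fun i => hD.exists_ext (hξi i)
  have hgk : ∀ᶠ y in 𝓝 x, diff EZ g (D.ptZ y) = diff EZ (∑ i, Ξ i * k i : Fn EZ Z) (D.ptZ y) := by
    filter_upwards [hg, eventually_all.2 hΞ, eventually_all.2 hk] with y h1 h2 h3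
    rw [h1, diff_sum]
    conv_lhs => rw [← b.sum_repr (ξ y), map_sum]
    refine Finset.sum_congr rfl fun i _ => ?_
    rw [diff_mul, hk0, zero_smul, add_zero, h2, h3, map_smul]
    rfl
  have ham0 : ∀ i, D.poisson.bracket f (k i) (D.ptZ x) = 0 := fun i => by
    rw [D.poisson.bracket_apply, hD.ham_zero_ptZ, map_zero]
    intro u
    rw [(hk i).self_of_nhds]
    exact (σ.mem x hx).1.sZ _ u
  have hamΞ : ∀ i, D.poisson.bracket f (Ξ i) (D.ptZ x) = b.coord i δ := fun i => by
    rw [D.poisson.bracket_eq_neg_sharp, hv, map_neg, neg_neg, ← hδ (b.coord i)]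
    rw [← diff_congr (E := EX) (hΞ i), diff_comp (fn_mdiff _ _)
      ((D.contMDiff_ptZ x).mdifferentiableAt (by simp))]
    rw [tXZ_eq]
    rfl
  rw [hD.diff_bracket_congr hf hgk, D.poisson.bracket_sum_right, diff_sum]
  conv_rhs => rw [← b.sum_repr δ]; arg 2; arg 2; rw [← b.sum_repr (ξ x)]
  rw [map_sum, map_add, map_sum, map_sum, ← Finset.sum_add_distrib]
  refine Finset.sum_congr rfl fun i _ => ?_
  rw [D.poisson.bracket_mul_right, diff_add, diff_mul, diff_mul, ham0, hamΞ, hk0, zero_smul,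
    zero_smul, add_zero, zero_add, hd (b i) (k i) (hk i), (hk i).self_of_nhds,
    (hΞ i).self_of_nhds, map_smul, map_smul, map_smul, add_comm]
  rfl

end ConstraintData

end

/-! ### Local connection forms on `N_𝔤(c)/c`. -/

noncomputable section

section LieData

variable {𝔤 : Type*} [LieRing 𝔤] [LieAlgebra ℝ 𝔤] [Module.Finite ℝ 𝔤] {c : LieSubalgebra ℝ 𝔤}

theorem invClass_surjective (m : invQuot c) : ∃ ξ : invLift c, m = invClass c ξ := by
  obtain ⟨_, ξ, hξ, rfl⟩ := m
  exact ⟨⟨ξ, hξ⟩, rfl⟩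

theorem mkQ_eq_iff {ξ η : 𝔤} : c.toSubmodule.mkQ ξ = c.toSubmodule.mkQ η ↔ ξ - η ∈ c :=
  Submodule.Quotient.eq c.toSubmodule

theorem derivation_invLift {d : LieDerivation ℝ 𝔤 𝔤} (hd : ∀ ξ ∈ c, d ξ ∈ c) {ξ : 𝔤}
    (hξ : ξ ∈ invLift c) : d ξ ∈ invLift c := by
  rw [mem_invLift_iff] at hξ ⊢
  intro ζ hζ
  have e : ⁅ζ, d ξ⁆ = d ⁅ζ, ξ⁆ + ⁅ξ, d ζ⁆ := by rw [d.apply_lie_eq_sub]; abel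
  have h : ⁅d ζ, ξ⁆ ∈ c := hξ _ (hd ζ hζ)
  rw [e, ← lie_skew ξ (d ζ)]
  exact c.add_mem (hd _ (hξ ζ hζ)) (c.neg_mem h)

/-- The endomorphism of `N_𝔤(c)/c` induced by a derivation that preserves `c`. -/
def indQuot (d : LieDerivation ℝ 𝔤 𝔤) (hd : ∀ ξ ∈ c, d ξ ∈ c) : invQuot c →ₗ[ℝ] invQuot c :=
  (Submodule.mapQ c.toSubmodule c.toSubmodule d.toLinearMap hd).restrict (by
    rintro _ ⟨ξ, hξ, rfl⟩
    exact ⟨d ξ, derivation_invLift hd hξ, rfl⟩)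

theorem indQuot_class (d : LieDerivation ℝ 𝔤 𝔤) (hd : ∀ ξ ∈ c, d ξ ∈ c) (ξ : invLift c) :
    (indQuot d hd (invClass c ξ) : 𝔤 ⧸ c.toSubmodule) = c.toSubmodule.mkQ (d ξ) := rfl

theorem invQuot_hom_ext {T T' : invQuot c →ₗ[ℝ] invQuot c}
    (h : ∀ ξ : invLift c, (T (invClass c ξ) : 𝔤 ⧸ c.toSubmodule) = T' (invClass c ξ)) : T = T' := by
  refine LinearMap.ext fun m => ?_
  obtain ⟨ξ, rfl⟩ := invClass_surjective m
  exact Subtype.ext (h ξ)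

end LieData

namespace ConstraintData

variable {EX X ES S EQ Q EZ Z : Type*}
    [NormedAddCommGroup EX] [NormedSpace ℝ EX] [FiniteDimensional ℝ EX]
    [TopologicalSpace X] [ChartedSpace EX X] [IsManifold 𝓘(ℝ, EX) ∞ X]
    [T2Space X] [SecondCountableTopology X]
    [NormedAddCommGroup ES] [NormedSpace ℝ ES] [FiniteDimensional ℝ ES]
    [TopologicalSpace S] [ChartedSpace ES S] [IsManifold 𝓘(ℝ, ES) ∞ S]
    [T2Space S] [SecondCountableTopology S]
    [NormedAddCommGroup EQ] [NormedSpace ℝ EQ] [FiniteDimensional ℝ EQ]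
    [TopologicalSpace Q] [ChartedSpace EQ Q] [IsManifold 𝓘(ℝ, EQ) ∞ Q]
    [T2Space Q] [SecondCountableTopology Q]
    [NormedAddCommGroup EZ] [NormedSpace ℝ EZ] [FiniteDimensional ℝ EZ]
    [TopologicalSpace Z] [ChartedSpace EZ Z] [IsManifold 𝓘(ℝ, EZ) ∞ Z]
    [T2Space Z] [SecondCountableTopology Z]
    {D : ConstraintData EX X ES S EQ Q EZ Z}
    {𝔤 : Type*} [LieRing 𝔤] [LieAlgebra ℝ 𝔤] [Module.Finite ℝ 𝔤] {c : LieSubalgebra ℝ 𝔤}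

theorem IsTheta.add (σ : D.LocalFrame c) {x : X} {f f' : Fn EZ Z} {d d' : LieDerivation ℝ 𝔤 𝔤}
    (h : D.IsTheta σ x f d) (h' : D.IsTheta σ x f' d') : D.IsTheta σ x (f + f') (d + d') :=
  fun ξ g hg => by
    rw [D.poisson.bracket_add_left, diff_add, h ξ g hg, h' ξ g hg, ← map_add]
    rfl

theorem IsTheta.smul (σ : D.LocalFrame c) {x : X} {f : Fn EZ Z} {d : LieDerivation ℝ 𝔤 𝔤}
    (h : D.IsTheta σ x f d) (r : ℝ) : D.IsTheta σ x (r • f) (r • d) :=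
  fun ξ g hg => by
    have e : D.poisson.bracket (r • f) g = r • D.poisson.bracket f g := by
      ext z
      rw [D.poisson.bracket_apply, diff_smul]
      rfl
    rw [e, diff_smul, h ξ g hg, ← map_smul]
    rfl

variable (hD : D.IsConstraint)
include hD

/-- A covector in `(TQ)⁰` is the image of some `ζ ∈ c`, and `⁅ζ, ξ⁆ ∈ c` for `ξ` in the normalizer.
-/
theorem IsConstraint.diff_bracket_null {x : X} {p : 𝔤 →ₗ[ℝ] Cot EZ (D.ptZ x)}
    (hp : D.IsConstraintFrame c x p) {h g : Fn EZ Z}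
    (hh : ∀ u, diff EZ h (D.ptZ x) (D.qZ x u) = 0) {ξ : 𝔤} (hξ : ξ ∈ invLift c)
    (hg : diff EZ g (D.ptZ x) = p ξ) (u : Tan EQ (D.ptQ x)) :
    diff EZ (D.poisson.bracket h g) (D.ptZ x) (D.qZ x u) = 0 := by
  obtain ⟨ζ, hζ, e⟩ := hp.exists_mem hh
  rw [hp.1.2.2 ζ ξ h g e.symm hg]
  exact (hp.mem_iff _).1 (mem_invLift_iff.1 hξ ζ hζ) u

/-- Same mechanism: bracketing with a function that vanishes on `Q` is the action of an element of
`c`, which is trivial on `N_𝔤(c)/c`. -/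
theorem IsConstraint.adm_resQ {x : X} {p : 𝔤 →ₗ[ℝ] Cot EZ (D.ptZ x)}
    (hp : D.IsConstraintFrame c x p) {ξ : 𝔤} (hξ : ξ ∈ invLift c) : D.Adm x (D.resQ p ξ) := by
  obtain ⟨f, hf⟩ := exists_fn_diff (D.ptZ x) (p ξ)
  refine hD.adm_of_exists (f := f) (fun u => by rw [hf, resQ_apply]) fun g hg u => ?_
  rw [D.poisson.bracket_skew]
  have e : diff EZ (-D.poisson.bracket g f : Fn EZ Z) (D.ptZ x) =
      -diff EZ (D.poisson.bracket g f) (D.ptZ x) := diff_neg' (fn_mdiff _ _)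
  rw [e]
  change -(diff EZ (D.poisson.bracket g f) (D.ptZ x) (D.qZ x u)) = 0
  rw [hD.diff_bracket_null hp (h := g) (fun u => hD.diff_tQ hg _ u) hξ hf, neg_zero]

theorem IsConstraint.theta_sub_mem (σ : D.LocalFrame c) {x : X} (hx : x ∈ σ.U) {f f' : Fn EZ Z}
    (hf : ∀ u, diff EZ f (D.ptZ x) (D.qZ x u) = diff EZ f' (D.ptZ x) (D.qZ x u))
    {d d' : LieDerivation ℝ 𝔤 𝔤} (hd : D.IsTheta σ x f d) (hd' : D.IsTheta σ x f' d') {ξ : 𝔤}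
    (hξ : ξ ∈ invLift c) : d ξ - d' ξ ∈ c := by
  obtain ⟨g, -, hg⟩ := hD.exists_frame_fn σ hx ξ
  rw [(σ.mem x hx).mem_iff, map_sub, ← hd ξ g hg, ← hd' ξ g hg, ← diff_sub,
    ← D.poisson.bracket_sub_left]
  refine hD.diff_bracket_null (σ.mem x hx) (fun u => ?_) hξ hg.self_of_nhds
  rw [diff_sub]
  exact sub_eq_zero.2 (hf u)

variable {α : ∀ x, Tan EX x →ₗ[ℝ] D.Etil x}
  (ha : ∀ x v, D.Adm x (α x v : Cot EQ (D.ptQ x)))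
include ha

/-- The derivation depends on the extension `f` of `α v`, but its action on `N_𝔤(c)/c` does not
(`theta_sub_mem`). This makes the result linear in `v` although the functions `f v` are chosen
independently. -/
theorem IsConstraint.exists_pot (σ : D.LocalFrame c) {x : X} (hx : x ∈ σ.U) :
    ∃ P : Tan EX x →ₗ[ℝ] invQuot c →ₗ[ℝ] invQuot c, ∀ v (f : Fn EZ Z),
      (∀ u, diff EZ f (D.ptZ x) (D.qZ x u) = (α x v : Cot EQ (D.ptQ x)) u) →
      ∀ d, D.IsTheta σ x f d → ∀ ξ : invLift c,
        (P v (invClass c ξ) : 𝔤 ⧸ c.toSubmodule) = c.toSubmodule.mkQ (d ξ) := by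
  choose f hf using fun v => hD.exists_fn_Etil_pt (α x v)
  choose d hd using fun v => hD.exists_theta σ hx (diff_tXZ_of_Etil (hf v))
  have hc : ∀ v, ∀ ξ ∈ c, d v ξ ∈ c := fun v ξ hξ =>
    hD.theta_mem σ hx (hf v) (ha x v) (hd v) hξ
  have key : ∀ v (f' : Fn EZ Z),
      (∀ u, diff EZ f' (D.ptZ x) (D.qZ x u) = (α x v : Cot EQ (D.ptQ x)) u) →
      ∀ d', D.IsTheta σ x f' d' → ∀ ξ : invLift c,
        (indQuot (d v) (hc v) (invClass c ξ) : 𝔤 ⧸ c.toSubmodule) = c.toSubmodule.mkQ (d' ξ) :=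
    fun v f' hf' d' hd' ξ => by
      rw [indQuot_class, mkQ_eq_iff]
      exact hD.theta_sub_mem σ hx (fun u => by rw [hf, hf']) (hd v) hd' ξ.2
  refine ⟨{ toFun := fun v => indQuot (d v) (hc v)
            map_add' := fun v w => invQuot_hom_ext fun ξ => ?_
            map_smul' := fun r v => invQuot_hom_ext fun ξ => ?_ }, key⟩
  · refine (key (v + w) (f v + f w) (fun u => ?_) _ ((hd v).add σ (hd w)) ξ).trans ?_
    · rw [diff_add, map_add]
      exact congrArg₂ (· + ·) (hf v u) (hf w u)
    · exact map_add c.toSubmodule.mkQ (d v ξ) (d w ξ)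
  · refine (key (r • v) (r • f v) (fun u => ?_) _ ((hd v).smul σ r) ξ).trans ?_
    · rw [diff_smul, map_smul]
      exact congrArg (r * ·) (hf v u)
    · exact map_smul c.toSubmodule.mkQ r (d v ξ)

omit ha in
/-- The derivations defined by a local section `σ` and a vector field form a smooth family. -/
theorem IsConstraint.exists_theta_family (hα : D.IsConnForm α) (σ : D.LocalFrame c) {x₀ : X}
    (hx : x₀ ∈ σ.U) {V : ∀ x, Tan EX x} (hV : VecNear (EX := EX) (fun x : X => x) V x₀) :
    ∃ (f : Fn EZ Z) (Θ : X → LieDerivation ℝ 𝔤 𝔤),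
      (∀ᶠ y in 𝓝 x₀, ∀ u, diff EZ f (D.ptZ y) (D.qZ y u) = (α y (V y) : Cot EQ (D.ptQ y)) u) ∧
      (∀ᶠ y in 𝓝 x₀, D.IsTheta σ y f (Θ y)) ∧
      ∀ ξ, SmoothNear (E := EX) (fun y => coord 𝔤 (Θ y ξ)) x₀ := by
  classical
  obtain ⟨f, hf⟩ := hD.exists_fn_Etil (a := fun y => α y (V y)) (hα.near hV)
  have hex : ∀ᶠ y in 𝓝 x₀, ∃ d, D.IsTheta σ y f d := by
    filter_upwards [hf, σ.near hx] with y h1 h2 using hD.exists_theta σ h2 (diff_tXZ_of_Etil h1)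
  let Θ : X → LieDerivation ℝ 𝔤 𝔤 := fun y =>
    if h : ∃ d, D.IsTheta σ y f d then h.choose else 0
  have hΘ : ∀ᶠ y in 𝓝 x₀, D.IsTheta σ y f (Θ y) := by
    filter_upwards [hex] with y h
    change D.IsTheta σ y f (if h : ∃ d, D.IsTheta σ y f d then h.choose else 0)
    rw [dif_pos h]
    exact h.choose_spec
  refine ⟨f, Θ, hf, hΘ, fun ξ => σ.smoothNear hx ?_⟩
  obtain ⟨g, -, hg⟩ := hD.exists_frame_fn σ hx ξ
  refine (covNear_diff D.contMDiff_ptZ (D.poisson.bracket f g) x₀).congr ?_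
  filter_upwards [hΘ, hg.eventually_nhds] with y h1 h2
  exact (h1 ξ g h2).symm

end ConstraintData

end

/-! ### The principal connection, and local representatives of sections of `L̃₁`. -/

noncomputable section

namespace ConstraintData

variable {EX X ES S EQ Q EZ Z : Type*}
    [NormedAddCommGroup EX] [NormedSpace ℝ EX] [FiniteDimensional ℝ EX]
    [TopologicalSpace X] [ChartedSpace EX X] [IsManifold 𝓘(ℝ, EX) ∞ X]
    [T2Space X] [SecondCountableTopology X]
    [NormedAddCommGroup ES] [NormedSpace ℝ ES] [FiniteDimensional ℝ ES]
    [TopologicalSpace S] [ChartedSpace ES S] [IsManifold 𝓘(ℝ, ES) ∞ S]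
    [T2Space S] [SecondCountableTopology S]
    [NormedAddCommGroup EQ] [NormedSpace ℝ EQ] [FiniteDimensional ℝ EQ]
    [TopologicalSpace Q] [ChartedSpace EQ Q] [IsManifold 𝓘(ℝ, EQ) ∞ Q]
    [T2Space Q] [SecondCountableTopology Q]
    [NormedAddCommGroup EZ] [NormedSpace ℝ EZ] [FiniteDimensional ℝ EZ]
    [TopologicalSpace Z] [ChartedSpace EZ Z] [IsManifold 𝓘(ℝ, EZ) ∞ Z]
    [T2Space Z] [SecondCountableTopology Z]
    {D : ConstraintData EX X ES S EQ Q EZ Z}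
    {𝔤 : Type*} [LieRing 𝔤] [LieAlgebra ℝ 𝔤] [Module.Finite ℝ 𝔤] {c : LieSubalgebra ℝ 𝔤}

theorem smoothNear_of_contMDiffOn {U : Set X} (hU : IsOpen U) {x : X} (hx : x ∈ U) {F : Type*}
    [NormedAddCommGroup F] [NormedSpace ℝ F] {f : X → F}
    (hf : ContMDiffOn 𝓘(ℝ, EX) 𝓘(ℝ, F) ∞ f U) : SmoothNear (E := EX) f x := by
  filter_upwards [hU.mem_nhds hx] with y hy using hf.contMDiffAt (hU.mem_nhds hy)

theorem smoothNear_coord {U : Set X} (hU : IsOpen U) {x : X} (hx : x ∈ U) {ξ : X → 𝔤}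
    (hξ : ∀ l : Module.Dual ℝ 𝔤, ContMDiffOn 𝓘(ℝ, EX) 𝓘(ℝ, ℝ) ∞ (fun y => l (ξ y)) U) :
    SmoothNear (E := EX) (fun y => coord 𝔤 (ξ y)) x :=
  SmoothNear.pi fun i => smoothNear_of_contMDiffOn hU hx (hξ ((Module.finBasis ℝ 𝔤).coord i))

theorem SmoothNear_dual {ξ : X → 𝔤} {x : X}
    (h : SmoothNear (E := EX) (fun y => coord 𝔤 (ξ y)) x) (l : Module.Dual ℝ 𝔤) :
    SmoothNear (E := EX) (F := ℝ) (fun y => l (ξ y)) x := by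
  refine (h.clm (LinearMap.toContinuousLinearMap (l ∘ₗ (coord 𝔤).symm.toLinearMap))).congr
    (Eventually.of_forall fun y => ?_)
  change _ = l ((coord 𝔤).symm (coord 𝔤 (ξ y)))
  rw [LinearEquiv.symm_apply_apply]

/-- The derivative of a smooth `𝔤`-valued function exists. -/
theorem exists_deriv {ξ : X → 𝔤} {x : X}
    (h : SmoothNear (E := EX) (fun y => coord 𝔤 (ξ y)) x) (v : Tan EX x) :
    ∃ δ : 𝔤, ∀ l : Module.Dual ℝ 𝔤, diff EX (fun y => l (ξ y)) x v = l δ := by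
  refine ⟨(coord 𝔤).symm (mfderiv 𝓘(ℝ, EX) 𝓘(ℝ, Coord 𝔤) (fun y => coord 𝔤 (ξ y)) x v : Coord 𝔤),
    fun l => ?_⟩
  let l' : Coord 𝔤 →L[ℝ] ℝ := LinearMap.toContinuousLinearMap (l ∘ₗ (coord 𝔤).symm.toLinearMap)
  have e : (fun y => l (ξ y)) = fun y => l' (coord 𝔤 (ξ y)) := by
    funext y
    change _ = l ((coord 𝔤).symm (coord 𝔤 (ξ y)))
    rw [LinearEquiv.symm_apply_apply]
  rw [e]
  have h1 := (l'.hasFDerivAt (x := coord 𝔤 (ξ x))).hasMFDerivAt.comp x h.mdiff.hasMFDerivAt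
  exact congrArg (fun L => L v) h1.mfderiv

theorem deriv_mem {W : Submodule ℝ 𝔤} {ξ : X → 𝔤} {x : X} (hW : ∀ᶠ y in 𝓝 x, ξ y ∈ W)
    {v : Tan EX x} {δ : 𝔤} (hδ : ∀ l : Module.Dual ℝ 𝔤, diff EX (fun y => l (ξ y)) x v = l δ) :
    δ ∈ W := by
  refine mem_of_dual fun l hl => ?_
  rw [← hδ, diff_congr (g := fun _ => (0 : ℝ)) (by filter_upwards [hW] with y hy using hl _ hy),
    diff_const]
  rfl

variable (hD : D.IsConstraint) {α : ∀ x, Tan EX x →ₗ[ℝ] D.Etil x}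
  (hα : D.IsConnForm α) (ha : ∀ x v, D.Adm x (α x v : Cot EQ (D.ptQ x)))

open Classical in
/-- The local connection form of the connection induced by `α`. -/
def IsConstraint.connPot (σ : D.LocalFrame c) (x : X) : Tan EX x →ₗ[ℝ] invQuot c →ₗ[ℝ] invQuot c :=
  if hx : x ∈ σ.U then (hD.exists_pot ha σ hx).choose else 0

theorem IsConstraint.connPot_spec (σ : D.LocalFrame c) {x : X} (hx : x ∈ σ.U) {v : Tan EX x}
    {f : Fn EZ Z} (hf : ∀ u, diff EZ f (D.ptZ x) (D.qZ x u) = (α x v : Cot EQ (D.ptQ x)) u)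
    {d : LieDerivation ℝ 𝔤 𝔤} (hd : D.IsTheta σ x f d) (ξ : invLift c) :
    (hD.connPot ha σ x v (invClass c ξ) : 𝔤 ⧸ c.toSubmodule) = c.toSubmodule.mkQ (d ξ) := by
  unfold IsConstraint.connPot
  rw [dif_pos hx]
  exact (hD.exists_pot ha σ hx).choose_spec v f hf d hd ξ

include hα in
/-- The principal connection induced by an `Ẽ_X`-connection form with admissible values. -/
def IsConstraint.conn : D.PrincipalConnection c where
  pot := hD.connPot ha
  smooth σ V hV ξ l := by
    intro x₀ hx
    obtain ⟨f, Θ, hf, hΘ, hs⟩ := hD.exists_theta_family hα σ hx (hV.vecNear x₀)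
    obtain ⟨ξ, rfl⟩ := invClass_surjective ξ
    refine ContMDiffAt.contMDiffWithinAt ?_
    refine (SmoothNear.congr (SmoothNear_dual (hs ξ) (l ∘ₗ c.toSubmodule.mkQ)) ?_).at
    filter_upwards [hf, hΘ, σ.near hx] with y h1 h2 h3
    rw [hD.connPot_spec ha σ h3 h1 h2]
    rfl
  mem_lie σ x hx v := by
    obtain ⟨f, hf⟩ := hD.exists_fn_Etil_pt (α x v)
    obtain ⟨d, hd⟩ := hD.exists_theta σ hx (diff_tXZ_of_Etil hf)
    exact ⟨d, fun ξ hξ => hD.theta_mem σ hx hf (ha x v) hd hξ, hD.connPot_spec ha σ hx hf hd⟩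
  equivariant σ σ' W n hW hWσ hWσ' hn hs hσ x hx v ξ η δ hξ hnξ hη hδ := by
    obtain ⟨f, hf⟩ := hD.exists_fn_Etil_pt (α x v)
    obtain ⟨d, hd⟩ := hD.exists_theta σ (hWσ hx) (diff_tXZ_of_Etil hf)
    obtain ⟨d', hd'⟩ := hD.exists_theta σ' (hWσ' hx) (diff_tXZ_of_Etil hf)
    obtain ⟨g, -, hg⟩ := hD.exists_frame_fn σ' (hWσ' hx) ξ
    have e1 := hd' ξ g hg
    -- The same covector `d{f, g}` is computed twice: in `σ'` with the constant `ξ`, and in `σ` with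
    -- the moving element `n y ξ`. Comparison gives the transformation law.
    have e2 := hD.diff_bracket_frame σ (hWσ hx) (diff_tXZ_of_Etil hf) (hD.ham_conn hα hf) hd
      (ξ := fun y => n y ξ) (smoothNear_coord hW hx (hs ξ)) hδ (g := g) (by
        filter_upwards [hg, hW.mem_nhds hx] with y h1 h2
        rw [h1, hσ y h2])
    rw [e1, hσ x hx] at e2
    have e3 := (σ.mem x (hWσ hx)).1.1 e2
    rw [hD.connPot_spec ha σ' (hWσ' hx) hf hd'] at hη
    rw [hD.connPot_spec ha σ (hWσ hx) hf hd]
    have h4 : n x η - n x (d' ξ) ∈ c := by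
      rw [← map_sub]
      exact (hn x hx _).2 (mkQ_eq_iff.1 hη)
    change c.toSubmodule.mkQ (n x η) = c.toSubmodule.mkQ (d (n x ξ)) + c.toSubmodule.mkQ δ
    rw [mkQ_eq_iff.2 h4, e3, map_add, add_comm]

theorem IsConstraint.conn_pot_spec (σ : D.LocalFrame c) {x : X} (hx : x ∈ σ.U) {v : Tan EX x}
    {f : Fn EZ Z} (hf : ∀ u, diff EZ f (D.ptZ x) (D.qZ x u) = (α x v : Cot EQ (D.ptQ x)) u)
    {d : LieDerivation ℝ 𝔤 𝔤} (hd : D.IsTheta σ x f d) (ξ : invLift c) :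
    ((hD.conn hα ha : D.PrincipalConnection c).pot σ x v (invClass c ξ) : 𝔤 ⧸ c.toSubmodule) =
      c.toSubmodule.mkQ (d ξ) := hD.connPot_spec ha σ hx hf hd ξ

include hD in
/-- The subbundle `L̃₁` does not depend on the frames used to define it. -/
theorem IsConstraint.mem_invLift_of_frames {x : X} {p q : 𝔤 →ₗ[ℝ] Cot EZ (D.ptZ x)}
    (hp : D.IsConstraintFrame c x p) (hq : D.IsConstraintFrame c x q) {ξ ξ' : 𝔤} (h : p ξ = q ξ')
    (hξ : ∀ ζ ∈ c, ⁅ζ, ξ⁆ ∈ c) : ∀ ζ ∈ c, ⁅ζ, ξ'⁆ ∈ c := by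
  intro ζ' hζ'
  obtain ⟨ζ, hζ, e⟩ := hp.exists_mem ((hq.mem_iff ζ').1 hζ')
  obtain ⟨f, hf⟩ := exists_fn_diff (D.ptZ x) (p ζ)
  obtain ⟨g, hg⟩ := exists_fn_diff (D.ptZ x) (p ξ)
  have e1 := hp.1.2.2 ζ ξ f g hf hg
  rw [hq.1.2.2 ζ' ξ' f g (hf.trans e) (hg.trans h)] at e1
  rw [hq.mem_iff, e1, ← hp.mem_iff]
  exact hξ ζ hζ

include hD in
theorem IsConstraint.L1_eq {x : X} {q : 𝔤 →ₗ[ℝ] Cot EZ (D.ptZ x)} (hq : D.IsConstraintFrame c x q)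
    {a : Cot EQ (D.ptQ x)} (h : a ∈ D.L1 c x) : ∃ ξ ∈ invLift c, a = D.resQ q ξ := by
  obtain ⟨p, hp, ξ, hξ, rfl⟩ := h
  obtain ⟨ξ', e⟩ := hq.1.exists_eq (hp.1.sZ ξ)
  refine ⟨ξ', mem_invLift_iff.2 (hD.mem_invLift_of_frames hp hq e.symm (mem_invLift_iff.1 hξ)), ?_⟩
  refine ContinuousLinearMap.ext fun u => ?_
  rw [resQ_apply, resQ_apply, e]

include hD in
/-- Smooth sections of `L̃₁` have smooth local representatives in a frame. -/
theorem IsConstraint.exists_smooth_rep {s : ∀ x, D.Etil x} (hs : D.IsSecL1 c s) (σ : D.LocalFrame c)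
    {x : X} (hx : x ∈ σ.U) : ∃ ξ : X → 𝔤, SmoothNear (E := EX) (fun y => coord 𝔤 (ξ y)) x ∧
      ∀ᶠ y in 𝓝 x, ξ y ∈ invLift c ∧ (s y : Cot EQ (D.ptQ y)) = D.resQ (σ.frame y) (ξ y) := by
  classical
  -- A section determines its representative only modulo `c`. Restricting to a complement of `c`
  -- makes it unique, hence smooth as the solution of an injective system.
  obtain ⟨W, hW⟩ := Submodule.exists_isCompl c.toSubmodule
  let e := (Module.finBasis ℝ W).equivFun
  let κ : (Fin (Module.finrank ℝ W) → ℝ) →ₗ[ℝ] 𝔤 := W.subtype ∘ₗ e.symm.toLinearMap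
  have hex : ∀ y, ∃ w : Fin (Module.finrank ℝ W) → ℝ, y ∈ σ.U → κ w ∈ invLift c ∧
      (s y : Cot EQ (D.ptQ y)) = D.resQ (σ.frame y) (κ w) := by
    intro y
    by_cases hy : y ∈ σ.U
    · obtain ⟨ξ, hξ, h⟩ := hD.L1_eq (σ.mem y hy) (hs.2 y)
      obtain ⟨ζ, hζ, w, hw, rfl⟩ := Submodule.mem_sup.1 (hW.sup_eq_top.ge (Submodule.mem_top (x := ξ)))
      have hκ : κ (e ⟨w, hw⟩) = w := by
        change ((e.symm (e ⟨w, hw⟩) : W) : 𝔤) = w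
        rw [LinearEquiv.symm_apply_apply]
      refine ⟨e ⟨w, hw⟩, fun _ => ?_⟩
      rw [hκ, h]
      refine ⟨?_, ((σ.mem y hy).resQ_eq_iff _ _).2 (by rwa [add_sub_cancel_right])⟩
      have := (invLift c).sub_mem hξ (le_invLift hζ)
      rwa [add_sub_cancel_left] at this
    · exact ⟨0, fun h => absurd h hy⟩
  choose u hu using hex
  let L : X → (Fin (Module.finrank ℝ W) → ℝ) →L[ℝ] (EQ →L[ℝ] ℝ) := fun y =>
    LinearMap.toContinuousLinearMap
    { toFun := fun w => (D.resQ (σ.frame y) (κ w)).comp (Ti (E := EQ) (D.ptQ x) (D.ptQ y))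
      map_add' := fun w w' => by rw [map_add, resQ_add]; rfl
      map_smul' := fun r w => by rw [map_smul, resQ_smul]; rfl }
  have hL : SmoothNear (E := EX) L x := SmoothNear.of_apply fun w =>
    CovNear.pull D.iQ D.contMDiff_ptQ
      (SmoothCovOn.covNear D.contMDiff_ptZ (σ.smooth (κ w)) (σ.isOpen.mem_nhds hx))
  have hsm : SmoothNear (E := EX) u x := by
    refine SmoothNear.of_injective hL ?_ (SmoothNear.congr (SmoothSec.covNear hs.1 x) ?_)
    · intro w w' h
      have h1 : D.resQ (σ.frame x) (κ w) = D.resQ (σ.frame x) (κ w') := by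
        refine ContinuousLinearMap.ext fun v => ?_
        have := congrArg (fun l : EQ →L[ℝ] ℝ => l (Tc (E := EQ) (D.ptQ x) (D.ptQ x) v)) h
        change D.resQ (σ.frame x) (κ w) (Ti (E := EQ) (D.ptQ x) (D.ptQ x) _) =
          D.resQ (σ.frame x) (κ w') (Ti (E := EQ) (D.ptQ x) (D.ptQ x) _) at this
        rwa [Ti_Tc (mem_chart_source _ _)] at this
      rw [(σ.mem x hx).resQ_eq_iff, ← map_sub] at h1
      have h2 : κ (w - w') = 0 := by
        have := hW.inf_eq_bot.le (Submodule.mem_inf.2 ⟨h1, (e.symm (w - w')).2⟩)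
        exact (Submodule.mem_bot ℝ).1 this
      have h3 : e.symm (w - w') = 0 := Subtype.ext h2
      exact sub_eq_zero.1 (e.symm.map_eq_zero_iff.1 h3)
    · filter_upwards [σ.near hx] with y hy
      change (D.resQ (σ.frame y) (κ (u y))).comp (Ti (E := EQ) (D.ptQ x) (D.ptQ y)) = _
      rw [← (hu y hy).2]
  refine ⟨fun y => κ (u y), ?_, ?_⟩
  · exact hsm.clm (LinearMap.toContinuousLinearMap ((coord 𝔤).toLinearMap ∘ₗ κ))
  · filter_upwards [σ.near hx] with y hy using hu y hy

end ConstraintData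

end

/-! ### The induced covariant derivative and uniqueness of the connection. -/

noncomputable section

namespace ConstraintData

variable {EX X ES S EQ Q EZ Z : Type*}
    [NormedAddCommGroup EX] [NormedSpace ℝ EX] [FiniteDimensional ℝ EX]
    [TopologicalSpace X] [ChartedSpace EX X] [IsManifold 𝓘(ℝ, EX) ∞ X]
    [T2Space X] [SecondCountableTopology X]
    [NormedAddCommGroup ES] [NormedSpace ℝ ES] [FiniteDimensional ℝ ES]
    [TopologicalSpace S] [ChartedSpace ES S] [IsManifold 𝓘(ℝ, ES) ∞ S]
    [T2Space S] [SecondCountableTopology S]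
    [NormedAddCommGroup EQ] [NormedSpace ℝ EQ] [FiniteDimensional ℝ EQ]
    [TopologicalSpace Q] [ChartedSpace EQ Q] [IsManifold 𝓘(ℝ, EQ) ∞ Q]
    [T2Space Q] [SecondCountableTopology Q]
    [NormedAddCommGroup EZ] [NormedSpace ℝ EZ] [FiniteDimensional ℝ EZ]
    [TopologicalSpace Z] [ChartedSpace EZ Z] [IsManifold 𝓘(ℝ, EZ) ∞ Z]
    [T2Space Z] [SecondCountableTopology Z]
    {D : ConstraintData EX X ES S EQ Q EZ Z}
    {𝔤 : Type*} [LieRing 𝔤] [LieAlgebra ℝ 𝔤] [Module.Finite ℝ 𝔤] {c : LieSubalgebra ℝ 𝔤}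
    (hD : D.IsConstraint) {α : ∀ x, Tan EX x →ₗ[ℝ] D.Etil x}
    (hα : D.IsConnForm α) (ha : ∀ x v, D.Adm x (α x v : Cot EQ (D.ptQ x)))

include hD hα ha

theorem IsConstraint.adm_sec {s : ∀ x, D.Etil x} (hs : D.IsSecL1 c s) (x : X) :
    D.Adm x (s x : Cot EQ (D.ptQ x)) := by
  obtain ⟨p, hp, ξ, hξ, e⟩ := hs.2 x
  rw [e]
  exact hD.adm_resQ hp hξ

/-- The reduced bracket with the function of a connection form, in a local frame. -/
theorem IsConstraint.redBracket_frame {V : ∀ x, Tan EX x} (hV : SmoothField EX V)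
    {s : ∀ x, D.Etil x} (hs : D.IsSecL1 c s) (σ : D.LocalFrame c) {x : X} (hx : x ∈ σ.U) {ξ : X → 𝔤}
    (hξ : SmoothNear (E := EX) (fun y => coord 𝔤 (ξ y)) x)
    (hsξ : ∀ᶠ y in 𝓝 x, (s y : Cot EQ (D.ptQ y)) = D.resQ (σ.frame y) (ξ y))
    (hi : ξ x ∈ invLift c) {δ η : 𝔤}
    (hδ : ∀ l : Module.Dual ℝ 𝔤, diff EX (fun y => l (ξ y)) x (V x) = l δ)
    (hη : c.toSubmodule.mkQ η = (hD.conn hα ha : D.PrincipalConnection c).pot σ x (V x)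
      (invClass c ⟨ξ x, hi⟩)) (u : Tan EQ (D.ptQ x)) :
    D.redBracket (D.bar (fun x => α x (V x))) (D.bar s) ⟨x, Submodule.Quotient.mk u⟩ =
      D.resQ (σ.frame x) (δ + η) u := by
  obtain ⟨f, hf⟩ := hD.exists_fn_Etil (a := fun y => α y (V y)) (hα.near (hV.vecNear x))
  obtain ⟨g, -, hg⟩ := hD.exists_frame_fn' σ hx hξ
  obtain ⟨d, hd⟩ := hD.exists_theta σ hx (diff_tXZ_of_Etil hf.self_of_nhds)
  rw [hD.redBracket_bar (hα.1 V hV) (fun y => ha y (V y)) hs.1 (hD.adm_sec hα ha hs) hf (by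
    filter_upwards [hg, hsξ] with y h1 h2 u
    rw [h1, h2, resQ_apply]) u, hD.diff_bracket_frame σ hx (diff_tXZ_of_Etil hf.self_of_nhds)
    (hD.ham_conn hα hf.self_of_nhds) hd hξ hδ hg, ← resQ_apply]
  rw [hD.conn_pot_spec hα ha σ hx hf.self_of_nhds hd, mkQ_eq_iff] at hη
  have e : D.resQ (σ.frame x) (δ + d (ξ x)) = D.resQ (σ.frame x) (δ + η) := by
    rw [(σ.mem x hx).resQ_eq_iff, add_sub_add_left_eq_sub, ← neg_sub]
    exact c.neg_mem hη
  rw [e]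

omit hα ha in
theorem IsConstraint.resQ_tXQ {x : X} {p : 𝔤 →ₗ[ℝ] Cot EZ (D.ptZ x)}
    (hp : D.IsConstraintFrame c x p) (ξ : 𝔤) : D.resQ p ξ ∈ D.Etil x := fun w => by
  rw [resQ_apply, ← tXZ_qZ]
  exact hp.1.tXZ ξ w

/-- The frame formula shows that the bracket is fibrewise linear with values in `L̃₁`, since the
derivative of a curve in the subspace `invLift c` stays in it. Smoothness comes from the expression
`d{f, g}` with `f`, `g` fixed near the point. -/
theorem IsConstraint.exists_covDeriv (hr : D.Reducible c) {V : ∀ x, Tan EX x}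
    (hV : SmoothField EX V) {s : ∀ x, D.Etil x} (hs : D.IsSecL1 c s) :
    ∃ t : ∀ x, D.Etil x, D.IsSecL1 c t ∧
      ∀ m, D.redBracket (D.bar (fun x => α x (V x))) (D.bar s) m = D.bar t m := by
  have hex : ∀ x, ∃ t : D.Etil x, (t : Cot EQ (D.ptQ x)) ∈ D.L1 c x ∧ ∀ u,
      D.redBracket (D.bar (fun x => α x (V x))) (D.bar s) ⟨x, Submodule.Quotient.mk u⟩ =
        (t : Cot EQ (D.ptQ x)) u := by
    intro x
    obtain ⟨σ, hx⟩ := hr x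
    obtain ⟨ξ, h1, h2⟩ := hD.exists_smooth_rep hs σ hx
    obtain ⟨δ, hδ⟩ := exists_deriv h1 (V x)
    have hi := h2.self_of_nhds.1
    obtain ⟨η, hη⟩ := invClass_surjective
      ((hD.conn hα ha : D.PrincipalConnection c).pot σ x (V x) (invClass c ⟨ξ x, hi⟩))
    refine ⟨⟨D.resQ (σ.frame x) (δ + η), hD.resQ_tXQ (σ.mem x hx) _⟩,
      ⟨σ.frame x, σ.mem x hx, δ + η, (invLift c).add_mem (deriv_mem (h2.mono fun _ h => h.1) hδ) η.2,
        rfl⟩, fun u => ?_⟩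
    exact hD.redBracket_frame hα ha hV hs σ hx h1 (h2.mono fun _ h => h.2) hi hδ
      (congrArg Subtype.val hη).symm u
  choose t ht1 ht using hex
  refine ⟨t, ⟨smoothSec_of_covNear fun x => ?_, ht1⟩, ?_⟩
  · obtain ⟨f, hf⟩ := hD.exists_fn_Etil (a := fun y => α y (V y)) (hα.near (hV.vecNear x))
    obtain ⟨g, hg⟩ := hD.exists_fn_Etil (a := s) (SmoothSec.covNear hs.1 x)
    refine (CovNear.pull D.iQ D.contMDiff_ptQ
      (covNear_diff D.contMDiff_ptZ (D.poisson.bracket f g) x)).congr ?_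
    filter_upwards [hf.eventually_nhds, hg.eventually_nhds] with y h1 h2
    refine ContinuousLinearMap.ext fun u => ?_
    rw [← ht, hD.redBracket_bar (hα.1 V hV) (fun y => ha y (V y)) hs.1 (hD.adm_sec hα ha hs) h1 h2]
    rfl
  · rintro ⟨x, m⟩
    induction m using Submodule.Quotient.induction_on with
    | H u => exact ht x u

theorem IsConstraint.isInducedBy_conn (hr : D.Reducible c) :
    D.IsInducedBy c (hD.conn hα ha) α := by
  intro V s hV hs
  refine ⟨hD.ptilPrime_bar (hα.1 V hV) fun y => ha y (V y),
    hD.ptilPrime_bar hs.1 (hD.adm_sec hα ha hs), ?_⟩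
  obtain ⟨t, ht1, ht⟩ := hD.exists_covDeriv hα ha hr hV hs
  refine ⟨t, ht1, ?_, ht⟩
  intro σ ξ hξ _ hsξ x hx hi η δ hη hδ
  refine ContinuousLinearMap.ext fun u => ?_
  rw [← hD.redBracket_frame hα ha hV hs σ hx (smoothNear_coord σ.isOpen hx hξ)
    (by filter_upwards [σ.near hx] with y hy using hsξ y hy) hi hδ hη u]
  exact (ht ⟨x, Submodule.Quotient.mk u⟩).symm

/-- The bracket determines `∇_V s`. For a section equal to `σ ξ₀` near `x` with `ξ₀` constant, and a
field with value `v` at `x`, this is the connection form applied to `ξ₀`. Cut-offs provide such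
global objects. -/
theorem IsConstraint.conn_unique (hr : D.Reducible c) {A : D.PrincipalConnection c}
    (hA : D.IsInducedBy c A α) (σ : D.LocalFrame c) {x : X} (hx : x ∈ σ.U) :
    A.pot σ x = (hD.conn hα ha : D.PrincipalConnection c).pot σ x := by
  refine LinearMap.ext fun v => invQuot_hom_ext fun ξ₀ => ?_
  obtain ⟨χ, hχ1, hχ⟩ := VecNear.cutoff (vecNear_const_id x (Tc (E := EX) x x v))
  set V : ∀ y, Tan EX y := fun y => χ y • Ti x y (Tc (E := EX) x x v) with hVdef
  have hVx : V x = v := by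
    change χ x • Ti x x (Tc (E := EX) x x v) = v
    rw [hχ1.self_of_nhds, one_smul, Ti_Tc (mem_chart_source _ _)]
  obtain ⟨ψ, hψ1, hψs, hψ⟩ := CovNear.cutoff (EX := EX) D.contMDiff_ptQ
    (a := fun y => D.resQ (σ.frame y) ξ₀) (x₀ := x)
    (CovNear.pull D.iQ D.contMDiff_ptQ (SmoothCovOn.covNear D.contMDiff_ptZ (σ.smooth ξ₀)
      (σ.isOpen.mem_nhds hx))) (σ.isOpen.mem_nhds hx)
  have hz : ∀ y, y ∉ σ.U → ψ y = 0 := fun y hy =>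
    image_eq_zero_of_notMem_tsupport fun h => hy (hψs h)
  let s : ∀ y, D.Etil y := fun y => ⟨ψ y • D.resQ (σ.frame y) ξ₀, by
    by_cases hy : y ∈ σ.U
    · exact (D.Etil y).smul_mem _ (hD.resQ_tXQ (σ.mem y hy) _)
    · rw [hz y hy, zero_smul]
      exact (D.Etil y).zero_mem⟩
  have hsξ : ∀ y, (s y : Cot EQ (D.ptQ y)) = D.resQ (σ.frame y) (ψ y • (ξ₀ : 𝔤)) := fun y =>
    (resQ_smul _ _ _).symm
  have hs : D.IsSecL1 c s := by
    refine ⟨hψ, fun y => ?_⟩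
    by_cases hy : y ∈ σ.U
    · exact ⟨σ.frame y, σ.mem y hy, _, (invLift c).smul_mem (ψ y) ξ₀.2, hsξ y⟩
    -- Off the domain of `σ` the section is zero, but membership in `L1` still asks for some frame
    -- at `y`.
    · obtain ⟨σ', hy'⟩ := hr y
      refine ⟨σ'.frame y, σ'.mem y hy', 0, (invLift c).zero_mem, ?_⟩
      rw [hsξ, hz y hy, zero_smul]
      refine ContinuousLinearMap.ext fun u => ?_
      rw [resQ_apply, resQ_apply, map_zero, map_zero]
  have hξ : ∀ l : Module.Dual ℝ 𝔤,
      ContMDiffOn 𝓘(ℝ, EX) 𝓘(ℝ, ℝ) ∞ (fun y => l (ψ y • (ξ₀ : 𝔤))) σ.U := fun l => by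
    have e : (fun y => l (ψ y • (ξ₀ : 𝔤))) = fun y => ψ y • l ξ₀ := by
      funext y
      rw [map_smul]
    rw [e]
    exact (ψ.contMDiff.smul contMDiff_const).contMDiffOn
  have hi : ∀ y, ψ y • (ξ₀ : 𝔤) ∈ invLift c := fun y => (invLift c).smul_mem _ ξ₀.2
  have hδ : ∀ l : Module.Dual ℝ 𝔤, diff EX (fun y => l (ψ y • (ξ₀ : 𝔤))) x (V x) = l 0 :=
    fun l => by
      rw [map_zero, diff_congr (g := fun _ => l ξ₀) (by
        filter_upwards [hψ1] with y hy
        rw [hy, one_smul]), diff_const]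
      rfl
  have hx1 : (⟨ψ x • (ξ₀ : 𝔤), hi x⟩ : invLift c) = ξ₀ := Subtype.ext (by
    change ψ x • (ξ₀ : 𝔤) = ξ₀
    rw [hψ1.self_of_nhds, one_smul])
  obtain ⟨-, -, t, -, ht2, ht3⟩ := hA V s hχ hs
  obtain ⟨-, -, t', -, ht2', ht3'⟩ := hD.isInducedBy_conn hα ha hr V s hχ hs
  obtain ⟨η, hη⟩ := invClass_surjective (A.pot σ x (V x) (invClass c ⟨ψ x • (ξ₀ : 𝔤), hi x⟩))
  obtain ⟨η', hη'⟩ := invClass_surjective ((hD.conn hα ha : D.PrincipalConnection c).pot σ x (V x)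
    (invClass c ⟨ψ x • (ξ₀ : 𝔤), hi x⟩))
  have e1 := ht2 σ _ hξ (fun y _ => hi y) (fun y _ => hsξ y) x hx (hi x) η 0
    (congrArg Subtype.val hη).symm hδ
  have e2 := ht2' σ _ hξ (fun y _ => hi y) (fun y _ => hsξ y) x hx (hi x) η' 0
    (congrArg Subtype.val hη').symm hδ
  have e3 : (t x : Cot EQ (D.ptQ x)) = t' x := ContinuousLinearMap.ext fun u =>
    (ht3 ⟨x, Submodule.Quotient.mk u⟩).symm.trans (ht3' ⟨x, Submodule.Quotient.mk u⟩)
  rw [e1, e2, (σ.mem x hx).resQ_eq_iff, zero_add, zero_add] at e3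
  rw [← hVx, ← hx1, hη, hη']
  exact mkQ_eq_iff.2 e3

end ConstraintData

end

/-! ### Linearization of Hamiltonian vector fields and invariance of `χ`. -/

noncomputable section

section Linearization

variable {E : Type*} {M : Type*} [NormedAddCommGroup E] [NormedSpace ℝ E] [FiniteDimensional ℝ E]
  [TopologicalSpace M] [ChartedSpace E M] [IsManifold 𝓘(ℝ, E) ∞ M] [T2Space M]

theorem hess_add (f g : Fn E M) {z : M} (hf : diff E f z = 0) (hg : diff E g z = 0)
    (u v : Tan E z) : hess E (f + g : Fn E M) z u v = hess E f z u v + hess E g z u v := by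
  have h := hess_sub (f + g) g (by rw [diff_add, hf, hg, add_zero]) hg u v
  rw [add_sub_cancel_right] at h
  linarith

theorem hess_zero (z : M) (u v : Tan E z) : hess E (0 : Fn E M) z u v = 0 := by
  have h := hess_sub (0 : Fn E M) 0 (diff_zero z) (diff_zero z) u v
  rwa [sub_self, sub_self] at h

theorem hess_sum {ι : Type*} (s : Finset ι) (f : ι → Fn E M) {z : M} (hf : ∀ i, diff E (f i) z = 0)
    (u v : Tan E z) : hess E (∑ i ∈ s, f i : Fn E M) z u v = ∑ i ∈ s, hess E (f i) z u v := by
  classical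
  induction s using Finset.induction_on with
  | empty => exact hess_zero z u v
  | insert i s hi ih =>
    rw [Finset.sum_insert hi, Finset.sum_insert hi, hess_add _ _ (hf i), ih]
    rw [diff_sum]
    exact Finset.sum_eq_zero fun j _ => hf j

/-- The linearization of a Hamiltonian vector field at a zero. -/
theorem PoissonStructure.exists_linearization (P : PoissonStructure E M) {g : Fn E M} {z : M}
    (hg : P.ham g z = 0) : ∃ N : Tan E z →ₗ[ℝ] Tan E z,
      (∀ f v, diff E (P.bracket f g) z v = diff E f z (N v)) ∧
      ∀ K : Fn E M, diff E K z = 0 → ∀ u v,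
        hess E (P.bracket K g) z u v = hess E K z u (N v) + hess E K z v (N u) := by
  obtain ⟨q, -, hq⟩ := exists_coordFn (E := E) z (O := Set.univ) Filter.univ_mem
  set b := Module.finBasis ℝ E
  let l : Fin (Module.finrank ℝ E) → E →L[ℝ] ℝ := fun i => LinearMap.toContinuousLinearMap (b.coord i)
  let m : Fin (Module.finrank ℝ E) → Fn E M := fun i => P.bracket (q (l i)) g
  have m0 : ∀ i, m i z = 0 := fun i => by
    change P.bracket (q (l i)) g z = 0
    rw [P.bracket_apply, hg, map_zero]
  let N : Tan E z →ₗ[ℝ] Tan E z := ∑ i, (diff E (m i) z).toLinearMap.smulRight (Ti z z (b i))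
  have hN : ∀ v, N v = ∑ i, diff E (m i) z v • Ti z z (b i) := fun v => by
    change (∑ i, (diff E (m i) z).toLinearMap.smulRight (Ti z z (b i))) v = _
    rw [LinearMap.sum_apply]
    rfl
  -- Near `z` the bracket is `Σ ∂ᵢf · mᵢ`, where the components `mᵢ` of `X_g` vanish at `z`. First
  -- and second derivatives at `z` follow from the product rule.
  have hex : ∀ f : Fn E M, ∀ G : E → Fn E M, (∀ e, ∀ᶠ y in 𝓝 z, G e y = diff E f y (Ti z y e)) →
      ∀ᶠ y in 𝓝 z, P.bracket f g y = (∑ i, G (b i) * m i : Fn E M) y := fun f G hG => by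
    filter_upwards [hq, eventually_all.2 fun i => hG (b i)] with y h1 h2
    rw [fn_sum_apply, P.bracket_apply]
    have e : P.ham g y = ∑ i, m i y • Ti z y (b i) := by
      have e1 : Tc z y (P.ham g y) = ∑ i, m i y • b i := by
        conv_lhs => rw [← b.sum_repr (Tc z y (P.ham g y))]
        refine Finset.sum_congr rfl fun i _ => ?_
        congr 1
        exact (h1.2 (l i) (P.ham g y)).symm
      rw [← Ti_Tc h1.1 (P.ham g y), e1, map_sum]
      exact Finset.sum_congr rfl fun i _ => map_smul _ _ _
    rw [e, map_sum]
    refine Finset.sum_congr rfl fun i _ => ?_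
    rw [map_smul, ← h2]
    exact mul_comm _ _
  refine ⟨N, fun f v => ?_, fun K hK u v => ?_⟩
  · obtain ⟨G, hG⟩ := exists_hess_fn f z
    rw [diff_congr (hex f G fun e => (hG e).mono fun _ h => h.1), diff_sum, hN, map_sum, sum_apply]
    refine Finset.sum_congr rfl fun i _ => ?_
    rw [diff_mul, m0, zero_smul, add_zero, (hG (b i)).self_of_nhds.1, map_smul]
    exact mul_comm _ _
  · obtain ⟨G, hG⟩ := exists_hess_fn K z
    have G0 : ∀ i, G (b i) z = 0 := fun i => by
      rw [(hG (b i)).self_of_nhds.1, hK]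
      rfl
    have d0 : ∀ i, diff E (G (b i) * m i : Fn E M) z = 0 := fun i => by
      rw [diff_mul, G0, m0, zero_smul, zero_smul, add_zero]
    have hn := hex K G fun e => (hG e).mono fun _ h => h.1
    have dk : diff E (P.bracket K g) z = 0 := by
      rw [diff_congr hn, diff_sum]
      exact Finset.sum_eq_zero fun i _ => d0 i
    rw [hess_of_diff_near dk hn, hess_sum _ _ d0, hN, hN, map_sum, map_sum,
      ← Finset.sum_add_distrib]
    refine Finset.sum_congr rfl fun i _ => ?_
    rw [hess_mul _ _ (G0 i) (m0 i), ← (hG (b i)).self_of_nhds.2 hK u,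
      ← (hG (b i)).self_of_nhds.2 hK v, map_smul, map_smul, smul_eq_mul, smul_eq_mul]
    ring

end Linearization

namespace ConstraintData

variable {EX X ES S EQ Q EZ Z : Type*}
    [NormedAddCommGroup EX] [NormedSpace ℝ EX] [FiniteDimensional ℝ EX]
    [TopologicalSpace X] [ChartedSpace EX X] [IsManifold 𝓘(ℝ, EX) ∞ X]
    [T2Space X] [SecondCountableTopology X]
    [NormedAddCommGroup ES] [NormedSpace ℝ ES] [FiniteDimensional ℝ ES]
    [TopologicalSpace S] [ChartedSpace ES S] [IsManifold 𝓘(ℝ, ES) ∞ S]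
    [T2Space S] [SecondCountableTopology S]
    [NormedAddCommGroup EQ] [NormedSpace ℝ EQ] [FiniteDimensional ℝ EQ]
    [TopologicalSpace Q] [ChartedSpace EQ Q] [IsManifold 𝓘(ℝ, EQ) ∞ Q]
    [T2Space Q] [SecondCountableTopology Q]
    [NormedAddCommGroup EZ] [NormedSpace ℝ EZ] [FiniteDimensional ℝ EZ]
    [TopologicalSpace Z] [ChartedSpace EZ Z] [IsManifold 𝓘(ℝ, EZ) ∞ Z]
    [T2Space Z] [SecondCountableTopology Z]
    {D : ConstraintData EX X ES S EQ Q EZ Z}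
    {𝔤 : Type*} [LieRing 𝔤] [LieAlgebra ℝ 𝔤] [Module.Finite ℝ 𝔤] {c : LieSubalgebra ℝ 𝔤}
    (hD : D.IsConstraint)

include hD

/-- An admissible extension is corrected by a function vanishing on `Q` so as to be critical in `Z`,
not only along `Q`. Coisotropy preserves admissibility. -/
theorem IsConstraint.exists_ptil_ext {H : Fn EQ Q} (hP : D.Ptil H) {x : X}
    (h0 : diff EQ H (D.ptQ x) = 0) {g : Fn EZ Z} (hg : ∀ q, g (D.iQ q) = 0) :
    ∃ K : Fn EZ Z, (∀ q, K (D.iQ q) = H q) ∧ diff EZ K (D.ptZ x) = 0 ∧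
      ∀ q, D.poisson.bracket K g (D.iQ q) = 0 := by
  obtain ⟨K, hK1, hK⟩ := hP
  have hcomp : (K.comp D.iQ : Fn EQ Q) = H := by
    ext q
    exact hK q
  have hk : ∀ u, diff EZ K (D.ptZ x) (D.qZ x u) = 0 := fun u => by
    have e := diff_comp_fn K D.iQ (D.ptQ x)
    rw [hcomp, h0] at e
    exact (congrArg (fun L => L u) e).symm
  obtain ⟨f, hf, e⟩ := hD.exists_fn_van hk
  refine ⟨K - f, fun q => ?_, ?_, fun q => ?_⟩
  · change K (D.iQ q) - f (D.iQ q) = H q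
    rw [hK, hf, sub_zero]
  · rw [diff_sub, e, sub_self]
  · rw [D.poisson.bracket_sub_left]
    change D.poisson.bracket K g (D.iQ q) - D.poisson.bracket f g (D.iQ q) = 0
    rw [hK1 g hg, hD.bracket_van hf hg, sub_zero]

/-- The linearization of the Hamiltonian vector field of a constraint function leaves the second
derivative of an admissible function invariant. -/
theorem IsConstraint.exists_infinitesimal {H : Fn EQ Q} (hP : D.Ptil H) {x : X}
    (h0 : diff EQ H (D.ptQ x) = 0) {g : Fn EZ Z} (hg : ∀ q, g (D.iQ q) = 0) :
    ∃ N : Tan EQ (D.ptQ x) → Tan EQ (D.ptQ x),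
      (∀ (f : Fn EZ Z) u, diff EZ (D.poisson.bracket f g) (D.ptZ x) (D.qZ x u) =
        diff EZ f (D.ptZ x) (D.qZ x (N u))) ∧
      ∀ u v, hess EQ H (D.ptQ x) u (N v) + hess EQ H (D.ptQ x) (N u) v = 0 := by
  obtain ⟨K, hK, hK0, hKg⟩ := hD.exists_ptil_ext hP h0 hg
  have hham := hD.ham_van_ptZ hg x
  obtain ⟨N, hN1, hN2⟩ := D.poisson.exists_linearization hham
  -- The linearization preserves `TQ`: dually, `{·, g}` preserves the functions vanishing on `Q`.
  have hN3 : ∀ u, ∃ v, D.qZ x v = N (D.qZ x u) := fun u => by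
    have : N (D.qZ x u) ∈ LinearMap.range (D.qZ x).toLinearMap := by
      refine mem_of_annihilator fun a ha => ?_
      obtain ⟨f, hf, rfl⟩ := hD.exists_fn_van (x := x) fun u => ha _ ⟨u, rfl⟩
      rw [← hN1]
      exact hD.diff_tQ (hD.bracket_van hf hg) _ u
    exact this
  choose n hn using hN3
  refine ⟨n, fun f u => by rw [hN1, hn], fun u v => ?_⟩
  have dk : diff EZ (D.poisson.bracket K g) (D.ptZ x) = 0 := by
    refine ContinuousLinearMap.ext fun v => ?_
    rw [hN1, hK0]
    rfl
  -- `{K, g}` vanishes on `Q`, so its second derivative vanishes on `TQ`. By the linearization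
  -- formula this second derivative is the variation of that of `H`.
  have e := hess_restrict (H := 0) hKg dk u v
  rw [hess_zero, hN2 K hK0, ← hn, ← hn, ← hess_restrict hK hK0, ← hess_restrict hK hK0] at e
  rw [e, hess_symm _ _ _ (n u)]

/-- `χ` is the inverse of the second derivative, restricted to `L̃`. For `ζ ∈ c` the action of `ad
ζ` on `L̃` is minus the transpose of a linearization `N` that is skew for the second derivative, so
it is skew for `χ`. The group statement follows from `isInvForm_of_infinitesimal`. -/
theorem IsConstraint.chi_mem_L2Dual {H : Fn EQ Q} {hH : D.Critical H} (hP : D.Ptil H)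
    (hJ : ∀ x, Function.Bijective (D.jV H hH x)) {τ : D.Fields} (hτ : D.IsTriple τ)
    (hd : ∀ x, D.Diagram x (D.jV H hH x) τ) (hr : D.Reducible c) (x : X) :
    τ.χ x ∈ D.L2Dual c x := by
  obtain ⟨σ, hx⟩ := hr x
  set p := σ.frame x with hpdef
  have hp : D.IsConstraintFrame c x p := σ.mem x hx
  let r : 𝔤 →ₗ[ℝ] D.Ltil x :=
    { toFun := fun ξ => ⟨D.resQ p ξ, fun u => hp.1.sZ ξ u⟩
      map_add' := fun ξ η => Subtype.ext (resQ_add p ξ η)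
      map_smul' := fun t ξ => Subtype.ext (resQ_smul p t ξ) }
  have hr' : ∀ ξ u, (r ξ : Cot EQ (D.ptQ x)) u = p ξ (D.qZ x u) := fun ξ u => rfl
  let B : LinearMap.BilinForm ℝ 𝔤 := (τ.χ x).compl₁₂ r r
  have hB : ∀ ξ η, B ξ η = τ.χ x (r ξ) (r η) := fun ξ η => rfl
  have hχ : ∀ (a b : D.Ltil x) (u : Tan EQ (D.ptQ x)),
      (∀ v, hess EQ H (D.ptQ x) u v = (a : Cot EQ (D.ptQ x)) v) →
      τ.χ x a b = (b : Cot EQ (D.ptQ x)) u := fun a b u h =>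
    (hd x).2 a b (Submodule.Quotient.mk u) (Subtype.ext ((jV_mk hH x u).trans
      (ContinuousLinearMap.ext h)))
  have hJ' : ∀ a : D.Ltil x, ∃ u, ∀ v, hess EQ H (D.ptQ x) u v = (a : Cot EQ (D.ptQ x)) v := by
    intro a
    obtain ⟨m, hm⟩ := (hJ x).2 (D.incl x a)
    induction m using Submodule.Quotient.induction_on with
    | H u =>
      refine ⟨u, fun v => ?_⟩
      rw [← jV_mk hH x u, hm]
      rfl
  refine ⟨p, hp, B, isInvForm_of_infinitesimal (fun ξ η => hτ.2.2.1 x _ _) ?_ ?_, ?_⟩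
  · intro ξ hξ η
    have h0 : r ξ = 0 := Subtype.ext (ContinuousLinearMap.ext fun u => (hp.mem_iff ξ).1 hξ u)
    rw [hB, h0, map_zero]
    rfl
  · intro ζ hζ ξ η
    obtain ⟨g, hg, hgp⟩ := hD.exists_fn_van ((hp.mem_iff ζ).1 hζ)
    obtain ⟨N, hN1, hN2⟩ := hD.exists_infinitesimal hP (hH x) hg
    have hbr : ∀ ξ u, (r ⁅ζ, ξ⁆ : Cot EQ (D.ptQ x)) u = -(r ξ : Cot EQ (D.ptQ x)) (N u) := by
      intro ξ u
      obtain ⟨f, hf⟩ := exists_fn_diff (D.ptZ x) (p ξ)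
      rw [hr', hr', ← hf, ← hN1, hp.1.2.2 ξ ζ f g hf hgp, ← lie_skew ξ ζ, map_neg]
      exact (neg_neg _).symm
    obtain ⟨u, hu⟩ := hJ' (r ξ)
    -- If `u` represents `r ξ` under the second derivative, then `N u` represents `r ⁅ζ, ξ⁆`, by
    -- skewness of `N`.
    rw [hB, hB, hχ (r ξ) _ u hu, hbr, hχ (r ⁅ζ, ξ⁆) _ (N u) fun v => ?_, add_neg_cancel]
    rw [hbr, ← hu]
    exact eq_neg_of_add_eq_zero_right (hN2 u v)
  · intro ξ η a b h1 h2
    rw [hB]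
    exact congrArg₂ (fun a b => τ.χ x a b) (Subtype.ext h1) (Subtype.ext h2)

end ConstraintData

end

/-! ### Parallel transport along rays, smooth in the end point. -/

noncomputable section

section ParallelTransport

/-- The unit interval. -/
abbrev II := Set.Icc (0 : ℝ) 1

section Slice

variable {E F : Type*} [NormedAddCommGroup E] [NormedSpace ℝ E] [FiniteDimensional ℝ E]
  [NormedAddCommGroup F] [NormedSpace ℝ F]

/-- The restriction to the unit interval of a function of two variables. -/
def slice (G : E × ℝ → F) (hG : Continuous G) (y : E) : C(II, F) :=
  ⟨fun s => G (y, s), by fun_prop⟩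

theorem continuous_slice (G : E × ℝ → F) (hG : Continuous G) : Continuous (slice G hG) := by
  have hc : Continuous (fun p : E × II => G (p.1, (p.2 : ℝ))) := by fun_prop
  exact (ContinuousMap.curry ⟨_, hc⟩).continuous

/-- The partial derivative in the first variable. -/
def dslice (G : E × ℝ → F) (p : E × ℝ) : E →L[ℝ] F :=
  (fderiv ℝ G p).comp (ContinuousLinearMap.inl ℝ E ℝ)

theorem contDiff_dslice {G : E × ℝ → F} (hG : ContDiff ℝ ∞ G) : ContDiff ℝ ∞ (dslice G) :=
  (hG.fderiv_right (m := ∞) (by simp)).clm_comp contDiff_const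

theorem hasFDerivAt_slice {G : E × ℝ → F} (hG : ContDiff ℝ ∞ G) (y : E) (s : ℝ) :
    HasFDerivAt (fun y => G (y, s)) (dslice G (y, s)) y := by
  have h := (hG.differentiable (by simp) (y, s)).hasFDerivAt
  have h2 : HasFDerivAt (fun y : E => (y, s)) (ContinuousLinearMap.inl ℝ E ℝ) y :=
    hasFDerivAt_prodMk_left y s
  exact h.comp y h2

/-- The derivative of a slice. -/
def dsl (G : E × ℝ → F) (hG : ContDiff ℝ ∞ G) (y : E) : E →L[ℝ] C(II, F) :=
  LinearMap.toContinuousLinearMap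
    { toFun := fun e => slice (fun p => dslice G p e)
        ((contDiff_dslice hG).continuous.clm_apply continuous_const) y
      map_add' := fun e e' => by ext s; exact map_add (dslice G (y, s)) e e'
      map_smul' := fun r e => by ext s; exact map_smul (dslice G (y, s)) r e }

/-- The remainder must be small uniformly in `s`. On a ball where the slice of the partial
derivative moves by less than `ε` in the sup norm, the mean value inequality gives this for all `s`
at once. -/
theorem slice_hasFDerivAt {G : E × ℝ → F} (hG : ContDiff ℝ ∞ G) (y : E) :
    HasFDerivAt (slice G hG.continuous) (dsl G hG y) y := by
  rw [hasFDerivAt_iff_isLittleO, Asymptotics.isLittleO_iff]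
  intro ε hε
  have hc := (continuous_slice _ (contDiff_dslice hG).continuous).tendsto y
  obtain ⟨δ, hδ, hb⟩ := Metric.eventually_nhds_iff_ball.1 (Metric.tendsto_nhds.1 hc ε hε)
  filter_upwards [Metric.ball_mem_nhds y hδ] with y' hy'
  rw [ContinuousMap.norm_le _ (by positivity)]
  intro s
  refine (convex_ball y δ).norm_image_sub_le_of_norm_hasFDerivWithin_le'
    (f := fun y => G (y, (s : ℝ))) (f' := fun y => dslice G (y, (s : ℝ)))
    (φ := dslice G (y, (s : ℝ)))
    (fun z _ => (hasFDerivAt_slice hG z s).hasFDerivWithinAt) (fun z hz => ?_)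
    (Metric.mem_ball_self hδ) hy'
  have h1 := (ContinuousMap.dist_apply_le_dist s).trans (hb z hz).le
  rwa [dist_eq_norm] at h1

/-- Induction on the order: each directional derivative of a slice is the slice of a partial
derivative. -/
theorem contDiff_slice {G : E × ℝ → F} (hG : ContDiff ℝ ∞ G) :
    ContDiff ℝ ∞ (slice G hG.continuous) := by
  rw [contDiff_infty]
  intro n
  induction n generalizing G with
  | zero => exact contDiff_zero.2 (continuous_slice _ _)
  | succ n ih =>
    rw [Nat.cast_succ, contDiff_succ_iff_fderiv]
    refine ⟨fun y => (slice_hasFDerivAt hG y).differentiableAt, by simp, ?_⟩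
    rw [show fderiv ℝ (slice G hG.continuous) = dsl G hG from
      funext fun y => (slice_hasFDerivAt hG y).fderiv, contDiff_clm_apply_iff]
    intro e
    exact ih (G := fun p => dslice G p e) ((contDiff_dslice hG).clm_apply contDiff_const)

end Slice

section Volterra

variable {𝔸 : Type*} [NormedRing 𝔸] [NormedAlgebra ℝ 𝔸] [CompleteSpace 𝔸]

/-- The primitive of a continuous function on the unit interval. -/
def prim (f : C(II, 𝔸)) (t : ℝ) : 𝔸 := ∫ s in (0 : ℝ)..t, f (Set.projIcc 0 1 zero_le_one s)

theorem continuous_projIcc_comp (f : C(II, 𝔸)) :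
    Continuous fun s => f (Set.projIcc 0 1 zero_le_one s) :=
  f.continuous.comp continuous_projIcc

theorem prim_hasDerivAt (f : C(II, 𝔸)) (t : ℝ) :
    HasDerivAt (prim f) (f (Set.projIcc 0 1 zero_le_one t)) t :=
  (continuous_projIcc_comp f).integral_hasStrictDerivAt 0 t |>.hasDerivAt

theorem prim_zero (f : C(II, 𝔸)) : prim f 0 = 0 := intervalIntegral.integral_same

/-- The Volterra operator. -/
def volterra : C(II, 𝔸) →L[ℝ] C(II, 𝔸) :=
  LinearMap.mkContinuous
    { toFun := fun f => ⟨fun t => prim f t, by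
        have : Continuous (prim f) :=
          continuous_iff_continuousAt.2 fun t => (prim_hasDerivAt f t).continuousAt
        fun_prop⟩
      map_add' := fun f g => by
        ext t
        exact intervalIntegral.integral_add ((continuous_projIcc_comp f).intervalIntegrable _ _)
          ((continuous_projIcc_comp g).intervalIntegrable _ _)
      map_smul' := fun r f => by
        ext t
        exact intervalIntegral.integral_smul r _ } 1 (fun f => by
    rw [one_mul, ContinuousMap.norm_le _ (norm_nonneg f)]
    intro t
    refine (intervalIntegral.norm_integral_le_of_norm_le_const fun s _ => f.norm_coe_le_norm _).trans ?_
    rw [sub_zero, abs_of_nonneg t.2.1]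
    exact mul_le_of_le_one_right (norm_nonneg f) t.2.2)

/-- A linear equation with smooth small coefficients has smooth solutions. -/
theorem exists_solution {E 𝓒 : Type*} [NormedAddCommGroup E] [NormedSpace ℝ E] [NormedRing 𝓒]
    [NormedAlgebra ℝ 𝓒] [CompleteSpace 𝓒] (v : 𝓒 →L[ℝ] 𝓒) {A : E → 𝓒} (hA : ContDiff ℝ ∞ A)
    (hA0 : A 0 = 0) : ∃ n : E → 𝓒, n 0 = 1 ∧ ∀ᶠ y in 𝓝 (0 : E), ContDiffAt ℝ ∞ n y ∧
      (∀ᶠ z in 𝓝 y, n z + v (A z * n z) = 1) ∧ IsUnit (n y) ∧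
      ∀ e, fderiv ℝ n y e + v (A y * fderiv ℝ n y e + fderiv ℝ A y e * n y) = 0 := by
  -- The equation reads `P y (n y) = 1`. As `P 0 = 1`, the operator is invertible near `0`, and `n`
  -- is smooth because inversion is.
  set P : E → 𝓒 →L[ℝ] 𝓒 := fun y => 1 + v.comp (ContinuousLinearMap.mul ℝ 𝓒 (A y)) with hP
  have hPs : ContDiff ℝ ∞ P := by
    have h1 : ContDiff ℝ ∞ fun y => ContinuousLinearMap.mul ℝ 𝓒 (A y) :=
      (ContinuousLinearMap.mul ℝ 𝓒).contDiff.comp hA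
    exact contDiff_const.add (contDiff_const.clm_comp h1)
  have hP0 : P 0 = 1 := by
    simp only [hP, hA0, map_zero, ContinuousLinearMap.comp_zero, add_zero]
  have hu : ∀ᶠ y in 𝓝 (0 : E), IsUnit (P y) := by
    refine hPs.continuous.continuousAt.eventually (p := fun L => IsUnit L)
      (Units.isOpen.mem_nhds ?_)
    change IsUnit (P 0)
    rw [hP0]
    exact isUnit_one
  set n : E → 𝓒 := fun y => Ring.inverse (P y) 1 with hn
  have hns : ∀ y, IsUnit (P y) → ContDiffAt ℝ ∞ n y := by
    rintro y ⟨u, hu⟩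
    have h1 := contDiffAt_ringInverse ℝ (n := ∞) u
    rw [hu] at h1
    exact (h1.comp y hPs.contDiffAt).clm_apply contDiffAt_const
  have hneq : ∀ y, IsUnit (P y) → n y + v (A y * n y) = 1 := fun y hy =>
    congrArg (fun L : 𝓒 →L[ℝ] 𝓒 => L 1) (Ring.mul_inverse_cancel _ hy)
  have hn0 : n 0 = 1 := by
    simp only [hn, hP0, Ring.inverse_one]
    rfl
  have hnu : ∀ᶠ y in 𝓝 (0 : E), IsUnit (n y) := by
    refine (hns 0 hu.self_of_nhds).continuousAt.eventually (p := fun a => IsUnit a)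
      (Units.isOpen.mem_nhds ?_)
    change IsUnit (n 0)
    rw [hn0]
    exact isUnit_one
  refine ⟨n, hn0, ?_⟩
  filter_upwards [hu, hu.eventually_nhds, hnu] with y hy hy' hny
  refine ⟨hns y hy, hy'.mono hneq, hny, fun e => ?_⟩
  have hnd : HasFDerivAt n (fderiv ℝ n y) y :=
    ((hns y hy).differentiableAt (by simp)).hasFDerivAt
  have hAd : HasFDerivAt A (fderiv ℝ A y) y :=
    (hA.differentiable (by simp) y).hasFDerivAt
  have h1 := hnd.add (v.hasFDerivAt.comp y (hAd.mul' hnd))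
  have h2 : HasFDerivAt (fun y => n y + v (A y * n y)) (0 : E →L[ℝ] 𝓒) y :=
    (hasFDerivAt_const 1 y).congr_of_eventuallyEq (hy'.mono fun z hz => hneq z hz)
  exact congrArg (fun L : E →L[ℝ] 𝓒 => L e) (h1.unique h2)

variable {E : Type*} [NormedAddCommGroup E] [NormedSpace ℝ E] [FiniteDimensional ℝ E]

/-- Parallel transport along rays, with its dependence on the end point. -/
theorem exists_radial_gauge {T : E → E →L[ℝ] 𝔸} (hT : ContDiff ℝ ∞ T) :
    ∃ m : E → ℝ → 𝔸, ContDiffAt ℝ ∞ (fun y => m y 1) 0 ∧ m 0 1 = 1 ∧ ∀ᶠ y in 𝓝 (0 : E),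
      ContDiffAt ℝ ∞ (fun y => m y 1) y ∧ m y 0 = 1 ∧
      (∀ t ∈ II, IsUnit (m y t) ∧ HasDerivAt (m y) (-(T (t • y) y * m y t)) t) ∧
      ∀ e, ∃ M : ℝ → 𝔸, M 0 = 0 ∧ M 1 = fderiv ℝ (fun y => m y 1) y e ∧ ∀ t ∈ II,
        HasDerivAt M (-((t • fderiv ℝ T (t • y) e y + T (t • y) e) * m y t
          + T (t • y) y * M t)) t := by
  -- The connection form along the ray `t ↦ t y`, paired with its velocity. It vanishes for `y = 0`,
  -- which is the smallness required by `exists_solution`.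
  set G : E × ℝ → 𝔸 := fun p => T (p.2 • p.1) p.1 with hGdef
  have hG : ContDiff ℝ ∞ G := by
    have h1 : ContDiff ℝ ∞ (fun p : E × ℝ => p.2 • p.1) := contDiff_snd.smul contDiff_fst
    exact (hT.comp h1).clm_apply contDiff_fst
  set A : E → C(II, 𝔸) := slice G hG.continuous with hA
  have hAs : ContDiff ℝ ∞ A := contDiff_slice hG
  have hA0 : A 0 = 0 := by
    ext s
    change T ((s : ℝ) • (0 : E)) 0 = 0
    rw [map_zero]
  obtain ⟨n, hn0, hn⟩ := exists_solution volterra hAs hA0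
  -- `n y` lives only on the unit interval. The primitive is defined for all real `t`, so that
  -- two-sided derivatives exist also at the end points; on the interval both agree.
  set m : E → ℝ → 𝔸 := fun y t => 1 - prim (A y * n y) t with hm
  have hmn : ∀ y, n y + volterra (A y * n y) = 1 → ∀ t : II, m y t = n y t := fun y hy t => by
    have := congrArg (fun f : C(II, 𝔸) => f t) hy
    change n y t + prim (A y * n y) t = 1 at this
    exact (eq_sub_of_add_eq this).symm
  let ev : II → C(II, 𝔸) →L[ℝ] 𝔸 := fun t => ContinuousMap.evalCLM ℝ t
  have hm1 : ∀ᶠ y in 𝓝 (0 : E), (fun y => m y 1) =ᶠ[𝓝 y] fun y => ev ⟨1, by simp⟩ (n y) :=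
    hn.mono fun y hy => hy.2.1.mono fun z hz => hmn z hz ⟨1, by simp⟩
  have hs1 : ∀ᶠ y in 𝓝 (0 : E), ContDiffAt ℝ ∞ (fun y => m y 1) y := by
    filter_upwards [hn, hm1] with y hy h1
    exact ((ev ⟨1, by simp⟩).contDiff.contDiffAt.comp y hy.1).congr_of_eventuallyEq h1
  have hproj : ∀ t (ht : t ∈ II), Set.projIcc 0 1 zero_le_one t = (⟨t, ht⟩ : II) := fun t ht =>
    Set.projIcc_of_mem _ ht
  refine ⟨m, hs1.self_of_nhds, ?_, ?_⟩
  · exact (hmn 0 hn.self_of_nhds.2.1.self_of_nhds ⟨1, by simp⟩).trans (by rw [hn0]; rfl)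
  filter_upwards [hn, hs1, hm1] with y ⟨hns, hy', hny, hlin⟩ hs hm1
  have hy := hy'.self_of_nhds
  refine ⟨hs, by simp [hm, prim_zero], fun t ht => ⟨?_, ?_⟩, fun e => ?_⟩
  · rw [hmn y hy ⟨t, ht⟩]
    obtain ⟨⟨a, b, hab, hba⟩, rfl⟩ := hny
    exact ⟨⟨n y ⟨t, ht⟩, b ⟨t, ht⟩, congrArg (fun f : C(II, 𝔸) => f ⟨t, ht⟩) hab,
      congrArg (fun f : C(II, 𝔸) => f ⟨t, ht⟩) hba⟩, rfl⟩
  · have h := (prim_hasDerivAt (A y * n y) t).const_sub 1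
    rw [hproj t ht] at h
    rw [hmn y hy ⟨t, ht⟩]
    exact h
  · replace hlin := hlin e
    set N1 := fderiv ℝ n y e with hN1
    set A1 := fderiv ℝ A y e with hA1
    have hnd : HasFDerivAt n (fderiv ℝ n y) y := (hns.differentiableAt (by simp)).hasFDerivAt
    have hAd : HasFDerivAt A (fderiv ℝ A y) y :=
      (hAs.differentiable (by simp) y).hasFDerivAt
    have hN1t : ∀ t : II, N1 t = -prim (A y * N1 + A1 * n y) t := fun t =>
      congrArg (fun f : C(II, 𝔸) => f t) (eq_neg_of_add_eq_zero_left hlin)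
    -- Both occurrences of `y` in `T (t y) y` are varied. This is the inhomogeneous term of the
    -- variational equation for `M`.
    have hA1t : ∀ t : II, A1 t = (t : ℝ) • fderiv ℝ T ((t : ℝ) • y) e y + T ((t : ℝ) • y) e := by
      intro t
      have h1 : HasFDerivAt (fun y => A y t) ((ev t).comp (fderiv ℝ A y)) y :=
        (ev t).hasFDerivAt.comp y hAd
      have h2 : HasFDerivAt (fun y : E => T ((t : ℝ) • y)) ((fderiv ℝ T ((t : ℝ) • y)).comp
          ((t : ℝ) • ContinuousLinearMap.id ℝ E)) y :=
        HasFDerivAt.comp y (hT.differentiable (by simp) _).hasFDerivAt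
          ((hasFDerivAt_id y).const_smul (t : ℝ))
      have h3 := h2.clm_apply (hasFDerivAt_id y)
      have h4 := congrArg (fun L : E →L[ℝ] 𝔸 => L e) (h1.unique h3)
      refine h4.trans ?_
      simp [add_comm]
    refine ⟨fun t => -prim (A y * N1 + A1 * n y) t, by simp [prim_zero], ?_, fun t ht => ?_⟩
    · have e1 : fderiv ℝ (fun y => m y 1) y e = N1 ⟨1, by simp⟩ := by
        rw [hm1.fderiv_eq]
        exact congrArg (fun L : E →L[ℝ] 𝔸 => L e)
          ((ev ⟨1, by simp⟩).hasFDerivAt.comp y hnd).fderiv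
      rw [e1, hN1t]
    · have h := (prim_hasDerivAt (A y * N1 + A1 * n y) t).neg
      rw [hproj t ht] at h
      beta_reduce
      rw [← hN1t ⟨t, ht⟩, hmn y hy ⟨t, ht⟩, ← hA1t ⟨t, ht⟩]
      refine h.congr_deriv ?_
      change -(A y ⟨t, ht⟩ * N1 ⟨t, ht⟩ + A1 ⟨t, ht⟩ * n y ⟨t, ht⟩) =
        -(A1 ⟨t, ht⟩ * n y ⟨t, ht⟩ + A y ⟨t, ht⟩ * N1 ⟨t, ht⟩)
      rw [add_comm]

end Volterra

end ParallelTransport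

end

/-! ### Parallel transport for derivations takes values in the stabilizer group. -/

noncomputable section

section Gauge

variable {𝔤 : Type*} [LieRing 𝔤] [LieAlgebra ℝ 𝔤] [Module.Finite ℝ 𝔤] {c : LieSubalgebra ℝ 𝔤}

variable (𝔤) in
/-- Bounded operators on the coordinate space. -/
abbrev Op := Coord 𝔤 →L[ℝ] Coord 𝔤

/-- A linear automorphism that preserves the bracket and `c`. -/
def IsGauge (c : LieSubalgebra ℝ 𝔤) (n : Module.End ℝ 𝔤) : Prop :=
  IsUnit n ∧ (∀ ξ η, n ⁅ξ, η⁆ = ⁅n ξ, n η⁆) ∧ ∀ ξ, n ξ ∈ c ↔ ξ ∈ c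

theorem inverse_hasDerivAt {𝔸 : Type*} [NormedRing 𝔸] [NormedAlgebra ℝ 𝔸] [CompleteSpace 𝔸]
    {m : ℝ → 𝔸} {t : ℝ} {b : 𝔸} (hu : IsUnit (m t)) (hm : HasDerivAt m (-(b * m t)) t) :
    HasDerivAt (fun s => Ring.inverse (m s)) (Ring.inverse (m t) * b) t := by
  obtain ⟨u, hu⟩ := hu
  have h1 := hasFDerivAt_ringInverse (𝕜 := ℝ) u
  rw [hu] at h1
  refine (h1.comp_hasDerivAt t hm).congr_deriv ?_
  rw [← hu, Ring.inverse_unit]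
  change -((↑u⁻¹ : 𝔸) * -(b * u) * ↑u⁻¹) = _
  rw [mul_neg, neg_mul, neg_neg, mul_assoc, mul_assoc, Units.mul_inv, mul_one]

theorem const_of_deriv_zero {F : Type*} [NormedAddCommGroup F] [NormedSpace ℝ F] {w : ℝ → F}
    (h : ∀ t ∈ II, HasDerivAt w 0 t) : ∀ t ∈ II, w t = w 0 :=
  constant_of_has_deriv_right_zero (fun t ht => (h t ht).continuousAt.continuousWithinAt)
    fun t ht => (h t ⟨ht.1, ht.2.le⟩).hasDerivWithinAt

theorem opCoord_symm_apply (a : Op 𝔤) (ξ : 𝔤) :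
    coord 𝔤 ((opCoord 𝔤).symm a ξ) = a (coord 𝔤 ξ) := by
  rw [← opCoord_apply, AlgEquiv.apply_symm_apply]

variable (𝔤) in
/-- The bracket in coordinates. -/
def bracketCoord : Coord 𝔤 →L[ℝ] Coord 𝔤 →L[ℝ] Coord 𝔤 :=
  LinearMap.toContinuousLinearMap
    { toFun := fun v => opCoord 𝔤 (LieAlgebra.ad ℝ 𝔤 ((coord 𝔤).symm v))
      map_add' := fun v w => by rw [map_add, map_add, map_add]
      map_smul' := fun r v => by rw [map_smul, map_smul, map_smul]; rfl }

theorem bracketCoord_apply (ξ η : 𝔤) :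
    bracketCoord 𝔤 (coord 𝔤 ξ) (coord 𝔤 η) = coord 𝔤 ⁅ξ, η⁆ := by
  change opCoord 𝔤 (LieAlgebra.ad ℝ 𝔤 ((coord 𝔤).symm (coord 𝔤 ξ))) (coord 𝔤 η) = _
  rw [opCoord_apply, LinearEquiv.symm_apply_apply]
  rfl

/-- Parallel transport for derivations consists of automorphisms. -/
theorem isGauge_of_ode {B m : ℝ → Op 𝔤} (hB : Continuous B)
    (hd : ∀ t ∈ II, ∃ d : LieDerivation ℝ 𝔤 𝔤, (∀ ξ ∈ c, d ξ ∈ c) ∧ B t = opCoord 𝔤 d.toLinearMap)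
    (h0 : m 0 = 1) (hu : ∀ t ∈ II, IsUnit (m t)) (hm : ∀ t ∈ II, HasDerivAt m (-(B t * m t)) t) :
    ∀ t ∈ II, IsGauge c ((opCoord 𝔤).symm (m t)) := by
  have hpt : ∀ t ∈ II, ∀ v : Coord 𝔤, HasDerivAt (fun s => m s v) (-(B t (m t v))) t :=
    fun t ht v => ((ContinuousLinearMap.apply ℝ (Coord 𝔤) v).hasFDerivAt.comp_hasDerivAt t (hm t ht))
  have hlie : ∀ t ∈ II, ∀ ξ η : 𝔤,
      m t (coord 𝔤 ⁅ξ, η⁆) = bracketCoord 𝔤 (m t (coord 𝔤 ξ)) (m t (coord 𝔤 η)) := by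
    intro t ht ξ η
    -- The bracket transported back to time `0`. Its derivative vanishes because `B s` is a
    -- derivation, so it is constantly `⁅ξ, η⁆`.
    let w : ℝ → Coord 𝔤 := fun s => Ring.inverse (m s)
      (bracketCoord 𝔤 (m s (coord 𝔤 ξ)) (m s (coord 𝔤 η)))
    have hw : ∀ s ∈ II, HasDerivAt w 0 s := by
      intro s hs
      have h1 := (bracketCoord 𝔤).isBoundedBilinearMap.hasFDerivAt
        (m s (coord 𝔤 ξ), m s (coord 𝔤 η)) |>.comp_hasDerivAt s
          ((hpt s hs (coord 𝔤 ξ)).prodMk (hpt s hs (coord 𝔤 η)))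
      have h2 := (inverse_hasDerivAt (hu s hs) (hm s hs)).clm_apply h1
      refine h2.congr_deriv ?_
      obtain ⟨d, -, hd⟩ := hd s hs
      obtain ⟨x, hx⟩ := (coord 𝔤).surjective (m s (coord 𝔤 ξ))
      obtain ⟨z, hz⟩ := (coord 𝔤).surjective (m s (coord 𝔤 η))
      change Ring.inverse (m s) (B s (bracketCoord 𝔤 (m s (coord 𝔤 ξ)) (m s (coord 𝔤 η)))) +
        Ring.inverse (m s) (bracketCoord 𝔤 (m s (coord 𝔤 ξ)) (-(B s (m s (coord 𝔤 η)))) +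
          bracketCoord 𝔤 (-(B s (m s (coord 𝔤 ξ)))) (m s (coord 𝔤 η))) = 0
      rw [← hx, ← hz, hd, opCoord_apply, opCoord_apply, bracketCoord_apply, opCoord_apply,
        (map_neg (coord 𝔤) (d.toLinearMap z)).symm, (map_neg (coord 𝔤) (d.toLinearMap x)).symm,
        bracketCoord_apply, bracketCoord_apply, ← map_add, ← map_add, ← map_add]
      have e : d.toLinearMap ⁅x, z⁆ + (⁅x, -d.toLinearMap z⁆ + ⁅-d.toLinearMap x, z⁆) = 0 := by
        change d ⁅x, z⁆ + (⁅x, -d z⁆ + ⁅-d x, z⁆) = 0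
        rw [d.apply_lie_eq_sub, lie_neg, neg_lie, ← lie_skew z (d x)]
        abel
      rw [e, map_zero, map_zero]
    have h := const_of_deriv_zero hw t ht
    have h3 : w 0 = coord 𝔤 ⁅ξ, η⁆ := by
      change Ring.inverse (m 0) (bracketCoord 𝔤 (m 0 (coord 𝔤 ξ)) (m 0 (coord 𝔤 η))) = _
      rw [h0, Ring.inverse_one]
      exact bracketCoord_apply ξ η
    have h4 : m t (w t) = bracketCoord 𝔤 (m t (coord 𝔤 ξ)) (m t (coord 𝔤 η)) :=
      congrArg (fun a : Op 𝔤 => a (bracketCoord 𝔤 (m t (coord 𝔤 ξ)) (m t (coord 𝔤 η))))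
        (Ring.mul_inverse_cancel _ (hu t ht))
    rw [← h4, h, h3]
  obtain ⟨W, hW⟩ := Submodule.exists_isCompl c.toSubmodule
  -- A projection with kernel `c`. A derivation that preserves `c` descends modulo `c`, so the
  -- component of `m s ξ` transverse to `c` satisfies a linear equation of its own.
  let π' : Module.End ℝ 𝔤 := Submodule.subtype W ∘ₗ W.projectionOnto c.toSubmodule hW.symm
  have hπ : ∀ ξ, π' ξ = 0 ↔ ξ ∈ c := fun ξ => by
    change ((W.projectionOnto c.toSubmodule hW.symm ξ : W) : 𝔤) = 0 ↔ _
    rw [ZeroMemClass.coe_eq_zero]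
    exact Submodule.projectionOnto_apply_eq_zero_iff hW.symm
  have hπd : ∀ (d : LieDerivation ℝ 𝔤 𝔤), (∀ ξ ∈ c, d ξ ∈ c) → ∀ ξ, π' (d ξ) = π' (d (π' ξ)) := by
    intro d hd ξ
    rw [← sub_eq_zero, ← map_sub, hπ, ← map_sub]
    refine hd _ ((hπ _).1 ?_)
    rw [map_sub, sub_eq_zero]
    change _ = ((W.projectionOnto c.toSubmodule hW.symm
      (W.projectionOnto c.toSubmodule hW.symm ξ : W) : W) : 𝔤)
    rw [Submodule.projectionOnto_apply_left]
    rfl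
  have hsub : ∀ t ∈ II, ∀ ξ ∈ c, (opCoord 𝔤).symm (m t) ξ ∈ c := by
    intro t ht ξ hξ
    obtain ⟨K, hK⟩ := (isCompact_Icc (a := (0 : ℝ)) (b := 1)).exists_bound_of_continuousOn
      hB.continuousOn
    set p := opCoord 𝔤 π'
    -- For `ξ ∈ c` the transverse component starts at zero and stays zero by Grönwall, with the
    -- bound `K` of `B` on the compact interval.
    have hw := eq_zero_of_abs_deriv_le_mul_abs_self_of_eq_zero_right (a := 0) (b := 1)
      (f := fun s => p (m s (coord 𝔤 ξ))) (f' := fun s => p (-(B s (m s (coord 𝔤 ξ)))))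
      (K := ‖p‖ * K)
      (fun s hs => (p.hasFDerivAt.comp_hasDerivAt s
        (hpt s hs (coord 𝔤 ξ))).continuousAt.continuousWithinAt)
      (fun s hs => (p.hasFDerivAt.comp_hasDerivAt s
        (hpt s ⟨hs.1, hs.2.le⟩ (coord 𝔤 ξ))).hasDerivWithinAt) (by
          rw [h0]
          change p (coord 𝔤 ξ) = 0
          rw [opCoord_apply, (hπ ξ).2 hξ, map_zero]) (fun s hs => by
        obtain ⟨d, hd1, hd2⟩ := hd s ⟨hs.1, hs.2.le⟩
        obtain ⟨x, hx⟩ := (coord 𝔤).surjective (m s (coord 𝔤 ξ))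
        have e : p (-(B s (m s (coord 𝔤 ξ)))) = -(p (B s (p (m s (coord 𝔤 ξ))))) := by
          have e1 : ∀ x : 𝔤, p (B s (coord 𝔤 x)) = coord 𝔤 (π' (d x)) := fun x => by
            rw [hd2, opCoord_apply]
            exact opCoord_apply _ _
          rw [← hx, map_neg, e1, show p (coord 𝔤 x) = coord 𝔤 (π' x) from opCoord_apply _ _, e1,
            hπd d hd1 x]
        rw [e, norm_neg, mul_assoc]
        refine (p.le_opNorm _).trans (mul_le_mul_of_nonneg_left ?_ (norm_nonneg p))
        exact (B s).le_of_opNorm_le (hK s ⟨hs.1, hs.2.le⟩) _) t ht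
    rw [← hπ, ← (coord 𝔤).map_eq_zero_iff, ← opCoord_apply, opCoord_symm_apply]
    exact hw
  intro t ht
  have hun : IsUnit ((opCoord 𝔤).symm (m t)) := (hu t ht).map (opCoord 𝔤).symm
  refine ⟨hun, fun ξ η => ?_, fun ξ => ⟨fun h => ?_, hsub t ht ξ⟩⟩
  · apply (coord 𝔤).injective
    rw [opCoord_symm_apply, hlie t ht, ← bracketCoord_apply, opCoord_symm_apply, opCoord_symm_apply]
  · have hinj : Function.Injective ((opCoord 𝔤).symm (m t)) :=
      ((Module.End.isUnit_iff _).1 hun).1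
    -- An injective map of the finite-dimensional space `c` into itself is onto, so no element
    -- outside `c` can be mapped into `c`.
    have hinj' : Function.Injective (((opCoord 𝔤).symm (m t)).restrict (hsub t ht)) :=
      fun a b hab => Subtype.ext (hinj (congrArg Subtype.val hab))
    obtain ⟨a, ha⟩ := LinearMap.injective_iff_surjective.1 hinj' ⟨_, h⟩
    have : (a : 𝔤) = ξ := hinj (congrArg Subtype.val ha)
    rw [← this]
    exact a.2

end Gauge

end

/-! ### The radial gauge of a connection with inner curvature. -/

noncomputable section

section Gauge

variable {𝔤 : Type*} [LieRing 𝔤] [LieAlgebra ℝ 𝔤] [Module.Finite ℝ 𝔤] {c : LieSubalgebra ℝ 𝔤}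

theorem mem_of_deriv_mem {F : Type*} [NormedAddCommGroup F] [NormedSpace ℝ F]
    [FiniteDimensional ℝ F] (W : Submodule ℝ F) {w : ℝ → F} (h0 : w 0 ∈ W)
    (h : ∀ t ∈ II, ∃ b ∈ W, HasDerivAt w b t) : ∀ t ∈ II, w t ∈ W := by
  intro t ht
  by_contra hw
  obtain ⟨l, hl, hlW⟩ := W.exists_le_ker_of_notMem hw
  let L : F →L[ℝ] ℝ := LinearMap.toContinuousLinearMap l
  have hL : ∀ z ∈ W, L z = 0 := fun z hz => hlW hz
  have h1 := const_of_deriv_zero (w := fun s => L (w s)) (fun s hs => by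
    obtain ⟨b, hb, hd⟩ := h s hs
    have := L.hasFDerivAt.comp_hasDerivAt s hd
    rwa [hL b hb] at this) t ht
  exact hl (h1.trans (hL _ h0))

/-- The inner derivations by elements of the normalizer of `c`, in coordinates. -/
def adNormalizer (c : LieSubalgebra ℝ 𝔤) : Submodule ℝ (Op 𝔤) where
  carrier := {a | ∃ ζ ∈ c.normalizer, a = opCoord 𝔤 (LieAlgebra.ad ℝ 𝔤 ζ)}
  zero_mem' := ⟨0, zero_mem _, by rw [map_zero, map_zero]⟩
  add_mem' := by
    rintro _ _ ⟨ζ, h1, rfl⟩ ⟨κ, h2, rfl⟩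
    exact ⟨ζ + κ, add_mem h1 h2, by rw [map_add, map_add]⟩
  smul_mem' := by
    rintro r _ ⟨ζ, h1, rfl⟩
    exact ⟨r • ζ, c.normalizer.smul_mem r h1, by rw [map_smul, map_smul]⟩

/-- For an automorphism, `n⁻¹ (ad ζ) n = ad (n⁻¹ ζ)`, and an automorphism that stabilizes `c`
stabilizes its normalizer. -/
theorem IsGauge.conj_mem {n : Op 𝔤} (h : IsGauge c ((opCoord 𝔤).symm n)) {a : Op 𝔤}
    (ha : a ∈ adNormalizer c) : Ring.inverse n * (a * n) ∈ adNormalizer c := by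
  obtain ⟨ζ, hζ, rfl⟩ := ha
  obtain ⟨hu, hl, hc⟩ := h
  obtain ⟨κ, hκ⟩ := ((Module.End.isUnit_iff _).1 hu).2 ζ
  have hun : IsUnit n := by
    have := hu.map (opCoord 𝔤)
    rwa [AlgEquiv.apply_symm_apply] at this
  refine ⟨κ, ?_, ?_⟩
  · rw [LieSubalgebra.mem_normalizer_iff] at hζ ⊢
    intro ξ hξ
    rw [← hc, hl, hκ]
    exact hζ _ ((hc ξ).2 hξ)
  · rw [Ring.inverse_mul_eq_iff_eq_mul _ _ _ hun]
    apply ContinuousLinearMap.ext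
    intro v
    obtain ⟨ξ, rfl⟩ := (coord 𝔤).surjective v
    change opCoord 𝔤 (LieAlgebra.ad ℝ 𝔤 ζ) (n (coord 𝔤 ξ)) =
      n (opCoord 𝔤 (LieAlgebra.ad ℝ 𝔤 κ) (coord 𝔤 ξ))
    rw [← opCoord_symm_apply, opCoord_apply, opCoord_apply, ← opCoord_symm_apply]
    change coord 𝔤 ⁅ζ, _⁆ = coord 𝔤 ((opCoord 𝔤).symm n ⁅κ, ξ⁆)
    rw [hl, hκ]

variable {E : Type*} [NormedAddCommGroup E] [NormedSpace ℝ E] [FiniteDimensional ℝ E]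

/-- With `M` the variation of `m` in the direction `e`, the left-hand side is the connection form in
the radial gauge, pulled back by `y ↦ t y` and evaluated on `e`. Its radial derivative is the
curvature on `(y, e)`, conjugated by the transport. -/
theorem hasDerivAt_radial {𝔸 : Type*} [NormedRing 𝔸] [NormedAlgebra ℝ 𝔸] [CompleteSpace 𝔸]
    {T : E → E →L[ℝ] 𝔸} {m M : ℝ → 𝔸} {t : ℝ} {y e : E} (hT : DifferentiableAt ℝ T (t • y))
    (hu : IsUnit (m t)) (hm : HasDerivAt m (-(T (t • y) y * m t)) t)
    (hM : HasDerivAt M (-((t • fderiv ℝ T (t • y) e y + T (t • y) e) * m t + T (t • y) y * M t)) t) :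
    HasDerivAt (fun s => Ring.inverse (m s) * (s • (T (s • y) e * m s) + M s))
      (t • (Ring.inverse (m t) * ((fderiv ℝ T (t • y) y e - fderiv ℝ T (t • y) e y +
        (T (t • y) y * T (t • y) e - T (t • y) e * T (t • y) y)) * m t))) t := by
  have hcurve : HasDerivAt (fun s : ℝ => s • y) y t := by
    simpa using (hasDerivAt_id t).smul_const y
  have hTt : HasDerivAt (fun s : ℝ => T (s • y) e) (fderiv ℝ T (t • y) y e) t :=
    (ContinuousLinearMap.apply ℝ 𝔸 e).hasFDerivAt.comp_hasDerivAt t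
      (hT.hasFDerivAt.comp_hasDerivAt t hcurve)
  have hZ := ((hasDerivAt_id t).smul (hTt.mul hm)).add hM
  refine ((inverse_hasDerivAt hu hm).mul hZ).congr_deriv ?_
  simp only [id_eq, Pi.add_apply, Pi.smul_apply', Pi.mul_apply, smul_add, smul_neg, mul_add, add_mul,
    sub_mul, mul_sub, smul_sub,
    neg_add, mul_neg, smul_mul_assoc, mul_smul_comm, one_smul, mul_assoc]
  abel

/-- A connection by derivations that preserve `c`, with inner curvature, is gauge equivalent to a
connection by inner derivations. -/
theorem exists_gauge {T : E → E →L[ℝ] Op 𝔤} (hT : ContDiff ℝ ∞ T)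
    (h1 : ∀ᶠ y in 𝓝 (0 : E), ∀ e, ∃ d : LieDerivation ℝ 𝔤 𝔤,
      (∀ ξ ∈ c, d ξ ∈ c) ∧ T y e = opCoord 𝔤 d.toLinearMap)
    (h2 : ∀ᶠ y in 𝓝 (0 : E), ∀ e e', fderiv ℝ T y e e' - fderiv ℝ T y e' e +
      (T y e * T y e' - T y e' * T y e) ∈ adNormalizer c) :
    ∃ n : E → Op 𝔤, n 0 = 1 ∧ ∀ᶠ y in 𝓝 (0 : E), ContDiffAt ℝ ∞ n y ∧
      IsGauge c ((opCoord 𝔤).symm (n y)) ∧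
      ∀ e, ∃ ζ ∈ c.normalizer, T y e * n y + fderiv ℝ n y e =
        n y * opCoord 𝔤 (LieAlgebra.ad ℝ 𝔤 ζ) := by
  obtain ⟨m, -, hm0, hm⟩ := exists_radial_gauge hT
  refine ⟨fun y => m y 1, hm0, ?_⟩
  obtain ⟨r, hr, hball⟩ := Metric.eventually_nhds_iff_ball.1 (h1.and h2)
  filter_upwards [hm, Metric.ball_mem_nhds (0 : E) hr] with y hy hyr
  obtain ⟨hs, h0, hode, hvar⟩ := hy
  have hty : ∀ t ∈ II, t • y ∈ Metric.ball (0 : E) r := fun t ht => by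
    rw [mem_ball_zero_iff] at hyr ⊢
    rw [norm_smul, Real.norm_of_nonneg ht.1]
    exact (mul_le_of_le_one_left (norm_nonneg y) ht.2).trans_lt hyr
  have hTd : Differentiable ℝ T := hT.differentiable (by simp)
  have hg : ∀ t ∈ II, IsGauge c ((opCoord 𝔤).symm (m y t)) :=
    isGauge_of_ode (B := fun t => T (t • y) y)
      ((hTd.continuous.comp (continuous_id.smul continuous_const)).clm_apply continuous_const)
      (fun t ht => (hball _ (hty t ht)).1 y) h0 (fun t ht => (hode t ht).1)
      fun t ht => (hode t ht).2
  have h1I : (1 : ℝ) ∈ II := ⟨zero_le_one, le_rfl⟩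
  refine ⟨hs, hg 1 h1I, fun e => ?_⟩
  obtain ⟨M, hM0, hM1, hM⟩ := hvar e
  -- `w` starts at zero and its derivative is conjugated curvature, which lies in `adNormalizer c`.
  -- So `w 1 = n⁻¹ (T e n + ∂ₑ n)` lies there too.
  let w : ℝ → Op 𝔤 := fun t => Ring.inverse (m y t) * (t • (T (t • y) e * m y t) + M t)
  have hw := mem_of_deriv_mem (adNormalizer c) (w := w) (by
      change Ring.inverse (m y 0) * ((0 : ℝ) • (T ((0 : ℝ) • y) e * m y 0) + M 0) ∈ _
      rw [hM0, zero_smul, add_zero, mul_zero]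
      exact Submodule.zero_mem _) (fun t ht => by
    obtain ⟨hu, hmt⟩ := hode t ht
    exact ⟨_, Submodule.smul_mem _ t ((hg t ht).conj_mem ((hball _ (hty t ht)).2 y e)),
      hasDerivAt_radial (hTd _) hu hmt (hM t ht)⟩) 1 h1I
  obtain ⟨ζ, hζ, he⟩ := hw
  refine ⟨ζ, hζ, ?_⟩
  rw [← he]
  change _ = m y 1 * (Ring.inverse (m y 1) * _)
  rw [← mul_assoc, Ring.mul_inverse_cancel _ (hode 1 h1I).1, one_mul, hM1, one_smul, one_smul]

end Gauge

end

/-! ### Curvature of the derivations defined by a frame. -/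

noncomputable section

/-- Coordinate vector fields commute. -/
theorem diff_diff_chart_symm {E M : Type*} [NormedAddCommGroup E] [NormedSpace ℝ E]
    [FiniteDimensional ℝ E] [TopologicalSpace M] [ChartedSpace E M] [IsManifold 𝓘(ℝ, E) ∞ M]
    (k : Fn E M) {z₀ z : M} (hz : z ∈ (chartAt E z₀).source) (e e' : E) :
    diff E (fun y => diff E k y (Ti z₀ y e')) z (Ti z₀ z e) =
      diff E (fun y => diff E k y (Ti z₀ y e)) z (Ti z₀ z e') := by
  set φ := extChartAt 𝓘(ℝ, E) z₀ with hφ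
  have hs : φ.source = (chartAt E z₀).source := extChartAt_source 𝓘(ℝ, E) z₀
  have hc := contDiffAt_chart' k hz
  have key : ∀ a b : E, diff E (fun y => diff E k y (Ti z₀ y b)) z (Ti z₀ z a) =
      fderiv ℝ (fderiv ℝ (k ∘ φ.symm)) (φ z) a b := by
    intro a b
    let G : M → ℝ := fun y => fderiv ℝ (k ∘ φ.symm) (φ y) b
    have hd : ContDiffAt ℝ ∞ (fun v => fderiv ℝ (k ∘ φ.symm) v b) (φ z) :=
      ((ContinuousLinearMap.apply ℝ ℝ b).contDiff.contDiffAt.comp (φ z)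
        (hc.fderiv_right (m := ∞) (by simp)))
    have h1 : (fun y => diff E k y (Ti z₀ y b)) =ᶠ[𝓝 z] G := by
      filter_upwards [(chartAt E z₀).open_source.mem_nhds hz] with y hy
      exact diff_apply_chart hy (fn_mdiff k y) b
    have hG : MDifferentiableAt 𝓘(ℝ, E) 𝓘(ℝ, ℝ) G z :=
      (hd.contMDiffAt.mdifferentiableAt (by simp)).comp z (smoothNear_extChart hz).mdiff
    have h2 : G ∘ φ.symm =ᶠ[𝓝 (φ z)] fun v => fderiv ℝ (k ∘ φ.symm) v b := by
      filter_upwards [extChartAt_target_mem_nhds' (I := 𝓘(ℝ, E)) (x := z₀)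
        (φ.map_source (by rw [hs]; exact hz))] with v hv
      change fderiv ℝ (k ∘ φ.symm) (φ (φ.symm v)) b = _
      rw [φ.right_inv hv]
    rw [diff_congr h1, diff_apply_chart hz hG, h2.fderiv_eq]
    have h3 := (ContinuousLinearMap.apply ℝ ℝ b).hasFDerivAt.comp (φ z)
      ((hc.fderiv_right (m := 1) (by norm_num; exact ENat.LEInfty.out)).differentiableAt
        (by norm_num)).hasFDerivAt
    exact congrArg (fun L : E →L[ℝ] ℝ => L a) h3.fderiv
  rw [key, key]
  exact (hc.isSymmSndFDerivAt (by simpa using ENat.LEInfty.out)) e e'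

namespace ConstraintData

variable {EX X ES S EQ Q EZ Z : Type*}
    [NormedAddCommGroup EX] [NormedSpace ℝ EX] [FiniteDimensional ℝ EX]
    [TopologicalSpace X] [ChartedSpace EX X] [IsManifold 𝓘(ℝ, EX) ∞ X]
    [T2Space X] [SecondCountableTopology X]
    [NormedAddCommGroup ES] [NormedSpace ℝ ES] [FiniteDimensional ℝ ES]
    [TopologicalSpace S] [ChartedSpace ES S] [IsManifold 𝓘(ℝ, ES) ∞ S]
    [T2Space S] [SecondCountableTopology S]
    [NormedAddCommGroup EQ] [NormedSpace ℝ EQ] [FiniteDimensional ℝ EQ]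
    [TopologicalSpace Q] [ChartedSpace EQ Q] [IsManifold 𝓘(ℝ, EQ) ∞ Q]
    [T2Space Q] [SecondCountableTopology Q]
    [NormedAddCommGroup EZ] [NormedSpace ℝ EZ] [FiniteDimensional ℝ EZ]
    [TopologicalSpace Z] [ChartedSpace EZ Z] [IsManifold 𝓘(ℝ, EZ) ∞ Z]
    [T2Space Z] [SecondCountableTopology Z]
    {D : ConstraintData EX X ES S EQ Q EZ Z}
    {𝔤 : Type*} [LieRing 𝔤] [LieAlgebra ℝ 𝔤] [Module.Finite ℝ 𝔤] {c : LieSubalgebra ℝ 𝔤}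
    (hD : D.IsConstraint) {α : ∀ x, Tan EX x →ₗ[ℝ] D.Etil x}
    (hα : D.IsConnForm α) (ha : ∀ x v, D.Adm x (α x v : Cot EQ (D.ptQ x)))

include hD hα

theorem IsConstraint.bracket_ptZ {f : Fn EZ Z} {x : X} {v : Tan EX x}
    (hf : ∀ u, diff EZ f (D.ptZ x) (D.qZ x u) = (α x v : Cot EQ (D.ptQ x)) u) (k : Fn EZ Z) :
    D.poisson.bracket f k (D.ptZ x) = diff EX (fun y => k (D.ptZ y)) x v := by
  rw [PoissonStructure.bracket_eq_neg_sharp, hD.ham_conn hα hf, map_neg, neg_neg, tXZ_eq]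
  exact (congrArg (fun L : Cot EX x => L v) (diff_comp_fn k D.zmap x)).symm

/-- The bracket of two functions that define coordinate vector fields is isotropic along `X`. -/
theorem IsConstraint.diff_bracket_coord {x₀ x : X} (hx : x ∈ (chartAt EX x₀).source) {e e' : EX}
    {f f' : Fn EZ Z}
    (hf : ∀ᶠ y in 𝓝 x, ∀ u, diff EZ f (D.ptZ y) (D.qZ y u) =
      (α y (Ti x₀ y e) : Cot EQ (D.ptQ y)) u)
    (hf' : ∀ᶠ y in 𝓝 x, ∀ u, diff EZ f' (D.ptZ y) (D.qZ y u) =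
      (α y (Ti x₀ y e') : Cot EQ (D.ptQ y)) u) (u : Tan ES (D.ptS x)) :
    diff EZ (D.poisson.bracket f f') (D.ptZ x) (D.sZ x u) = 0 := by
  -- On `X` the brackets with `f` and `f'` are derivatives along coordinate fields, which commute.
  -- By the Jacobi identity the Hamiltonian vector field of `{f, f'}` is therefore zero at `x`.
  have hk : ∀ k : Fn EZ Z, D.poisson.bracket (D.poisson.bracket f f') k (D.ptZ x) = 0 := by
    intro k
    have h1 := congrArg (fun g : Fn EZ Z => g (D.ptZ x)) (D.poisson.bracket_leibniz f f' k)
    have h2 : D.poisson.bracket f (D.poisson.bracket f' k) (D.ptZ x) =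
        D.poisson.bracket (D.poisson.bracket f f') k (D.ptZ x) +
          D.poisson.bracket f' (D.poisson.bracket f k) (D.ptZ x) := h1
    have h3 : D.poisson.bracket f (D.poisson.bracket f' k) (D.ptZ x) =
        D.poisson.bracket f' (D.poisson.bracket f k) (D.ptZ x) := by
      rw [hD.bracket_ptZ hα hf.self_of_nhds, hD.bracket_ptZ hα hf'.self_of_nhds]
      have e1 : (fun y => D.poisson.bracket f' k (D.ptZ y)) =ᶠ[𝓝 x]
          fun y => diff EX (k.comp D.zmap : Fn EX X) y (Ti x₀ y e') :=
        hf'.mono fun y hy => hD.bracket_ptZ hα hy k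
      have e2 : (fun y => D.poisson.bracket f k (D.ptZ y)) =ᶠ[𝓝 x]
          fun y => diff EX (k.comp D.zmap : Fn EX X) y (Ti x₀ y e) :=
        hf.mono fun y hy => hD.bracket_ptZ hα hy k
      rw [diff_congr e1, diff_congr e2]
      exact diff_diff_chart_symm _ hx e e'
    linarith
  have hham : D.poisson.ham (D.poisson.bracket f f') (D.ptZ x) = 0 := by
    apply tan_eq_zero
    intro a
    obtain ⟨k, rfl⟩ := exists_fn_diff (D.ptZ x) a
    have := hk k
    rwa [PoissonStructure.bracket_eq_neg_sharp, neg_eq_zero] at this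
  exact (hD.sharp_ptZ_eq_zero_iff _).1 hham u

include ha

/-- The curvature of the derivations defined by a local frame is inner. -/
theorem IsConstraint.exists_curvature (σ : D.LocalFrame c) {x₀ x : X} (hxσ : x ∈ σ.U)
    (hx : x ∈ (chartAt EX x₀).source) {e e' : EX} {f f' : Fn EZ Z}
    {Θ Θ' : X → LieDerivation ℝ 𝔤 𝔤}
    (hf : ∀ᶠ y in 𝓝 x, ∀ u, diff EZ f (D.ptZ y) (D.qZ y u) =
      (α y (Ti x₀ y e) : Cot EQ (D.ptQ y)) u)
    (hf' : ∀ᶠ y in 𝓝 x, ∀ u, diff EZ f' (D.ptZ y) (D.qZ y u) =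
      (α y (Ti x₀ y e') : Cot EQ (D.ptQ y)) u)
    (hΘ : ∀ᶠ y in 𝓝 x, D.IsTheta σ y f (Θ y)) (hΘ' : ∀ᶠ y in 𝓝 x, D.IsTheta σ y f' (Θ' y))
    (hs : ∀ ξ, SmoothNear (E := EX) (fun y => coord 𝔤 (Θ y ξ)) x)
    (hs' : ∀ ξ, SmoothNear (E := EX) (fun y => coord 𝔤 (Θ' y ξ)) x) :
    ∃ ζ ∈ c.normalizer, ∀ ξ δ δ',
      (∀ l : Module.Dual ℝ 𝔤, diff EX (fun y => l (Θ' y ξ)) x (Ti x₀ x e) = l δ) →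
      (∀ l : Module.Dual ℝ 𝔤, diff EX (fun y => l (Θ y ξ)) x (Ti x₀ x e') = l δ') →
      δ - δ' + (Θ x (Θ' x ξ) - Θ' x (Θ x ξ)) = ⁅ζ, ξ⁆ := by
  -- `ζ` represents the isotropic covector `d{f, f'}` in the frame. The commutator of the two
  -- covariant derivatives is then the bracket with `{f, f'}`, that is, `ad ζ`.
  obtain ⟨ζ, hζ⟩ := (σ.mem x hxσ).1.exists_eq
    (hD.diff_bracket_coord hα hx hf hf')
  have key : ∀ ξ δ δ',
      (∀ l : Module.Dual ℝ 𝔤, diff EX (fun y => l (Θ' y ξ)) x (Ti x₀ x e) = l δ) →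
      (∀ l : Module.Dual ℝ 𝔤, diff EX (fun y => l (Θ y ξ)) x (Ti x₀ x e') = l δ') →
      δ - δ' + (Θ x (Θ' x ξ) - Θ' x (Θ x ξ)) = ⁅ζ, ξ⁆ := by
    intro ξ δ δ' hδ hδ'
    obtain ⟨g, -, hg⟩ := hD.exists_frame_fn σ hxσ ξ
    have h1 : ∀ᶠ y in 𝓝 x, diff EZ (D.poisson.bracket f' g) (D.ptZ y) = σ.frame y (Θ' y ξ) := by
      filter_upwards [hΘ', hg.eventually_nhds] with y h h' using h ξ g h'
    have h2 : ∀ᶠ y in 𝓝 x, diff EZ (D.poisson.bracket f g) (D.ptZ y) = σ.frame y (Θ y ξ) := by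
      filter_upwards [hΘ, hg.eventually_nhds] with y h h' using h ξ g h'
    have h3 := hD.diff_bracket_frame σ hxσ (diff_tXZ_of_Etil hf.self_of_nhds)
      (hD.ham_conn hα hf.self_of_nhds) hΘ.self_of_nhds (hs' ξ) hδ h1
    have h4 := hD.diff_bracket_frame σ hxσ (diff_tXZ_of_Etil hf'.self_of_nhds)
      (hD.ham_conn hα hf'.self_of_nhds) hΘ'.self_of_nhds (hs ξ) hδ' h2
    have h5 := (σ.mem x hxσ).1.2.2 ζ ξ (D.poisson.bracket f f') g hζ.symm hg.self_of_nhds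
    rw [D.poisson.bracket_leibniz f f' g, diff_add, h4, h5, ← map_add] at h3
    have h6 := (σ.mem x hxσ).1.1 h3
    rw [← sub_eq_iff_eq_add] at h6
    rw [← h6]
    abel
  refine ⟨ζ, ?_, key⟩
  rw [LieSubalgebra.mem_normalizer_iff]
  intro ξ hξ
  -- For `ξ ∈ c`, each term of the curvature formula lies in `c`, since the derivations preserve `c`
  -- at all nearby points and hence so do their derivatives.
  obtain ⟨δ, hδ⟩ := exists_deriv (hs' ξ) (Ti x₀ x e)
  obtain ⟨δ', hδ'⟩ := exists_deriv (hs ξ) (Ti x₀ x e')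
  have m1 : ∀ᶠ y in 𝓝 x, ∀ ξ ∈ c, Θ y ξ ∈ c := by
    filter_upwards [hΘ, hf, σ.near hxσ] with y h1 h2 h3 ξ hξ
      using hD.theta_mem σ h3 h2 (ha y _) h1 hξ
  have m2 : ∀ᶠ y in 𝓝 x, ∀ ξ ∈ c, Θ' y ξ ∈ c := by
    filter_upwards [hΘ', hf', σ.near hxσ] with y h1 h2 h3 ξ hξ
      using hD.theta_mem σ h3 h2 (ha y _) h1 hξ
  have d1 : δ ∈ c := deriv_mem (W := c.toSubmodule) (m2.mono fun y h => h ξ hξ) hδ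
  have d2 : δ' ∈ c := deriv_mem (W := c.toSubmodule) (m1.mono fun y h => h ξ hξ) hδ'
  rw [← key ξ δ δ' hδ hδ']
  exact c.add_mem (c.sub_mem d1 d2) (c.sub_mem (m1.self_of_nhds _ (m2.self_of_nhds _ hξ))
    (m2.self_of_nhds _ (m1.self_of_nhds _ hξ)))

omit ha in
/-- The derivations defined by a local frame, as a linear form in the direction. -/
theorem IsConstraint.exists_theta_linear (σ : D.LocalFrame c) {x₀ : X} (hx : x₀ ∈ σ.U) :
    ∃ (F : EX → Fn EZ Z) (Θ : X → EX →ₗ[ℝ] LieDerivation ℝ 𝔤 𝔤),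
      (∀ᶠ y in 𝓝 x₀, ∀ e u, diff EZ (F e) (D.ptZ y) (D.qZ y u) =
        (α y (Ti x₀ y e) : Cot EQ (D.ptQ y)) u) ∧
      (∀ᶠ y in 𝓝 x₀, ∀ e, D.IsTheta σ y (F e) (Θ y e)) ∧
      ∀ e ξ, SmoothNear (E := EX) (fun y => coord 𝔤 (Θ y e ξ)) x₀ := by
  let b := Module.finBasis ℝ EX
  -- The derivation on all of `𝔤` depends on the function and not just on the direction. Functions
  -- and derivations are therefore chosen for a basis and extended linearly.
  choose f θ hf hθ hs using fun i => hD.exists_theta_family hα σ hx (vecNear_const_id x₀ (b i))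
  refine ⟨fun e => ∑ i, b.repr e i • f i, fun y => ∑ i, (b.coord i).smulRight (θ i y), ?_, ?_, ?_⟩
  · filter_upwards [eventually_all.2 hf] with y hy e u
    have he : Ti x₀ y e = ∑ i, b.repr e i • Ti x₀ y (b i) := by
      conv_lhs => rw [← b.sum_repr e]
      rw [map_sum]
      exact Finset.sum_congr rfl fun i _ => map_smul _ _ _
    rw [he, map_sum, diff_sum]
    let ev : Cot EZ (D.ptZ y) →ₗ[ℝ] ℝ :=
      { toFun := fun a => a (D.qZ y u), map_add' := fun _ _ => rfl, map_smul' := fun _ _ => rfl }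
    let ev' : D.Etil y →ₗ[ℝ] ℝ :=
      { toFun := fun a => (a : Cot EQ (D.ptQ y)) u
        map_add' := fun _ _ => rfl, map_smul' := fun _ _ => rfl }
    change ev _ = ev' _
    rw [map_sum, map_sum]
    refine Finset.sum_congr rfl fun i _ => ?_
    rw [diff_smul, map_smul, map_smul, map_smul]
    exact congrArg (b.repr e i * ·) (hy i u)
  · filter_upwards [eventually_all.2 hθ] with y hy e
    rw [LinearMap.sum_apply]
    change D.IsTheta σ y (∑ i, b.repr e i • f i) (∑ i, b.repr e i • θ i y)
    induction (Finset.univ : Finset (Fin (Module.finrank ℝ EX))) using Finset.induction_on with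
    | empty =>
      intro ξ g _
      have : D.poisson.bracket 0 g = 0 := by
        have := D.poisson.bracket_add_left 0 0 g
        rwa [add_zero, left_eq_add] at this
      rw [Finset.sum_empty, Finset.sum_empty, this, diff_zero]
      exact (map_zero _).symm
    | insert i s hi ih =>
      rw [Finset.sum_insert hi, Finset.sum_insert hi]
      exact ((hy i).smul σ _).add σ ih
  · intro e ξ
    let ev : LieDerivation ℝ 𝔤 𝔤 →ₗ[ℝ] Coord 𝔤 :=
      { toFun := fun d => coord 𝔤 (d ξ)
        map_add' := fun d d' => map_add (coord 𝔤) (d ξ) (d' ξ)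
        map_smul' := fun r d => map_smul (coord 𝔤) r (d ξ) }
    have he : (fun y => coord 𝔤 ((∑ i, (b.coord i).smulRight (θ i y) : EX →ₗ[ℝ] _) e ξ)) =
        fun y => ∑ i, b.repr e i • coord 𝔤 (θ i y ξ) := by
      funext y
      change ev ((∑ i, (b.coord i).smulRight (θ i y) : EX →ₗ[ℝ] _) e) = ∑ i, b.repr e i • ev (θ i y)
      rw [LinearMap.sum_apply, map_sum]
      exact Finset.sum_congr rfl fun i _ => map_smul ev _ _
    rw [he]
    exact SmoothNear.sum fun i => (SmoothNear.const _).smul (hs i ξ)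

end ConstraintData

end

/-! ### Centred charts. -/

noncomputable section

/-- A germ of a smooth map between vector spaces has a globally smooth representative. -/
theorem exists_contDiff_eventuallyEq {E F : Type*} [NormedAddCommGroup E] [NormedSpace ℝ E]
    [FiniteDimensional ℝ E] [NormedAddCommGroup F] [NormedSpace ℝ F] {f : E → F} {x : E}
    (hf : ∀ᶠ y in 𝓝 x, ContDiffAt ℝ ∞ f y) : ∃ g : E → F, ContDiff ℝ ∞ g ∧ g =ᶠ[𝓝 x] f := by
  obtain ⟨r, hr, hball⟩ := Metric.eventually_nhds_iff_ball.1 hf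
  let χ : ContDiffBump x := ⟨r / 4, r / 2, by positivity, by linarith⟩
  refine ⟨fun y => χ y • f y, contDiff_iff_contDiffAt.2 fun y => ?_, ?_⟩
  · by_cases hy : y ∈ Metric.ball x r
    · exact χ.contDiff.contDiffAt.smul (hball y hy)
    · have : y ∉ tsupport χ := by
        rw [χ.tsupport_eq]
        intro h
        exact hy (Metric.closedBall_subset_ball (show r / 2 < r by linarith) h)
      refine (contDiffAt_const (c := (0 : F))).congr_of_eventuallyEq ?_
      filter_upwards [notMem_tsupport_iff_eventuallyEq.1 this] with z hz
      rw [hz]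
      exact zero_smul ℝ _
  · filter_upwards [χ.eventuallyEq_one] with y hy
    rw [hy]
    exact one_smul ℝ _

section Chart

variable {E M : Type*} [NormedAddCommGroup E] [NormedSpace ℝ E] [FiniteDimensional ℝ E]
  [TopologicalSpace M] [ChartedSpace E M] [IsManifold 𝓘(ℝ, E) ∞ M]

/-- The inverse of the chart at `x₀`, centred at `x₀`. -/
def chartInv (x₀ : M) (w : E) : M :=
  (extChartAt 𝓘(ℝ, E) x₀).symm (extChartAt 𝓘(ℝ, E) x₀ x₀ + w)

/-- The chart at `x₀`, centred at `x₀`. -/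
def chartFun (x₀ y : M) : E := extChartAt 𝓘(ℝ, E) x₀ y - extChartAt 𝓘(ℝ, E) x₀ x₀

theorem chartFun_self (x₀ : M) : chartFun (E := E) x₀ x₀ = 0 := sub_self _

theorem chartInv_chartFun {x₀ y : M} (hy : y ∈ (chartAt E x₀).source) :
    chartInv (E := E) x₀ (chartFun x₀ y) = y := by
  rw [chartInv, chartFun, add_sub_cancel,
    (extChartAt 𝓘(ℝ, E) x₀).left_inv (by rwa [extChartAt_source])]

theorem eventually_chartInv (x₀ : M) : ∀ᶠ w in 𝓝 (0 : E),
    extChartAt 𝓘(ℝ, E) x₀ x₀ + w ∈ (extChartAt 𝓘(ℝ, E) x₀).target := by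
  have hc : ContinuousAt (fun w : E => extChartAt 𝓘(ℝ, E) x₀ x₀ + w) 0 := by fun_prop
  refine hc.eventually ?_
  beta_reduce
  rw [add_zero]
  exact extChartAt_target_mem_nhds x₀

theorem chartInv_mem {x₀ : M} {w : E}
    (hw : extChartAt 𝓘(ℝ, E) x₀ x₀ + w ∈ (extChartAt 𝓘(ℝ, E) x₀).target) :
    chartInv x₀ w ∈ (chartAt E x₀).source := by
  have := (extChartAt 𝓘(ℝ, E) x₀).map_target hw
  rwa [extChartAt_source] at this

theorem chartFun_chartInv {x₀ : M} {w : E}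
    (hw : extChartAt 𝓘(ℝ, E) x₀ x₀ + w ∈ (extChartAt 𝓘(ℝ, E) x₀).target) :
    chartFun x₀ (chartInv x₀ w) = w := by
  rw [chartFun, chartInv, (extChartAt 𝓘(ℝ, E) x₀).right_inv hw, add_sub_cancel_left]

theorem tendsto_chartInv (x₀ : M) : Tendsto (chartInv (E := E) x₀) (𝓝 0) (𝓝 x₀) := by
  have h : Tendsto (fun w : E => extChartAt 𝓘(ℝ, E) x₀ x₀ + w) (𝓝 0)
      (𝓝 (extChartAt 𝓘(ℝ, E) x₀ x₀)) := by
    have : Continuous (fun w : E => extChartAt 𝓘(ℝ, E) x₀ x₀ + w) := by fun_prop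
    simpa using this.tendsto 0
  have h' := (continuousAt_extChartAt_symm (I := 𝓘(ℝ, E)) x₀).tendsto
  rw [extChartAt_to_inv] at h'
  exact h'.comp h

theorem tendsto_chartFun (x₀ : M) : Tendsto (chartFun (E := E) x₀) (𝓝 x₀) (𝓝 0) := by
  have h := ((continuousAt_extChartAt (I := 𝓘(ℝ, E)) x₀).sub
    (continuousAt_const (y := extChartAt 𝓘(ℝ, E) x₀ x₀))).tendsto
  rwa [Pi.sub_apply, sub_self] at h

theorem smoothNear_chartFun {x₀ y : M} (hy : y ∈ (chartAt E x₀).source) :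
    SmoothNear (E := E) (chartFun (E := E) x₀) y :=
  (smoothNear_extChart hy).sub (SmoothNear.const _)

/-- Smooth functions on `M` are smooth in the chart. -/
theorem contDiffAt_chartInv {F : Type*} [NormedAddCommGroup F] [NormedSpace ℝ F] {f : M → F}
    {x₀ : M} (hf : SmoothNear (E := E) f x₀) :
    ∀ᶠ w in 𝓝 (0 : E), ContDiffAt ℝ ∞ (fun w => f (chartInv x₀ w)) w := by
  filter_upwards [eventually_chartInv (E := E) x₀, (tendsto_chartInv x₀).eventually hf] with w h1 h2
  have h3 : ContMDiffAt 𝓘(ℝ, E) 𝓘(ℝ, E) ∞ (extChartAt 𝓘(ℝ, E) x₀).symm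
      (extChartAt 𝓘(ℝ, E) x₀ x₀ + w) :=
    (contMDiffOn_extChartAt_symm (I := 𝓘(ℝ, E)) (n := ∞) x₀).contMDiffAt
      ((isOpen_extChartAt_target (I := 𝓘(ℝ, E)) x₀).mem_nhds h1)
  have h4 : ContMDiffAt 𝓘(ℝ, E) 𝓘(ℝ, E) ∞ (fun w : E => extChartAt 𝓘(ℝ, E) x₀ x₀ + w) w :=
    (contDiff_const.add contDiff_id).contDiffAt.contMDiffAt
  exact (ContMDiffAt.comp w h2 (ContMDiffAt.comp w h3 h4)).contDiffAt

/-- Derivatives of functions on `M` in the chart. -/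
theorem fderiv_chartInv {f : M → ℝ} {x₀ : M} {w : E}
    (hw : extChartAt 𝓘(ℝ, E) x₀ x₀ + w ∈ (extChartAt 𝓘(ℝ, E) x₀).target)
    (hf : MDifferentiableAt 𝓘(ℝ, E) 𝓘(ℝ, ℝ) f (chartInv x₀ w)) (e : E) :
    fderiv ℝ (fun w => f (chartInv x₀ w)) w e =
      diff E f (chartInv x₀ w) (Ti x₀ (chartInv x₀ w) e) := by
  rw [diff_apply_chart (chartInv_mem hw) hf,
    show extChartAt 𝓘(ℝ, E) x₀ (chartInv x₀ w) = extChartAt 𝓘(ℝ, E) x₀ x₀ + w from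
      (extChartAt 𝓘(ℝ, E) x₀).right_inv hw]
  exact congrArg (fun L : E →L[ℝ] ℝ => L e)
    (fderiv_comp_add_left (f := f ∘ (extChartAt 𝓘(ℝ, E) x₀).symm) _)

/-- Derivatives of functions of the coordinates. -/
theorem diff_chartFun {f : E → ℝ} {x₀ y : M} (hy : y ∈ (chartAt E x₀).source)
    (hf : DifferentiableAt ℝ f (chartFun x₀ y)) (e : E) :
    diff E (fun y => f (chartFun x₀ y)) y (Ti x₀ y e) = fderiv ℝ f (chartFun x₀ y) e := by
  have hw : extChartAt 𝓘(ℝ, E) x₀ x₀ + chartFun x₀ y ∈ (extChartAt 𝓘(ℝ, E) x₀).target := by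
    rw [chartFun, add_sub_cancel]
    exact (extChartAt 𝓘(ℝ, E) x₀).map_source (by rwa [extChartAt_source])
  have hd : MDifferentiableAt 𝓘(ℝ, E) 𝓘(ℝ, ℝ) (fun y => f (chartFun x₀ y)) y :=
    MDifferentiableAt.comp (g := f) y hf.mdifferentiableAt (smoothNear_chartFun hy).mdiff
  have h := fderiv_chartInv hw (by rw [chartInv_chartFun hy]; exact hd) e
  rw [chartInv_chartFun hy] at h
  rw [← h]
  congr 1
  refine Filter.EventuallyEq.fderiv_eq ?_
  have hc : ContinuousAt (fun w : E => extChartAt 𝓘(ℝ, E) x₀ x₀ + w) (chartFun x₀ y) := by fun_prop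
  filter_upwards [hc.eventually ((isOpen_extChartAt_target (I := 𝓘(ℝ, E)) x₀).mem_nhds hw)]
    with v hv
  rw [chartFun_chartInv hv]

end Chart

end

/-! ### Change of a local frame that makes the connection inner. -/

noncomputable section

theorem fderiv_clm_eval {E F G : Type*} [NormedAddCommGroup E] [NormedSpace ℝ E]
    [NormedAddCommGroup F] [NormedSpace ℝ F] [NormedAddCommGroup G] [NormedSpace ℝ G]
    {T : E → E →L[ℝ] F} {w : E} (hT : DifferentiableAt ℝ T w) (L : F →L[ℝ] G) (e e' : E) :
    fderiv ℝ (fun z => L (T z e')) w e = L (fderiv ℝ T w e e') := by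
  have h := (L.comp (ContinuousLinearMap.apply ℝ F e')).hasFDerivAt.comp w hT.hasFDerivAt
  exact congrArg (fun A : E →L[ℝ] G => A e) h.fderiv

namespace ConstraintData

variable {EX X ES S EQ Q EZ Z : Type*}
    [NormedAddCommGroup EX] [NormedSpace ℝ EX] [FiniteDimensional ℝ EX]
    [TopologicalSpace X] [ChartedSpace EX X] [IsManifold 𝓘(ℝ, EX) ∞ X]
    [T2Space X] [SecondCountableTopology X]
    [NormedAddCommGroup ES] [NormedSpace ℝ ES] [FiniteDimensional ℝ ES]
    [TopologicalSpace S] [ChartedSpace ES S] [IsManifold 𝓘(ℝ, ES) ∞ S]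
    [T2Space S] [SecondCountableTopology S]
    [NormedAddCommGroup EQ] [NormedSpace ℝ EQ] [FiniteDimensional ℝ EQ]
    [TopologicalSpace Q] [ChartedSpace EQ Q] [IsManifold 𝓘(ℝ, EQ) ∞ Q]
    [T2Space Q] [SecondCountableTopology Q]
    [NormedAddCommGroup EZ] [NormedSpace ℝ EZ] [FiniteDimensional ℝ EZ]
    [TopologicalSpace Z] [ChartedSpace EZ Z] [IsManifold 𝓘(ℝ, EZ) ∞ Z]
    [T2Space Z] [SecondCountableTopology Z]
    {D : ConstraintData EX X ES S EQ Q EZ Z}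
    {𝔤 : Type*} [LieRing 𝔤] [LieAlgebra ℝ 𝔤] [Module.Finite ℝ 𝔤] {c : LieSubalgebra ℝ 𝔤}
    (hD : D.IsConstraint) {α : ∀ x, Tan EX x →ₗ[ℝ] D.Etil x}
    (hα : D.IsConnForm α) (ha : ∀ x v, D.Adm x (α x v : Cot EQ (D.ptQ x)))

/-- A constant vector of a Lie algebra, transformed by an operator on the coordinate space. -/
def opEval (ξ : 𝔤) (l : Module.Dual ℝ 𝔤) : Op 𝔤 →L[ℝ] ℝ :=
  (LinearMap.toContinuousLinearMap (l ∘ₗ (coord 𝔤).symm.toLinearMap)).comp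
    (ContinuousLinearMap.apply ℝ (Coord 𝔤) (coord 𝔤 ξ))

theorem opEval_eq (ξ : 𝔤) (l : Module.Dual ℝ 𝔤) (a : Op 𝔤) :
    opEval ξ l a = l ((coord 𝔤).symm (a (coord 𝔤 ξ))) := rfl

theorem eq_of_dual {ξ η : 𝔤} (h : ∀ l : Module.Dual ℝ 𝔤, l ξ = l η) : ξ = η := by
  rw [← sub_eq_zero, ← Module.forall_dual_apply_eq_zero_iff ℝ]
  intro l
  rw [map_sub, h, sub_self]

variable (𝔤) in
/-- Derivations as operators on the coordinate space. -/
def derOp : LieDerivation ℝ 𝔤 𝔤 →ₗ[ℝ] Op 𝔤 where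
  toFun d := opCoord 𝔤 d.toLinearMap
  map_add' d d' := map_add (opCoord 𝔤) d.toLinearMap d'.toLinearMap
  map_smul' r d := map_smul (opCoord 𝔤) r d.toLinearMap

theorem derOp_apply (d : LieDerivation ℝ 𝔤 𝔤) (ξ : 𝔤) :
    derOp 𝔤 d (coord 𝔤 ξ) = coord 𝔤 (d ξ) := opCoord_apply _ _

include hD hα ha

/-- A local frame can be changed to one in which the connection is inner. -/
theorem IsConstraint.exists_frame_gauge (σ : D.LocalFrame c) {x₀ : X} (hx : x₀ ∈ σ.U) :
    ∃ n : X → Op 𝔤, n x₀ = 1 ∧ ∀ᶠ y in 𝓝 x₀, SmoothNear (E := EX) n y ∧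
      IsGauge c ((opCoord 𝔤).symm (n y)) ∧ ∀ v : Tan EX y, ∃ (f : Fn EZ Z) (d : LieDerivation ℝ 𝔤 𝔤),
        (∀ u, diff EZ f (D.ptZ y) (D.qZ y u) = (α y v : Cot EQ (D.ptQ y)) u) ∧
        D.IsTheta σ y f d ∧ ∃ ζ ∈ c.normalizer, ∀ ξ δ,
          (∀ l : Module.Dual ℝ 𝔤, diff EX (fun z => l ((opCoord 𝔤).symm (n z) ξ)) y v = l δ) →
            δ + d ((opCoord 𝔤).symm (n y) ξ) = (opCoord 𝔤).symm (n y) ⁅ζ, ξ⁆ := by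
  obtain ⟨F, Θ, hF, hΘ, hs⟩ := hD.exists_theta_linear hα σ hx
  let T₀ : X → EX →L[ℝ] Op 𝔤 := fun y => LinearMap.toContinuousLinearMap (derOp 𝔤 ∘ₗ Θ y)
  have hT₀a : ∀ y e ξ, T₀ y e (coord 𝔤 ξ) = coord 𝔤 (Θ y e ξ) := fun y e ξ => derOp_apply _ _
  have hT₀ : SmoothNear (E := EX) T₀ x₀ := SmoothNear.of_apply fun e => SmoothNear.of_apply fun v => by
    obtain ⟨ξ, rfl⟩ := (coord 𝔤).surjective v
    exact SmoothNear.congr (hs e ξ) (Eventually.of_forall fun z => hT₀a z e ξ)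
  have hs' : ∀ {y}, SmoothNear (E := EX) T₀ y → ∀ e ξ,
      SmoothNear (E := EX) (fun z => coord 𝔤 (Θ z e ξ)) y := fun {y} h e ξ =>
    (((h.clm_apply (SmoothNear.const e)).clm_apply (SmoothNear.const (coord 𝔤 ξ)))).congr
      (Eventually.of_forall fun z => (hT₀a z e ξ).symm)
  -- The family of derivations, read in the centred chart, is only a germ. `exists_gauge` needs a
  -- globally smooth form but uses its structure only near `0`.
  obtain ⟨T, hT, hTe⟩ := exists_contDiff_eventuallyEq (contDiffAt_chartInv hT₀)
  have hgood := hF.and (hΘ.and (hT₀.near.and (σ.near hx)))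
  have h1 : ∀ᶠ w in 𝓝 (0 : EX), ∀ e, ∃ d : LieDerivation ℝ 𝔤 𝔤,
      (∀ ξ ∈ c, d ξ ∈ c) ∧ T w e = opCoord 𝔤 d.toLinearMap := by
    filter_upwards [hTe, (tendsto_chartInv x₀).eventually hgood] with w h1 h2 e
    refine ⟨Θ (chartInv x₀ w) e, fun ξ hξ => hD.theta_mem σ h2.2.2.2 (h2.1 e) (ha _ _)
      (h2.2.1 e) hξ, ?_⟩
    rw [h1]
    rfl
  have h2 : ∀ᶠ w in 𝓝 (0 : EX), ∀ e e', fderiv ℝ T w e e' - fderiv ℝ T w e' e +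
      (T w e * T w e' - T w e' * T w e) ∈ adNormalizer c := by
    filter_upwards [hTe.eventually_nhds, eventually_chartInv (E := EX) x₀,
      (tendsto_chartInv x₀).eventually hgood.eventually_nhds] with w h1 h2 h3 e e'
    obtain ⟨-, -, h4, h5⟩ := h3.self_of_nhds
    have key : ∀ e e' ξ (l : Module.Dual ℝ 𝔤),
        diff EX (fun z => l (Θ z e' ξ)) (chartInv x₀ w) (Ti x₀ (chartInv x₀ w) e) =
          l ((coord 𝔤).symm (fderiv ℝ T w e e' (coord 𝔤 ξ))) := by
      intro e e' ξ l
      rw [← fderiv_chartInv h2 (SmoothNear_dual (hs' h4 e' ξ) l).mdiff e]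
      have hee : (fun w => l (Θ (chartInv x₀ w) e' ξ)) =ᶠ[𝓝 w] fun z => opEval ξ l (T z e') := by
        filter_upwards [h1] with z hz
        rw [hz, opEval_eq, hT₀a, LinearEquiv.symm_apply_apply]
      rw [hee.fderiv_eq, fderiv_clm_eval (hT.differentiable (by simp) w)]
      rfl
    obtain ⟨ζ, hζ, hc⟩ := hD.exists_curvature hα ha σ h5 (chartInv_mem h2)
      (h3.mono fun y h => h.1 e) (h3.mono fun y h => h.1 e') (h3.mono fun y h => h.2.1 e)
      (h3.mono fun y h => h.2.1 e') (hs' h4 e) (hs' h4 e')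
    refine ⟨ζ, hζ, ContinuousLinearMap.ext fun v => ?_⟩
    obtain ⟨ξ, rfl⟩ := (coord 𝔤).surjective v
    have h6 := hc ξ _ _ (key e e' ξ) (key e' e ξ)
    rw [opCoord_apply]
    change _ = coord 𝔤 ⁅ζ, ξ⁆
    rw [← h6, map_add, map_sub, map_sub, LinearEquiv.apply_symm_apply, LinearEquiv.apply_symm_apply,
      ← hT₀a, ← hT₀a, ← hT₀a, ← hT₀a, ← h1.self_of_nhds]
    rfl
  obtain ⟨n, hn0, hn⟩ := exists_gauge hT h1 h2
  have hsm : SmoothNear (E := EX) (fun y => n (chartFun x₀ y)) x₀ := by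
    filter_upwards [(tendsto_chartFun x₀).eventually hn, chart_near (E := EX) x₀] with y h1 h2
    exact ContMDiffAt.comp (g := n) y h1.1.contMDiffAt (smoothNear_chartFun h2).at
  refine ⟨fun y => n (chartFun x₀ y), by beta_reduce; rw [chartFun_self (E := EX), hn0], ?_⟩
  filter_upwards [(tendsto_chartFun x₀).eventually hn, (tendsto_chartFun x₀).eventually hTe,
    chart_near (E := EX) x₀, hsm.near, hgood] with y h1 h2 h3 h4 h5
  refine ⟨h4, h1.2.1, fun v => ⟨F (Tc x₀ y v), Θ y (Tc x₀ y v), fun u => ?_, h5.2.1 _, ?_⟩⟩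
  · rw [h5.1, Ti_Tc h3]
  obtain ⟨ζ, hζ, he⟩ := h1.2.2 (Tc x₀ y v)
  refine ⟨ζ, hζ, fun ξ δ hδ => ?_⟩
  -- The derivative on the manifold of the gauge transformation is its derivative in the chart. With
  -- this the gauge equation becomes the required identity.
  have e1 : coord 𝔤 δ = fderiv ℝ n (chartFun x₀ y) (Tc x₀ y v) (coord 𝔤 ξ) := by
    rw [← LinearEquiv.eq_symm_apply]
    refine eq_of_dual fun l => ?_
    rw [← hδ l]
    have hd := (opEval ξ l).hasFDerivAt.comp (chartFun x₀ y)
      (h1.1.differentiableAt (by simp)).hasFDerivAt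
    have := diff_chartFun h3 hd.differentiableAt (Tc x₀ y v)
    rw [hd.fderiv, Ti_Tc h3] at this
    refine Eq.trans ?_ this
    congr 2
  apply (coord 𝔤).injective
  rw [map_add, e1, ← hT₀a, opCoord_symm_apply, opCoord_symm_apply]
  have e2 : T (chartFun x₀ y) = T₀ y := by rw [h2, chartInv_chartFun h3]
  have e3 := congrArg (fun a : Op 𝔤 => a (coord 𝔤 ξ)) he
  have e4 : T (chartFun x₀ y) (Tc x₀ y v) (n (chartFun x₀ y) (coord 𝔤 ξ)) +
      fderiv ℝ n (chartFun x₀ y) (Tc x₀ y v) (coord 𝔤 ξ) =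
        n (chartFun x₀ y) (opCoord 𝔤 (LieAlgebra.ad ℝ 𝔤 ζ) (coord 𝔤 ξ)) := e3
  rw [opCoord_apply, e2] at e4
  rw [add_comm]
  exact e4

end ConstraintData

end

/-! ### Change of frames and the values of the connection in inner derivations. -/

noncomputable section

namespace ConstraintData

variable {EX X ES S EQ Q EZ Z : Type*}
    [NormedAddCommGroup EX] [NormedSpace ℝ EX] [FiniteDimensional ℝ EX]
    [TopologicalSpace X] [ChartedSpace EX X] [IsManifold 𝓘(ℝ, EX) ∞ X]
    [T2Space X] [SecondCountableTopology X]
    [NormedAddCommGroup ES] [NormedSpace ℝ ES] [FiniteDimensional ℝ ES]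
    [TopologicalSpace S] [ChartedSpace ES S] [IsManifold 𝓘(ℝ, ES) ∞ S]
    [T2Space S] [SecondCountableTopology S]
    [NormedAddCommGroup EQ] [NormedSpace ℝ EQ] [FiniteDimensional ℝ EQ]
    [TopologicalSpace Q] [ChartedSpace EQ Q] [IsManifold 𝓘(ℝ, EQ) ∞ Q]
    [T2Space Q] [SecondCountableTopology Q]
    [NormedAddCommGroup EZ] [NormedSpace ℝ EZ] [FiniteDimensional ℝ EZ]
    [TopologicalSpace Z] [ChartedSpace EZ Z] [IsManifold 𝓘(ℝ, EZ) ∞ Z]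
    [T2Space Z] [SecondCountableTopology Z]
    {D : ConstraintData EX X ES S EQ Q EZ Z}
    {𝔤 : Type*} [LieRing 𝔤] [LieAlgebra ℝ 𝔤] [Module.Finite ℝ 𝔤] {c : LieSubalgebra ℝ 𝔤}

omit [Module.Finite ℝ 𝔤] in
theorem IsConstraintFrame.comp_gauge {x : X} {p : 𝔤 →ₗ[ℝ] Cot EZ (D.ptZ x)}
    (hp : D.IsConstraintFrame c x p) {n : Module.End ℝ 𝔤} (hn : IsGauge c n) :
    D.IsConstraintFrame c x (p ∘ₗ n) := by
  obtain ⟨hu, hl, hc⟩ := hn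
  have hb := (Module.End.isUnit_iff _).1 hu
  refine ⟨⟨fun ξ η h => hb.1 (hp.1.1 h), fun a => ?_, fun ξ η f g hf hg => ?_⟩, fun a => ?_⟩
  · rw [← hp.1.2.1 a]
    exact ⟨fun ⟨ξ, h⟩ => ⟨n ξ, h⟩, fun ⟨ξ, h⟩ => ⟨(hb.2 ξ).choose, by
      rw [← h]; exact congrArg p (hb.2 ξ).choose_spec⟩⟩
  · exact (hp.1.2.2 _ _ f g hf hg).trans (congrArg p (hl ξ η).symm)
  · rw [← hp.2 a]
    refine ⟨fun ⟨ξ, h, h'⟩ => ⟨n ξ, (hc ξ).2 h, h'⟩, fun ⟨ξ, h, h'⟩ => ?_⟩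
    obtain ⟨η, rfl⟩ := hb.2 ξ
    exact ⟨η, (hc η).1 h, h'⟩

/-- Two constraint frames at a point differ by an element of the stabilizer group. -/
theorem IsConstraintFrame.exists_gauge {x : X} {p q : 𝔤 →ₗ[ℝ] Cot EZ (D.ptZ x)}
    (hp : D.IsConstraintFrame c x p) (hq : D.IsConstraintFrame c x q) :
    ∃ n : Module.End ℝ 𝔤, IsGauge c n ∧ q = p ∘ₗ n := by
  have hr : ∀ ξ, ∃ η, p η = q ξ := fun ξ => hp.1.exists_eq (hq.1.sZ ξ)
  choose n hn using hr
  let N : Module.End ℝ 𝔤 :=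
    { toFun := n
      map_add' := fun ξ η => hp.1.1 (by rw [map_add, hn, hn, hn, map_add])
      map_smul' := fun r ξ => hp.1.1 (by rw [map_smul, hn, hn, map_smul]; rfl) }
  have hN : ∀ ξ, p (N ξ) = q ξ := hn
  refine ⟨N, ⟨?_, fun ξ η => ?_, fun ξ => ?_⟩, LinearMap.ext fun ξ => (hN ξ).symm⟩
  · have hinj : Function.Injective N := fun ξ η h => hq.1.1 (by rw [← hN, ← hN, h])
    exact (Module.End.isUnit_iff _).2 ⟨hinj, LinearMap.injective_iff_surjective.1 hinj⟩
  · obtain ⟨f, hf⟩ := exists_fn_diff (D.ptZ x) (q ξ)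
    obtain ⟨g, hg⟩ := exists_fn_diff (D.ptZ x) (q η)
    apply hp.1.1
    rw [hN, ← hq.1.2.2 ξ η f g hf hg]
    exact hp.1.2.2 _ _ f g (hf.trans (hN ξ).symm) (hg.trans (hN η).symm)
  · rw [hp.mem_iff, hq.mem_iff, hN]

/-- A local frame changed by a function with values in the stabilizer group. -/
def LocalFrame.twist (σ : D.LocalFrame c) (W : Set X) (hW : IsOpen W) (hWσ : W ⊆ σ.U)
    (n : X → Module.End ℝ 𝔤) (hn : ∀ x ∈ W, IsGauge c (n x))
    (hs : ∀ x ∈ W, ∀ ξ, SmoothNear (E := EX) (fun y => coord 𝔤 (n y ξ)) x) : D.LocalFrame c where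
  U := W
  isOpen := hW
  frame x := σ.frame x ∘ₗ n x
  smooth ξ := CovNear.smoothCovOn D.contMDiff_ptZ fun x hx => σ.covNear (hWσ hx) (hs x hx ξ)
  mem x hx := (σ.mem x (hWσ hx)).comp_gauge (hn x hx)

/-- A local frame is first moved by a constant element of the stabilizer so that it passes through
`p`, then by the radial gauge, which equals `1` at `x₀` and keeps the value there. -/
theorem IsConstraint.isAdValued_conn (hD : D.IsConstraint) {α : ∀ x, Tan EX x →ₗ[ℝ] D.Etil x}
    (hα : D.IsConnForm α) (ha : ∀ x v, D.Adm x (α x v : Cot EQ (D.ptQ x))) (hr : D.Reducible c) :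
    D.IsAdValued c (hD.conn hα ha) := by
  intro x₀ p hp
  obtain ⟨σ₀, hσ₀⟩ := hr x₀
  obtain ⟨n₀, hn₀, rfl⟩ := (σ₀.mem x₀ hσ₀).exists_gauge hp
  let σ := σ₀.twist σ₀.U σ₀.isOpen subset_rfl (fun _ => n₀) (fun _ _ => hn₀)
    fun _ _ ξ => SmoothNear.const _
  obtain ⟨n, hn0, hn⟩ := hD.exists_frame_gauge hα ha σ (show x₀ ∈ σ.U from hσ₀)
  obtain ⟨W, hWn, hWo, hxW⟩ := eventually_nhds_iff.1 (hn.and (σ.near hσ₀))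
  let τ := σ.twist W hWo (fun y hy => (hWn y hy).2) (fun y => (opCoord 𝔤).symm (n y))
    (fun y hy => (hWn y hy).1.2.1) (fun y hy ξ =>
      ((hWn y hy).1.1.clm_apply (SmoothNear.const (coord 𝔤 ξ))).congr
        (Eventually.of_forall fun z => opCoord_symm_apply _ _))
  refine ⟨τ, hxW, ?_, fun y hy v => ?_⟩
  · change σ.frame x₀ ∘ₗ (opCoord 𝔤).symm (n x₀) = _
    rw [hn0, map_one]
    rfl
  obtain ⟨⟨hs, hg, hfd⟩, hyσ⟩ := hWn y hy
  obtain ⟨f, d, hf, hd, ζ, hζ, he⟩ := hfd v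
  obtain ⟨d', hd'⟩ := hD.exists_theta τ hy (diff_tXZ_of_Etil hf)
  refine ⟨ζ, hζ, fun ξ => ?_⟩
  rw [hD.conn_pot_spec hα ha τ hy hf hd']
  have hsm : SmoothNear (E := EX) (fun z => coord 𝔤 ((opCoord 𝔤).symm (n z) (ξ : 𝔤))) y :=
    (hs.clm_apply (SmoothNear.const (coord 𝔤 (ξ : 𝔤)))).congr
      (Eventually.of_forall fun z => opCoord_symm_apply _ _)
  obtain ⟨δ, hδ⟩ := exists_deriv hsm v
  obtain ⟨g, -, hg'⟩ := hD.exists_frame_fn τ hy ξ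
  -- The covector `d{f, g}` is `σ (n (d' ξ))` in the new frame and `σ (δ + d (n ξ)) = σ (n ⁅ζ, ξ⁆)`
  -- in the old one, so `d' ξ = ⁅ζ, ξ⁆`.
  have h1 := hD.diff_bracket_frame σ hyσ (diff_tXZ_of_Etil hf) (hD.ham_conn hα hf) hd hsm hδ
    (g := g) hg'
  rw [hd' ξ g hg', he ξ δ hδ] at h1
  have h2 := (σ.mem y hyσ).1.1 h1
  rw [((Module.End.isUnit_iff _).1 hg.1).1 h2]

end ConstraintData

end

end PoissonReduction

/-! ### Assembly of the theorem. -/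

theorem mainTheorem6 {EX X ES S EQ Q EZ Z : Type*}
    [NormedAddCommGroup EX] [NormedSpace ℝ EX] [FiniteDimensional ℝ EX]
    [TopologicalSpace X] [ChartedSpace EX X] [IsManifold 𝓘(ℝ, EX) ∞ X]
    [T2Space X] [SecondCountableTopology X]
    [NormedAddCommGroup ES] [NormedSpace ℝ ES] [FiniteDimensional ℝ ES]
    [TopologicalSpace S] [ChartedSpace ES S] [IsManifold 𝓘(ℝ, ES) ∞ S]
    [T2Space S] [SecondCountableTopology S]
    [NormedAddCommGroup EQ] [NormedSpace ℝ EQ] [FiniteDimensional ℝ EQ]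
    [TopologicalSpace Q] [ChartedSpace EQ Q] [IsManifold 𝓘(ℝ, EQ) ∞ Q]
    [T2Space Q] [SecondCountableTopology Q]
    [NormedAddCommGroup EZ] [NormedSpace ℝ EZ] [FiniteDimensional ℝ EZ]
    [TopologicalSpace Z] [ChartedSpace EZ Z] [IsManifold 𝓘(ℝ, EZ) ∞ Z]
    [T2Space Z] [SecondCountableTopology Z]
    (D : PoissonReduction.ConstraintData EX X ES S EQ Q EZ Z) (hD : D.IsConstraint)
    (H : PoissonReduction.Fn EQ Q) (hH : D.Critical H)
    (hJ : ∀ x, Function.Bijective (D.jV H hH x))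
    {𝔤 : Type*} [LieRing 𝔤] [LieAlgebra ℝ 𝔤] [Module.Finite ℝ 𝔤] (c : LieSubalgebra ℝ 𝔤) :
    (∃ η, (D.IsBundleMetric D.Etil η ∧ ∀ x, D.IsInverse x (D.jV H hH x) (η x)) ∧
      (∀ η', (∀ x, D.IsInverse x (D.jV H hH x) (η' x)) → η' = η) ∧
      (∀ x, D.NondegOnL η x ↔ Function.Bijective (D.zeroPart (D.jV H hH x))) ∧
      ((∀ x, Function.Bijective (D.zeroPart (D.jV H hH x))) →
        ∃ τ : D.Fields, D.IsTriple τ ∧ (∀ x, D.Diagram x (D.jV H hH x) τ) ∧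
          (∀ τ' : D.Fields, (∀ x, D.Diagram x (D.jV H hH x) τ') → τ' = τ) ∧
          D.Corresponds η τ ∧
          (∀ K : PoissonReduction.Fn EZ Z, (∀ q, K (D.iQ q) = H q) →
            (∀ x, PoissonReduction.diff EZ K (D.ptZ x) = 0) →
            (∀ x u v, PoissonReduction.hess EQ H (D.ptQ x) u v =
              PoissonReduction.hess EZ K (D.ptZ x) (D.tQ _ u) (D.tQ _ v)) ∧
            ∀ x V, ∃ u, (∀ v, PoissonReduction.hess EZ K (D.ptZ x) (D.tSZ _ u) (D.tSZ _ v) =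
                (-D.omegaFlat _ (D.tX x V)) v) ∧
              (τ.α x V : PoissonReduction.Cot EQ (D.ptQ x)) =
                (PoissonReduction.hess EZ K (D.ptZ x) (D.tSZ _ u)).comp (D.tQ _)) ∧
          (D.Ptil H →
            (∀ V, PoissonReduction.SmoothField EX V →
              D.PtilPrime (D.bar (fun x => τ.α x (V x)))) ∧
            (D.Reducible c →
              (∃ A : D.PrincipalConnection c, D.IsInducedBy c A τ.α ∧ D.IsAdValued c A ∧
                ∀ A' : D.PrincipalConnection c, D.IsInducedBy c A' τ.α →
                  ∀ (σ : D.LocalFrame c), ∀ x ∈ σ.U, A'.pot σ x = A.pot σ x) ∧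
              ∀ x, τ.χ x ∈ D.L2Dual c x)))) ∧
    (∀ η, D.IsBundleMetric D.Etil η → (∀ x, D.NondegOnL η x) →
      ∃! τ : D.Fields, D.IsTriple τ ∧ D.Corresponds η τ) ∧
    (∀ τ : D.Fields, D.IsTriple τ →
      ∃! η, D.IsBundleMetric D.Etil η ∧ D.Corresponds η τ) := by
  choose η hη using fun x => PoissonReduction.ConstraintData.exists_form_of_bijective (hJ x)
  have hm : D.IsBundleMetric D.Etil η := hD.isBundleMetric_of_isInverse hη
  have hiff : ∀ x, D.NondegOnL η x ↔ Function.Bijective (D.zeroPart (D.jV H hH x)) :=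
    fun x => hD.nondeg_iff (hη x)
  refine ⟨⟨η, ⟨hm, hη⟩, fun η' h => funext fun x => (h x).unique (hη x), hiff, fun h0 => ?_⟩,
    fun η' hη' hn => ?_, fun τ hτ => ?_⟩
  · obtain ⟨τ, hτ, hmt, hu⟩ := hD.exists_triple hm fun x => (hiff x).2 (h0 x)
    have hdi : ∀ x (σ : D.Fields), D.Diagram x (D.jV H hH x) σ ↔ _ := fun x =>
      PoissonReduction.ConstraintData.diagram_iff (hη x)
    have hd : ∀ x, D.Diagram x (D.jV H hH x) τ := fun x => (hdi x τ).2 (hmt x)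
    refine ⟨τ, hτ, hd, fun τ' h => hu τ' fun x => (hdi x τ').1 (h x), fun x => ⟨_, hη x, hd x⟩,
      fun K hK hK0 => ?_, fun hP => ?_⟩
    · have hr := fun x => PoissonReduction.ConstraintData.hess_restrict hK (hK0 x)
      refine ⟨hr, fun x V => ?_⟩
      obtain ⟨u, h1, h2⟩ := (hd x).exists_vec V
      refine ⟨u, fun v => (hr x _ _).symm.trans (h1 v), ?_⟩
      rw [h2]
      exact ContinuousLinearMap.ext (hr x _)
    · have ha := hD.adm_alpha hP h0 hd
      refine ⟨fun V hV => hD.ptilPrime_bar (hτ.2.1.1 V hV) fun x => ha x (V x), fun hr =>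
        ⟨⟨hD.conn hτ.2.1 ha, hD.isInducedBy_conn hτ.2.1 ha hr, hD.isAdValued_conn hτ.2.1 ha hr,
          fun A' hA' σ x hx => hD.conn_unique hτ.2.1 ha hr hA' σ hx⟩,
        hD.chi_mem_L2Dual hP hJ hτ hd hr⟩⟩
  · obtain ⟨τ, hτ, hmt, hu⟩ := hD.exists_triple hη' hn
    exact ⟨τ, ⟨hτ, (PoissonReduction.ConstraintData.corresponds_iff hη'.2.1 τ).2 hmt⟩,
      fun τ' h =>
      hu τ' ((PoissonReduction.ConstraintData.corresponds_iff hη'.2.1 τ').1 h.2)⟩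
  · obtain ⟨η', h1, h2, hu⟩ := hD.exists_metric hτ
    exact ⟨η', ⟨h1, (PoissonReduction.ConstraintData.corresponds_iff h1.2.1 τ).2 h2⟩,
      fun η'' h =>
        hu η'' h.1 ((PoissonReduction.ConstraintData.corresponds_iff h.1.2.1 τ).1 h.2)⟩
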